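/- Let $k$ be a field of characteristic $0$; complexes are cohomologically graded complexes of $k$-vector spaces, and $\pm$ or "Koszul sign" always refers to the usual sign rule. **2-disks.** A 2-disk $U=(n_1,\dots,n_m)$ is a sequence with $m\ge1$ and all $n_i\ge1$; it has $m$ columns, the $i$-th of which contains $n_i$ balls, ordered by height. Let $\mathcal F(U)$ be the set of all balls, $\pi(\nu)$ the column of the ball $\nu$; $\mathcal F(U)$ is ordered lexicographically (by column, then by height). Equivalently, $U$ is a pruned 2-tree with leaves $\mathcal F(U)$. A surjective map $P\colon U\to V$ consists of a monotone map of the sets of columns and, for each column of $U$, of a monotone map from its balls to the balls of the column of $V$ below it, such that $\mathcal F(U)\to\mathcal F(V)$ is onto. For $\mu\in\mathcal F(V)$, the fibre $P^{-1}(\mu)$ is the 2-disk of the balls of $U$ over $\mu$ (empty columns are removed). **The 2-operad $\mathrm{Nor}(\mathbf{Breq})$.** A configuration in $U$ is a collection of finite ordinals $I_\nu=[\ell_\nu]=\{0<\dots<\ell_\nu\}$, $\nu\in\mathcal F(U)$, $\ell_\nu\ge0$, with a total order on $\bigsqcup_\nu I_\nu$ that extends the order of each $I_\nu$ and such that: if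 $\pi(\nu_1)=\pi(\nu_2)$ and $\nu_1<\nu_2$ then $I_{\nu_1}<I_{\nu_2}$; if $\pi(\nu_1)<\pi(\nu_2)$ then $I_{\nu_1}<I_{\nu_2}$, or $I_{\nu_2}<I_{\nu_1}$, or $[0,a]<I_{\nu_1}<[a+1,\ell_{\nu_2}]$ for some $0\le a<\ell_{\nu_2}$. It is written as a word in the letters $\nu$, in which $\nu$ occurs $\ell_\nu+1$ times. $\mathbf{Breq}(U)$ is the complex with basis the configurations, a configuration having degree $-\sum_\nu\ell_\nu$. Its differential is the one of the total complex of a polysimplicial vector space, the directions $\nu$ being ordered lexicographically: it is the sum, over the $\nu$ with $\ell_\nu>0$ and $0\le i\le\ell_\nu$, of $(-1)^{i+\sum_{\nu'<\nu}\ell_{\nu'}}$ times the deletion of the $i$-th occurrence of $\nu$. $\mathrm{Nor}(\mathbf{Breq})(U)$ is the quotient of $\mathbf{Breq}(U)$ by the subcomplex spanned by the words with two equal consecutive letters. Let $P\colon U\to V$ be a surjective map, $\beta$ a configuration in $V$ with ordinals $J_\mu=[j_\mu]$, and $\alpha_\mu$ configurations in $P^{-1}(\mu)$, $\mu\in\mathcal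 F(V)$. The composition $M_P(\beta;(\alpha_\mu))\in\mathbf{Breq}(U)$ is defined as follows. Choose, for each $\mu$, a multiplicity $r\ge0$ for each letter occurrence in $\alpha_\mu$, with total sum $j_\mu$; replace an occurrence of $\nu$ with multiplicity $r$ by $\nu^{r+1}$, and cut the new word between any two of these $r+1$ letters, so that it falls into $j_\mu+1$ segments; then replace, for all $\mu$ and $i$, the $i$-th occurrence of $\mu$ in $\beta$ by the $i$-th segment of $\mu$. $M_P(\beta;(\alpha_\mu))$ is the sum over all choices of the resulting words, with the sign of the following permutation of elementary intervals: the ones of the $J_\mu$, followed, for all $\mu$ in turn, by the ones of the ordinals of $\alpha_\mu$ (each family being ordered lexicographically), are permuted into the elementary intervals of the ordinals of the new word, ordered lexicographically. Here the cuts in the new word correspond, in their order in $\alpha_\mu$, to the elementary intervals of $J_\mu$, and the other elementary intervals of its ordinals to those of the ordinals of $\alpha_\mu$. The operadic unit is the one-letter word in the 2-disk $(1)$. These differentials, compositions and unit descend to $\mathrm{Nor}(\mathbf{Breq})$. **The 2-operad $\mathcal O$.** For small dg categories $C,D$ the twisted tensor product $C\mathbin{\widetilde\otimes}D$ is the dg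 category with objects $\mathrm{Ob}\,C\times\mathrm{Ob}\,D$ generated by $\mathrm{id}_X\otimes g$ and $\varepsilon(f;g_1,\dots,g_r)$, $r\ge0$, from $(X_0,Y_0)$ to $(X_1,Y_r)$, of degree $\deg f+\sum(\deg g_i-1)$, for $f\colon X_0\to X_1$ in $C$ and composable $g_i\colon Y_{i-1}\to Y_i$ in $D$, where $\varepsilon(f;)=f\otimes\mathrm{id}$. The relations are: $\mathrm{id}_X\otimes-$ is a dg functor; $\varepsilon$ is multilinear; $\varepsilon(f;\dots)=0$ if some $g_i$ is an identity; $\varepsilon(\mathrm{id};g_1,\dots,g_r)=0$ for $r\ge1$; $\mathrm{id}_X\otimes\mathrm{id}_Y$ and $\varepsilon(\mathrm{id}_X;)$ are identities; $\varepsilon(f_2\circ f_1;g_1,\dots,g_r)=\sum_{i=0}^r\pm\varepsilon(f_2;g_{i+1},\dots,g_r)\circ\varepsilon(f_1;g_1,\dots,g_i)$; and the Hochschild formula $$d\,\varepsilon(f;g_1,\dots,g_r)=\varepsilon(df;g_1,\dots,g_r)+\sum_i\pm\varepsilon(f;\dots,dg_i,\dots)+\sum_i\pm\varepsilon(f;\dots,g_{i+1}\circ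 g_i,\dots)\pm\varepsilon(f;g_2,\dots,g_r)\circ(\mathrm{id}\otimes g_1)\pm(\mathrm{id}\otimes g_r)\circ\varepsilon(f;g_1,\dots,g_{r-1})$$ (the last two terms occurring for $r\ge1$). Let $I_n$ be the category with objects $0,\dots,n$ and $I_n(a,b)=k$ for $a\le b$, $0$ otherwise, and set $$\mathcal O(n_1,\dots,n_m)=\bigl(I_{n_m}\mathbin{\widetilde\otimes}(\cdots\mathbin{\widetilde\otimes}(I_{n_2}\mathbin{\widetilde\otimes}I_{n_1})\cdots)\bigr)(\min,\max),\qquad \min=(0,\dots,0),\quad \max=(n_m,\dots,n_1).$$ The innermost factor $I_{n_1}$ is taken in the form $I_{n_1}\mathbin{\widetilde\otimes}I_0$, where $I_0$ is the unit category. The composition along $P\colon U\to V$ plugs elements $a_\mu\in\mathcal O(P^{-1}(\mu))$ into $b\in\mathcal O(V)$: the $i$-th generator of the interval category of a column of $V$ is replaced by $a_\mu$, $\mu$ being the $i$-th ball of this column, and then the associativity functors $(C\mathbin{\widetilde\otimes}D)\mathbin{\widetilde\otimes}E\to C\mathbin{\widetilde\otimes}(D\mathbin{\widetilde\otimes}E)$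 are applied, with Koszul signs. On $\varepsilon$ of a composite or of an $\varepsilon$ the associativity functor is given by $\varepsilon(f'\circ f;\underline c)\mapsto\sum\pm\varepsilon(f';\underline c'')\circ\varepsilon(f;\underline c')$, summed over the ways to cut $\underline c$ in two, and $\varepsilon(\varepsilon(f;g_1,\dots,g_r);\underline c)\mapsto\sum\pm\varepsilon(f;\dots,\varepsilon(g_1;\underline c_1),\dots,\varepsilon(g_r;\underline c_r),\dots)$, summed over the choices of disjoint, possibly empty, consecutive subchains $\underline c_1,\dots,\underline c_r$ of $\underline c$, the other entries of $\underline c$ remaining in between. The operadic unit is the generator $f\otimes\mathrm{id}\in\mathcal O(1)$. **Proposition.** The plugging operation on $\mathcal O$ exists (it is determined by these rules on generators), and the dg 2-operads $\mathrm{Nor}(\mathbf{Breq})$ and $\mathcal O$ are isomorphic. More precisely, there are isomorphisms of complexes $\Phi_U\colon\mathrm{Nor}(\mathbf{Breq})(U)\to\mathcal O(U)$, for all 2-disks $U$, such that $\Phi$ preserves the units and, for all surjective maps $P\colon U\to V$ and all $\beta,(\alpha_\mu)$, $$\Phi_U\bigl(M_P(\beta;(\alpha_\mu)_\mu)\bigr)=\Phi_V(\beta)\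 \text{with the}\ \Phi_{P^{-1}(\mu)}(\alpha_\mu),\ \mu\in\mathcal F(V),\ \text{plugged in}.$$ Moreover $\Phi_U$ sends each configuration without equal consecutive letters, up to a sign, to the morphism $\varphi(\omega)$ of its word $\omega$ that is defined by induction on the number of columns: with $\lambda_1<\dots<\lambda_n$ the balls of the last column and $f_i$ the corresponding generators of $I_n$, $\varphi(\omega)$ is the composition of the factors of the fragments of $\omega$, in the order of the word, where the factor is $\varepsilon(f_i;\varphi(X_1),\dots,\varphi(X_\ell))$ for a fragment $\lambda_iX_1\lambda_iX_2\lambda_i\cdots X_\ell\lambda_i$ that contains all the occurrences of $\lambda_i$, with $X_j$ in the other columns (in particular $f_i\otimes\mathrm{id}$ if $\lambda_i$ occurs once), and $\mathrm{id}\otimes\varphi(Y)$ for a fragment $Y$ in the other columns. -/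

import Mathlib

universe u

namespace TwoOperad

/-! ## Differential graded categories -/

/-- The sign `(-1)^n` in `k`. -/
def sgn (k : Type u) [Field k] (n : ℤ) : k := ((n.negOnePow : ℤˣ) : ℤ)

/-- Small dg categories over `k`, with cohomological grading. Composition is written in
diagrammatic order: `comp f g` is "first `f`, then `g`". -/
structure DGCat (k : Type u) [Field k] where
  Obj : Type
  Hom : Obj → Obj → ℤ → Type u
  [acg : ∀ x y n, AddCommGroup (Hom x y n)]
  [mod : ∀ x y n, Module k (Hom x y n)]
  d : ∀ {x y : Obj} {n m : ℤ}, n + 1 = m → Hom x y n →ₗ[k] Hom x y m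
  one : ∀ x, Hom x x 0
  comp : ∀ {x y z : Obj} {m n p : ℤ}, m + n = p →
    (Hom x y m →ₗ[k] Hom y z n →ₗ[k] Hom x z p)
  d_d : ∀ {x y : Obj} {n m p : ℤ} (h : n + 1 = m) (h' : m + 1 = p) (f : Hom x y n),
    d h' (d h f) = 0
  one_comp : ∀ {x y : Obj} {n : ℤ} (h : 0 + n = n) (f : Hom x y n), comp h (one x) f = f
  comp_one : ∀ {x y : Obj} {n : ℤ} (h : n + 0 = n) (f : Hom x y n), comp h f (one y) = f
  assoc : ∀ {x y z w : Obj} {a b c ab bc abc : ℤ} (h₁ : a + b = ab) (h₂ : ab + c = abc)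
    (h₃ : b + c = bc) (h₄ : a + bc = abc) (f : Hom x y a) (g : Hom y z b) (e : Hom z w c),
    comp h₂ (comp h₁ f g) e = comp h₄ f (comp h₃ g e)
  d_comp : ∀ {x y z : Obj} {a b ab a' b' s : ℤ} (h : a + b = ab) (hs : ab + 1 = s)
    (ha : a + 1 = a') (hb : b + 1 = b') (h₁ : a' + b = s) (h₂ : a + b' = s)
    (f : Hom x y a) (g : Hom y z b),
    d hs (comp h f g) = comp h₁ (d ha f) g + sgn k a • comp h₂ f (d hb g)

attribute [instance] DGCat.acg DGCat.mod

variable {k : Type u} [Field k]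

/-- dg functors. -/
structure DGFunctor (C D : DGCat k) where
  obj : C.Obj → D.Obj
  map : ∀ {x y : C.Obj} {n : ℤ}, C.Hom x y n →ₗ[k] D.Hom (obj x) (obj y) n
  map_one : ∀ x, map (C.one x) = D.one (obj x)
  map_comp : ∀ {x y z : C.Obj} {m n p : ℤ} (h : m + n = p) (f : C.Hom x y m)
    (g : C.Hom y z n), map (C.comp h f g) = D.comp h (map f) (map g)
  map_d : ∀ {x y : C.Obj} {n m : ℤ} (h : n + 1 = m) (f : C.Hom x y n),
    map (C.d h f) = D.d h (map f)

def DGFunctor.refl (C : DGCat k) : DGFunctor C C where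
  obj x := x
  map := LinearMap.id
  map_one _ := rfl
  map_comp _ _ _ := rfl
  map_d _ _ := rfl

def DGFunctor.trans {C D E : DGCat k} (F : DGFunctor C D) (G : DGFunctor D E) :
    DGFunctor C E where
  obj x := G.obj (F.obj x)
  map := G.map ∘ₗ F.map
  map_one x := by simp [F.map_one, G.map_one]
  map_comp h f g := by simp [F.map_comp, G.map_comp]
  map_d h f := by simp [F.map_d, G.map_d]

/-- Transport of a morphism along equalities of its end points. -/
def DGCat.cast (C : DGCat k) {x x' y y' : C.Obj} {n : ℤ} (hx : x = x') (hy : y = y')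
    (f : C.Hom x y n) : C.Hom x' y' n := hx ▸ hy ▸ f

/-! ## Interval categories -/

/-- The line `k` in degree `0` if `a ≤ b`, and `0` otherwise. -/
def intervalHom (k : Type u) [Field k] {n : ℕ} (a b : Fin (n + 1)) (q : ℤ) : Submodule k k where
  carrier := {c | ¬ (a ≤ b ∧ q = 0) → c = 0}
  add_mem' := by intro c c' h h' hn; simp [h hn, h' hn]
  zero_mem' := by intro _; rfl
  smul_mem' := by intro r c h hn; simp [h hn]

lemma intervalHom_mul_mem {n : ℕ} {a b c : Fin (n + 1)} {p q r : ℤ} (h : p + q = r)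
    (f : intervalHom k a b p) (g : intervalHom k b c q) :
    (f : k) * (g : k) ∈ intervalHom k a c r := by
  intro hn
  by_cases h₁ : a ≤ b ∧ p = 0
  · by_cases h₂ : b ≤ c ∧ q = 0
    · exact absurd ⟨h₁.1.trans h₂.1, by omega⟩ hn
    · rw [g.2 h₂, mul_zero]
  · rw [f.2 h₁, zero_mul]

/-- The interval category `I_n`: objects `0, …, n`, with `I_n(a, b) = k` if `a ≤ b` and `0`
otherwise. In particular `I_0` is the unit category. -/
def interval (k : Type u) [Field k] (n : ℕ) : DGCat k where
  Obj := Fin (n + 1)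
  Hom a b q := intervalHom k a b q
  d _ := 0
  one a := ⟨1, fun h => absurd ⟨le_refl a, rfl⟩ h⟩
  comp h := LinearMap.mk₂ k (fun f g => ⟨(f : k) * (g : k), intervalHom_mul_mem h f g⟩)
    (by intros; ext; simp [add_mul]) (by intros; ext; simp [mul_assoc])
    (by intros; ext; simp [mul_add]) (by intros; ext; simp [mul_left_comm])
  d_d := by intros; rfl
  one_comp := by intros; ext; simp
  comp_one := by intros; ext; simp
  assoc := by intros; ext; simp [mul_assoc]
  d_comp := by intros; ext; simp

/-- The generator `i → i + 1` of `I_n`. -/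
def interval.gen (k : Type u) [Field k] {n : ℕ} (i : Fin n) :
    (interval k n).Hom i.castSucc i.succ 0 :=
  ⟨(1 : k), fun h => absurd ⟨Fin.castSucc_lt_succ.le, rfl⟩ h⟩

/-- The object `o + s` of `I_n`. -/
def interval.shiftObj (k : Type u) [Field k] {h n : ℕ} (o : ℕ) (ho : o + h ≤ n)
    (s : (interval k h).Obj) : (interval k n).Obj :=
  let s' : Fin (h + 1) := s
  (⟨o + s'.1, by have := s'.2; omega⟩ : Fin (n + 1))

/-- The inclusion `I_h → I_n` onto the objects `o, …, o + h`. -/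
def interval.shift (k : Type u) [Field k] {h n : ℕ} (o : ℕ) (ho : o + h ≤ n) :
    DGFunctor (interval k h) (interval k n) where
  obj := interval.shiftObj k o ho
  map {x y q} :=
    { toFun := fun f => ⟨f.1, fun hn => f.2 fun hxy => hn
        ⟨Nat.add_le_add_left (Fin.le_def.1 hxy.1) o, hxy.2⟩⟩
      map_add' := by intros; rfl
      map_smul' := by intros; rfl }
  map_one _ := rfl
  map_comp _ _ _ := rfl
  map_d _ _ := rfl

/-! ## Chains of composable morphisms -/

/-- Composable chains `g₁, …, g_r` (`r ≥ 0`) of homogeneous morphisms of `D`. -/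
inductive Chain (D : DGCat k) : D.Obj → D.Obj → Type u
  | nil (y : D.Obj) : Chain D y y
  | cons {y z w : D.Obj} {m : ℤ} (g : D.Hom y z m) (c : Chain D z w) : Chain D y w

namespace Chain

/-- `∑ (|g_i| - 1)`, the degree of `[g₁|…|g_r]` in the bar construction. -/
def deg {D : DGCat k} : ∀ {y w : D.Obj}, Chain D y w → ℤ
  | _, _, nil _ => 0
  | _, _, cons (m := m) _ c => m - 1 + c.deg

/-- A way to cut a chain into two consecutive (possibly empty) chains. -/
structure Split (D : DGCat k) (y w : D.Obj) (s : ℤ) where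
  mid : D.Obj
  left : Chain D y mid
  right : Chain D mid w
  deg_eq : left.deg + right.deg = s

/-- All the ways to cut a chain in two. -/
def splits {D : DGCat k} : ∀ {y w : D.Obj} (c : Chain D y w), List (Split D y w c.deg)
  | _, _, nil y => [⟨y, nil y, nil y, by simp [deg]⟩]
  | y, _, cons g c => ⟨y, nil y, cons g c, by simp [deg]⟩ ::
      c.splits.map fun S => ⟨S.mid, cons g S.left, S.right, by
        have := S.deg_eq; simp only [deg]; omega⟩

/-- A chain of degree `s` with a sign `(-1)^sign`. -/
structure Term (D : DGCat k) (y w : D.Obj) (s : ℤ) where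
  sign : ℤ
  chain : Chain D y w
  deg_eq : chain.deg = s

/-- The terms of the bar differential, with `[g] ↦ -[dg]` and
`[g|g'] ↦ (-1)^|g| [g g']`, extended as a coderivation. -/
def bar {D : DGCat k} : ∀ {y w : D.Obj} (c : Chain D y w), List (Term D y w (c.deg + 1))
  | _, _, nil _ => []
  | _, _, cons (m := m) g c =>
      [⟨1, cons (D.d rfl g) c, by simp only [deg]; omega⟩] ++
      (match c with
        | nil _ => []
        | cons g' c' => [⟨m, cons (D.comp rfl g g') c', by simp only [deg]; omega⟩]) ++
      c.bar.map fun t => ⟨t.sign + (m - 1), cons g t.chain, by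
        have := t.deg_eq; simp only [deg]; omega⟩

/-- `c` is obtained from `c₁` and `c₂` by adding the entries at one place, all the other entries
being the same. -/
inductive IsSum {D : DGCat k} : ∀ {y w : D.Obj},
    Chain D y w → Chain D y w → Chain D y w → Prop
  | head {y z w : D.Obj} {m : ℤ} (g g' : D.Hom y z m) (c : Chain D z w) :
      IsSum (cons (g + g') c) (cons g c) (cons g' c)
  | tail {y z w : D.Obj} {m : ℤ} (g : D.Hom y z m) {c c₁ c₂ : Chain D z w} :
      IsSum c c₁ c₂ → IsSum (cons g c) (cons g c₁) (cons g c₂)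

/-- `c` is obtained from `c₁` by multiplying one entry by `r`. -/
inductive IsSmul {D : DGCat k} (r : k) : ∀ {y w : D.Obj}, Chain D y w → Chain D y w → Prop
  | head {y z w : D.Obj} {m : ℤ} (g : D.Hom y z m) (c : Chain D z w) :
      IsSmul r (cons (r • g) c) (cons g c)
  | tail {y z w : D.Obj} {m : ℤ} (g : D.Hom y z m) {c c₁ : Chain D z w} :
      IsSmul r c c₁ → IsSmul r (cons g c) (cons g c₁)

/-- Some entry of the chain is an identity morphism. -/
inductive HasOne {D : DGCat k} : ∀ {y w : D.Obj}, Chain D y w → Prop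
  | head {y w : D.Obj} (c : Chain D y w) : HasOne (cons (D.one y) c)
  | tail {y z w : D.Obj} {m : ℤ} (g : D.Hom y z m) {c : Chain D z w} :
      HasOne c → HasOne (cons g c)

/-- The image of a chain under a dg functor. -/
def map {D E : DGCat k} (F : DGFunctor D E) : ∀ {y w : D.Obj}, Chain D y w →
    Chain E (F.obj y) (F.obj w)
  | _, _, nil y => nil (F.obj y)
  | _, _, cons g c => cons (F.map g) (c.map F)

lemma deg_map {D E : DGCat k} (F : DGFunctor D E) : ∀ {y w : D.Obj} (c : Chain D y w),
    (c.map F).deg = c.deg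
  | _, _, nil _ => rfl
  | _, _, cons _ c => by simp only [map, deg, deg_map F c]

end Chain

/-! ## The twisted tensor product of dg categories -/

/-- Formal expressions for the morphisms of the twisted tensor product, built from the generators
`right x g = id_x ⊗ g` and `eps f [g₁, …, g_r] = ε(f; g₁, …, g_r)` (where `ε(f; ) = f ⊗ id`) by
linear combinations, composition, identities and the differential. -/
inductive Pre (C D : DGCat k) : C.Obj × D.Obj → C.Obj × D.Obj → ℤ → Type u
  | zero {X Y : C.Obj × D.Obj} {n : ℤ} : Pre C D X Y n
  | add {X Y : C.Obj × D.Obj} {n : ℤ} (a b : Pre C D X Y n) : Pre C D X Y n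
  | smul {X Y : C.Obj × D.Obj} {n : ℤ} (r : k) (a : Pre C D X Y n) : Pre C D X Y n
  | diff {X Y : C.Obj × D.Obj} {n m : ℤ} (h : n + 1 = m) (a : Pre C D X Y n) : Pre C D X Y m
  | one (X : C.Obj × D.Obj) : Pre C D X X 0
  | comp {X Y Z : C.Obj × D.Obj} {m n p : ℤ} (h : m + n = p) (a : Pre C D X Y m)
      (b : Pre C D Y Z n) : Pre C D X Z p
  | right (x : C.Obj) {y w : D.Obj} {m n : ℤ} (h : m = n) (g : D.Hom y w m) :
      Pre C D (x, y) (x, w) n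
  | eps {x x' : C.Obj} {y w : D.Obj} {n p : ℤ} (f : C.Hom x x' n) (c : Chain D y w)
      (h : n + c.deg = p) : Pre C D (x, y) (x', w) p

namespace Pre

variable {C D : DGCat k}

/-- The sum of a list of expressions. -/
def sum {X Y : C.Obj × D.Obj} {n : ℤ} : List (Pre C D X Y n) → Pre C D X Y n
  | [] => zero
  | a :: l => add a (sum l)

/-- The universal twisting cochain: `[g] ↦ id_x ⊗ g`, and `0` on chains of length `≠ 1`. -/
def tau (x : C.Obj) : ∀ {y w : D.Obj} {n : ℤ} (c : Chain D y w), c.deg + 1 = n →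
    Pre C D (x, y) (x, w) n
  | _, _, _, .cons g (.nil _), h => right x (by simpa [Chain.deg] using h) g
  | _, _, _, .nil _, _ => zero
  | _, _, _, .cons _ (.cons _ _), _ => zero

/-- `ε(f₁; c') ε(f₂; c'')` summed with Koszul signs over all the ways to cut `c` into `c'`, `c''`. -/
def epsComp {x x' x'' : C.Obj} {y w : D.Obj} {m n q p : ℤ} (f : C.Hom x x' m)
    (f' : C.Hom x' x'' n) (c : Chain D y w) (hq : m + n = q) (hp : q + c.deg = p) :
    Pre C D (x, y) (x'', w) p :=
  sum (c.splits.map fun S => smul (sgn k (n * S.left.deg))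
    (comp (by have := S.deg_eq; omega) (eps f S.left rfl) (eps f' S.right rfl)))

/-- The Hochschild type differential of `ε(f; c)`: the sum of `ε(df; c)`, of the terms in which the
bar differential is applied to `c`, and of the two boundary terms, in which the first, or the last,
entry of `c` is split off. -/
def epsDiff {x x' : C.Obj} {y w : D.Obj} {n p q : ℤ} (f : C.Hom x x' n) (c : Chain D y w)
    (hp : n + c.deg = p) (hq : p + 1 = q) : Pre C D (x, y) (x', w) q :=
  add (eps (C.d rfl f) c (by omega))
    (add (sum (c.bar.map fun t => smul (sgn k (n + t.sign))
        (eps f t.chain (by have := t.deg_eq; omega))))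
      (add (sum (c.splits.map fun S => smul (-sgn k (n * S.left.deg))
          (comp (by have := S.deg_eq; omega) (tau x S.left rfl) (eps f S.right rfl))))
        (sum (c.splits.map fun S => smul (sgn k (n + S.left.deg))
          (comp (by have := S.deg_eq; omega) (eps f S.left rfl) (tau x' S.right rfl))))))

end Pre

open Pre in
/-- The relations: those of a dg category, and the defining relations between the generators. -/
inductive Rel (C D : DGCat k) : ∀ {X Y : C.Obj × D.Obj} {n : ℤ},
    Pre C D X Y n → Pre C D X Y n → Prop
  | refl {X Y : C.Obj × D.Obj} {n : ℤ} (a : Pre C D X Y n) : Rel C D a a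
  | symm {X Y : C.Obj × D.Obj} {n : ℤ} {a b : Pre C D X Y n} : Rel C D a b → Rel C D b a
  | trans {X Y : C.Obj × D.Obj} {n : ℤ} {a b c : Pre C D X Y n} :
      Rel C D a b → Rel C D b c → Rel C D a c
  | add_congr {X Y : C.Obj × D.Obj} {n : ℤ} {a a' b b' : Pre C D X Y n} :
      Rel C D a a' → Rel C D b b' → Rel C D (add a b) (add a' b')
  | smul_congr {X Y : C.Obj × D.Obj} {n : ℤ} (r : k) {a a' : Pre C D X Y n} :
      Rel C D a a' → Rel C D (smul r a) (smul r a')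
  | diff_congr {X Y : C.Obj × D.Obj} {n m : ℤ} (h : n + 1 = m) {a a' : Pre C D X Y n} :
      Rel C D a a' → Rel C D (diff h a) (diff h a')
  | comp_congr {X Y Z : C.Obj × D.Obj} {m n p : ℤ} (h : m + n = p) {a a' : Pre C D X Y m}
      {b b' : Pre C D Y Z n} :
      Rel C D a a' → Rel C D b b' → Rel C D (comp h a b) (comp h a' b')
  -- the morphisms form vector spaces
  | add_comm {X Y : C.Obj × D.Obj} {n : ℤ} (a b : Pre C D X Y n) : Rel C D (add a b) (add b a)
  | add_assoc {X Y : C.Obj × D.Obj} {n : ℤ} (a b c : Pre C D X Y n) :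
      Rel C D (add (add a b) c) (add a (add b c))
  | zero_add {X Y : C.Obj × D.Obj} {n : ℤ} (a : Pre C D X Y n) : Rel C D (add zero a) a
  | neg_add {X Y : C.Obj × D.Obj} {n : ℤ} (a : Pre C D X Y n) :
      Rel C D (add (smul (-1) a) a) zero
  | smul_add {X Y : C.Obj × D.Obj} {n : ℤ} (r : k) (a b : Pre C D X Y n) :
      Rel C D (smul r (add a b)) (add (smul r a) (smul r b))
  | add_smul {X Y : C.Obj × D.Obj} {n : ℤ} (r s : k) (a : Pre C D X Y n) :
      Rel C D (smul (r + s) a) (add (smul r a) (smul s a))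
  | mul_smul {X Y : C.Obj × D.Obj} {n : ℤ} (r s : k) (a : Pre C D X Y n) :
      Rel C D (smul (r * s) a) (smul r (smul s a))
  | one_smul {X Y : C.Obj × D.Obj} {n : ℤ} (a : Pre C D X Y n) : Rel C D (smul 1 a) a
  -- the morphisms form a dg category
  | diff_add {X Y : C.Obj × D.Obj} {n m : ℤ} (h : n + 1 = m) (a b : Pre C D X Y n) :
      Rel C D (diff h (add a b)) (add (diff h a) (diff h b))
  | diff_smul {X Y : C.Obj × D.Obj} {n m : ℤ} (h : n + 1 = m) (r : k) (a : Pre C D X Y n) :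
      Rel C D (diff h (smul r a)) (smul r (diff h a))
  | add_comp {X Y Z : C.Obj × D.Obj} {m n p : ℤ} (h : m + n = p) (a a' : Pre C D X Y m)
      (b : Pre C D Y Z n) : Rel C D (comp h (add a a') b) (add (comp h a b) (comp h a' b))
  | smul_comp {X Y Z : C.Obj × D.Obj} {m n p : ℤ} (h : m + n = p) (r : k) (a : Pre C D X Y m)
      (b : Pre C D Y Z n) : Rel C D (comp h (smul r a) b) (smul r (comp h a b))
  | comp_add {X Y Z : C.Obj × D.Obj} {m n p : ℤ} (h : m + n = p) (a : Pre C D X Y m)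
      (b b' : Pre C D Y Z n) : Rel C D (comp h a (add b b')) (add (comp h a b) (comp h a b'))
  | comp_smul {X Y Z : C.Obj × D.Obj} {m n p : ℤ} (h : m + n = p) (r : k) (a : Pre C D X Y m)
      (b : Pre C D Y Z n) : Rel C D (comp h a (smul r b)) (smul r (comp h a b))
  | diff_diff {X Y : C.Obj × D.Obj} {n m p : ℤ} (h : n + 1 = m) (h' : m + 1 = p)
      (a : Pre C D X Y n) : Rel C D (diff h' (diff h a)) zero
  | one_comp {X Y : C.Obj × D.Obj} {n : ℤ} (h : 0 + n = n) (a : Pre C D X Y n) :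
      Rel C D (comp h (one X) a) a
  | comp_one {X Y : C.Obj × D.Obj} {n : ℤ} (h : n + 0 = n) (a : Pre C D X Y n) :
      Rel C D (comp h a (one Y)) a
  | assoc {X Y Z W : C.Obj × D.Obj} {a b c ab bc abc : ℤ} (h₁ : a + b = ab) (h₂ : ab + c = abc)
      (h₃ : b + c = bc) (h₄ : a + bc = abc) (e : Pre C D X Y a) (f : Pre C D Y Z b)
      (g : Pre C D Z W c) : Rel C D (comp h₂ (comp h₁ e f) g) (comp h₄ e (comp h₃ f g))
  | diff_comp {X Y Z : C.Obj × D.Obj} {a b ab a' b' s : ℤ} (h : a + b = ab) (hs : ab + 1 = s)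
      (ha : a + 1 = a') (hb : b + 1 = b') (h₁ : a' + b = s) (h₂ : a + b' = s)
      (f : Pre C D X Y a) (g : Pre C D Y Z b) :
      Rel C D (diff hs (comp h f g))
        (add (comp h₁ (diff ha f) g) (smul (sgn k a) (comp h₂ f (diff hb g))))
  -- `id_x ⊗ -` is a dg functor
  | right_add (x : C.Obj) {y w : D.Obj} {m n : ℤ} (h : m = n) (g g' : D.Hom y w m) :
      Rel C D (right x h (g + g')) (add (right x h g) (right x h g'))
  | right_smul (x : C.Obj) {y w : D.Obj} {m n : ℤ} (h : m = n) (r : k) (g : D.Hom y w m) :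
      Rel C D (right x h (r • g)) (smul r (right x h g))
  | right_one (x : C.Obj) (y : D.Obj) (h : (0 : ℤ) = 0) :
      Rel C D (right x h (D.one y)) (one (x, y))
  | right_comp (x : C.Obj) {y z w : D.Obj} {a b ab a' b' ab' : ℤ} (h : a + b = ab)
      (ha : a = a') (hb : b = b') (hab : ab = ab') (h' : a' + b' = ab')
      (g : D.Hom y z a) (g' : D.Hom z w b) :
      Rel C D (right x hab (D.comp h g g')) (comp h' (right x ha g) (right x hb g'))
  | right_diff (x : C.Obj) {y w : D.Obj} {m n m' n' : ℤ} (h : m + 1 = n) (hm : m = m')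
      (hn : n = n') (h' : m' + 1 = n') (g : D.Hom y w m) :
      Rel C D (right x hn (D.d h g)) (diff h' (right x hm g))
  -- `ε` is multilinear
  | eps_add {x x' : C.Obj} {y w : D.Obj} {n p : ℤ} (f f' : C.Hom x x' n) (c : Chain D y w)
      (h : n + c.deg = p) : Rel C D (eps (f + f') c h) (add (eps f c h) (eps f' c h))
  | eps_smul {x x' : C.Obj} {y w : D.Obj} {n p : ℤ} (r : k) (f : C.Hom x x' n)
      (c : Chain D y w) (h : n + c.deg = p) : Rel C D (eps (r • f) c h) (smul r (eps f c h))
  | eps_chain_add {x x' : C.Obj} {y w : D.Obj} {n p : ℤ} (f : C.Hom x x' n)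
      {c c₁ c₂ : Chain D y w} (hc : Chain.IsSum c c₁ c₂) (h : n + c.deg = p)
      (h₁ : n + c₁.deg = p) (h₂ : n + c₂.deg = p) :
      Rel C D (eps f c h) (add (eps f c₁ h₁) (eps f c₂ h₂))
  | eps_chain_smul {x x' : C.Obj} {y w : D.Obj} {n p : ℤ} (f : C.Hom x x' n) {r : k}
      {c c₁ : Chain D y w} (hc : Chain.IsSmul r c c₁) (h : n + c.deg = p)
      (h₁ : n + c₁.deg = p) : Rel C D (eps f c h) (smul r (eps f c₁ h₁))
  -- `ε` is normalised
  | eps_chain_one {x x' : C.Obj} {y w : D.Obj} {n p : ℤ} (f : C.Hom x x' n) {c : Chain D y w}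
      (hc : Chain.HasOne c) (h : n + c.deg = p) : Rel C D (eps f c h) zero
  | eps_one_cons (x : C.Obj) {y z w : D.Obj} {m p : ℤ} (g : D.Hom y z m) (c : Chain D z w)
      (h : 0 + (Chain.cons g c).deg = p) : Rel C D (eps (C.one x) (Chain.cons g c) h) zero
  | eps_one_nil (x : C.Obj) (y : D.Obj) (h : 0 + (Chain.nil y).deg = 0) :
      Rel C D (eps (C.one x) (Chain.nil y) h) (one (x, y))
  -- composition in the first argument, and the differential
  | eps_comp {x x' x'' : C.Obj} {y w : D.Obj} {m n q p : ℤ} (f : C.Hom x x' m)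
      (f' : C.Hom x' x'' n) (c : Chain D y w) (hq : m + n = q) (hp : q + c.deg = p) :
      Rel C D (eps (C.comp hq f f') c hp) (epsComp f f' c hq hp)
  | eps_diff {x x' : C.Obj} {y w : D.Obj} {n p q : ℤ} (f : C.Hom x x' n) (c : Chain D y w)
      (hp : n + c.deg = p) (hq : p + 1 = q) :
      Rel C D (diff hq (eps f c hp)) (epsDiff f c hp hq)

def relSetoid (C D : DGCat k) (X Y : C.Obj × D.Obj) (n : ℤ) : Setoid (Pre C D X Y n) where
  r := Rel C D
  iseqv := ⟨Rel.refl, Rel.symm, Rel.trans⟩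

/-- Morphisms of the twisted tensor product. -/
def TwHom (C D : DGCat k) (X Y : C.Obj × D.Obj) (n : ℤ) : Type u :=
  Quotient (relSetoid C D X Y n)

namespace TwHom

variable {C D : DGCat k}

/-- The class of an expression. -/
def mk {X Y : C.Obj × D.Obj} {n : ℤ} (a : Pre C D X Y n) : TwHom C D X Y n :=
  Quotient.mk (relSetoid C D X Y n) a

lemma sound {X Y : C.Obj × D.Obj} {n : ℤ} {a b : Pre C D X Y n} (h : Rel C D a b) :
    mk a = mk b := Quotient.sound (s := relSetoid C D X Y n) h

lemma ind {X Y : C.Obj × D.Obj} {n : ℤ} {P : TwHom C D X Y n → Prop} (h : ∀ a, P (mk a)) :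
    ∀ a, P a := Quotient.ind h

def add {X Y : C.Obj × D.Obj} {n : ℤ} (a b : TwHom C D X Y n) : TwHom C D X Y n :=
  Quotient.liftOn₂ a b (fun a b => mk (Pre.add a b))
    fun _ _ _ _ h h' => sound (Rel.add_congr h h')

def smul {X Y : C.Obj × D.Obj} {n : ℤ} (r : k) (a : TwHom C D X Y n) : TwHom C D X Y n :=
  Quotient.liftOn a (fun a => mk (Pre.smul r a)) fun _ _ h => sound (Rel.smul_congr r h)

instance (X Y : C.Obj × D.Obj) (n : ℤ) : Zero (TwHom C D X Y n) := ⟨mk Pre.zero⟩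

instance (X Y : C.Obj × D.Obj) (n : ℤ) : Add (TwHom C D X Y n) := ⟨add⟩

instance (X Y : C.Obj × D.Obj) (n : ℤ) : Neg (TwHom C D X Y n) := ⟨smul (-1)⟩

instance (X Y : C.Obj × D.Obj) (n : ℤ) : AddCommGroup (TwHom C D X Y n) where
  add_assoc := by
    refine ind fun a => ind fun b => ind fun c => sound (Rel.add_assoc a b c)
  zero_add := ind fun a => sound (Rel.zero_add a)
  add_zero := ind fun a => sound ((Rel.add_comm _ _).trans (Rel.zero_add a))
  neg_add_cancel := ind fun a => sound (Rel.neg_add a)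
  add_comm := ind fun a => ind fun b => sound (Rel.add_comm a b)
  nsmul := nsmulRec
  zsmul := zsmulRec

instance (X Y : C.Obj × D.Obj) (n : ℤ) : SMul k (TwHom C D X Y n) := ⟨smul⟩

instance (X Y : C.Obj × D.Obj) (n : ℤ) : Module k (TwHom C D X Y n) :=
  Module.ofMinimalAxioms
    (fun r => ind fun a => ind fun b => sound (Rel.smul_add r a b))
    (fun r s => ind fun a => sound (Rel.add_smul r s a))
    (fun r s => ind fun a => sound (Rel.mul_smul r s a))
    (ind fun a => sound (Rel.one_smul a))

end TwHom

open TwHom in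
/-- The twisted tensor product of `C` and `D`: the dg category with objects `Ob C × Ob D` presented
by the generators `id_x ⊗ g`, `f ⊗ id_y`, `ε(f; g₁, …, g_r)` and the relations above. -/
def tw (C D : DGCat k) : DGCat k where
  Obj := C.Obj × D.Obj
  Hom := TwHom C D
  d h :=
    { toFun := fun a => Quotient.liftOn a (fun a => mk (Pre.diff h a))
        fun _ _ e => sound (Rel.diff_congr h e)
      map_add' := ind fun a => ind fun b => sound (Rel.diff_add h a b)
      map_smul' := fun r => ind fun a => sound (Rel.diff_smul h r a) }
  one X := mk (Pre.one X)
  comp h := LinearMap.mk₂ k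
    (fun a b => Quotient.liftOn₂ a b (fun a b => mk (Pre.comp h a b))
      fun _ _ _ _ e e' => sound (Rel.comp_congr h e e'))
    (ind fun a => ind fun a' => ind fun b => sound (Rel.add_comp h a a' b))
    (fun r => ind fun a => ind fun b => sound (Rel.smul_comp h r a b))
    (ind fun a => ind fun b => ind fun b' => sound (Rel.comp_add h a b b'))
    (fun r => ind fun a => ind fun b => sound (Rel.comp_smul h r a b))
  d_d h h' := ind fun a => sound (Rel.diff_diff h h' a)
  one_comp h := ind fun a => sound (Rel.one_comp h a)
  comp_one h := ind fun a => sound (Rel.comp_one h a)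
  assoc h₁ h₂ h₃ h₄ := ind fun a => ind fun b => ind fun c => sound (Rel.assoc h₁ h₂ h₃ h₄ a b c)
  d_comp h hs ha hb h₁ h₂ := ind fun a => ind fun b =>
    sound (Rel.diff_comp h hs ha hb h₁ h₂ a b)

/-- The object `(x, y)` of the twisted tensor product. -/
def tw.pt {C D : DGCat k} (x : C.Obj) (y : D.Obj) : (tw C D).Obj := (x, y)

/-- The generator `ε(f; c)`. -/
def tw.eps {C D : DGCat k} {x x' : C.Obj} {y w : D.Obj} {n p : ℤ} (f : C.Hom x x' n)
    (c : Chain D y w) (h : n + c.deg = p) : (tw C D).Hom (tw.pt x y) (tw.pt x' w) p :=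
  TwHom.mk (Pre.eps f c h)

/-- The dg functor `D → C ⊗ D`, `g ↦ id_x ⊗ g`. -/
def tw.right {C D : DGCat k} (x : C.Obj) : DGFunctor D (tw C D) where
  obj y := tw.pt x y
  map :=
    { toFun := fun g => TwHom.mk (Pre.right x rfl g)
      map_add' := fun g g' => TwHom.sound (Rel.right_add x rfl g g')
      map_smul' := fun r g => TwHom.sound (Rel.right_smul x rfl r g) }
  map_one y := TwHom.sound (Rel.right_one x y rfl)
  map_comp h g g' := TwHom.sound (Rel.right_comp x h rfl rfl rfl h g g')
  map_d h g := TwHom.sound (Rel.right_diff x h rfl rfl h g)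

namespace Chain

lemma splits_map {D E : DGCat k} (F : DGFunctor D E) {Z : Type*} : ∀ {y w : D.Obj}
    (c : Chain D y w) (Ψ : ∀ (z : E.Obj) (l : Chain E (F.obj y) z) (r : Chain E z (F.obj w)),
      l.deg + r.deg = (c.map F).deg → Z),
    (c.map F).splits.map (fun S => Ψ S.mid S.left S.right S.deg_eq) =
      c.splits.map fun S => Ψ (F.obj S.mid) (S.left.map F) (S.right.map F) (by
        rw [deg_map, deg_map, deg_map, S.deg_eq])
  | _, _, nil _, _ => rfl
  | _, _, cons (m := m) g c, Ψ => by
    have := splits_map F c fun z l r h => Ψ z (cons (F.map g) l) r (by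
      simp only [map, deg] at h ⊢; omega)
    simp only [map, splits, List.map_cons, List.map_map, Function.comp_def] at this ⊢
    rw [this]

lemma bar_map {D E : DGCat k} (F : DGFunctor D E) {Z : Type*} : ∀ {y w : D.Obj}
    (c : Chain D y w) (Ψ : ∀ (_ : ℤ) (l : Chain E (F.obj y) (F.obj w)),
      l.deg = (c.map F).deg + 1 → Z),
    (c.map F).bar.map (fun t => Ψ t.sign t.chain t.deg_eq) =
      c.bar.map fun t => Ψ t.sign (t.chain.map F) (by rw [deg_map, deg_map, t.deg_eq])
  | _, _, nil _, _ => rfl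
  | _, _, cons (m := m) g c, Ψ => by
    have := bar_map F c fun s l h => Ψ (s + (m - 1)) (cons (F.map g) l) (by
      simp only [map, deg] at h ⊢; omega)
    cases c with
    | nil => simp only [map, bar, F.map_d, List.map_cons, List.map_nil, List.append_nil]
    | cons g' c' =>
      simp only [map, bar, F.map_d, F.map_comp, List.map_append, List.map_cons, List.map_nil,
        List.map_map, Function.comp_def] at this ⊢
      rw [this]

lemma IsSum.map {D E : DGCat k} (F : DGFunctor D E) {y w : D.Obj} {c c₁ c₂ : Chain D y w}
    (h : IsSum c c₁ c₂) : IsSum (c.map F) (c₁.map F) (c₂.map F) := by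
  induction h with
  | head g g' c => simpa only [Chain.map, map_add] using IsSum.head _ _ _
  | tail g _ ih => exact IsSum.tail _ ih

lemma IsSmul.map {D E : DGCat k} (F : DGFunctor D E) {r : k} {y w : D.Obj} {c c₁ : Chain D y w}
    (h : IsSmul r c c₁) : IsSmul r (c.map F) (c₁.map F) := by
  induction h with
  | head g c => simpa only [Chain.map, map_smul] using IsSmul.head _ _
  | tail g _ ih => exact IsSmul.tail _ ih

lemma HasOne.map {D E : DGCat k} (F : DGFunctor D E) {y w : D.Obj} {c : Chain D y w}
    (h : HasOne c) : HasOne (c.map F) := by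
  induction h with
  | head c => simpa only [Chain.map, F.map_one] using HasOne.head _
  | tail g _ ih => exact HasOne.tail _ ih

end Chain

namespace Pre

variable {C C' D D' : DGCat k}

/-- The effect of dg functors on expressions. -/
def map (F : DGFunctor C C') (G : DGFunctor D D') : ∀ {X Y : C.Obj × D.Obj} {n : ℤ},
    Pre C D X Y n → Pre C' D' (F.obj X.1, G.obj X.2) (F.obj Y.1, G.obj Y.2) n
  | _, _, _, zero => zero
  | _, _, _, add a b => add (a.map F G) (b.map F G)
  | _, _, _, smul r a => smul r (a.map F G)
  | _, _, _, diff h a => diff h (a.map F G)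
  | _, _, _, one X => one (F.obj X.1, G.obj X.2)
  | _, _, _, comp h a b => comp h (a.map F G) (b.map F G)
  | _, _, _, right x h g => right (F.obj x) h (G.map g)
  | _, _, _, eps f c h => eps (F.map f) (c.map G) (by rw [Chain.deg_map, h])

lemma map_sum (F : DGFunctor C C') (G : DGFunctor D D') {X Y : C.Obj × D.Obj} {n : ℤ} :
    ∀ l : List (Pre C D X Y n), (sum l).map F G = sum (l.map (map F G))
  | [] => rfl
  | a :: l => by simp only [sum, map, List.map_cons, map_sum F G l]

lemma map_tau (F : DGFunctor C C') (G : DGFunctor D D') (x : C.Obj) : ∀ {y w : D.Obj} {n : ℤ}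
    (c : Chain D y w) (h : c.deg + 1 = n),
    (tau x c h).map F G = tau (F.obj x) (c.map G) (by rw [Chain.deg_map, h])
  | _, _, _, .nil _, _ => rfl
  | _, _, _, .cons _ (.nil _), _ => rfl
  | _, _, _, .cons _ (.cons _ _), _ => rfl

lemma comp_eps_eps {x x' x'' : C.Obj} {y z w : D.Obj} {m n a a' b b' p : ℤ} (f : C.Hom x x' m)
    (f' : C.Hom x' x'' n) (l : Chain D y z) (r : Chain D z w) (h₁ : m + l.deg = a)
    (h₁' : m + l.deg = a') (h₂ : n + r.deg = b) (h₂' : n + r.deg = b') (h : a + b = p)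
    (h' : a' + b' = p) :
    comp h (eps f l h₁) (eps f' r h₂) = comp h' (eps f l h₁') (eps f' r h₂') := by
  subst h₁ h₁' h₂ h₂'; rfl

lemma comp_tau_eps {x x' : C.Obj} {y z w : D.Obj} {n a a' b b' p : ℤ}
    (f : C.Hom x x' n) (l : Chain D y z) (r : Chain D z w) (h₁ : l.deg + 1 = a)
    (h₁' : l.deg + 1 = a') (h₂ : n + r.deg = b) (h₂' : n + r.deg = b') (h : a + b = p)
    (h' : a' + b' = p) :
    comp h (tau x l h₁) (eps f r h₂) = comp h' (tau x l h₁') (eps f r h₂') := by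
  subst h₁ h₁' h₂ h₂'; rfl

lemma comp_eps_tau {x x' : C.Obj} {y z w : D.Obj} {n a a' b b' p : ℤ}
    (f : C.Hom x x' n) (l : Chain D y z) (r : Chain D z w) (h₁ : n + l.deg = a)
    (h₁' : n + l.deg = a') (h₂ : r.deg + 1 = b) (h₂' : r.deg + 1 = b') (h : a + b = p)
    (h' : a' + b' = p) :
    comp h (eps f l h₁) (tau x' r h₂) = comp h' (eps f l h₁') (tau x' r h₂') := by
  subst h₁ h₁' h₂ h₂'; rfl

lemma map_epsComp (F : DGFunctor C C') (G : DGFunctor D D') {x x' x'' : C.Obj} {y w : D.Obj}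
    {m n q p : ℤ} (f : C.Hom x x' m) (f' : C.Hom x' x'' n) (c : Chain D y w) (hq : m + n = q)
    (hp : q + c.deg = p) :
    (epsComp f f' c hq hp).map F G =
      epsComp (F.map f) (F.map f') (c.map G) hq (by rw [Chain.deg_map, hp]) := by
  unfold epsComp
  rw [map_sum, List.map_map]
  refine congrArg sum ((List.map_congr_left fun S _ => ?_).trans
    (Chain.splits_map G c fun z l r h => smul (sgn k (n * l.deg))
      (comp (by rw [Chain.deg_map] at h; omega) (eps (F.map f) l rfl)
        (eps (F.map f') r rfl))).symm)
  simp only [Function.comp, map, Chain.deg_map]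
  exact congrArg _ (comp_eps_eps _ _ _ _ _ _ _ _ _ _)

lemma map_epsDiff (F : DGFunctor C C') (G : DGFunctor D D') {x x' : C.Obj} {y w : D.Obj}
    {n p q : ℤ} (f : C.Hom x x' n) (c : Chain D y w) (hp : n + c.deg = p) (hq : p + 1 = q) :
    (epsDiff f c hp hq).map F G =
      epsDiff (F.map f) (c.map G) (by rw [Chain.deg_map, hp]) hq := by
  unfold epsDiff
  simp only [map, map_sum, List.map_map, F.map_d]
  refine congrArg₂ add rfl (congrArg₂ add (congrArg sum ?_)
    (congrArg₂ add (congrArg sum ?_) (congrArg sum ?_)))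
  · exact (Chain.bar_map G c fun s l h => smul (sgn k (n + s))
      (eps (F.map f) l (by rw [Chain.deg_map] at h; omega))).symm
  · refine (List.map_congr_left fun S _ => ?_).trans
      (Chain.splits_map G c fun z l r h => smul (-sgn k (n * l.deg))
        (comp (by rw [Chain.deg_map] at h; omega) (tau (F.obj x) l rfl)
          (eps (F.map f) r rfl))).symm
    simp only [Function.comp, map, map_tau, Chain.deg_map]
    exact congrArg _ (comp_tau_eps _ _ _ _ _ _ _ _ _)
  · refine (List.map_congr_left fun S _ => ?_).trans
      (Chain.splits_map G c fun z l r h => smul (sgn k (n + l.deg))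
        (comp (by rw [Chain.deg_map] at h; omega) (eps (F.map f) l rfl)
          (tau (F.obj x') r rfl))).symm
    simp only [Function.comp, map, map_tau, Chain.deg_map]
    exact congrArg _ (comp_eps_tau _ _ _ _ _ _ _ _ _)

end Pre

open Pre in
lemma Rel.map {C C' D D' : DGCat k} (F : DGFunctor C C') (G : DGFunctor D D')
    {X Y : C.Obj × D.Obj} {n : ℤ} {a b : Pre C D X Y n} (h : Rel C D a b) :
    Rel C' D' (a.map F G) (b.map F G) := by
  induction h with
  | refl => exact Rel.refl _
  | symm _ ih => exact ih.symm
  | trans _ _ ih ih' => exact ih.trans ih'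
  | add_congr _ _ ih ih' => exact Rel.add_congr ih ih'
  | smul_congr r _ ih => exact Rel.smul_congr r ih
  | diff_congr h _ ih => exact Rel.diff_congr h ih
  | comp_congr h _ _ ih ih' => exact Rel.comp_congr h ih ih'
  | add_comm => exact Rel.add_comm _ _
  | add_assoc => exact Rel.add_assoc _ _ _
  | zero_add => exact Rel.zero_add _
  | neg_add => exact Rel.neg_add _
  | smul_add => exact Rel.smul_add _ _ _
  | add_smul => exact Rel.add_smul _ _ _
  | mul_smul => exact Rel.mul_smul _ _ _
  | one_smul => exact Rel.one_smul _
  | diff_add => exact Rel.diff_add _ _ _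
  | diff_smul => exact Rel.diff_smul _ _ _
  | add_comp => exact Rel.add_comp _ _ _ _
  | smul_comp => exact Rel.smul_comp _ _ _ _
  | comp_add => exact Rel.comp_add _ _ _ _
  | comp_smul => exact Rel.comp_smul _ _ _ _
  | diff_diff => exact Rel.diff_diff _ _ _
  | one_comp => exact Rel.one_comp _ _
  | comp_one => exact Rel.comp_one _ _
  | assoc h₁ h₂ h₃ h₄ => exact Rel.assoc h₁ h₂ h₃ h₄ _ _ _
  | diff_comp h hs ha hb h₁ h₂ => exact Rel.diff_comp h hs ha hb h₁ h₂ _ _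
  | right_add => simpa only [Pre.map, map_add] using Rel.right_add _ _ _ _
  | right_smul => simpa only [Pre.map, map_smul] using Rel.right_smul _ _ _ _
  | right_one => simpa only [Pre.map, G.map_one] using Rel.right_one _ _ _
  | right_comp x h ha hb hab h' =>
      simpa only [Pre.map, G.map_comp] using Rel.right_comp _ h ha hb hab h' _ _
  | right_diff x h hm hn h' =>
      simpa only [Pre.map, G.map_d] using Rel.right_diff _ h hm hn h' _
  | eps_add => simpa only [Pre.map, map_add] using Rel.eps_add _ _ _ _
  | eps_smul => simpa only [Pre.map, map_smul] using Rel.eps_smul _ _ _ _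
  | eps_chain_add f hc => exact Rel.eps_chain_add _ (hc.map G) _ _ _
  | eps_chain_smul f hc => exact Rel.eps_chain_smul _ (hc.map G) _ _
  | eps_chain_one f hc => exact Rel.eps_chain_one _ (hc.map G) _
  | eps_one_cons =>
      simp only [Pre.map, F.map_one]
      exact Rel.eps_one_cons _ _ _ _
  | eps_one_nil =>
      simp only [Pre.map, F.map_one]
      exact Rel.eps_one_nil _ _ _
  | eps_comp f f' c hq hp =>
      rw [map_epsComp]
      simpa only [Pre.map, F.map_comp] using Rel.eps_comp _ _ _ hq _
  | eps_diff f c hp hq =>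
      rw [map_epsDiff]
      exact Rel.eps_diff _ _ _ hq

/-- The twisted tensor product of two dg functors. -/
def tw.map {C C' D D' : DGCat k} (F : DGFunctor C C') (G : DGFunctor D D') :
    DGFunctor (tw C D) (tw C' D') where
  obj X := tw.pt (F.obj X.1) (G.obj X.2)
  map :=
    { toFun := fun a => Quotient.liftOn a (fun a => TwHom.mk (a.map F G))
        fun _ _ h => TwHom.sound (h.map F G)
      map_add' := TwHom.ind fun _ => TwHom.ind fun _ => rfl
      map_smul' := fun _ => TwHom.ind fun _ => rfl }
  map_one _ := rfl
  map_comp _ := TwHom.ind fun _ => TwHom.ind fun _ => rfl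
  map_d _ := TwHom.ind fun _ => rfl

/-! ## Iterated twisted tensor products of interval categories

A diagram `(n_1, …, n_k)` is stored as the list `[n_k, …, n_1]` of its columns, from right to
left. -/

/-- `T [n_k, …, n_1] = I_{n_k} ⊗ (I_{n_{k-1}} ⊗ (… (I_{n_1} ⊗ I_0) …))`, where the last factor
`I_0` is the unit category. -/
def T (k : Type u) [Field k] : List ℕ → DGCat k
  | [] => interval k 0
  | n :: L => tw (interval k n) (T k L)

namespace T

variable {n : ℕ} {L : List ℕ}

/-- The object `(i, x)`. -/
def pt (i : Fin (n + 1)) (x : (T k L).Obj) : (T k (n :: L)).Obj :=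
  tw.pt (C := interval k n) i x

def fst (X : (T k (n :: L)).Obj) : Fin (n + 1) :=
  let X' : Fin (n + 1) × (T k L).Obj := X
  X'.1

def snd (X : (T k (n :: L)).Obj) : (T k L).Obj :=
  let X' : Fin (n + 1) × (T k L).Obj := X
  X'.2

/-- `g ↦ id_i ⊗ g`. -/
def right (i : Fin (n + 1)) : DGFunctor (T k L) (T k (n :: L)) :=
  tw.right (C := interval k n) i

/-- `ε(f; c)`. -/
def eps {i j : Fin (n + 1)} {y w : (T k L).Obj} {m p : ℤ} (f : (interval k n).Hom i j m)
    (c : Chain (T k L) y w) (h : m + c.deg = p) : (T k (n :: L)).Hom (pt i y) (pt j w) p :=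
  tw.eps f c h

/-- The object `min = (0, …, 0)`. -/
def bot : ∀ L : List ℕ, (T k L).Obj
  | [] => (0 : Fin 1)
  | _ :: L => pt 0 (bot L)

/-- The object `max = (n_k, …, n_1)`. -/
def top : ∀ L : List ℕ, (T k L).Obj
  | [] => (0 : Fin 1)
  | n :: L => pt (Fin.last n) (top L)

/-- The dg functor `g ↦ id_x ⊗ g` from `T L` to `T (cs ++ L)`, for an object `x` of `T cs`. -/
def embed : ∀ (cs L : List ℕ) (_ : (T k cs).Obj), DGFunctor (T k L) (T k (cs ++ L))
  | [], _, _ => DGFunctor.refl _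
  | _ :: cs, L, x => (embed cs L (snd x)).trans (right (fst x))

/-- The object `(x, y)` of `T (cs ++ L)`. -/
def pair {cs L : List ℕ} (x : (T k cs).Obj) (y : (T k L).Obj) : (T k (cs ++ L)).Obj :=
  (embed cs L x).obj y

end T

/-- The components of the twisted tensor product 2-operad: `O(n_1, …, n_k)` is the complex of
morphisms `min → max`. -/
abbrev O (k : Type u) [Field k] (L : List ℕ) (n : ℤ) : Type u := (T k L).Hom (T.bot L) (T.top L) n

/-! ## 2-disks and their maps -/

/-- A 2-disk `(n_1, …, n_k)` with `k ≥ 1` and `n_i ≥ 1` (equivalently, a pruned 2-tree with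
`k` vertices of level 1, the `i`-th one carrying `n_i` leaves). -/
structure Disk where
  heights : List ℕ
  ne_nil : heights ≠ []
  pos : ∀ n ∈ heights, 0 < n

/-- A column of height `ht` of the source of a map of 2-trees, lying over a column of height `m` of
the target, together with the restriction of the map to this column. -/
structure Col (m : ℕ) where
  ht : ℕ
  pos : 0 < ht
  map : Fin ht → Fin m
  mono : Monotone map

namespace Col

variable {m : ℕ} (c : Col m)

/-- The number of the balls of the column in the fibre over `i`. -/
def fibre (i : Fin m) : ℕ := (Finset.univ.filter fun t => c.map t = i).card

/-- The number of the balls of the column that lie over balls below the level `i`. -/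
def below (i : Fin (m + 1)) : ℕ := (Finset.univ.filter fun t => (c.map t).castSucc < i).card

lemma below_le (i : Fin (m + 1)) : c.below i ≤ c.ht := by
  simpa [below] using Finset.card_filter_le (Finset.univ : Finset (Fin c.ht))
    (fun t => (c.map t).castSucc < i)

lemma below_zero : c.below 0 = 0 := by simp [below]

lemma below_last : c.below (Fin.last m) = c.ht := by simp [below, Fin.castSucc_lt_last]

lemma below_succ (i : Fin m) : c.below i.castSucc + c.fibre i = c.below i.succ := by
  unfold below fibre
  rw [← Finset.card_union_of_disjoint]
  · congr 1
    ext t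
    simp only [Finset.mem_union, Finset.mem_filter, Finset.mem_univ, true_and, Fin.lt_def,
      Fin.ext_iff, Fin.val_castSucc, Fin.val_succ]
    omega
  · rw [Finset.disjoint_filter]
    intro t _ h h'
    rw [h'] at h
    exact lt_irrefl _ h

lemma below_add_fibre_le (i : Fin m) : c.below i.castSucc + c.fibre i ≤ c.ht := by
  rw [below_succ]; exact c.below_le _

/-- The cut of the column at the level `i` of the target, as an object of `I_ht`. -/
def cutAt (i : Fin (m + 1)) : Fin (c.ht + 1) := ⟨c.below i, Nat.lt_succ_of_le (c.below_le i)⟩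

end Col

/-- `h :: L` if `h ≠ 0`, and `L` otherwise. -/
def consNZ : ℕ → List ℕ → List ℕ
  | 0, L => L
  | h + 1, L => (h + 1) :: L

/-- The fibre over `i` of a block of columns: its columns are the non-empty ones among the fibres
of the columns (the empty columns are pruned). -/
def fibreList {m : ℕ} : List (Col m) → Fin m → List ℕ
  | [], _ => []
  | c :: cs, i => consNZ (c.fibre i) (fibreList cs i)

lemma fibreList_pos {m : ℕ} : ∀ (cs : List (Col m)) (i : Fin m), ∀ n ∈ fibreList cs i, 0 < n
  | [], _, n, h => by simp [fibreList] at h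
  | c :: cs, i, n, h => by
    have ih := fibreList_pos cs i n
    cases hf : c.fibre i with
    | zero => simp only [fibreList, hf, consNZ] at h; exact ih h
    | succ a =>
      simp only [fibreList, hf, consNZ, List.mem_cons] at h
      rcases h with h | h
      · omega
      · exact ih h

lemma fibreList_ne_nil {m : ℕ} : ∀ (cs : List (Col m)) (i : Fin m),
    (∃ c ∈ cs, ∃ t, c.map t = i) → fibreList cs i ≠ []
  | [], _, h => by simp at h
  | c :: cs, i, h => by
    cases hf : c.fibre i with
    | succ a => simp [fibreList, hf, consNZ]
    | zero =>
      simp only [fibreList, hf, consNZ]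
      apply fibreList_ne_nil cs i
      obtain ⟨c', hc', t, ht⟩ := h
      rcases List.mem_cons.1 hc' with rfl | hc'
      · have := Finset.card_eq_zero.1 hf
        have : t ∈ (∅ : Finset (Fin c'.ht)) := this ▸ by simp [ht]
        simp at this
      · exact ⟨c', hc', t, ht⟩

/-- A column of the target of a surjective map of pruned 2-trees, of height `ht`, with the block of
the columns of the source that lie over it, from right to left. -/
structure Block where
  ht : ℕ
  pos : 0 < ht
  cols : List (Col ht)
  surj : ∀ i : Fin ht, ∃ c ∈ cols, ∃ t, c.map t = i

namespace Block

/-- The heights of the columns of the source in the block. -/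
def heights (b : Block) : List ℕ := b.cols.map Col.ht

/-- The (pruned) fibre over the `i`-th ball of the column. -/
def fibre (b : Block) (i : Fin b.ht) : Disk where
  heights := fibreList b.cols i
  ne_nil := fibreList_ne_nil _ _ (b.surj i)
  pos := fibreList_pos _ _

end Block

/-- The heights of the columns of the target. -/
def trg : List Block → List ℕ
  | [] => []
  | b :: bs => b.ht :: trg bs

/-- The heights of the columns of the source. -/
def src : List Block → List ℕ
  | [] => []
  | b :: bs => b.heights ++ src bs

lemma trg_pos : ∀ (bs : List Block), ∀ n ∈ trg bs, 0 < n
  | [], n, h => by simp [trg] at h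
  | b :: bs, n, h => by
    rcases List.mem_cons.1 h with rfl | h
    · exact b.pos
    · exact trg_pos bs n h

lemma src_pos : ∀ (bs : List Block), ∀ n ∈ src bs, 0 < n
  | [], n, h => by simp [src] at h
  | b :: bs, n, h => by
    rcases List.mem_append.1 h with h | h
    · obtain ⟨c, -, rfl⟩ := List.mem_map.1 h
      exact c.pos
    · exact src_pos bs n h

/-- A surjective map of pruned 2-trees `U → V`, that is, a monotone map from the columns of `U` to
the columns of `V` and, for each column of `U`, a monotone map from its balls to the balls of the
column of `V` below it, such that each ball of `V` is in the image. The columns of `V` are listed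
from right to left, each one with the columns of `U` over it. -/
structure DiskMap where
  blocks : List Block
  ne_nil : blocks ≠ []

namespace DiskMap

/-- `U` -/
def source (P : DiskMap) : Disk where
  heights := src P.blocks
  ne_nil := by
    obtain ⟨bs, h⟩ := P
    cases bs with
    | nil => exact absurd rfl h
    | cons b bs =>
      obtain ⟨c, hc, -⟩ := b.surj ⟨0, b.pos⟩
      have : c.ht ∈ src (b :: bs) := List.mem_append_left _ (List.mem_map_of_mem hc)
      exact List.ne_nil_of_mem this
  pos := src_pos _

/-- `V` -/
def target (P : DiskMap) : Disk where
  heights := trg P.blocks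
  ne_nil := by
    obtain ⟨bs, h⟩ := P
    cases bs with
    | nil => exact absurd rfl h
    | cons b bs => simp [trg]
  pos := trg_pos _

end DiskMap

/-- The 2-disk `(1)`. -/
def Disk.unit : Disk := ⟨[1], by simp, by simp⟩

/-! ## The composition of the twisted tensor product 2-operad -/

/-- The object of `T` of a block of columns of `U` that is the cut over the level `i` of `V`. -/
def cut {m : ℕ} : ∀ (cs : List (Col m)) (_ : Fin (m + 1)), (T k (cs.map Col.ht)).Obj
  | [], _ => (0 : Fin 1)
  | c :: cs, i => T.pt (c.cutAt i) (cut cs i)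

lemma cut_zero {m : ℕ} : ∀ cs : List (Col m), cut (k := k) cs 0 = T.bot (cs.map Col.ht)
  | [] => rfl
  | c :: cs => congrArg₂ T.pt (Fin.ext c.below_zero) (cut_zero cs)

lemma cut_last {m : ℕ} : ∀ cs : List (Col m),
    cut (k := k) cs (Fin.last m) = T.top (cs.map Col.ht)
  | [] => rfl
  | c :: cs => congrArg₂ T.pt (Fin.ext c.below_last) (cut_last cs)

/-- The inclusion of a column of height `h` onto the part `o, …, o + h` of a column of height `n`,
tensored with a dg functor; for `h = 0` the source column is omitted. -/
def inclNZ {L L' : List ℕ} (F : DGFunctor (T k L) (T k L')) : ∀ (h n o : ℕ) (_ : o + h ≤ n),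
    DGFunctor (T k (consNZ h L)) (T k (n :: L'))
  | 0, _, o, ho => F.trans (T.right ⟨o, Nat.lt_succ_of_le ho⟩)
  | _ + 1, _, o, ho => tw.map (interval.shift k o ho) F

lemma inclNZ_bot {L L' : List ℕ} (F : DGFunctor (T k L) (T k L')) : ∀ (h n o : ℕ)
    (ho : o + h ≤ n), (inclNZ F h n o ho).obj (T.bot _) =
      T.pt ⟨o, by omega⟩ (F.obj (T.bot L))
  | 0, _, _, _ => rfl
  | _ + 1, _, _, _ => rfl

lemma inclNZ_top {L L' : List ℕ} (F : DGFunctor (T k L) (T k L')) : ∀ (h n o : ℕ)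
    (ho : o + h ≤ n), (inclNZ F h n o ho).obj (T.top _) =
      T.pt ⟨o + h, by omega⟩ (F.obj (T.top L))
  | 0, _, _, _ => rfl
  | _ + 1, _, _, _ => rfl

/-- The dg functor induced by the inclusion of the fibre over `i` into a block of columns. -/
def fibreIncl {m : ℕ} : ∀ (cs : List (Col m)) (i : Fin m),
    DGFunctor (T k (fibreList cs i)) (T k (cs.map Col.ht))
  | [], _ => DGFunctor.refl _
  | c :: cs, i => inclNZ (fibreIncl cs i) (c.fibre i) c.ht (c.below i.castSucc)
      (c.below_add_fibre_le i)

lemma fibreIncl_bot {m : ℕ} : ∀ (cs : List (Col m)) (i : Fin m),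
    (fibreIncl (k := k) cs i).obj (T.bot _) = cut cs i.castSucc
  | [], _ => rfl
  | _ :: cs, i => (inclNZ_bot _ _ _ _ _).trans (congrArg₂ T.pt rfl (fibreIncl_bot cs i))

lemma fibreIncl_top {m : ℕ} : ∀ (cs : List (Col m)) (i : Fin m),
    (fibreIncl (k := k) cs i).obj (T.top _) = cut cs i.succ
  | [], _ => rfl
  | c :: cs, i => (inclNZ_top _ _ _ _ _).trans
      (congrArg₂ T.pt (Fin.ext (c.below_succ i)) (fibreIncl_top cs i))

/-- An element of `O` of the fibre over the `i`-th ball, as a morphism of `T` of the block. -/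
def place (b : Block) (i : Fin b.ht) {q : ℤ} (a : O k (b.fibre i).heights q) :
    (T k b.heights).Hom (cut b.cols i.castSucc) (cut b.cols i.succ) q :=
  DGCat.cast _ (fibreIncl_bot b.cols i) (fibreIncl_top b.cols i) ((fibreIncl b.cols i).map a)

namespace Chain

/-- The image of a chain under `emb`, as a chain with vanishing sign. -/
def mapTerm {A E : DGCat k} {po : E.Obj → A.Obj}
    (emb : ∀ {y y' : E.Obj} {n : ℤ}, E.Hom y y' n → A.Hom (po y) (po y') n) :
    ∀ {y y' : E.Obj} (c : Chain E y y'), Term A (po y) (po y') c.deg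
  | _, _, nil y => ⟨0, nil (po y), rfl⟩
  | _, _, cons g c => ⟨0, cons (emb g) (mapTerm emb c).chain, by
      simp only [deg, (mapTerm emb c).deg_eq]⟩

variable {A D E : DGCat k} (po : D.Obj → E.Obj → A.Obj)
  (emb : ∀ (x : D.Obj) {y y' : E.Obj} {n : ℤ}, E.Hom y y' n → A.Hom (po x y) (po x y') n)
  (φ : ∀ {x x' : D.Obj} {y y' : E.Obj} {n : ℤ}, D.Hom x x' n → ∀ c : Chain E y y',
    A.Hom (po x y) (po x' y') (n + c.deg))

/-- One step of `insert`: if `rec c` runs over the insertions of `c` into a chain `gs` of degree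
`s`, this runs over the insertions of `c` into `g :: gs`. -/
def insertCons {x x₁ x' : D.Obj} {m : ℤ} (g : D.Hom x x₁ m) (s : ℤ)
    (rec : ∀ {y y' : E.Obj} (c : Chain E y y'), List (Term A (po x₁ y) (po x' y') (s + c.deg))) :
    ∀ {y y' : E.Obj} (c : Chain E y y'), List (Term A (po x y) (po x' y') (m - 1 + s + c.deg))
  | _, _, c =>
      (c.splits.flatMap fun S => (rec S.right).map fun t =>
        ⟨s * S.left.deg + t.sign, cons (φ g S.left) t.chain, by
          have := S.deg_eq; have := t.deg_eq; simp only [deg]; omega⟩) ++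
      match c with
      | nil _ => []
      | cons (m := n) h c' => (insertCons g s rec c').map fun t =>
          ⟨(m - 1 + s) * (n - 1) + t.sign, cons (emb x h) t.chain, by
            have := t.deg_eq; simp only [deg]; omega⟩

/-- All the ways to insert the chain `c` into the chain `g₁, …, g_r`: the entries are
`φ(g₁; c₁), …, φ(g_r; c_r)`, where `c₁, …, c_r` are disjoint, possibly empty, consecutive subchains
of `c`, in this order, with the remaining entries of `c` in between. The signs are the Koszul
signs. -/
def insert : ∀ {x x' : D.Obj} (gs : Chain D x x') {y y' : E.Obj} (c : Chain E y y'),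
    List (Term A (po x y) (po x' y') (gs.deg + c.deg))
  | _, _, nil x, _, _, c => [⟨0, (mapTerm (po := po x) (emb x) c).chain, by
      simp only [deg, (mapTerm (po := po x) (emb x) c).deg_eq, zero_add]⟩]
  | _, _, cons g gs, _, _, c => insertCons po emb φ g gs.deg (fun c => insert gs c) c

end Chain

/-- Homogeneous elements of `O` of the fibres, one for each ball of the target. -/
def Inputs (k : Type u) [Field k] : List Block → Type u
  | [] => PUnit
  | b :: bs => (∀ i : Fin b.ht, Σ q : ℤ, O k (b.fibre i).heights q) × Inputs k bs

namespace Inputs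

variable {b : Block} {bs : List Block}

/-- The inputs at the balls of the right column of the target. -/
def head (a : Inputs k (b :: bs)) (i : Fin b.ht) : Σ q : ℤ, O k (b.fibre i).heights q :=
  Prod.fst (β := Inputs k bs) a i

/-- The inputs at the balls of the other columns. -/
def tail (a : Inputs k (b :: bs)) : Inputs k bs :=
  Prod.snd (α := ∀ i : Fin b.ht, Σ q : ℤ, O k (b.fibre i).heights q) a

/-- The total degree of the inputs in the right column below the level `i`. -/
def colDeg (a : Inputs k (b :: bs)) (i : Fin (b.ht + 1)) : ℤ :=
  ∑ t ∈ Finset.univ.filter (fun t : Fin b.ht => t.castSucc < i), (a.head t).1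

/-- The total degree of the inputs at the balls below the object `x`. -/
def degBelow : ∀ {bs : List Block} (_ : Inputs k bs) (_ : (T k (trg bs)).Obj), ℤ
  | [], _, _ => 0
  | _ :: _, a, x => a.colDeg (T.fst x) + a.tail.degBelow (T.snd x)

/-- The total degree of the inputs at the balls between the objects `x ≤ y`. -/
def deg (a : Inputs k bs) (x y : (T k (trg bs)).Obj) : ℤ := a.degBelow y - a.degBelow x

/-- The exponent of the Koszul sign of the permutation that takes the inputs at the balls between
`x` and `z`, ordered lexicographically (by the column, then by the height), to the ones between `x`
and `y` followed by the ones between `y` and `z`. -/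
def shuffle : ∀ {bs : List Block} (_ : Inputs k bs) (_ _ _ : (T k (trg bs)).Obj), ℤ
  | [], _, _, _, _ => 0
  | _ :: _, a, x, y, z =>
      (a.colDeg (T.fst y) - a.colDeg (T.fst x)) * a.tail.deg (T.snd y) (T.snd z) +
        a.tail.shuffle (T.snd x) (T.snd y) (T.snd z)

end Inputs

/-- The map from the objects of `T V` to the objects of `T U` given by a map `U → V`. -/
def obMap : ∀ (bs : List Block) (_ : (T k (trg bs)).Obj), (T k (src bs)).Obj
  | [], x => x
  | b :: bs, x => T.pair (cs := b.heights) (cut b.cols (T.fst x)) (obMap bs (T.snd x))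

lemma pair_bot : ∀ (cs L : List ℕ), T.pair (k := k) (T.bot cs) (T.bot L) = T.bot (cs ++ L)
  | [], _ => rfl
  | _ :: cs, L => congrArg (T.pt 0) (pair_bot cs L)

lemma pair_top : ∀ (cs L : List ℕ), T.pair (k := k) (T.top cs) (T.top L) = T.top (cs ++ L)
  | [], _ => rfl
  | n :: cs, L => congrArg (T.pt (Fin.last n)) (pair_top cs L)

lemma obMap_bot : ∀ bs : List Block, obMap (k := k) bs (T.bot (trg bs)) = T.bot (src bs)
  | [] => rfl
  | b :: bs => (congrArg₂ (T.pair (cs := b.heights)) (cut_zero b.cols) (obMap_bot bs)).trans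
      (pair_bot _ _)

lemma obMap_top : ∀ bs : List Block, obMap (k := k) bs (T.top (trg bs)) = T.top (src bs)
  | [] => rfl
  | b :: bs => (congrArg₂ (T.pair (cs := b.heights)) (cut_last b.cols) (obMap_top bs)).trans
      (pair_top _ _)

/-- A chain with a sign `(-1)^sign`. -/
structure SignedChain (D : DGCat k) (y w : D.Obj) where
  sign : ℤ
  chain : Chain D y w

/-- The image of a chain under a family of maps `F` that raises the degrees by the degrees of the
inputs, with its Koszul sign. -/
def plugChain {bs : List Block} (a : Inputs k bs)
    (F : ∀ {x y : (T k (trg bs)).Obj} {n : ℤ}, (T k (trg bs)).Hom x y n →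
      (T k (src bs)).Hom (obMap bs x) (obMap bs y) (n + a.deg x y)) :
    ∀ {x y : (T k (trg bs)).Obj}, Chain (T k (trg bs)) x y →
      SignedChain (T k (src bs)) (obMap bs x) (obMap bs y)
  | _, _, .nil x => ⟨0, .nil _⟩
  | x, z, .cons (z := y) g c =>
      ⟨a.shuffle x y z + a.deg x y * c.deg + (plugChain a F c).sign,
        .cons (F g) (plugChain a F c).chain⟩

/-- The operation of plugging morphisms into the generators of the iterated twisted tensor products.

* `ext` extends `ε(f; c)` from `f` in an interval category to `f` in an iterated twisted tensor
  product: `ext cs L c _ f` is the image of `ε(f; c)`, a morphism of `T cs ⊗ T L`, in `T (cs ++ L)`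
  under the associativity constraints `(C ⊗ D) ⊗ E → C ⊗ (D ⊗ E)`.
* `plug bs a _ f` is the result of the substitution, in `f`, of the inputs `a` for the generators of
  the interval categories, with its Koszul sign.

Both are determined uniquely by their values on the generators, which are prescribed here. -/
structure Plugging (k : Type u) [Field k] where
  ext : ∀ (cs L : List ℕ) {x x' : (T k cs).Obj} {y y' : (T k L).Obj} {n p : ℤ}
    (c : Chain (T k L) y y'), n + c.deg = p →
    ((T k cs).Hom x x' n →ₗ[k] (T k (cs ++ L)).Hom (T.pair x y) (T.pair x' y') p)
  ext_one_nil : ∀ (cs L : List ℕ) (x : (T k cs).Obj) (y : (T k L).Obj)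
    (h : 0 + (Chain.nil y).deg = 0),
    ext cs L (Chain.nil y) h ((T k cs).one x) = (T k (cs ++ L)).one (T.pair x y)
  ext_one_cons : ∀ (cs L : List ℕ) (x : (T k cs).Obj) {y z w : (T k L).Obj} {m p : ℤ}
    (g : (T k L).Hom y z m) (c : Chain (T k L) z w) (h : 0 + (Chain.cons g c).deg = p),
    ext cs L (Chain.cons g c) h ((T k cs).one x) = 0
  ext_comp : ∀ (cs L : List ℕ) {x x' x'' : (T k cs).Obj} {y w : (T k L).Obj} {m n q p : ℤ}
    (f : (T k cs).Hom x x' m) (f' : (T k cs).Hom x' x'' n) (c : Chain (T k L) y w)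
    (hq : m + n = q) (hp : q + c.deg = p),
    ext cs L c hp ((T k cs).comp hq f f') =
      (c.splits.map fun S => sgn k (n * S.left.deg) • (T k (cs ++ L)).comp
        (show (m + S.left.deg) + (n + S.right.deg) = p by have := S.deg_eq; omega)
        (ext cs L S.left rfl f) (ext cs L S.right rfl f')).sum
  ext_right : ∀ (n : ℕ) (cs L : List ℕ) (i : Fin (n + 1)) {x x' : (T k cs).Obj}
    {y w : (T k L).Obj} {m p : ℤ} (g : (T k cs).Hom x x' m) (c : Chain (T k L) y w)
    (h : m + c.deg = p),
    ext (n :: cs) L c h ((T.right i).map g) = (T.right (L := cs ++ L) i).map (ext cs L c h g)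
  ext_eps : ∀ (n : ℕ) (cs L : List ℕ) {i j : Fin (n + 1)} {x x' : (T k cs).Obj}
    {y w : (T k L).Obj} {m q p : ℤ} (f : (interval k n).Hom i j m) (gs : Chain (T k cs) x x')
    (c : Chain (T k L) y w) (hq : m + gs.deg = q) (hp : q + c.deg = p),
    ext (n :: cs) L c hp (T.eps f gs hq) =
      ((Chain.insert T.pair (fun x => (T.embed cs L x).map) (fun g c => ext cs L c rfl g) gs c).map
        fun t => sgn k t.sign • T.eps (L := cs ++ L) f t.chain
          (show m + t.chain.deg = p by have := t.deg_eq; omega)).sum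
  plug : ∀ (bs : List Block) (a : Inputs k bs) {x y : (T k (trg bs)).Obj} {n p : ℤ},
    n + a.deg x y = p →
    ((T k (trg bs)).Hom x y n →ₗ[k] (T k (src bs)).Hom (obMap bs x) (obMap bs y) p)
  plug_one : ∀ (bs : List Block) (a : Inputs k bs) (x : (T k (trg bs)).Obj)
    (h : 0 + a.deg x x = 0),
    plug bs a h ((T k (trg bs)).one x) = (T k (src bs)).one (obMap bs x)
  plug_comp : ∀ (bs : List Block) (a : Inputs k bs) {x y z : (T k (trg bs)).Obj}
    {m n q p m' n' : ℤ} (f : (T k (trg bs)).Hom x y m) (g : (T k (trg bs)).Hom y z n)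
    (hq : m + n = q) (hp : q + a.deg x z = p) (hm : m + a.deg x y = m')
    (hn : n + a.deg y z = n') (h : m' + n' = p),
    plug bs a hp ((T k (trg bs)).comp hq f g) =
      sgn k (a.shuffle x y z + a.deg x y * n) •
        (T k (src bs)).comp h (plug bs a hm f) (plug bs a hn g)
  plug_right : ∀ (b : Block) (bs : List Block) (a : Inputs k (b :: bs)) (i : Fin (b.ht + 1))
    {x y : (T k (trg bs)).Obj} {n p : ℤ} (g : (T k (trg bs)).Hom x y n)
    (h : n + a.deg (T.pt i x) (T.pt i y) = p) (h' : n + a.tail.deg x y = p),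
    plug (b :: bs) a h ((T.right i).map g) =
      (T.embed b.heights (src bs) (cut b.cols i)).map (plug bs a.tail h' g)
  plug_eps : ∀ (b : Block) (bs : List Block) (a : Inputs k (b :: bs)) (i : Fin b.ht)
    {x y : (T k (trg bs)).Obj} {m p : ℤ} (c : Chain (T k (trg bs)) x y) (hm : 0 + c.deg = m)
    (hp : m + a.deg (T.pt i.castSucc x) (T.pt i.succ y) = p)
    (h : (a.head i).1 +
      (plugChain a.tail (fun g => plug bs a.tail rfl g) c).chain.deg = p),
    plug (b :: bs) a hp (T.eps (interval.gen k i) c hm) =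
      sgn k ((a.head i).1 * (c.deg + a.tail.deg x y) +
          (plugChain a.tail (fun g => plug bs a.tail rfl g) c).sign) •
        ext b.heights (src bs) (plugChain a.tail (fun g => plug bs a.tail rfl g) c).chain h
          (place b i (a.head i).2)

/-- The composition of the twisted tensor product 2-operad along a map `U → V`: the inputs, which
are elements of `O` of the fibres, are plugged into an element of `O V`. -/
def Plugging.comp (S : Plugging k) (P : DiskMap) (a : Inputs k P.blocks) {n p : ℤ}
    (h : n + a.deg (T.bot _) (T.top _) = p) (f : O k P.target.heights n) :
    O k P.source.heights p :=
  DGCat.cast _ (obMap_bot P.blocks) (obMap_top P.blocks) (S.plug P.blocks a h f)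

/-- The operadic unit of the twisted tensor product 2-operad: the generator of `I_1`. -/
def unitO (k : Type u) [Field k] : O k Disk.unit.heights 0 :=
  T.eps (L := []) (interval.gen k (0 : Fin 1)) (Chain.nil _) (by simp [Chain.deg])

/-! ## The 2-operad `Nor(Breq)` -/

/-- The ball of height `i` in the column `c`, both counted from `0`, the columns from left to
right. -/
abbrev Letter : Type := ℕ × ℕ

/-- The lexicographic order of the balls: by the column, then by the height. -/
def Letter.lt (a b : Letter) : Prop := a.1 < b.1 ∨ a.1 = b.1 ∧ a.2 < b.2

instance : DecidableRel Letter.lt := fun a b =>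
  inferInstanceAs (Decidable (a.1 < b.1 ∨ a.1 = b.1 ∧ a.2 < b.2))

/-- The minimal balls of a diagram. -/
def balls : List ℕ → Finset Letter
  | [] => ∅
  | n :: L => balls L ∪ (Finset.range n).image fun i => (L.length, i)

/-- The total order `w` restricted to the letters `a`, `b`. -/
def restrict (w : List Letter) (a b : Letter) : List Letter :=
  w.filter fun x => x = a ∨ x = b

/-- A total order on `⊔ I_ν`, with `I_ν = [ℓ_ν]`, that agrees with the order on each `I_ν` is given
by the word in the balls `ν` in which `ν` occurs `ℓ_ν + 1 ≥ 1` times, the `i`-th occurrence of `ν`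
being the `i`-th element of `I_ν`. The conditions are the ones of the Tamarkin 2-operad `seq`, so
that these words are the elements of `seq(U)({I_ν}; [0])`. -/
def IsConfig (L : List ℕ) (w : List Letter) : Prop :=
  (∀ a, a ∈ w ↔ a ∈ balls L) ∧
  (∀ a ∈ balls L, ∀ b ∈ balls L, a.1 = b.1 → a.2 < b.2 →
    restrict w a b = List.replicate (w.count a) a ++ List.replicate (w.count b) b) ∧
  (∀ a ∈ balls L, ∀ b ∈ balls L, a.1 < b.1 →
    (restrict w a b = List.replicate (w.count a) a ++ List.replicate (w.count b) b ∨
    restrict w a b = List.replicate (w.count b) b ++ List.replicate (w.count a) a ∨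
    ∃ r, r + 1 < w.count b ∧ restrict w a b = List.replicate (r + 1) b ++
      List.replicate (w.count a) a ++ List.replicate (w.count b - (r + 1)) b))

/-- The dimension `ℓ_ν` of `I_ν = [ℓ_ν]`. -/
def ell (w : List Letter) (a : Letter) : ℕ := w.count a - 1

/-- The sum of all `ℓ_ν`. -/
def dim (w : List Letter) : ℕ := ∑ a ∈ w.toFinset, ell w a

/-- The words of cohomological degree `n`. -/
def Config (L : List ℕ) (n : ℤ) : Type := {w : List Letter // IsConfig L w ∧ -(dim w : ℤ) = n}

/-- The component of degree `n` of `Breq`, the unnormalised total complex of the polysimplicial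
vector space spanned by `seq(U)({I_ν}; [0])`. -/
abbrev Breq (k : Type u) [Field k] (L : List ℕ) (n : ℤ) : Type u := Config L n →₀ k

open Classical in
/-- The basis element of `Breq` given by a word (`0` if the word is not a configuration of degree
`n`; this value is not used below). -/
noncomputable def ofWord (k : Type u) [Field k] (L : List ℕ) (n : ℤ) (w : List Letter) :
    Breq k L n :=
  if h : IsConfig L w ∧ -(dim w : ℤ) = n then Finsupp.single ⟨w, h⟩ 1 else 0

/-- The number of the elementary intervals of the `I_ν` before the `t`-th letter of `w`, in the
order in which the `I_ν` are put one after the other, lexicographically. -/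
def before (w : List Letter) (t : Fin w.length) : ℕ :=
  (∑ a ∈ w.toFinset with Letter.lt a (w.get t), ell w a) + (w.take t).count (w.get t)

/-- The differential of the total complex: the `i`-th face in the direction of `ν` deletes the
`i`-th occurrence of `ν` (if there are at least two occurrences), and has the sign `(-1)^i` times the
Koszul sign of the lexicographically ordered total complex. -/
noncomputable def breqD (k : Type u) [Field k] (L : List ℕ) (n : ℤ) :
    Breq k L n →ₗ[k] Breq k L (n + 1) :=
  Finsupp.linearCombination k fun w => ∑ t : Fin w.1.length,
    if 2 ≤ w.1.count (w.1.get t) then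
      sgn k (before w.1 t) • ofWord k L (n + 1) (w.1.eraseIdx t) else 0

/-- The words with two equal consecutive letters, that is, the degenerate simplices. -/
def IsDegenerate (w : List Letter) : Prop := ∃ u v a, w = u ++ a :: a :: v

/-- The subspace of the degenerate elements. -/
noncomputable def degenerate (k : Type u) [Field k] (L : List ℕ) (n : ℤ) : Submodule k (Breq k L n) :=
  Submodule.span k {x | ∃ w : Config L n, IsDegenerate w.1 ∧ x = Finsupp.single w 1}

/-- The component of degree `n` of the normalised complex `Nor(Breq)`. -/
abbrev Nor (k : Type u) [Field k] (L : List ℕ) (n : ℤ) : Type u :=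
  Breq k L n ⧸ degenerate k L n

/-- The class in `Nor(Breq)`. -/
noncomputable def toNor {L : List ℕ} {n : ℤ} (x : Breq k L n) : Nor k L n := (degenerate k L n).mkQ x

/-- An element of `seq(U)({I_ν}; [m])` is a configuration with a weakly monotone map `W` to
`[m] = {0, …, m}`, that is, a configuration cut into `m + 1` consecutive, possibly empty, segments
`W⁻¹(0), …, W⁻¹(m)`. Given a word in which each letter carries the number of the elementary
intervals to be inserted in it, this replaces a letter `x` that carries `r` by `x^{r+1}`, and cuts the
resulting word between any two of these `r + 1` letters. -/
def segmentsAux : List (Letter × ℕ) → List (List Letter)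
  | [] => [[]]
  | (x, r) :: l => List.replicate r [x] ++
      ((x :: (segmentsAux l).headD []) :: (segmentsAux l).tail)

/-- The summand of the whiskering map that inserts `r t` new elementary intervals in the `t`-th
letter of `w`, as the list of its segments. -/
def segments (w : List Letter) (r : Fin w.length → ℕ) : List (List Letter) :=
  segmentsAux (w.zip (List.ofFn r))

/-- The exponent of the sign of that summand: the number of inversions of the permutation that
takes (the new elementary intervals, the old ones) to the elementary intervals of the new `I_ν`. -/
def whiskerSign (w : List Letter) (r : Fin w.length → ℕ) : ℕ :=
  (∑ t, r t * before w t) +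
    ∑ t : Fin w.length, ∑ t' : Fin w.length,
      if t < t' ∧ Letter.lt (w.get t') (w.get t) then r t * r t' else 0

/-- Replace the `j`-th occurrence of each letter `a` by the `j`-th segment of `σ a`. -/
def substitute : List Letter → (Letter → List (List Letter)) → List Letter
  | [], _ => []
  | a :: w, σ => (σ a).headD [] ++ substitute w (Function.update σ a (σ a).tail)

/-- The exponent of the sign of the permutation that takes (the `J_μ`, the `I_ν` over all `μ`) to
(`J_μ` followed by the `I_ν` over `μ`, for all `μ`). -/
def koszulSign (V : Finset Letter) (β : List Letter) (α : Letter → List Letter) : ℕ :=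
  ∑ a ∈ V, ∑ b ∈ V with Letter.lt a b, dim (α a) * ell β b

/-- The exponent of the sign of the permutation that puts the `I_ν` of the composition `w` into the
lexicographic order. -/
def shuffleSign (V : Finset Letter) (α : Letter → List Letter) (w : List Letter) : ℕ :=
  ∑ a ∈ V, ∑ b ∈ V with Letter.lt a b, ∑ x ∈ (α a).toFinset,
    ∑ y ∈ (α b).toFinset with Letter.lt y x, ell w x * ell w y

/-- The composition of the 2-operad `Breq`, along a map `U → V`, of a word `β` in the balls of `V` and
of words `α μ` in the balls of `U` over the ball `μ` of `V`: the whiskering map, with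
`J_μ = [ell β μ]`, is applied to each `α μ`, and then the composition in `seq`, which
replaces the `j`-th occurrence of `μ` in `β` by the `j`-th segment. -/
noncomputable def breqComp (k : Type u) [Field k] (bs : List Block) (β : List Letter)
    (α : Letter → List Letter) (p : ℤ) : Breq k (src bs) p :=
  ∑ r ∈ (balls (trg bs)).pi fun a => Finset.Nat.antidiagonalTuple (α a).length (ell β a),
    let w := substitute β fun a => if h : a ∈ balls (trg bs) then segments (α a) (r a h) else []
    sgn k ((∑ a ∈ (balls (trg bs)).attach, whiskerSign (α a) (r a a.2)) +
      koszulSign (balls (trg bs)) β α + shuffleSign (balls (trg bs)) α w : ℕ) •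
        ofWord k (src bs) p w

/-- The inclusion of the balls of the fibre over `i` of a block of columns into the balls of the
source, where `o` is the number of the columns to the left of the block. -/
def fibreLetter {m : ℕ} : List (Col m) → Fin m → ℕ → Letter → Letter
  | [], _, _, x => x
  | c :: cs, i, o, x =>
      if x.1 < (fibreList cs i).length then fibreLetter cs i o x
      else (o + cs.length, c.below i.castSucc + x.2)

/-- Configurations in the fibres, one for each ball of the target. -/
def WordInputs : List Block → Type
  | [] => Unit
  | b :: bs => (∀ i : Fin b.ht, {w // IsConfig (b.fibre i).heights w}) × WordInputs bs

namespace WordInputs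

/-- The inputs as words in the balls of the source. -/
def word : ∀ {bs : List Block} (_ : WordInputs bs) (_ : Letter), List Letter
  | [], _, _ => []
  | b :: bs, α, a =>
      if a.1 = bs.length then
        if h : a.2 < b.ht then
          (α.1 ⟨a.2, h⟩).1.map (fibreLetter b.cols ⟨a.2, h⟩ (src bs).length)
        else []
      else word α.2 a

/-- The images of the inputs under maps `Φ U n : Nor(Breq)(U)^n → O(U)^n`. -/
noncomputable def toInputs (Φ : ∀ (U : Disk) (n : ℤ), Nor k U.heights n ≃ₗ[k] O k U.heights n) :
    ∀ {bs : List Block} (_ : WordInputs bs), Inputs k bs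
  | [], _ => PUnit.unit
  | b :: _, α => (fun i => ⟨-(dim (α.1 i).1 : ℤ),
      Φ (b.fibre i) _ (toNor (Finsupp.single ⟨(α.1 i).1, (α.1 i).2, rfl⟩ 1))⟩, toInputs Φ α.2)

end WordInputs

/-- The word `ν` in the only ball `ν` of the 2-disk `(1)`, the operadic unit of `Breq`. -/
def unitWord : Config Disk.unit.heights 0 :=
  ⟨[(0, 0)], by
    refine ⟨⟨fun a => ?_, fun a ha b hb _ h => ?_, fun a ha b hb h => ?_⟩, by simp [dim, ell]⟩
    · simp [balls, Disk.unit, Prod.ext_iff]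
    · simp only [balls, Disk.unit, Finset.mem_union, Finset.notMem_empty, false_or,
        Finset.mem_image, Finset.mem_range] at ha hb
      obtain ⟨i, hi, rfl⟩ := ha
      obtain ⟨j, hj, rfl⟩ := hb
      simp only at h
      omega
    · simp only [balls, Disk.unit, Finset.mem_union, Finset.notMem_empty, false_or,
        Finset.mem_image, Finset.mem_range] at ha hb
      obtain ⟨i, hi, rfl⟩ := ha
      obtain ⟨j, hj, rfl⟩ := hb
      exact absurd h (lt_irrefl _)⟩

/-! ## Words and monomials -/

mutual

/-- `IsMonomial L f w`: the morphism `f` of `T L` is the composition of the factors assigned to the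
fragments of the word `w`. A fragment `λ X₁ λ X₂ λ … X_l λ` (`l ≥ 0`), with `λ` in the right column
and `X₁, …, X_l` in the other columns, corresponds to `ε(f_λ; φ(X₁), …, φ(X_l))`, where `f_λ` is the
generator of the interval category and `φ(X_j)` is a monomial of `X_j` (for `l = 0` this is
`f_λ ⊗ id`); a fragment `Y` in the other columns corresponds to `id ⊗ φ(Y)`. -/
inductive IsMonomial : ∀ (L : List ℕ) {x y : (T k L).Obj} {n : ℤ},
    (T k L).Hom x y n → List Letter → Prop
  | one (L : List ℕ) (x : (T k L).Obj) : IsMonomial L ((T k L).one x) []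
  | comp (L : List ℕ) {x y z : (T k L).Obj} {m n p : ℤ} (h : m + n = p) {f : (T k L).Hom x y m}
      {g : (T k L).Hom y z n} {w w' : List Letter} :
      IsMonomial L f w → IsMonomial L g w' → IsMonomial L ((T k L).comp h f g) (w ++ w')
  | right (n : ℕ) (L : List ℕ) (i : Fin (n + 1)) {x y : (T k L).Obj} {m : ℤ}
      {g : (T k L).Hom x y m} {w : List Letter} :
      IsMonomial L g w → IsMonomial (n :: L) ((T.right i).map g) w
  | brace (n : ℕ) (L : List ℕ) (i : Fin n) {x y : (T k L).Obj} {m : ℤ} {c : Chain (T k L) x y}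
      (h : 0 + c.deg = m) {w : List Letter} : IsChainMonomial L (L.length, i.1) c w →
      IsMonomial (n :: L) (T.eps (interval.gen k i) c h) ((L.length, i.1) :: w)

/-- `IsChainMonomial L a c w`: the chain `c` consists of monomials of the words `X₁, …, X_l` and
`w = X₁ a X₂ a … X_l a`. -/
inductive IsChainMonomial : ∀ (L : List ℕ) (_ : Letter) {x y : (T k L).Obj},
    Chain (T k L) x y → List Letter → Prop
  | nil (L : List ℕ) (a : Letter) (x : (T k L).Obj) : IsChainMonomial L a (Chain.nil x) []
  | cons (L : List ℕ) (a : Letter) {x y z : (T k L).Obj} {m : ℤ} {g : (T k L).Hom x y m}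
      {c : Chain (T k L) y z} {w w' : List Letter} : IsMonomial L g w →
      IsChainMonomial L a c w' → IsChainMonomial L a (Chain.cons g c) (w ++ a :: w')

end

end TwoOperad

open TwoOperad

namespace TwoOperad
variable {k : Type u} [Field k]

/-! ## The algebra of words -/

-- Both 2-operads are compared inside one algebra, `WAlg`, spanned by the words in the balls modulo
-- the words with two equal consecutive letters. There the elementary intervals of a word are
-- ordered by the positions of their starting letters, not lexicographically. In this convention the
-- signed deletion of letters is a differential `dW`, and it satisfies the Leibniz rule for products
-- of elements with disjoint sets of letters (`dW_mul`).
--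
-- The complex `Nor(Breq)` embeds by sending a configuration `w` to `(-1)^(inv w)` times `w`, where
-- `inv w` counts the inversions between the two orders of the intervals. `sum_delete` says that
-- this turns the lexicographic signs of the differential into those of `dW`.
--
-- The iterated twisted tensor product embeds as well. A morphism `i → j` of the new interval
-- category goes to a multiple of the word `λ_i … λ_{j-1}`, and `ε(f; g₁, …, g_r)` goes to `insW`:
-- the signed sum over all ways to double letters of this word and to insert the images of `g₁, …,
-- g_r`, in their order, between the copies. The composition rule for `ε` is then the behaviour of
-- insertion on concatenated words (`insW_append`), the normalisation says that inserting `1`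
-- creates a degenerate word, and the Hochschild formula is a telescoping sum (`Rep.dW_insW`).
-- Hence, by induction on the columns, there is a representation `repT` of `T k L`. It is faithful:
-- the normal forms `(id ⊗ g₀) ε(f_i; c) (id ⊗ g₁) ε(f_{i+1}; c') …` built from basis elements are
-- closed under composition up to linear combinations, so they span, and they are sent, up to sign,
-- to different nondegenerate words, because such a word can be parsed in only one way
-- (`WordBasis.NormalWord.unique`, `repT_map_injective`). The words that arise between `min` and
-- `max` are exactly the nondegenerate configurations (`isConfig_iff_rel`). So both complexes have
-- the same image `configSpan` in `WAlg`, and `phi` is the resulting identification.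
--
-- The same independence of normal forms yields a universal property: as a graded category, the
-- twisted tensor product maps to every structure with a functor for each object of the interval and
-- with multilinear, normalised braces for each edge (`WordBasis.exists_hom`). The associativity
-- constraint is insertion into the words of arbitrary morphisms, and its formula on an `ε` of an
-- `ε` is `Chain.insN_insert`. Once these constraints are available, plugging exists by induction on
-- the columns, because its target, with composition twisted by a Koszul sign, is such a brace
-- structure (`plugBrace`).
--
-- For the compatibility with compositions, plugging is evaluated on basis elements. In words it is
-- given by the recursion `plugW` (`plugsTo_of_rel`), which at each letter either cuts the plugged
-- word or moves on in it. Unfolding the recursion gives a sum over runs, which are the choices of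
-- multiplicities in the composition of `Breq`. The agreement of the signs is checked one move at a
-- time, modulo 2, in `expo_cut` and `expo_consume`.

lemma IsDegenerate.append_left {w : List Letter} (u : List Letter) (h : IsDegenerate w) :
    IsDegenerate (u ++ w) := by
  obtain ⟨p, q, a, rfl⟩ := h
  exact ⟨u ++ p, q, a, by simp⟩

lemma IsDegenerate.append_right {w : List Letter} (u : List Letter) (h : IsDegenerate w) :
    IsDegenerate (w ++ u) := by
  obtain ⟨p, q, a, rfl⟩ := h
  exact ⟨p, q ++ u, a, by simp⟩

/-- The ideal of the free algebra spanned by the degenerate words. -/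
def wordIdeal (k : Type u) [Field k] : Ideal (MonoidAlgebra k (FreeMonoid Letter)) where
  carrier := {v | ∀ w : FreeMonoid Letter, ¬ IsDegenerate w.toList → v.coeff w = 0}
  add_mem' := by intro a b ha hb w hw; simp [ha w hw, hb w hw]
  zero_mem' := by intro w _; simp
  smul_mem' := by
    intro c v hv w hw
    by_contra hne
    classical
    have hmem := MonoidAlgebra.support_coeff_mul_subset c v (Finsupp.mem_support_iff.2 hne)
    obtain ⟨x, -, y, hy, rfl⟩ := Finset.mem_mul.1 hmem
    refine (Finsupp.mem_support_iff.1 hy) (hv y fun hd => hw ?_)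
    exact hd.append_left x.toList

instance : (wordIdeal k).IsTwoSided where
  mul_mem_of_left := by
    intro v c hv
    show ∀ w : FreeMonoid Letter, _
    intro w hw
    by_contra hne
    classical
    have hmem := MonoidAlgebra.support_coeff_mul_subset v c (Finsupp.mem_support_iff.2 hne)
    obtain ⟨x, hx, y, -, rfl⟩ := Finset.mem_mul.1 hmem
    refine (Finsupp.mem_support_iff.1 hx) (hv x fun hd => hw ?_)
    exact hd.append_right y.toList

/-- The algebra spanned by the words, the degenerate ones being zero. -/
def WAlg (k : Type u) [Field k] : Type u := MonoidAlgebra k (FreeMonoid Letter) ⧸ wordIdeal k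

noncomputable instance : Ring (WAlg k) :=
  inferInstanceAs (Ring (MonoidAlgebra k (FreeMonoid Letter) ⧸ wordIdeal k))

noncomputable instance : Algebra k (WAlg k) :=
  inferInstanceAs (Algebra k (MonoidAlgebra k (FreeMonoid Letter) ⧸ wordIdeal k))

/-- The quotient map. -/
noncomputable def toWAlg (k : Type u) [Field k] :
    MonoidAlgebra k (FreeMonoid Letter) →ₐ[k] WAlg k :=
  Ideal.Quotient.mkₐ k (wordIdeal k)

lemma toWAlg_surjective : Function.Surjective (toWAlg k) :=
  Ideal.Quotient.mkₐ_surjective k (wordIdeal k)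

lemma toWAlg_eq_zero {v : MonoidAlgebra k (FreeMonoid Letter)} :
    toWAlg k v = 0 ↔ v ∈ wordIdeal k := Ideal.Quotient.eq_zero_iff_mem

/-- The class of a word. -/
noncomputable def bw (k : Type u) [Field k] (w : List Letter) : WAlg k :=
  toWAlg k (MonoidAlgebra.single (FreeMonoid.ofList w) 1)

lemma bw_nil : bw k [] = 1 := (toWAlg k).map_one

lemma bw_append (u v : List Letter) : bw k (u ++ v) = bw k u * bw k v := by
  simp [bw, ← map_mul, MonoidAlgebra.single_mul_single]

lemma bw_cons (a : Letter) (v : List Letter) : bw k (a :: v) = bw k [a] * bw k v :=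
  bw_append [a] v

lemma mem_wordIdeal {v : MonoidAlgebra k (FreeMonoid Letter)} :
    v ∈ wordIdeal k ↔ ∀ w : FreeMonoid Letter, ¬ IsDegenerate w.toList → v.coeff w = 0 := Iff.rfl

lemma bw_deg {w : List Letter} (h : IsDegenerate w) : bw k w = 0 := by
  classical
  refine toWAlg_eq_zero.2 (mem_wordIdeal.2 fun v hv => ?_)
  rw [MonoidAlgebra.coeff_single, Finsupp.single_apply, if_neg]
  rintro rfl
  exact hv h

lemma bw_sq (a : Letter) : bw k [a] * bw k [a] = 0 := by
  rw [← bw_append]; exact bw_deg ⟨[], [], a, rfl⟩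

lemma bw_sq_assoc (a : Letter) (v : WAlg k) : bw k [a] * (bw k [a] * v) = 0 := by
  rw [← mul_assoc, bw_sq, zero_mul]

lemma toWAlg_eq_sum (v : MonoidAlgebra k (FreeMonoid Letter)) :
    toWAlg k v = v.coeff.sum fun w r => r • bw k w.toList := by
  induction v using MonoidAlgebra.induction_linear with
  | zero => simp
  | add f g hf hg =>
    rw [map_add, hf, hg, MonoidAlgebra.coeff_add, Finsupp.sum_add_index'] <;> simp [add_smul]
  | single w r =>
    rw [MonoidAlgebra.coeff_single, Finsupp.sum_single_index (by simp)]
    rw [bw, ← map_smul]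
    simp

/-- Linear maps out of the algebra of words. -/
noncomputable def WAlg.lift {V : Type*} [AddCommGroup V] [Module k V] (f : List Letter → V)
    (hf : ∀ w, IsDegenerate w → f w = 0) : WAlg k →ₗ[k] V :=
  ((wordIdeal k).restrictScalars k).liftQ
    ((Finsupp.linearCombination k fun w : FreeMonoid Letter => f w.toList) ∘ₗ
      (MonoidAlgebra.coeffLinearEquiv k).toLinearMap) (by
    intro v hv
    rw [LinearMap.mem_ker, LinearMap.comp_apply]
    refine Finset.sum_eq_zero fun w _ => ?_
    by_cases h : IsDegenerate w.toList
    · simp [hf _ h]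
    · have : v.coeff w = 0 := mem_wordIdeal.1 hv w h
      simp [this])

@[simp] lemma WAlg.lift_bw {V : Type*} [AddCommGroup V] [Module k V] (f : List Letter → V)
    (hf : ∀ w, IsDegenerate w → f w = 0) (w : List Letter) : WAlg.lift f hf (bw k w) = f w := by
  have : WAlg.lift f hf (bw k w) = Finsupp.linearCombination k
    (fun w : FreeMonoid Letter => f w.toList)
    (MonoidAlgebra.single (FreeMonoid.ofList w) (1 : k)).coeff := rfl
  rw [this, MonoidAlgebra.coeff_single, Finsupp.linearCombination_single, one_smul]
  rfl

lemma span_bw : Submodule.span k (Set.range (bw k)) = ⊤ := by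
  refine eq_top_iff.2 fun v _ => ?_
  obtain ⟨v, rfl⟩ := toWAlg_surjective v
  rw [toWAlg_eq_sum]
  exact Submodule.sum_mem _ fun w _ => Submodule.smul_mem _ _ (Submodule.subset_span ⟨_, rfl⟩)

lemma WAlg.hom_ext {V : Type*} [AddCommGroup V] [Module k V] {f g : WAlg k →ₗ[k] V}
    (h : ∀ w, f (bw k w) = g (bw k w)) : f = g :=
  LinearMap.ext_on_range span_bw h

/-- The coefficient of a nondegenerate word. -/
noncomputable def coefW (w : List Letter) (hw : ¬ IsDegenerate w) : WAlg k →ₗ[k] k :=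
  WAlg.lift (fun v => if v = w then 1 else 0) fun v hv => by
    rw [if_neg]; rintro rfl; exact hw hv

@[simp] lemma coefW_bw (w : List Letter) (hw : ¬ IsDegenerate w) (v : List Letter) :
    coefW w hw (bw k v) = if v = w then 1 else 0 := WAlg.lift_bw _ _ _

lemma IsDegenerate.map {w : List Letter} (ρ : Letter → Letter) (h : IsDegenerate w) :
    IsDegenerate (w.map ρ) := by
  obtain ⟨u, v, a, rfl⟩ := h
  exact ⟨u.map ρ, v.map ρ, ρ a, by simp⟩

/-- The effect of a map of letters on the algebra of words. -/
noncomputable def relabel (ρ : Letter → Letter) : WAlg k →ₗ[k] WAlg k :=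
  WAlg.lift (fun w => bw k (w.map ρ)) fun _ h => bw_deg (h.map ρ)

@[simp] lemma relabel_bw (ρ : Letter → Letter) (w : List Letter) :
    relabel ρ (bw k w) = bw k (w.map ρ) := WAlg.lift_bw _ _ _

lemma WAlg.ind {P : WAlg k → Prop} (h : ∀ w, P (bw k w)) (h0 : P 0)
    (hadd : ∀ x y, P x → P y → P (x + y)) (hsmul : ∀ (r : k) x, P x → P (r • x)) (x : WAlg k) :
    P x := by
  have hx : x ∈ Submodule.span k (Set.range (bw k)) := by rw [span_bw]; trivial
  induction hx using Submodule.span_induction with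
  | mem x hx => obtain ⟨w, rfl⟩ := hx; exact h w
  | zero => exact h0
  | add x y _ _ hx hy => exact hadd x y hx hy
  | smul r x _ hx => exact hsmul r x hx

lemma relabel_mul (ρ : Letter → Letter) (x y : WAlg k) :
    relabel ρ (x * y) = relabel ρ x * relabel ρ y := by
  induction x using WAlg.ind with
  | h w =>
    induction y using WAlg.ind with
    | h v => simp [← bw_append]
    | h0 => simp
    | hadd x y hx hy => simp [mul_add, hx, hy]
    | hsmul r x hx => simp [hx]
  | h0 => simp
  | hadd x y hx hy => simp [add_mul, hx, hy]
  | hsmul r x hx => simp [hx]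

lemma relabel_one (ρ : Letter → Letter) : relabel ρ (1 : WAlg k) = 1 := by
  rw [← bw_nil, relabel_bw, List.map_nil]

/-! ## Signs and dimensions -/

/-- Reduces every comparison of Koszul signs to an identity in `ZMod 2`, where signs of exponents
disappear and ring arithmetic applies. -/
lemma sgn_congr {m n : ℤ} (h : (m : ZMod 2) = n) : sgn k m = sgn k n := by
  have : Even (m - n) := by
    rw [← ZMod.intCast_eq_zero_iff_even]; push_cast; rw [h, sub_self]
  unfold sgn
  rw [Int.negOnePow_eq_iff m n |>.2 this]

lemma sgn_add (m n : ℤ) : sgn k (m + n) = sgn k m * sgn k n := by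
  simp [sgn, Int.negOnePow_add]

lemma sgn_zero : sgn k 0 = 1 := by simp [sgn]

lemma sgn_one : sgn k 1 = -1 := by simp [sgn]

lemma sgn_mul_self (n : ℤ) : sgn k n * sgn k n = 1 := by
  rw [← sgn_add, ← sgn_zero (k := k)]
  refine sgn_congr ?_
  push_cast
  exact CharTwo.add_self_eq_zero _

lemma sgn_smul_smul {V : Type*} [AddCommGroup V] [Module k V] (m n : ℤ) (v : V) :
    sgn k m • sgn k n • v = sgn k (m + n) • v := by rw [smul_smul, sgn_add]

lemma neg_sgn (n : ℤ) : -sgn k n = sgn k (n + 1) := by rw [sgn_add, sgn_one]; ring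

lemma sgn_eq_or (n : ℤ) : sgn k n = 1 ∨ sgn k n = -1 := by
  rcases Int.even_or_odd n with h | h
  · left; simp [sgn, Int.negOnePow_even n h]
  · right; simp [sgn, Int.negOnePow_odd n h]

/-- A new first letter starts an elementary interval exactly when the same letter occurs again. All
recursions on words below rest on this count. -/
lemma dim_cons (a : Letter) (w : List Letter) :
    dim (a :: w) = dim w + if a ∈ w then 1 else 0 := by
  unfold dim ell
  by_cases h : a ∈ w
  · rw [if_pos h, List.toFinset_cons, Finset.insert_eq_of_mem (by simpa using h),
      ← Finset.add_sum_erase _ _ (List.mem_toFinset.2 h),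
      ← Finset.add_sum_erase _ (fun b => w.count b - 1) (List.mem_toFinset.2 h),
      List.count_cons_self]
    have : ∑ x ∈ w.toFinset.erase a, (List.count x (a :: w) - 1) =
        ∑ x ∈ w.toFinset.erase a, (List.count x w - 1) :=
      Finset.sum_congr rfl fun x hx => by
        rw [List.count_cons_of_ne (Finset.ne_of_mem_erase hx).symm]
    have h1 := List.count_pos_iff.2 h
    omega
  · rw [if_neg h, List.toFinset_cons, Finset.sum_insert (by simpa using h)]
    rw [List.count_cons_self, List.count_eq_zero_of_not_mem h, zero_add, Nat.sub_self, zero_add,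
      add_zero]
    refine Finset.sum_congr rfl fun x hx => ?_
    rw [List.count_cons_of_ne]
    rintro rfl
    exact h (List.mem_toFinset.1 hx)

lemma dim_nil : dim [] = 0 := rfl

lemma dim_append {u v : List Letter} (h : ∀ a ∈ u, a ∉ v) : dim (u ++ v) = dim u + dim v := by
  induction u with
  | nil => simp [dim_nil]
  | cons a u ih =>
    have ha := h a (by simp)
    rw [List.cons_append, dim_cons, dim_cons, ih fun b hb => h b (by simp [hb])]
    simp only [List.mem_append, ha, or_false]
    omega

lemma dim_map {ρ : Letter → Letter} {w : List Letter} (h : Set.InjOn ρ {a | a ∈ w}) :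
    dim (w.map ρ) = dim w := by
  induction w with
  | nil => rfl
  | cons a w ih =>
    rw [List.map_cons, dim_cons, dim_cons, ih (h.mono fun b hb => List.mem_cons_of_mem _ hb)]
    congr 2
    refine propext ⟨fun hm => ?_, fun hm => List.mem_map_of_mem hm⟩
    obtain ⟨b, hb, hab⟩ := List.mem_map.1 hm
    rwa [← h (List.mem_cons_of_mem _ hb) List.mem_cons_self hab]

/-- A letter with a single occurrence carries no elementary interval; after its removal the
truncated subtraction in `ell` still gives `0`. -/
lemma dim_erase {a : Letter} {w : List Letter} (h : w.count a = 1) :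
    dim (w.erase a) = dim w := by
  induction w with
  | nil => simp at h
  | cons b w ih =>
    by_cases hb : b = a
    · subst hb
      have : b ∉ w := by
        rw [List.count_cons_self] at h; exact List.count_eq_zero.1 (by omega)
      rw [List.erase_cons_head, dim_cons, if_neg this, add_zero]
    · rw [List.erase_cons_tail (by simpa using hb), dim_cons, dim_cons,
        ih (by rwa [List.count_cons_of_ne hb] at h)]
      congr 2
      exact propext (List.mem_erase_of_ne hb)

end TwoOperad

namespace TwoOperad
variable {k : Type u} [Field k]

/-! ## The differential of the algebra of words -/

/-- The differential of a word: the signed sum of the deletions of its letters. -/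
noncomputable def dWord (k : Type u) [Field k] : List Letter → WAlg k
  | [] => 0
  | a :: w => if a ∈ w then
      -- The interval that starts at the leading `a` comes first. Deleting this `a` has sign `+`,
      -- and any other deletion has to pass the interval, whence the minus sign. If `a` occurs once
      -- in `w`, that occurrence cannot be deleted within `w` but can be deleted in `a :: w`; as the
      -- face of index `1` it has sign `-`, and it is added separately.
      bw k w - bw k [a] * dWord k w - (if w.count a = 1 then bw k (a :: w.erase a) else 0)
    else bw k [a] * dWord k w

lemma dWord_cons_of_mem {a : Letter} {w : List Letter} (h : a ∈ w) : dWord k (a :: w) =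
    bw k w - bw k [a] * dWord k w - (if w.count a = 1 then bw k (a :: w.erase a) else 0) :=
  if_pos h

lemma dWord_cons_of_not_mem {a : Letter} {w : List Letter} (h : a ∉ w) :
    dWord k (a :: w) = bw k [a] * dWord k w := if_neg h

/-- The deletions of the two equal neighbours give the same word with opposite signs, and every
other deletion keeps the pair, so the result is degenerate. -/
lemma dWord_deg {w : List Letter} (h : IsDegenerate w) : dWord k w = 0 := by
  obtain ⟨u, v, b, rfl⟩ := h
  induction u with
  | nil =>
    by_cases hb : b ∈ v
    · have : (b :: v).count b ≠ 1 := by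
        have := List.count_pos_iff.2 hb
        rw [List.count_cons_self]; omega
      simp only [List.nil_append, dWord, List.mem_cons, true_or, if_true, hb, if_neg this,
        mul_sub, bw_sq_assoc, sub_zero, mul_ite, mul_zero]
      rw [bw_cons b (v.erase b), bw_sq_assoc, ite_self, sub_zero, ← bw_cons, sub_self]
    · have : (b :: v).count b = 1 := by
        rw [List.count_cons_self, List.count_eq_zero_of_not_mem hb]
      simp only [List.nil_append, dWord, List.mem_cons, true_or, if_true, hb, if_false, this,
        bw_sq_assoc, sub_zero, List.erase_cons_head, sub_self]
  | cons a u ih =>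
    have hd : IsDegenerate (u ++ b :: b :: v) := ⟨u, v, b, rfl⟩
    rw [List.cons_append, dWord, ih, bw_deg hd]
    simp only [mul_zero, sub_zero, zero_sub, ite_eq_right_iff, neg_eq_zero]
    -- Since `a` occurs only once in the rest, it is not the doubled letter `b`, so erasing it
    -- leaves the pair `b b` intact.
    intro _ hc
    refine bw_deg ?_
    have hab : b ≠ a := by
      rintro rfl
      simp only [List.count_append, List.count_cons_self] at hc
      omega
    by_cases hau : a ∈ u
    · rw [List.erase_append_left _ hau]
      exact ⟨a :: u.erase a, v, b, by simp⟩
    · rw [List.erase_append_right _ hau, List.erase_cons_tail (by simpa using hab),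
        List.erase_cons_tail (by simpa using hab)]
      exact ⟨a :: u, v.erase a, b, by simp⟩

/-- The differential. -/
noncomputable def dW : WAlg k →ₗ[k] WAlg k := WAlg.lift (dWord k) fun _ h => dWord_deg h

@[simp] lemma dW_bw (w : List Letter) : dW (bw k w) = dWord k w := WAlg.lift_bw _ _ _

/-- Deletion of a letter that occurs exactly once. -/
noncomputable def eraseW (a : Letter) : WAlg k →ₗ[k] WAlg k :=
  WAlg.lift (fun w => if w.count a = 1 then bw k (w.erase a) else 0) fun w h => by
    obtain ⟨u, v, b, rfl⟩ := h
    simp only [ite_eq_right_iff]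
    intro hc
    refine bw_deg ?_
    have hab : b ≠ a := by
      rintro rfl
      simp only [List.count_append, List.count_cons_self] at hc
      omega
    by_cases hau : a ∈ u
    · rw [List.erase_append_left _ hau]
      exact ⟨u.erase a, v, b, by simp⟩
    · rw [List.erase_append_right _ hau, List.erase_cons_tail (by simpa using hab),
        List.erase_cons_tail (by simpa using hab)]
      exact ⟨u, v.erase a, b, by simp⟩

@[simp] lemma eraseW_bw (a : Letter) (w : List Letter) :
    eraseW a (bw k w) = if w.count a = 1 then bw k (w.erase a) else 0 := WAlg.lift_bw _ _ _

/-! ## Elements with a given set of letters -/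

/-- The words with the set of letters `A` and of degree `n`. -/
def wordsOf (A : Set Letter) (n : ℤ) : Set (List Letter) :=
  {w | (∀ a, a ∈ w ↔ a ∈ A) ∧ -(dim w : ℤ) = n}

/-- The elements with the set of letters `A` and of degree `n`. -/
noncomputable def HW (k : Type u) [Field k] (A : Set Letter) (n : ℤ) : Submodule k (WAlg k) :=
  Submodule.span k (bw k '' wordsOf A n)

lemma bw_mem_HW {A : Set Letter} {n : ℤ} {w : List Letter} (h : w ∈ wordsOf A n) :
    bw k w ∈ HW k A n := Submodule.subset_span ⟨w, h, rfl⟩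

lemma bw_mem_HW_self (w : List Letter) : bw k w ∈ HW k {a | a ∈ w} (-(dim w : ℤ)) :=
  bw_mem_HW ⟨fun _ => Iff.rfl, rfl⟩

lemma HW.ind {A : Set Letter} {n : ℤ} {P : WAlg k → Prop} (h : ∀ w ∈ wordsOf A n, P (bw k w))
    (h0 : P 0) (hadd : ∀ x y, P x → P y → P (x + y)) (hsmul : ∀ (r : k) x, P x → P (r • x))
    {x : WAlg k} (hx : x ∈ HW k A n) : P x := by
  induction hx using Submodule.span_induction with
  | mem x hx => obtain ⟨w, hw, rfl⟩ := hx; exact h w hw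
  | zero => exact h0
  | add x y _ _ hx hy => exact hadd x y hx hy
  | smul r x _ hx => exact hsmul r x hx

/-- Two linear maps that agree on the words agree on all elements. -/
lemma HW.eq_of {V : Type*} [AddCommGroup V] [Module k V] {A : Set Letter} {n : ℤ}
    {f g : WAlg k →ₗ[k] V} (h : ∀ w ∈ wordsOf A n, f (bw k w) = g (bw k w)) {x : WAlg k}
    (hx : x ∈ HW k A n) : f x = g x :=
  HW.ind (P := fun x => f x = g x) h (by simp) (fun x y hx hy => by simp [hx, hy])
    (fun r x hx => by simp [hx]) hx

lemma HW.map_mem {V : Type*} [AddCommGroup V] [Module k V] {A : Set Letter} {n : ℤ}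
    {f : WAlg k →ₗ[k] V} {S : Submodule k V} (h : ∀ w ∈ wordsOf A n, f (bw k w) ∈ S) {x : WAlg k}
    (hx : x ∈ HW k A n) : f x ∈ S :=
  HW.ind (P := fun x => f x ∈ S) h (by simp) (fun x y hx hy => by simpa using S.add_mem hx hy)
    (fun r x hx => by simpa using S.smul_mem r hx) hx

lemma one_mem_HW : (1 : WAlg k) ∈ HW k ∅ 0 := by
  rw [← bw_nil]; exact bw_mem_HW ⟨by simp, by simp [dim_nil]⟩

/-- Disjointness is what makes the degrees add: a letter common to both factors would create one
more elementary interval across the junction. -/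
lemma mul_mem_HW {A B : Set Letter} {m n : ℤ} (hAB : Disjoint A B) {x y : WAlg k}
    (hx : x ∈ HW k A m) (hy : y ∈ HW k B n) : x * y ∈ HW k (A ∪ B) (m + n) := by
  refine HW.map_mem (f := LinearMap.mulRight k y) (fun w hw => ?_) hx
  refine HW.map_mem (f := LinearMap.mulLeft k (bw k w)) (fun v hv => ?_) hy
  simp only [LinearMap.mulLeft_apply, ← bw_append]
  refine bw_mem_HW ⟨fun a => by simp [hw.1, hv.1], ?_⟩
  rw [dim_append, ← hw.2, ← hv.2]
  · push_cast; ring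
  · intro a ha hb
    exact Set.disjoint_left.1 hAB ((hw.1 a).1 ha) ((hv.1 a).1 hb)

lemma cons_mem_HW {A : Set Letter} {n : ℤ} {a : Letter} (ha : a ∈ A) {x : WAlg k}
    (hx : x ∈ HW k A n) : bw k [a] * x ∈ HW k A (n - 1) := by
  refine HW.map_mem (f := LinearMap.mulLeft k (bw k [a])) (fun v hv => ?_) hx
  simp only [LinearMap.mulLeft_apply, ← bw_append]
  have hm := (hv.1 a).2 ha
  refine bw_mem_HW ⟨fun b => ?_, ?_⟩
  · simp only [List.singleton_append, List.mem_cons, ← hv.1]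
    exact ⟨by rintro (rfl | h) <;> assumption, Or.inr⟩
  · rw [List.singleton_append, dim_cons, if_pos hm, ← hv.2]; push_cast; ring

lemma cons_mem_HW' {A : Set Letter} {n : ℤ} {a : Letter} (ha : a ∉ A) {x : WAlg k}
    (hx : x ∈ HW k A n) : bw k [a] * x ∈ HW k (insert a A) n := by
  refine HW.map_mem (f := LinearMap.mulLeft k (bw k [a])) (fun v hv => ?_) hx
  simp only [LinearMap.mulLeft_apply, ← bw_append]
  have hm := fun h => ha ((hv.1 a).1 h)
  refine bw_mem_HW ⟨fun b => ?_, ?_⟩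
  · simp [hv.1]
  · rw [List.singleton_append, dim_cons, if_neg hm, ← hv.2]; push_cast; ring

lemma dWord_mem (w : List Letter) : dWord k w ∈ HW k {a | a ∈ w} (-(dim w : ℤ) + 1) := by
  induction w with
  | nil => exact Submodule.zero_mem _
  | cons a w ih =>
    rw [dWord]
    split_ifs with h hc
    · have hA : {b | b ∈ a :: w} = {b | b ∈ w} := by
        ext b; simp only [List.mem_cons, Set.mem_ofPred_eq, or_iff_right_iff_imp]
        rintro rfl; exact h
      have hd : (-(dim (a :: w) : ℤ) + 1) = -(dim w : ℤ) := by
        rw [dim_cons, if_pos h]; push_cast; ring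
      rw [hA, hd]
      refine Submodule.sub_mem _ (Submodule.sub_mem _ (bw_mem_HW_self _) ?_) ?_
      · have := cons_mem_HW (a := a) h ih
        rwa [add_sub_cancel_right] at this
      · refine bw_mem_HW ⟨fun b => ?_, ?_⟩
        · by_cases hb : b = a
          · subst hb; simp [h]
          · simp [hb, List.mem_erase_of_ne]
        · have : a ∉ w.erase a := by
            rw [← List.count_eq_zero, List.count_erase_self, hc]
          rw [dim_cons, if_neg this, dim_erase hc, add_zero]
    · have hA : {b | b ∈ a :: w} = {b | b ∈ w} := by
        ext b; simp only [List.mem_cons, Set.mem_ofPred_eq, or_iff_right_iff_imp]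
        rintro rfl; exact h
      have hd : (-(dim (a :: w) : ℤ) + 1) = -(dim w : ℤ) := by
        rw [dim_cons, if_pos h]; push_cast; ring
      rw [hA, hd, sub_zero]
      refine Submodule.sub_mem _ (bw_mem_HW_self _) ?_
      have := cons_mem_HW (a := a) h ih
      rwa [add_sub_cancel_right] at this
    · have hA : {b | b ∈ a :: w} = insert a {b | b ∈ w} := by
        ext b; simp
      rw [hA, dim_cons, if_neg h, add_zero]
      exact cons_mem_HW' h ih

lemma dW_mem_HW {A : Set Letter} {n : ℤ} {x : WAlg k} (hx : x ∈ HW k A n) :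
    dW x ∈ HW k A (n + 1) := by
  refine HW.map_mem (fun w hw => ?_) hx
  have := dWord_mem (k := k) w
  rw [dW_bw]
  have hA : {a | a ∈ w} = A := Set.ext hw.1
  rwa [hA, hw.2] at this

/-- With disjoint letters no elementary interval crosses the junction, and all the intervals of `x`
precede those of `y`. By bilinearity it suffices to treat words, where the formula follows from the
recursion of `dWord` along the first word. -/
lemma dW_mul {A B : Set Letter} {m n : ℤ} (hAB : Disjoint A B) {x y : WAlg k}
    (hx : x ∈ HW k A m) (hy : y ∈ HW k B n) :
    dW (x * y) = dW x * y + sgn k m • (x * dW y) := by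
  refine HW.eq_of (f := dW ∘ₗ LinearMap.mulRight k y)
    (g := LinearMap.mulRight k y ∘ₗ dW + sgn k m • LinearMap.mulRight k (dW y)) (fun w hw => ?_) hx
  refine HW.eq_of (f := dW ∘ₗ LinearMap.mulLeft k (bw k w))
    (g := LinearMap.mulLeft k (dW (bw k w)) + sgn k m • (LinearMap.mulLeft k (bw k w) ∘ₗ dW))
    (fun v hv => ?_) hy
  have hwv : ∀ a ∈ w, a ∉ v := fun a ha hb =>
    Set.disjoint_left.1 hAB ((hw.1 a).1 ha) ((hv.1 a).1 hb)
  rw [← hw.2]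
  clear hw hx hy hv
  simp only [LinearMap.comp_apply, LinearMap.add_apply, LinearMap.smul_apply,
    LinearMap.mulLeft_apply, ← bw_append, dW_bw]
  induction w with
  | nil => simp [dWord, bw_nil, sgn_zero, dim_nil]
  | cons a w ih =>
    have ih := ih fun b hb => hwv b (List.mem_cons_of_mem _ hb)
    have hav := hwv a List.mem_cons_self
    rw [List.cons_append]
    by_cases h : a ∈ w
    · have hs : sgn k (-((dim w + 1 : ℕ) : ℤ)) = -sgn k (-(dim w : ℤ)) := by
        rw [neg_sgn]; refine sgn_congr ?_; push_cast; grind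
      rw [dWord_cons_of_mem h, dWord_cons_of_mem (List.mem_append_left _ h), dim_cons, if_pos h, hs,
        List.count_append, List.count_eq_zero_of_not_mem hav, add_zero, List.erase_append_left _ h,
        ih, bw_cons a w, bw_append, ← List.cons_append]
      split_ifs
      · rw [bw_append]; simp only [sub_mul, mul_add, mul_smul_comm, neg_smul, mul_assoc]; abel
      · simp only [sub_mul, mul_add, mul_smul_comm, neg_smul, mul_assoc, zero_mul]; abel
    · rw [dWord_cons_of_not_mem h, dWord_cons_of_not_mem (by simp [h, hav]), dim_cons, if_neg h,
        add_zero, ih, bw_cons a w]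
      simp only [mul_add, mul_smul_comm, mul_assoc]

/-- The differential after left multiplication by a letter that occurs already. -/
lemma dW_cons {A : Set Letter} {n : ℤ} {a : Letter} (ha : a ∈ A) {x : WAlg k}
    (hx : x ∈ HW k A n) :
    dW (bw k [a] * x) = x - bw k [a] * dW x - bw k [a] * eraseW a x := by
  refine HW.eq_of (f := dW ∘ₗ LinearMap.mulLeft k (bw k [a]))
    (g := LinearMap.id - LinearMap.mulLeft k (bw k [a]) ∘ₗ dW -
      LinearMap.mulLeft k (bw k [a]) ∘ₗ eraseW a) (fun w hw => ?_) hx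
  simp only [LinearMap.comp_apply, LinearMap.sub_apply, LinearMap.id_apply,
    LinearMap.mulLeft_apply, ← bw_append, dW_bw, List.singleton_append, dWord,
    if_pos ((hw.1 a).2 ha), eraseW_bw]
  split_ifs
  · rw [← bw_append]; rfl
  · rw [mul_zero]

lemma dW_cons' {A : Set Letter} {n : ℤ} {a : Letter} (ha : a ∉ A) {x : WAlg k}
    (hx : x ∈ HW k A n) : dW (bw k [a] * x) = bw k [a] * dW x := by
  refine HW.eq_of (f := dW ∘ₗ LinearMap.mulLeft k (bw k [a]))
    (g := LinearMap.mulLeft k (bw k [a]) ∘ₗ dW) (fun w hw => ?_) hx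
  simp only [LinearMap.comp_apply,
    LinearMap.mulLeft_apply, ← bw_append, dW_bw, List.singleton_append, dWord,
    if_neg fun h => ha ((hw.1 a).1 h)]

lemma eraseW_mul_of_not_mem {A : Set Letter} {n : ℤ} {a : Letter} (ha : a ∉ A) {x : WAlg k}
    (hx : x ∈ HW k A n) (y : WAlg k) : eraseW a (x * y) = x * eraseW a y := by
  refine HW.eq_of (f := eraseW a ∘ₗ LinearMap.mulRight k y)
    (g := LinearMap.mulRight k (eraseW a y)) (fun w hw => ?_) hx
  have haw : a ∉ w := fun h => ha ((hw.1 a).1 h)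
  simp only [LinearMap.comp_apply, LinearMap.mulRight_apply]
  induction y using WAlg.ind with
  | h v =>
    rw [← bw_append, eraseW_bw, eraseW_bw, List.count_append, List.count_eq_zero_of_not_mem haw,
      zero_add, List.erase_append_right _ haw]
    split_ifs <;> simp [bw_append]
  | h0 => simp
  | hadd x y hx hy => simp [mul_add, hx, hy]
  | hsmul r x hx => simp [hx]

lemma eraseW_cons_self {A : Set Letter} {n : ℤ} {a : Letter} (ha : a ∉ A) {x : WAlg k}
    (hx : x ∈ HW k A n) : eraseW a (bw k [a] * x) = x := by
  refine HW.eq_of (f := eraseW a ∘ₗ LinearMap.mulLeft k (bw k [a]))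
    (g := LinearMap.id) (fun w hw => ?_) hx
  have haw : a ∉ w := fun h => ha ((hw.1 a).1 h)
  simp [← bw_append, List.count_eq_zero_of_not_mem haw]

lemma eraseW_cons_of_mem {A : Set Letter} {n : ℤ} {a : Letter} (ha : a ∈ A) {x : WAlg k}
    (hx : x ∈ HW k A n) : eraseW a (bw k [a] * x) = 0 := by
  refine HW.eq_of (f := eraseW a ∘ₗ LinearMap.mulLeft k (bw k [a]))
    (g := 0) (fun w hw => ?_) hx
  have haw : 0 < w.count a := List.count_pos_iff.2 ((hw.1 a).2 ha)
  simp only [LinearMap.comp_apply, LinearMap.mulLeft_apply, ← bw_append, List.singleton_append,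
    eraseW_bw, List.count_cons_self, LinearMap.zero_apply]
  rw [if_neg (by omega)]

/-- Erasing a single `a` does not affect which other letters can be deleted, nor with what sign. If
`a` occurs exactly twice, the only terms of the differential with one `a` left are the deletions of
either copy; after erasing the other copy they agree and have opposite signs. If it occurs more
often, no term has just one `a`. -/
lemma eraseW_dWord (a : Letter) (w : List Letter) :
    (w.count a = 1 → eraseW a (dWord k w) = dWord k (w.erase a)) ∧
    (2 ≤ w.count a → eraseW a (dWord k w) = 0) := by
  induction w with
  | nil => simp
  | cons b w ih =>
    by_cases hb : b = a
    · subst hb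
      rw [List.count_cons_self, List.erase_cons_head]
      refine ⟨fun h => ?_, fun h => ?_⟩
      · have hbw : b ∉ w := List.count_eq_zero.1 (by omega)
        rw [dWord_cons_of_not_mem hbw]
        exact eraseW_cons_self (A := {a | a ∈ w}) hbw (dWord_mem w)
      · have hbw : b ∈ w := List.count_pos_iff.1 (by omega)
        rw [dWord_cons_of_mem hbw, map_sub, map_sub,
          eraseW_cons_of_mem (A := {a | a ∈ w}) hbw (dWord_mem w), eraseW_bw]
        split_ifs with h1
        · have hbe : b ∉ w.erase b := by
            rw [← List.count_eq_zero, List.count_erase_self, h1]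
          rw [bw_cons, eraseW_cons_self hbe (bw_mem_HW_self _)]
          simp
        · simp
    · rw [List.count_cons_of_ne hb, List.erase_cons_tail (by simpa using hb)]
      have hab : a ≠ b := fun h => hb h.symm
      have hnb : a ∉ ({b} : Set Letter) := hab
      have hmul : ∀ y : WAlg k, eraseW a (bw k [b] * y) = bw k [b] * eraseW a y :=
        eraseW_mul_of_not_mem (n := 0) hnb (bw_mem_HW ⟨by simp, by simp [dim, ell]⟩)
      refine ⟨fun h => ?_, fun h => ?_⟩
      · by_cases hbw : b ∈ w
        · rw [dWord_cons_of_mem hbw, dWord_cons_of_mem ((List.mem_erase_of_ne hb).2 hbw),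
            List.count_erase_of_ne hab.symm, map_sub, map_sub, hmul, ih.1 h, eraseW_bw, if_pos h]
          split_ifs with h2
          · rw [eraseW_bw, List.count_cons_of_ne hb, List.count_erase_of_ne hab, if_pos h,
              List.erase_cons_tail (by simpa using hb), List.erase_comm]
          · rw [map_zero]
        · rw [dWord_cons_of_not_mem hbw,
            dWord_cons_of_not_mem (fun hm => hbw ((List.mem_erase_of_ne hb).1 hm)), hmul, ih.1 h]
      · have h1 : w.count a ≠ 1 := by omega
        by_cases hbw : b ∈ w
        · rw [dWord_cons_of_mem hbw, map_sub, map_sub, hmul, ih.2 h, eraseW_bw, if_neg h1]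
          split_ifs
          · rw [eraseW_bw, List.count_cons_of_ne hb, List.count_erase_of_ne hab, if_neg h1]
            simp
          · simp
        · rw [dWord_cons_of_not_mem hbw, hmul, ih.2 h, mul_zero]

/-- By `dW_cons`, the differential of `a · dWord w` contributes a term `a · eraseW a (dWord w)`. It
cancels the differential of the exceptional term of `dWord (a :: w)` when `a` occurs once in `w`,
and vanishes otherwise. -/
lemma dW_dWord (w : List Letter) : dW (dWord k w) = 0 := by
  induction w with
  | nil => simp [dWord]
  | cons a w ih =>
    by_cases h : a ∈ w
    · rw [dWord_cons_of_mem h, map_sub, map_sub, dW_cons (A := {a | a ∈ w}) h (dWord_mem w), ih,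
        dW_bw, mul_zero, sub_zero]
      split_ifs with hc
      · have hbe : a ∉ w.erase a := by
          rw [← List.count_eq_zero, List.count_erase_self, hc]
        rw [dW_bw, dWord_cons_of_not_mem hbe, (eraseW_dWord a w).1 hc]
        abel
      · have := List.count_pos_iff.2 h
        rw [(eraseW_dWord a w).2 (by omega)]; simp
    · rw [dWord_cons_of_not_mem h, dW_cons' (A := {a | a ∈ w}) h (dWord_mem w), ih, mul_zero]

lemma dW_dW (x : WAlg k) : dW (dW x) = 0 := by
  have : (dW ∘ₗ dW : WAlg k →ₗ[k] WAlg k) = 0 := WAlg.hom_ext fun w => by simp [dW_dWord]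
  exact LinearMap.congr_fun this x

lemma dWord_map {ρ : Letter → Letter} {w : List Letter} (h : Set.InjOn ρ {a | a ∈ w}) :
    dWord k (w.map ρ) = relabel ρ (dWord k w) := by
  induction w with
  | nil => simp [dWord]
  | cons a w ih =>
    have hw := h.mono fun b (hb : b ∈ w) => List.mem_cons_of_mem a hb
    have hcount : (w.map ρ).count (ρ a) = w.count a ∧ (w.map ρ).erase (ρ a) = (w.erase a).map ρ := by
      clear ih hw
      induction w with
      | nil => simp
      | cons b w ih =>
        have := ih (h.mono fun c hc => by
          simp only [List.mem_cons, Set.mem_ofPred_eq] at hc ⊢; tauto)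
        by_cases hb : b = a
        · subst hb; simp [this.1]
        · have hρ : ρ b ≠ ρ a := fun he => hb (h (by simp) (by simp) he)
          rw [List.map_cons, List.count_cons_of_ne hρ, List.count_cons_of_ne hb, this.1,
            List.erase_cons_tail (by simpa using hρ), List.erase_cons_tail (by simpa using hb),
            this.2]
          simp
    have hmem : ρ a ∈ w.map ρ ↔ a ∈ w := by
      rw [← List.count_pos_iff, hcount.1, List.count_pos_iff]
    by_cases ha : a ∈ w
    · rw [List.map_cons, dWord_cons_of_mem (hmem.2 ha), dWord_cons_of_mem ha, hcount.1, hcount.2,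
        ih hw]
      split_ifs <;> simp [relabel_mul]
    · rw [List.map_cons, dWord_cons_of_not_mem (fun h => ha (hmem.1 h)), dWord_cons_of_not_mem ha,
        ih hw]
      simp [relabel_mul]

lemma dW_relabel {ρ : Letter → Letter} {A : Set Letter} (h : Set.InjOn ρ A) {n : ℤ} {x : WAlg k}
    (hx : x ∈ HW k A n) : dW (relabel ρ x) = relabel ρ (dW x) := by
  refine HW.eq_of (f := dW ∘ₗ relabel ρ) (g := relabel ρ ∘ₗ dW) (fun w hw => ?_) hx
  have hA : {a | a ∈ w} = A := Set.ext hw.1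
  simp only [LinearMap.comp_apply, relabel_bw, dW_bw]
  exact dWord_map (hA ▸ h)

lemma relabel_mem_HW {ρ : Letter → Letter} {A : Set Letter} (h : Set.InjOn ρ A) {n : ℤ}
    {x : WAlg k} (hx : x ∈ HW k A n) : relabel ρ x ∈ HW k (ρ '' A) n := by
  refine HW.map_mem (fun w hw => ?_) hx
  have hA : {a | a ∈ w} = A := Set.ext hw.1
  rw [relabel_bw]
  refine bw_mem_HW ⟨fun a => ?_, ?_⟩
  · simp [← hA]
  · rw [dim_map (hA ▸ h), hw.2]

end TwoOperad

namespace TwoOperad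
variable {k : Type u} [Field k]

/-! ## Insertion of a sequence of elements into a word -/

/-- The degree of a sequence in the bar construction. -/
def bdeg (c : List (ℤ × WAlg k)) : ℤ := (c.map fun g => g.1 - 1).sum

@[simp] lemma bdeg_nil : bdeg ([] : List (ℤ × WAlg k)) = 0 := rfl

@[simp] lemma bdeg_cons (g : ℤ × WAlg k) (c : List (ℤ × WAlg k)) :
    bdeg (g :: c) = g.1 - 1 + bdeg c := rfl

/-- One step of `insW`. -/
noncomputable def insStep (g : ℤ × WAlg k) (F : List Letter → WAlg k) : List Letter → WAlg k
  | [] => 0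
  -- Either `g` is inserted after the leading `x`, in which case `x` stays at the front of the
  -- remaining word and further elements can be inserted at it, or `x` is passed. The sign moves
  -- `[g]`, of degree `|g| - 1`, past the elementary intervals of the remaining word, and the
  -- additional minus sign comes from the doubled letter.
  | x :: α => -(sgn k (dim (x :: α) * (g.1 - 1)) • (bw k [x] * (g.2 * F (x :: α)))) +
      bw k [x] * insStep g F α

/-- The signed sum over all the ways to cut a word at letters (which are doubled), and to insert the
given elements, in their order, at the cuts. -/
noncomputable def insW : List (ℤ × WAlg k) → List Letter → WAlg k
  | [] => bw k
  | g :: c => insStep g (insW c)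

lemma insW_nil (w : List Letter) : insW [] w = bw k w := rfl

lemma insW_cons_nil (g : ℤ × WAlg k) (c : List (ℤ × WAlg k)) : insW (g :: c) [] = 0 := rfl

lemma insW_cons_cons (g : ℤ × WAlg k) (c : List (ℤ × WAlg k)) (x : Letter) (α : List Letter) :
    insW (g :: c) (x :: α) = -(sgn k (dim (x :: α) * (g.1 - 1)) •
      (bw k [x] * (g.2 * insW c (x :: α)))) + bw k [x] * insW (g :: c) α := rfl

/-- Every term of the insertion still begins with the first letter of the word, so another copy in
front makes it degenerate. This is the source of all normalisation properties of `insW`. -/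
lemma bw_mul_insW_cons (c : List (ℤ × WAlg k)) (x : Letter) (α : List Letter) :
    bw k [x] * insW c (x :: α) = 0 := by
  cases c with
  | nil => rw [insW_nil, bw_cons x α, bw_sq_assoc]
  | cons g c => simp [insW_cons_cons, mul_add, bw_sq_assoc]

/-- For the word `b b v`, an insertion at the first `b` leaves `b b v` to the other elements, which
gives `0` by induction on the sequence. If the first `b` is passed, the remainder again starts with
`b`. -/
lemma insW_deg (c : List (ℤ × WAlg k)) {w : List Letter} (h : IsDegenerate w) : insW c w = 0 := by
  induction c generalizing w with
  | nil => exact bw_deg h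
  | cons g c ih =>
    obtain ⟨u, v, b, rfl⟩ := h
    induction u with
    | nil =>
      rw [List.nil_append, insW_cons_cons, ih (w := b :: b :: v) ⟨[], v, b, rfl⟩, bw_mul_insW_cons]
      simp
    | cons a u ih' =>
      rw [List.cons_append, insW_cons_cons, ih', ih (w := a :: (u ++ b :: b :: v)) ⟨a :: u, v, b, rfl⟩]
      simp

/-- The extension of `insW` to linear combinations of words. -/
noncomputable def insN (c : List (ℤ × WAlg k)) : WAlg k →ₗ[k] WAlg k :=
  WAlg.lift (insW c) fun _ h => insW_deg c h

@[simp] lemma insN_bw (c : List (ℤ × WAlg k)) (w : List Letter) : insN c (bw k w) = insW c w :=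
  WAlg.lift_bw _ _ _

lemma insN_nil : insN ([] : List (ℤ × WAlg k)) = LinearMap.id :=
  WAlg.hom_ext fun w => by simp [insW_nil]

lemma insN_nil_apply (x : WAlg k) : insN [] x = x := by rw [insN_nil]; rfl

lemma insN_one_cons (g : ℤ × WAlg k) (c : List (ℤ × WAlg k)) : insN (g :: c) 1 = 0 := by
  rw [← bw_nil, insN_bw, insW_cons_nil]

/-- All the ways to cut a list in two. -/
def lsplits {α : Type*} : List α → List (List α × List α)
  | [] => [([], [])]
  | g :: c => ([], g :: c) :: (lsplits c).map fun s => (g :: s.1, s.2)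

lemma sum_map_neg_smul {ι : Type*} (l : List ι) (r : ι → k) (f : ι → WAlg k) :
    (l.map fun i => -(r i • f i)).sum = -(l.map fun i => r i • f i).sum := by
  induction l with
  | nil => simp
  | cons a l ih => simp [ih]; abel

lemma sum_map_add {ι V : Type*} [AddCommMonoid V] (l : List ι) (f g : ι → V) :
    (l.map fun i => f i + g i).sum = (l.map f).sum + (l.map g).sum := by
  induction l with
  | nil => simp
  | cons a l ih => simp only [List.map_cons, List.sum_cons, ih]; abel

lemma map_list_sum {V V' ι : Type*} [AddCommGroup V] [AddCommGroup V'] [Module k V] [Module k V']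
    (F : V →ₗ[k] V') (l : List ι) (f : ι → V) :
    F (l.map f).sum = (l.map fun i => F (f i)).sum := by
  induction l with
  | nil => simp
  | cons a l ih => simp [ih]

lemma mul_list_sum {ι : Type*} (x : WAlg k) (l : List ι) (f : ι → WAlg k) :
    x * (l.map f).sum = (l.map fun i => x * f i).sum :=
  map_list_sum (LinearMap.mulLeft k x) l f

lemma smul_list_sum {ι : Type*} (r : k) (l : List ι) (f : ι → WAlg k) :
    r • (l.map f).sum = (l.map fun i => r • f i).sum :=
  map_list_sum (r • LinearMap.id (R := k) (M := WAlg k)) l f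

/-- The elements inserted in `α` form an initial segment of the sequence. The sign moves this
segment past the elementary intervals of `α'`. This is the formula for `ε` of a composite. -/
lemma insW_append (c : List (ℤ × WAlg k)) (α α' : List Letter) (h : ∀ a ∈ α, a ∉ α') :
    insW c (α ++ α') = ((lsplits c).map fun s =>
      sgn k (dim α' * bdeg s.1) • (insW s.1 α * insW s.2 α')).sum := by
  induction c generalizing α with
  | nil => simp [lsplits, insW_nil, sgn_zero, bw_append]
  | cons g c ih =>
    induction α with
    | nil =>
      simp only [lsplits, List.map_cons, List.map_map, Function.comp_def, List.sum_cons,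
        insW_cons_nil, zero_mul, smul_zero, bdeg_nil, mul_zero, sgn_zero, one_smul]
      simp [insW_nil, bw_nil]
    | cons x α ihα =>
      have ih1 := ih (x :: α) h
      have ih2 := ihα fun a ha => h a (List.mem_cons_of_mem _ ha)
      rw [List.cons_append, insW_cons_cons, ih2, ← List.cons_append, ih1, dim_append h]
      simp only [lsplits, List.map_cons, List.map_map, Function.comp_def, List.sum_cons,
        insW_cons_cons, insW_nil, bdeg_nil, mul_zero, sgn_zero, one_smul, bdeg_cons, add_mul,
        neg_mul, smul_add, smul_neg, sum_map_add, mul_list_sum, mul_add, mul_smul_comm,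
        smul_mul_assoc, sum_map_neg_smul, mul_assoc, sgn_smul_smul]
      rw [bw_cons x α, mul_assoc, add_left_comm]
      congr 2
      rw [smul_list_sum]
      refine congrArg Neg.neg (congrArg List.sum (List.map_congr_left fun s _ => ?_))
      rw [sgn_smul_smul]
      congr 1
      refine sgn_congr ?_
      push_cast
      ring

lemma insN_mul (c : List (ℤ × WAlg k)) {A B : Set Letter} {m n : ℤ} (hAB : Disjoint A B)
    {x y : WAlg k} (hx : x ∈ HW k A m) (hy : y ∈ HW k B n) :
    insN c (x * y) = ((lsplits c).map fun s =>
      sgn k (n * bdeg s.1) • (insN s.1 x * insN s.2 y)).sum := by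
  -- The right-hand side is rewritten as the value of a bilinear map, so that both arguments can be
  -- reduced to words.
  have key : ∀ l : List (List (ℤ × WAlg k) × List (ℤ × WAlg k)), ∀ y x : WAlg k,
      (l.map fun s => sgn k (n * bdeg s.1) • (insN s.1 x * insN s.2 y)).sum =
      ((l.map fun s => sgn k (n * bdeg s.1) • (LinearMap.mul k (WAlg k)).compl₁₂ (insN s.1)
        (insN s.2)).sum : WAlg k →ₗ[k] WAlg k →ₗ[k] WAlg k) x y := by
    intro l y x
    induction l with
    | nil => simp
    | cons a l ih => simp [ih]
  rw [key]
  refine HW.eq_of (f := insN c ∘ₗ LinearMap.mulRight k y) (g := LinearMap.flip (_ : WAlg k →ₗ[k] WAlg k →ₗ[k] WAlg k) y)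
    (fun w hw => ?_) hx
  rw [LinearMap.flip_apply]
  refine HW.eq_of (f := insN c ∘ₗ LinearMap.mulLeft k (bw k w)) (g := (_ : WAlg k →ₗ[k] _) (bw k w))
    (fun v hv => ?_) hy
  have hwv : ∀ a ∈ w, a ∉ v := fun a ha hb =>
    Set.disjoint_left.1 hAB ((hw.1 a).1 ha) ((hv.1 a).1 hb)
  rw [← key]
  simp only [LinearMap.comp_apply, LinearMap.mulLeft_apply, ← bw_append, insN_bw]
  rw [insW_append c w v hwv, ← hv.2]
  refine congrArg List.sum (List.map_congr_left fun s _ => ?_)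
  congr 1
  refine sgn_congr ?_
  push_cast
  rw [CharTwo.neg_eq]

/-- The recursion of `insW` for linear combinations. The number `e` is the degree of `x · v`, which
drops by one exactly when `x` occurs already; the two hypotheses on `e` allow both cases. -/
lemma insN_cons_mul (g : ℤ × WAlg k) (c : List (ℤ × WAlg k)) (x : Letter) {A : Set Letter}
    {n e : ℤ} (h : x ∈ A → e = n - 1) (h' : x ∉ A → e = n) {v : WAlg k} (hv : v ∈ HW k A n) :
    insN (g :: c) (bw k [x] * v) = -(sgn k (e * (g.1 - 1)) •
      (bw k [x] * (g.2 * insN c (bw k [x] * v)))) + bw k [x] * insN (g :: c) v := by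
  refine HW.eq_of (f := insN (g :: c) ∘ₗ LinearMap.mulLeft k (bw k [x]))
    (g := -(sgn k (e * (g.1 - 1)) • (LinearMap.mulLeft k (bw k [x]) ∘ₗ LinearMap.mulLeft k g.2 ∘ₗ
      insN c ∘ₗ LinearMap.mulLeft k (bw k [x]))) +
      LinearMap.mulLeft k (bw k [x]) ∘ₗ insN (g :: c)) (fun w hw => ?_) hv
  simp only [LinearMap.comp_apply, LinearMap.add_apply, LinearMap.neg_apply, LinearMap.smul_apply,
    LinearMap.mulLeft_apply, ← bw_append, List.singleton_append, insN_bw, insW_cons_cons]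
  congr 3
  refine sgn_congr ?_
  by_cases hx : x ∈ w
  · rw [h ((hw.1 x).1 hx), dim_cons, if_pos hx, ← hw.2]
    push_cast
    grind
  · rw [h' (fun h => hx ((hw.1 x).2 h)), dim_cons, if_neg hx, ← hw.2]
    push_cast
    grind

/-- The elements of the sequence are homogeneous, with disjoint sets of letters of union `A`. -/
inductive GoodSeq {k : Type u} [Field k] : List (ℤ × WAlg k) → Set Letter → Prop
  | nil : GoodSeq [] ∅
  | cons {g : ℤ × WAlg k} {c : List (ℤ × WAlg k)} {A B : Set Letter} (hg : g.2 ∈ HW k A g.1)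
      (hc : GoodSeq c B) (h : Disjoint A B) : GoodSeq (g :: c) (A ∪ B)

/-- Each insertion adds the degree of the inserted element and doubles one letter, which lowers the
degree by one. The total change is the degree in the bar construction. -/
lemma insW_mem {c : List (ℤ × WAlg k)} {B : Set Letter} (hc : GoodSeq c B) {w : List Letter}
    (h : ∀ a ∈ w, a ∉ B) : insW c w ∈ HW k ({a | a ∈ w} ∪ B) (-(dim w : ℤ) + bdeg c) := by
  induction hc generalizing w with
  | nil => simpa [insW_nil] using bw_mem_HW_self w
  | @cons g c A B hg hc hAB ih =>
    induction w with
    | nil => exact Submodule.zero_mem _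
    | cons x α ihα =>
      have h1 := ih (w := x :: α) fun a ha hb => h a ha (Or.inr hb)
      have h2 := ihα fun a ha => h a (List.mem_cons_of_mem _ ha)
      rw [insW_cons_cons]
      refine Submodule.add_mem _ (Submodule.neg_mem _ (Submodule.smul_mem _ _ ?_)) ?_
      · have hd : Disjoint A ({a | a ∈ x :: α} ∪ B) := by
          rw [Set.disjoint_union_right]
          exact ⟨Set.disjoint_left.2 fun a ha hb => h a hb (Or.inl ha), hAB⟩
        have h3 := cons_mem_HW (a := x) (by simp) (mul_mem_HW hd hg h1)
        convert h3 using 2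
        · ext a; simp only [Set.mem_union]; tauto
        · rw [bdeg_cons]; ring
      · by_cases hx : x ∈ α
        · have h3 := cons_mem_HW (a := x) (Or.inl hx) h2
          convert h3 using 2
          · ext a; simp only [Set.mem_union, Set.mem_ofPred_eq, List.mem_cons]
            refine or_congr_left ⟨?_, Or.inr⟩
            rintro (rfl | h) <;> assumption
          · rw [dim_cons, if_pos hx]; push_cast; ring
        · have h3 := cons_mem_HW' (a := x) (by
            rintro (h' | h')
            · exact hx h'
            · exact h x (by simp) h') h2
          convert h3 using 2
          · ext a; simp only [Set.mem_union, Set.mem_ofPred_eq, List.mem_cons, Set.mem_insert_iff]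
            tauto
          · rw [dim_cons, if_neg hx, add_zero]

/-- The letter `x` occurs once in precisely those terms in which nothing is inserted at it, and
these terms are `x` followed by the insertions into the rest. -/
lemma eraseW_insW {c : List (ℤ × WAlg k)} {B : Set Letter} (hc : GoodSeq c B) {x : Letter}
    {w : List Letter} (hx : x ∉ w) (h : ∀ a ∈ x :: w, a ∉ B) :
    eraseW x (insW c (x :: w)) = insW c w := by
  cases hc with
  | nil =>
    rw [insW_nil, insW_nil, bw_cons]
    exact eraseW_cons_self hx (bw_mem_HW_self w)
  | @cons g c A B hg hc hAB =>
    have h1 := insW_mem hc (w := x :: w) fun a ha hb => h a ha (Or.inr hb)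
    have hd : Disjoint A ({a | a ∈ x :: w} ∪ B) := by
      rw [Set.disjoint_union_right]
      exact ⟨Set.disjoint_left.2 fun a ha hb => h a hb (Or.inl ha), hAB⟩
    have h2 := insW_mem (GoodSeq.cons hg hc hAB) (w := w)
      fun a ha => h a (List.mem_cons_of_mem _ ha)
    rw [insW_cons_cons, map_add, map_neg, map_smul,
      eraseW_cons_of_mem (by simp) (mul_mem_HW hd hg h1), eraseW_cons_self ?_ h2]
    · simp
    · rintro (h' | h')
      · exact hx h'
      · exact h x (by simp) h'

lemma insStep_add (g : ℤ × WAlg k) (F F' : List Letter → WAlg k) (w : List Letter) :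
    insStep g (F + F') w = insStep g F w + insStep g F' w := by
  induction w with
  | nil => simp [insStep]
  | cons x α ih => simp only [insStep, ih, Pi.add_apply, mul_add, smul_add, neg_add]; abel

lemma insStep_smul (g : ℤ × WAlg k) (r : k) (F : List Letter → WAlg k) (w : List Letter) :
    insStep g (r • F) w = r • insStep g F w := by
  induction w with
  | nil => simp [insStep]
  | cons x α ih =>
    simp only [insStep, ih, Pi.smul_apply, smul_add, mul_smul_comm, smul_neg, smul_comm r]

lemma insStep_fst_add (m : ℤ) (g g' : WAlg k) (F : List Letter → WAlg k) (w : List Letter) :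
    insStep (m, g + g') F w = insStep (m, g) F w + insStep (m, g') F w := by
  induction w with
  | nil => simp [insStep]
  | cons x α ih => simp only [insStep, ih, add_mul, mul_add, smul_add, neg_add]; abel

lemma insStep_fst_smul (m : ℤ) (r : k) (g : WAlg k) (F : List Letter → WAlg k) (w : List Letter) :
    insStep (m, r • g) F w = r • insStep (m, g) F w := by
  induction w with
  | nil => simp [insStep]
  | cons x α ih =>
    simp only [insStep, ih, smul_add, smul_mul_assoc, mul_smul_comm, smul_neg, smul_comm r]

/-- Inserting the unit merely doubles a letter, and the two copies are then adjacent. This is the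
relation that `ε` vanishes if one of its entries is an identity. -/
lemma insW_one_cons (m : ℤ) (c : List (ℤ × WAlg k)) (w : List Letter) :
    insW ((m, 1) :: c) w = 0 := by
  induction w with
  | nil => rfl
  | cons x α ih => rw [insW_cons_cons, ih, one_mul, bw_mul_insW_cons]; simp

/-- The effect of a map of letters on a sequence. -/
noncomputable def relabelSeq (ρ : Letter → Letter) (c : List (ℤ × WAlg k)) : List (ℤ × WAlg k) :=
  c.map fun g => (g.1, relabel ρ g.2)

lemma relabel_insW {ρ : Letter → Letter} {w : List Letter} (h : Set.InjOn ρ {a | a ∈ w})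
    (c : List (ℤ × WAlg k)) : relabel ρ (insW c w) = insW (relabelSeq ρ c) (w.map ρ) := by
  induction c generalizing w with
  | nil => simp [relabelSeq, insW_nil]
  | cons g c ih =>
    induction w with
    | nil => simp [relabelSeq, insW_cons_nil]
    | cons x α ihα =>
      have h1 := ihα (h.mono fun b hb => List.mem_cons_of_mem x hb)
      have hs : relabelSeq ρ (g :: c) = (g.1, relabel ρ g.2) :: relabelSeq ρ c := rfl
      rw [hs] at h1 ⊢
      rw [List.map_cons, insW_cons_cons, insW_cons_cons, ← h1, ← List.map_cons, dim_map h, ← ih h]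
      simp [relabel_mul]

end TwoOperad

namespace TwoOperad
variable {k : Type u} [Field k]

/-! ## Representations of dg categories by words -/

/-- The letters between two positions, which assign to each column a height. -/
def btw (lo hi : ℕ → ℕ) : Set Letter := {a | lo a.1 ≤ a.2 ∧ a.2 < hi a.1}

lemma btw_self (lo : ℕ → ℕ) : btw lo lo = ∅ := by
  ext a; simp only [btw, Set.mem_ofPred_eq, Set.mem_empty_iff_false, iff_false]; omega

lemma btw_union {a b c : ℕ → ℕ} (h : a ≤ b) (h' : b ≤ c) : btw a b ∪ btw b c = btw a c := by
  ext x
  have h1 : a x.1 ≤ b x.1 := h x.1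
  have h2 : b x.1 ≤ c x.1 := h' x.1
  simp only [btw, Set.mem_union, Set.mem_ofPred_eq]
  omega

lemma btw_disjoint (a b c : ℕ → ℕ) : Disjoint (btw a b) (btw b c) := by
  refine Set.disjoint_left.2 fun x hx hy => ?_
  simp only [btw, Set.mem_ofPred_eq] at hx hy
  omega

open Classical in
/-- The elements of degree `n` with the letters between two positions `lo ≤ hi`. -/
noncomputable def HT (k : Type u) [Field k] (lo hi : ℕ → ℕ) (n : ℤ) : Submodule k (WAlg k) :=
  if lo ≤ hi then HW k (btw lo hi) n else ⊥

lemma HT_of_le {lo hi : ℕ → ℕ} (h : lo ≤ hi) (n : ℤ) : HT k lo hi n = HW k (btw lo hi) n :=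
  if_pos h

lemma mem_HT {lo hi : ℕ → ℕ} {n : ℤ} {v : WAlg k} :
    v ∈ HT k lo hi n ↔ v = 0 ∨ lo ≤ hi ∧ v ∈ HW k (btw lo hi) n := by
  unfold HT
  split_ifs with h
  · simp only [h, true_and]
    exact ⟨Or.inr, fun h => h.elim (fun h => h ▸ Submodule.zero_mem _) id⟩
  · simp [h]

lemma HT.mem_HW {lo hi : ℕ → ℕ} {n : ℤ} {v : WAlg k} (h : v ∈ HT k lo hi n) :
    v ∈ HW k (btw lo hi) n := by
  rcases mem_HT.1 h with rfl | h
  · exact Submodule.zero_mem _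
  · exact h.2

/-- Because `HT` vanishes for incomparable positions, the letters of two nonzero consecutive factors
are adjacent ranges in each column: they are disjoint and their union is the range of the product.
-/
lemma mul_mem_HT {a b c : ℕ → ℕ} {m n p : ℤ} (hp : m + n = p) {x y : WAlg k}
    (hx : x ∈ HT k a b m) (hy : y ∈ HT k b c n) : x * y ∈ HT k a c p := by
  rw [mem_HT] at hx hy ⊢
  rcases hx with rfl | hx
  · simp
  rcases hy with rfl | hy
  · simp
  refine Or.inr ⟨hx.1.trans hy.1, ?_⟩
  rw [← btw_union hx.1 hy.1, ← hp]
  exact mul_mem_HW (btw_disjoint a b c) hx.2 hy.2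

lemma dW_mem_HT {a b : ℕ → ℕ} {n m : ℤ} (h : n + 1 = m) {x : WAlg k} (hx : x ∈ HT k a b n) :
    dW x ∈ HT k a b m := by
  rw [mem_HT] at hx ⊢
  rcases hx with rfl | hx
  · simp
  · exact Or.inr ⟨hx.1, h ▸ dW_mem_HW hx.2⟩

lemma one_mem_HT (a : ℕ → ℕ) : (1 : WAlg k) ∈ HT k a a 0 := by
  rw [HT_of_le le_rfl, btw_self]; exact one_mem_HW

lemma dW_mul_HT {a b c : ℕ → ℕ} {m n : ℤ} {x y : WAlg k}
    (hx : x ∈ HT k a b m) (hy : y ∈ HT k b c n) :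
    dW (x * y) = dW x * y + sgn k m • (x * dW y) :=
  dW_mul (btw_disjoint a b c) (HT.mem_HW hx) (HT.mem_HW hy)

/-- A dg functor from `D` to the algebra of words that is compatible with the letters, the objects
of `D` being positions in the columns. -/
structure Rep (D : DGCat k) where
  len : ℕ
  co : D.Obj → ℕ → ℕ
  -- The columns from `len` on are empty, so that column `len` is free for the next tensor factor.
  co_eq : ∀ x c, len ≤ c → co x c = 0
  map : ∀ {x y : D.Obj} {n : ℤ}, D.Hom x y n →ₗ[k] WAlg k
  map_one : ∀ x, map (D.one x) = 1
  map_comp : ∀ {x y z : D.Obj} {m n p : ℤ} (h : m + n = p) (f : D.Hom x y m) (g : D.Hom y z n),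
    map (D.comp h f g) = map f * map g
  map_d : ∀ {x y : D.Obj} {n m : ℤ} (h : n + 1 = m) (f : D.Hom x y n), map (D.d h f) = dW (map f)
  mem : ∀ {x y : D.Obj} {n : ℤ} (f : D.Hom x y n), map f ∈ HT k (co x) (co y) n

namespace Rep

variable {D : DGCat k} (R : Rep D)

/-- The sequence of the elements of a chain. -/
noncomputable def seq : ∀ {y w : D.Obj}, Chain D y w → List (ℤ × WAlg k)
  | _, _, .nil _ => []
  | _, _, .cons (m := m) g c => (m, R.map g) :: seq c

@[simp] lemma seq_nil (y : D.Obj) : R.seq (Chain.nil y) = [] := rfl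

@[simp] lemma seq_cons {y z w : D.Obj} {m : ℤ} (g : D.Hom y z m) (c : Chain D z w) :
    R.seq (Chain.cons g c) = (m, R.map g) :: R.seq c := rfl

lemma bdeg_seq : ∀ {y w : D.Obj} (c : Chain D y w), bdeg (R.seq c) = c.deg
  | _, _, .nil _ => rfl
  | _, _, .cons _ c => by simp only [seq, bdeg_cons, bdeg_seq c, Chain.deg]

lemma seq_splits : ∀ {y w : D.Obj} (c : Chain D y w),
    lsplits (R.seq c) = c.splits.map fun S => (R.seq S.left, R.seq S.right)
  | _, _, .nil _ => rfl
  | _, _, .cons g c => by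
    simp only [seq, lsplits, Chain.splits, seq_splits c, List.map_cons, List.map_map,
      Function.comp_def]

/-- Homogeneity and disjointness can fail only through an entry that is represented by `0`, between
incomparable objects, and then all insertions vanish. Later proofs split along this dichotomy. -/
lemma good_seq : ∀ {y w : D.Obj} (c : Chain D y w),
    (R.co y ≤ R.co w ∧ GoodSeq (R.seq c) (btw (R.co y) (R.co w))) ∨ ∀ α, insW (R.seq c) α = 0
  | _, _, .nil y => Or.inl ⟨le_rfl, by rw [btw_self]; exact GoodSeq.nil⟩
  | _, _, .cons g c => by
    rcases mem_HT.1 (R.mem g) with h0 | hg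
    · right
      intro α
      simp only [seq, h0]
      induction α with
      | nil => rfl
      | cons x α ih => rw [insW_cons_cons, ih]; simp
    · rcases good_seq c with h | h
      · left
        refine ⟨hg.1.trans h.1, ?_⟩
        rw [← btw_union hg.1 h.1]
        exact GoodSeq.cons hg.2 h.2 (btw_disjoint _ _ _)
      · right
        intro α
        simp only [seq]
        induction α with
        | nil => rfl
        | cons x α ih => rw [insW_cons_cons, ih, h]; simp

/-- The value of a chain of length one, and `0` for the other chains. -/
noncomputable def tauW : ∀ {y w : D.Obj}, Chain D y w → WAlg k
  | _, _, .cons g (.nil _) => R.map g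
  | _, _, .nil _ => 0
  | _, _, .cons _ (.cons _ _) => 0

/-- The terms of the differential of `insW` that come from the bar differential. -/
noncomputable def barSum {y w : D.Obj} (c : Chain D y w) (α : List Letter) : WAlg k :=
  (c.bar.map fun t => sgn k t.sign • insW (R.seq t.chain) α).sum

/-- The terms in which the first entry is split off. -/
noncomputable def leftSum {y w : D.Obj} (c : Chain D y w) (α : List Letter) : WAlg k :=
  (c.splits.map fun S => R.tauW S.left * insW (R.seq S.right) α).sum

/-- The terms in which the last entry is split off. -/
noncomputable def rightSum {y w : D.Obj} (c : Chain D y w) (α : List Letter) : WAlg k :=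
  (c.splits.map fun S => sgn k S.left.deg • (insW (R.seq S.left) α * R.tauW S.right)).sum

lemma leftSum_nil (y : D.Obj) (α : List Letter) : R.leftSum (Chain.nil y) α = 0 := by
  simp [leftSum, Chain.splits, tauW]

lemma leftSum_cons {y z w : D.Obj} {m : ℤ} (g : D.Hom y z m) (c : Chain D z w)
    (α : List Letter) : R.leftSum (Chain.cons g c) α = R.map g * insW (R.seq c) α := by
  cases c with
  | nil => simp [leftSum, Chain.splits, tauW]
  | cons g' c => simp [leftSum, Chain.splits, tauW, Function.comp_def]

lemma insW_nodup (g : ℤ × WAlg k) (c : List (ℤ × WAlg k)) {x : Letter} {α : List Letter}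
    (h : (x :: α).Nodup) : insW (g :: c) (x :: α) =
      -(bw k [x] * (g.2 * insW c (x :: α))) + bw k [x] * insW (g :: c) α := by
  have : dim (x :: α) = 0 := by
    refine Finset.sum_eq_zero fun a _ => ?_
    have := List.nodup_iff_count_le_one.1 h a
    unfold ell
    omega
  rw [insW_cons_cons, this]
  simp [sgn_zero]

/-- The terms are sorted by whether the first entry of the altered chain is inserted at `x`. If it
is, that entry is `dg`, a product of `g` with the next entry (which accounts for `leftSum`), or `g`
itself with the bar differential acting on the rest. -/
lemma barSum_cons {y z w : D.Obj} {m : ℤ} (g : D.Hom y z m) (c : Chain D z w) {x : Letter}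
    {α : List Letter} (h : (x :: α).Nodup) :
    R.barSum (Chain.cons g c) (x :: α) = bw k [x] * R.barSum (Chain.cons g c) α +
      bw k [x] * (R.map (D.d rfl g) * insW (R.seq c) (x :: α)) -
      sgn k m • (bw k [x] * (R.map g * R.leftSum c (x :: α))) +
      sgn k m • (bw k [x] * (R.map g * R.barSum c (x :: α))) := by
  have hs : ∀ s : ℤ, sgn k (s + (m - 1)) = -(sgn k m * sgn k s) := fun s => by
    rw [← sgn_add, neg_sgn]; refine sgn_congr ?_; push_cast; grind
  have h1 : (c.bar.map fun t => sgn k (t.sign + (m - 1)) •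
      insW ((m, R.map g) :: R.seq t.chain) (x :: α)).sum =
      sgn k m • (bw k [x] * (R.map g * R.barSum c (x :: α))) +
      bw k [x] * (c.bar.map fun t => sgn k (t.sign + (m - 1)) •
        insW ((m, R.map g) :: R.seq t.chain) α).sum := by
    simp only [insW_nodup _ _ h, hs, smul_add, sum_map_add, barSum, mul_list_sum, smul_list_sum,
      mul_smul_comm, neg_smul, smul_neg, neg_neg, smul_smul, mul_neg]
  cases c with
  | nil =>
    simp only [barSum, Chain.bar, List.map_nil, List.append_nil, List.map_cons, List.sum_cons,
      List.sum_nil, seq_cons, seq_nil, leftSum_nil, sgn_one, insW_nodup _ _ h]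
    simp [add_comm]
  | cons g' c =>
    rw [leftSum_cons]
    simp only [barSum] at h1 ⊢
    rw [Chain.bar]
    simp only [List.map_append, List.map_cons, List.map_nil, List.map_map, Function.comp_def,
      List.sum_append, List.sum_cons, List.sum_nil, seq_cons, add_zero] at h1 ⊢
    rw [h1, insW_nodup (_, R.map (D.d rfl g)) _ h, insW_nodup (_, R.map (D.comp rfl g g')) _ h]
    simp only [sgn_one, R.map_comp, mul_add, mul_smul_comm, smul_add, smul_neg, neg_smul, one_smul,
      mul_neg, mul_assoc]
    abel

lemma rightSum_cons {y z w : D.Obj} {m : ℤ} (g : D.Hom y z m) (c : Chain D z w) {x : Letter}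
    {α : List Letter} (h : (x :: α).Nodup) :
    R.rightSum (Chain.cons g c) (x :: α) = bw k [x] * R.rightSum (Chain.cons g c) α +
      sgn k m • (bw k [x] * (R.map g * R.rightSum c (x :: α))) := by
  have hs : ∀ s : ℤ, sgn k (m - 1 + s) = -(sgn k m * sgn k s) := fun s => by
    rw [← sgn_add, neg_sgn]; refine sgn_congr ?_; push_cast; grind
  simp only [rightSum, Chain.splits, List.map_cons, List.map_map, Function.comp_def, List.sum_cons,
    seq_nil, seq_cons, Chain.deg, sgn_zero, one_smul, insW_nil, insW_nodup _ _ h, hs, smul_add,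
    add_mul, sum_map_add, mul_add, mul_list_sum, smul_list_sum, mul_smul_comm, neg_smul, smul_neg,
    neg_neg, smul_smul, mul_assoc, neg_mul, mul_neg]
  rw [bw_cons x α, mul_assoc]
  abel

/-- Deleting a letter between two elements inserted at the same place multiplies these elements.
Deleting the last copy of a doubled letter gives the same word, with the opposite sign, as inserting
at the next letter and deleting its first copy. So these terms telescope, and what remains is the
first entry in front of the whole word and the last entry behind it. Letters that are not doubled
cannot be deleted, since `α` has no repetitions. -/
lemma dW_insW : ∀ {y w : D.Obj} (c : Chain D y w) {α : List Letter}, α.Nodup →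
    (∀ a ∈ α, a ∉ btw (R.co y) (R.co w)) →
    dW (insW (R.seq c) α) = R.barSum c α - R.leftSum c α + R.rightSum c α
  | _, _, .nil y, α, hα, _ => by
    rw [leftSum_nil]
    have : dWord k α = 0 := by
      induction α with
      | nil => rfl
      | cons x α ih =>
        rw [dWord_cons_of_not_mem (List.nodup_cons.1 hα).1, ih (List.nodup_cons.1 hα).2
          fun a ha => by simp [btw_self], mul_zero]
    simp [insW_nil, this, barSum, rightSum, Chain.splits, Chain.bar, tauW]
  | y, w, .cons (z := z) (m := m) g c, [], _, _ => by
    rw [leftSum_cons]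
    -- Only the empty sequence can be inserted into the empty word, and all terms of the bar
    -- differential of a nonempty chain are nonempty. The two boundary sums cancel when the chain
    -- has length one and vanish when it is longer.
    have h1 : R.barSum (Chain.cons g c) [] = 0 := by
      refine List.sum_eq_zero fun v hv => ?_
      obtain ⟨t, ht, rfl⟩ := List.mem_map.1 hv
      have : ∃ g, ∃ c', R.seq t.chain = g :: c' := by
        cases c with
        | nil =>
          simp only [Chain.bar, List.map_nil, List.append_nil, List.mem_singleton] at ht
          subst ht; exact ⟨_, _, rfl⟩
        | cons g' c =>
          rw [Chain.bar] at ht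
          simp only [List.mem_append, List.mem_singleton, List.mem_map] at ht
          rcases ht with (rfl | rfl) | ⟨t, -, rfl⟩ <;> exact ⟨_, _, rfl⟩
      obtain ⟨g, c', h⟩ := this
      rw [h, insW_cons_nil, smul_zero]
    cases c with
    | nil =>
      simp [h1, rightSum, Chain.splits, insW_cons_nil, insW_nil, tauW, Chain.deg, sgn_zero, bw_nil]
    | cons g' c =>
      simp [h1, rightSum, Chain.splits, insW_cons_nil, insW_nil, tauW, Chain.deg, sgn_zero,
        Function.comp_def]
  | y, w, .cons (z := z) (m := m) g c, x :: α, hα, hd => by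
    have hα' := List.nodup_cons.1 hα
    -- Apart from the cases in which one of the factors vanishes, all the type information needed
    -- for the Leibniz rule is available.
    have F : R.map g = 0 ∨ (∀ α, insW (R.seq c) α = 0) ∨ (R.map g ∈ HW k (btw (R.co y) (R.co z)) m ∧
        (R.co y ≤ R.co z ∧ R.co z ≤ R.co w) ∧ GoodSeq (R.seq c) (btw (R.co z) (R.co w))) := by
      rcases mem_HT.1 (R.mem g) with h | h
      · exact Or.inl h
      · rcases R.good_seq c with h' | h'
        · exact Or.inr (Or.inr ⟨h.2, ⟨h.1, h'.1⟩, h'.2⟩)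
        · exact Or.inr (Or.inl h')
    have F0 : (∀ α, insW (R.seq (Chain.cons g c)) α = 0) ∨ R.co y ≤ R.co w ∧
        GoodSeq (R.seq (Chain.cons g c)) (btw (R.co y) (R.co w)) := (R.good_seq _).symm
    -- The insertions of `g` at `x`. Deleting the first copy of `x` gives the left boundary term.
    -- Deleting the only other copy, when nothing else is inserted at `x`, gives the last term,
    -- which cancels the left boundary term of the insertions that start after `x`.
    have F1 : dW (bw k [x] * (R.map g * insW (R.seq c) (x :: α))) =
        R.map g * insW (R.seq c) (x :: α) - bw k [x] * (R.map (D.d rfl g) * insW (R.seq c) (x :: α))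
        - sgn k m • (bw k [x] * (R.map g * dW (insW (R.seq c) (x :: α)))) -
        bw k [x] * (R.map g * insW (R.seq c) α) := by
      rw [R.map_d]
      rcases F with h | h | ⟨hg, hle, hc⟩
      · simp [h]
      · simp [h]
      · have hu := btw_union hle.1 hle.2
        have hc' := insW_mem hc (w := x :: α) fun a ha hb => hd a ha (hu ▸ Or.inr hb)
        have hdis : Disjoint (btw (R.co y) (R.co z))
            ({a | a ∈ x :: α} ∪ btw (R.co z) (R.co w)) := by
          rw [Set.disjoint_union_right]
          exact ⟨Set.disjoint_left.2 fun a ha hb => hd a hb (hu ▸ Or.inl ha), btw_disjoint _ _ _⟩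
        rw [dW_cons (by simp) (mul_mem_HW hdis hg hc'), dW_mul hdis hg hc',
          eraseW_mul_of_not_mem (fun h => hd x (by simp) (hu ▸ Or.inl h)) hg,
          eraseW_insW hc hα'.1 fun a ha hb => hd a ha (hu ▸ Or.inr hb)]
        simp only [mul_add, mul_smul_comm]
        abel
    -- If nothing is inserted at `x`, it occurs just once and cannot be deleted.
    have F2 : dW (bw k [x] * insW (R.seq (Chain.cons g c)) α) =
        bw k [x] * dW (insW (R.seq (Chain.cons g c)) α) := by
      rcases F0 with h | ⟨-, h⟩
      · rw [h]; simp
      · refine dW_cons' ?_ (insW_mem h fun a ha => hd a (List.mem_cons_of_mem _ ha))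
        rintro (h' | h')
        · exact hα'.1 h'
        · exact hd x (by simp) h'
    have ih2 := dW_insW (Chain.cons g c) hα'.2 fun a ha => hd a (List.mem_cons_of_mem _ ha)
    have ih1 : R.map g * dW (insW (R.seq c) (x :: α)) = R.map g * (R.barSum c (x :: α) -
        R.leftSum c (x :: α) + R.rightSum c (x :: α)) := by
      rcases F with h | h | ⟨hg, hle, hc⟩
      · simp [h]
      · rcases mem_HT.1 (R.mem g) with h | hg
        · simp [h]
        · rw [dW_insW c hα fun a ha hb => hd a ha ?_]
          simp only [btw, Set.mem_ofPred_eq] at hb ⊢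
          exact ⟨(hg.1 _).trans hb.1, hb.2⟩
      · rw [dW_insW c hα fun a ha hb => hd a ha ?_]
        rw [← btw_union hle.1 hle.2]
        exact Or.inr hb
    rw [leftSum_cons] at ih2
    rw [seq_cons, insW_nodup _ _ hα, map_add, map_neg, F1, ← seq_cons, F2, ih1, ih2,
      barSum_cons R g c hα, rightSum_cons R g c hα, leftSum_cons]
    simp only [mul_add, mul_sub, smul_add, smul_sub]
    abel

end Rep

end TwoOperad

namespace TwoOperad
variable {k : Type u} [Field k]

/-! ## The representation of a twisted tensor product -/

/-- A morphism of the interval category as a scalar. -/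
def interval.val {n : ℕ} {a b : (interval k n).Obj} {q : ℤ} : (interval k n).Hom a b q →ₗ[k] k :=
  Submodule.subtype (intervalHom k (n := n) a b q)

/-- The height of an object of the interval category. -/
def interval.ht {n : ℕ} (x : (interval k n).Obj) : ℕ :=
  let x' : Fin (n + 1) := x
  x'.1

lemma interval.val_eq_zero {n : ℕ} {a b : (interval k n).Obj} {q : ℤ}
    (f : (interval k n).Hom a b q) (h : ¬ (ht a ≤ ht b ∧ q = 0)) : interval.val f = 0 := f.2 h

lemma interval.val_injective {n : ℕ} {a b : (interval k n).Obj} {q : ℤ} :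
    Function.Injective (interval.val : (interval k n).Hom a b q → k) := Subtype.val_injective

lemma interval.val_one {n : ℕ} (a : (interval k n).Obj) :
    interval.val ((interval k n).one a) = 1 := rfl

lemma interval.val_d {n : ℕ} {a b : (interval k n).Obj} {p q : ℤ} (h : p + 1 = q)
    (f : (interval k n).Hom a b p) : interval.val ((interval k n).d h f) = 0 := rfl

lemma interval.val_comp {n : ℕ} {a b c : (interval k n).Obj} {p q r : ℤ} (h : p + q = r)
    (f : (interval k n).Hom a b p) (g : (interval k n).Hom b c q) :
    interval.val ((interval k n).comp h f g) = interval.val f * interval.val g := rfl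

/-- The word `λ_i … λ_{j-1}` of the letters of the column `c` between the heights `i` and `j`. -/
def ivWord (c i j : ℕ) : List Letter := (List.range' i (j - i)).map fun t => (c, t)

lemma mem_ivWord {c i j : ℕ} {a : Letter} : a ∈ ivWord c i j ↔ a.1 = c ∧ i ≤ a.2 ∧ a.2 < j := by
  obtain ⟨a, b⟩ := a
  simp only [ivWord, List.mem_map, List.mem_range'_1, Prod.mk.injEq]
  constructor
  · rintro ⟨t, h, rfl, rfl⟩
    omega
  · rintro ⟨rfl, h⟩
    exact ⟨b, by omega, rfl, rfl⟩

lemma ivWord_nodup (c i j : ℕ) : (ivWord c i j).Nodup :=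
  (List.nodup_range' (step := 1)).map fun _ _ h => by simpa using h

lemma ivWord_append (c : ℕ) {i j l : ℕ} (h : i ≤ j) (h' : j ≤ l) :
    ivWord c i j ++ ivWord c j l = ivWord c i l := by
  unfold ivWord
  rw [← List.map_append]
  have := List.range'_append_1 (s := i) (m := j - i) (n := l - j)
  rw [show i + (j - i) = j by omega, show j - i + (l - j) = l - i by omega] at this
  rw [this]

lemma ivWord_self (c i : ℕ) : ivWord c i i = [] := by simp [ivWord]

lemma ivWord_succ (c i : ℕ) : ivWord c i (i + 1) = [(c, i)] := by simp [ivWord]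

lemma dim_nodup {w : List Letter} (h : w.Nodup) : dim w = 0 := by
  refine Finset.sum_eq_zero fun a _ => ?_
  have := List.nodup_iff_count_le_one.1 h a
  unfold ell
  omega

namespace Rep

variable {D : DGCat k} (R : Rep D) (n : ℕ)

/-- The position of an object of the twisted tensor product. -/
def coTw (i : (interval k n).Obj) (x : D.Obj) (c : ℕ) : ℕ :=
  if c = R.len then interval.ht i else R.co x c

lemma coTw_le {i j : (interval k n).Obj} {x y : D.Obj} :
    R.coTw n i x ≤ R.coTw n j y ↔ interval.ht i ≤ interval.ht j ∧ R.co x ≤ R.co y := by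
  constructor
  · intro h
    refine ⟨by simpa [coTw] using h R.len, fun c => ?_⟩
    have := h c
    by_cases hc : c = R.len
    · rw [R.co_eq x c hc.ge]; exact Nat.zero_le _
    · simpa [coTw, hc] using this
  · rintro ⟨h, h'⟩ c
    unfold coTw
    split_ifs
    · exact h
    · exact h' c

lemma btw_coTw {i j : (interval k n).Obj} {x y : D.Obj} :
    btw (R.coTw n i x) (R.coTw n j y) =
      {a | a ∈ ivWord R.len (interval.ht i) (interval.ht j)} ∪ btw (R.co x) (R.co y) := by
  ext a
  by_cases h : a.1 = R.len
  · have := R.co_eq y R.len le_rfl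
    simp [btw, coTw, h, mem_ivWord, this]
  · simp [btw, coTw, h, mem_ivWord]

/-- The value of a formal expression in the algebra of words. -/
noncomputable def pre : ∀ {X Y : (interval k n).Obj × D.Obj} {m : ℤ},
    Pre (interval k n) D X Y m → WAlg k
  | _, _, _, .zero => 0
  | _, _, _, .add a b => pre a + pre b
  | _, _, _, .smul r a => r • pre a
  | _, _, _, .diff _ a => dW (pre a)
  | _, _, _, .one _ => 1
  | _, _, _, .comp _ a b => pre a * pre b
  | _, _, _, .right _ _ g => R.map g
  | _, _, _, .eps (x := x) (x' := x') f c _ =>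
      interval.val f • insW (R.seq c) (ivWord R.len (interval.ht x) (interval.ht x'))

lemma iv_not_mem {y w : D.Obj} (i j : ℕ) : ∀ a ∈ ivWord R.len i j, a ∉ btw (R.co y) (R.co w) := by
  intro a ha hb
  have := R.co_eq w a.1 (mem_ivWord.1 ha).1.ge
  have h2 : a.2 < R.co w a.1 := hb.2
  omega

lemma eps_mem {i j : (interval k n).Obj} {y w : D.Obj} {m p : ℤ} (f : (interval k n).Hom i j m)
    (c : Chain D y w) (h : m + c.deg = p) :
    interval.val f • insW (R.seq c) (ivWord R.len (interval.ht i) (interval.ht j)) ∈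
      HT k (R.coTw n i y) (R.coTw n j w) p := by
  by_cases hf : interval.ht i ≤ interval.ht j ∧ m = 0
  · rcases R.good_seq c with hc | hc
    · rw [HT_of_le ((R.coTw_le n).2 ⟨hf.1, hc.1⟩), R.btw_coTw]
      have := insW_mem hc.2 (R.iv_not_mem (interval.ht i) (interval.ht j))
      rw [dim_nodup (ivWord_nodup _ _ _), bdeg_seq] at this
      refine Submodule.smul_mem _ _ ?_
      convert this using 1
      rw [← h, hf.2]; simp
    · rw [hc, smul_zero]; exact Submodule.zero_mem _
  · rw [interval.val_eq_zero f hf, zero_smul]; exact Submodule.zero_mem _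

lemma right_mem (i : (interval k n).Obj) {y w : D.Obj} {m : ℤ} (g : D.Hom y w m) :
    R.map g ∈ HT k (R.coTw n i y) (R.coTw n i w) m := by
  rcases mem_HT.1 (R.mem g) with h | h
  · rw [h]; exact Submodule.zero_mem _
  · rw [HT_of_le ((R.coTw_le n).2 ⟨le_rfl, h.1⟩), R.btw_coTw, ivWord_self]
    simpa using h.2

lemma pre_mem {X Y : (interval k n).Obj × D.Obj} {m : ℤ} (a : Pre (interval k n) D X Y m) :
    R.pre n a ∈ HT k (R.coTw n X.1 X.2) (R.coTw n Y.1 Y.2) m := by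
  induction a with
  | zero => exact Submodule.zero_mem _
  | add a b ha hb => exact Submodule.add_mem _ ha hb
  | smul r a ha => exact Submodule.smul_mem _ _ ha
  | diff h a ha => exact dW_mem_HT h ha
  | one X => exact one_mem_HT _
  | comp h a b ha hb => exact mul_mem_HT h ha hb
  | right x h g => subst h; exact R.right_mem n x g
  | eps f c h => exact R.eps_mem n f c h

lemma pre_sum {X Y : (interval k n).Obj × D.Obj} {m : ℤ} {ι : Type*}
    (F : ι → Pre (interval k n) D X Y m) :
    ∀ l : List ι, R.pre n (Pre.sum (l.map F)) = (l.map fun i => R.pre n (F i)).sum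
  | [] => rfl
  | a :: l => by
    rw [List.map_cons, Pre.sum, pre, pre_sum F l, List.map_cons, List.sum_cons]

lemma pre_tau (x : (interval k n).Obj) : ∀ {y w : D.Obj} {m : ℤ} (c : Chain D y w)
    (h : c.deg + 1 = m), R.pre n (Pre.tau x c h) = R.tauW c
  | _, _, _, .nil _, _ => rfl
  | _, _, _, .cons _ (.nil _), _ => rfl
  | _, _, _, .cons _ (.cons _ _), _ => rfl

lemma insW_seq_isSum {y w : D.Obj} {c c₁ c₂ : Chain D y w} (h : Chain.IsSum c c₁ c₂) :
    insW (R.seq c) = insW (R.seq c₁) + insW (R.seq c₂) := by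
  induction h with
  | head g g' c => ext α; simp only [seq_cons, map_add]; exact insStep_fst_add _ _ _ _ _
  | tail g _ ih =>
    ext α
    simp only [seq_cons, insW, ih]
    exact insStep_add _ _ _ _

lemma insW_seq_isSmul {r : k} {y w : D.Obj} {c c₁ : Chain D y w} (h : Chain.IsSmul r c c₁) :
    insW (R.seq c) = r • insW (R.seq c₁) := by
  induction h with
  | head g c => ext α; simp only [seq_cons, map_smul]; exact insStep_fst_smul _ _ _ _ _
  | tail g _ ih =>
    ext α
    simp only [seq_cons, insW, ih]
    exact insStep_smul _ _ _ _

lemma insW_seq_hasOne {y w : D.Obj} {c : Chain D y w} (h : Chain.HasOne c) :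
    insW (R.seq c) = 0 := by
  induction h with
  | head c => ext α; simp only [seq_cons, R.map_one]; exact insW_one_cons _ _ _
  | tail g _ ih =>
    ext α
    simp only [seq_cons, insW, ih]
    simpa using insStep_smul (_, R.map g) (0 : k) 0 α

/-- The relations with content are the Leibniz rule, for which the letters have to be controlled by
`pre_mem`; the normalisation of chains; the composition rule, which is `insW_append`; and the
Hochschild formula, which is `dW_insW`. The others are formal. -/
lemma pre_rel {X Y : (interval k n).Obj × D.Obj} {m : ℤ} {a b : Pre (interval k n) D X Y m}
    (h : Rel (interval k n) D a b) : R.pre n a = R.pre n b := by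
  induction h with
  | refl => rfl
  | symm _ ih => exact ih.symm
  | trans _ _ ih ih' => exact ih.trans ih'
  | add_congr _ _ ih ih' => rw [pre, pre, ih, ih']
  | smul_congr r _ ih => rw [pre, pre, ih]
  | diff_congr h _ ih => rw [pre, pre, ih]
  | comp_congr h _ _ ih ih' => rw [pre, pre, ih, ih']
  | add_comm => simp only [pre]; exact _root_.add_comm _ _
  | add_assoc => simp only [pre]; exact _root_.add_assoc _ _ _
  | zero_add => simp [pre]
  | neg_add => simp [pre]
  | smul_add => simp [pre]
  | add_smul => simp [pre, _root_.add_smul]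
  | mul_smul => simp [pre, SemigroupAction.mul_smul]
  | one_smul => simp [pre]
  | diff_add => simp [pre]
  | diff_smul => simp [pre]
  | add_comp => simp [pre, add_mul]
  | smul_comp => simp [pre]
  | comp_add => simp [pre, mul_add]
  | comp_smul => simp [pre]
  | diff_diff => simp [pre, dW_dW]
  | one_comp => simp [pre]
  | comp_one => simp [pre]
  | assoc => simp [pre, mul_assoc]
  | diff_comp h hs ha hb h₁ h₂ f g =>
    exact dW_mul_HT (R.pre_mem n f) (R.pre_mem n g)
  | right_add => simp [pre]
  | right_smul => simp [pre]
  | right_one => simp [pre, R.map_one]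
  | right_comp => simp [pre, R.map_comp]
  | right_diff => simp [pre, R.map_d]
  | eps_add => simp [pre, _root_.add_smul]
  | eps_smul => simp [pre, SemigroupAction.mul_smul]
  | eps_chain_add f hc => simp [pre, R.insW_seq_isSum hc]
  | @eps_chain_smul x x' y w m p f r c c₁ hc h h₁ =>
    simp only [pre, R.insW_seq_isSmul hc, Pi.smul_apply]
    exact smul_comm _ _ _
  | eps_chain_one f hc => simp [pre, R.insW_seq_hasOne hc]
  | eps_one_cons => simp [pre, ivWord_self, insW_cons_nil]
  | eps_one_nil => simp [pre, ivWord_self, insW_nil, bw_nil, interval.val_one]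
  | @eps_comp x x' x'' y w m m' q p f f' c hq hp =>
    rw [Pre.epsComp, pre_sum]
    simp only [pre]
    rw [interval.val_comp]
    -- Unless both morphisms are increasing and of degree `0`, one of them is zero. If they are, the
    -- words of the two intervals concatenate and have dimension `0`.
    by_cases hf : interval.ht x ≤ interval.ht x' ∧ m = 0
    · by_cases hf' : interval.ht x' ≤ interval.ht x'' ∧ m' = 0
      · have := insW_append (R.seq c) (ivWord R.len (interval.ht x) (interval.ht x'))
          (ivWord R.len (interval.ht x') (interval.ht x'')) (by
            intro a ha hb
            have := (mem_ivWord.1 ha).2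
            have := (mem_ivWord.1 hb).2
            omega)
        rw [ivWord_append _ hf.1 hf'.1, seq_splits, List.map_map] at this
        rw [this, smul_list_sum]
        obtain ⟨-, rfl⟩ := hf'
        refine congrArg List.sum (List.map_congr_left fun S _ => ?_)
        simp only [Function.comp_apply]
        rw [dim_nodup (ivWord_nodup _ _ _)]
        simp [sgn_zero, smul_smul, mul_comm]
      · simp [interval.val_eq_zero f' hf']
    · simp [interval.val_eq_zero f hf]
  | @eps_diff x x' y w m p q f c hp hq =>
    rw [Pre.epsDiff]
    simp only [pre, pre_sum, pre_tau]
    by_cases hf : interval.ht x ≤ interval.ht x' ∧ m = 0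
    · obtain ⟨-, rfl⟩ := hf
      -- For `f` of degree `0` with `df = 0`, the terms of the Hochschild formula are those of
      -- `dW_insW`, multiplied by the scalar of `f`.
      rw [map_smul, R.dW_insW c (ivWord_nodup _ _ _) (R.iv_not_mem _ _)]
      rw [interval.val_d]
      simp only [zero_mul, sgn_zero, zero_add, zero_smul, barSum, leftSum, rightSum, smul_add,
        smul_sub, smul_list_sum, mul_smul_comm, smul_mul_assoc, neg_smul, one_smul,
        smul_comm (interval.val f)]
      rw [sub_eq_add_neg, add_assoc]
      congr 2
      rw [sum_map_neg_smul]
    · simp [interval.val_eq_zero f hf, interval.val_d]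

/-- The representation of the twisted tensor product. -/
noncomputable def tensor : Rep (tw (interval k n) D) where
  len := R.len + 1
  co := fun X => R.coTw n (Prod.fst (α := Fin (n + 1)) (β := D.Obj) X)
    (Prod.snd (α := Fin (n + 1)) (β := D.Obj) X)
  co_eq := by
    intro X c hc
    unfold coTw
    rw [if_neg (by omega), R.co_eq _ _ (by omega)]
  map :=
    { toFun := fun a => Quotient.liftOn a (fun a => R.pre n a) fun _ _ h => R.pre_rel n h
      map_add' := TwHom.ind fun _ => TwHom.ind fun _ => rfl
      map_smul' := fun _ => TwHom.ind fun _ => rfl }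
  map_one _ := rfl
  map_comp _ := TwHom.ind fun _ => TwHom.ind fun _ => rfl
  map_d _ := TwHom.ind fun _ => rfl
  mem := TwHom.ind fun a => R.pre_mem n a

end Rep

/-- The representation of the unit category. -/
noncomputable def Rep.unit : Rep (interval k 0) where
  len := 0
  co _ _ := 0
  co_eq _ _ _ := rfl
  map := interval.val.smulRight 1
  map_one _ := by simp [interval.val_one]
  map_comp h f g := by simp [interval.val_comp, mul_smul]; exact smul_comm _ _ _
  map_d h f := by
    rw [LinearMap.smulRight_apply, interval.val_d, LinearMap.smulRight_apply, map_smul, ← bw_nil, dW_bw]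
    simp [dWord]
  mem {x y q} f := by
    by_cases h : q = 0
    · subst h; exact Submodule.smul_mem _ _ (one_mem_HT _)
    · rw [LinearMap.smulRight_apply, interval.val_eq_zero f fun h' => h h'.2, zero_smul]
      exact Submodule.zero_mem _

/-- The representation of `T k L`. -/
noncomputable def repT (k : Type u) [Field k] : ∀ L : List ℕ, Rep (T k L)
  | [] => Rep.unit
  | n :: L => (repT k L).tensor n

lemma repT_len : ∀ L : List ℕ, (repT k L).len = L.length
  | [] => rfl
  | _ :: L => congrArg (· + 1) (repT_len L)

end TwoOperad

namespace TwoOperad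
variable {k : Type u} [Field k]

/-! ## Generators of the twisted tensor product -/

/-- The coefficient functional of a nondegenerate word vanishes on the spanning set of `HW` unless
the word belongs to it. -/
lemma HW.mem_wordsOf {A : Set Letter} {n : ℤ} {w : List Letter} (hw : ¬ IsDegenerate w)
    (h : bw k w ∈ HW k A n) : w ∈ wordsOf A n := by
  by_contra hn
  have := HW.eq_of (f := coefW (k := k) w hw) (g := 0) (fun v hv => by
    rw [coefW_bw, if_neg]
    · rfl
    · rintro rfl; exact hn hv) h
  rw [coefW_bw, if_pos rfl] at this
  exact one_ne_zero this

/-- The morphism `i → i + 1` of the interval category. -/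
def interval.edge (k : Type u) [Field k] {n : ℕ} {i j : Fin (n + 1)} (h : i.1 + 1 = j.1) :
    (interval k n).Hom i j 0 :=
  ⟨(1 : k), fun h' => absurd ⟨Fin.le_def.2 (by omega), rfl⟩ h'⟩

lemma interval.ext {n : ℕ} {a b : (interval k n).Obj} {q : ℤ} {f g : (interval k n).Hom a b q}
    (h : interval.val f = interval.val g) : f = g := interval.val_injective h

lemma interval.eq_val_smul {n : ℕ} {a b : (interval k n).Obj} {q : ℤ}
    (f e : (interval k n).Hom a b q) (he : interval.val e = 1) : f = interval.val f • e :=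
  interval.ext (by rw [map_smul, he, smul_eq_mul, mul_one])

/-- Morphisms of the twisted tensor product of an interval category that are obtained from the
generators `id ⊗ g` and `ε(f_i; c)` by linear combinations and compositions. -/
inductive Generated {n : ℕ} {D : DGCat k} : ∀ {X Y : (tw (interval k n) D).Obj} {p : ℤ},
    (tw (interval k n) D).Hom X Y p → Prop
  | zero {X Y : (tw (interval k n) D).Obj} {p : ℤ} :
      Generated (0 : (tw (interval k n) D).Hom X Y p)
  | add {X Y : (tw (interval k n) D).Obj} {p : ℤ} {f g : (tw (interval k n) D).Hom X Y p} :
      Generated f → Generated g → Generated (f + g)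
  | smul {X Y : (tw (interval k n) D).Obj} {p : ℤ} (r : k) {f : (tw (interval k n) D).Hom X Y p} :
      Generated f → Generated (r • f)
  | comp {X Y Z : (tw (interval k n) D).Obj} {p q s : ℤ} (h : p + q = s)
      {f : (tw (interval k n) D).Hom X Y p} {g : (tw (interval k n) D).Hom Y Z q} :
      Generated f → Generated g → Generated ((tw (interval k n) D).comp h f g)
  | right (i : Fin (n + 1)) {x y : D.Obj} {p : ℤ} (g : D.Hom x y p) :
      Generated ((tw.right (C := interval k n) i).map g)
  | eps {i j : Fin (n + 1)} (h : i.1 + 1 = j.1) {x y : D.Obj} {p : ℤ} (c : Chain D x y)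
      (hp : 0 + c.deg = p) : Generated (tw.eps (interval.edge k h) c hp)

namespace Generated

variable {n : ℕ} {D : DGCat k}

lemma mk_sum {X Y : (interval k n).Obj × D.Obj} {p : ℤ} {ι : Type*}
    (F : ι → Pre (interval k n) D X Y p) (l : List ι)
    (h : ∀ i ∈ l, Generated (X := X) (Y := Y) (TwHom.mk (F i))) :
    Generated (X := X) (Y := Y) (TwHom.mk (Pre.sum (l.map F))) := by
  induction l with
  | nil => exact zero
  | cons a l ih =>
    exact add (h a (by simp)) (ih fun i hi => h i (List.mem_cons_of_mem _ hi))

lemma mk_right (i : (interval k n).Obj) {x y : D.Obj} {p q : ℤ} (h : p = q) (g : D.Hom x y p) :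
    Generated (X := (i, x)) (Y := (i, y)) (TwHom.mk (Pre.right i h g)) := by
  subst h; exact right i g

lemma mk_tau (i : (interval k n).Obj) : ∀ {x y : D.Obj} {q : ℤ} (c : Chain D x y)
    (h : c.deg + 1 = q), Generated (X := (i, x)) (Y := (i, y)) (TwHom.mk (Pre.tau i c h))
  | _, _, _, .nil _, _ => zero
  | _, _, _, .cons _ (.nil _), _ => mk_right _ _ _
  | _, _, _, .cons _ (.cons _ _), _ => zero

lemma mk_eps_of_val_eq_zero {i j : (interval k n).Obj} {x y : D.Obj} {m p : ℤ}
    (f : (interval k n).Hom i j m) (c : Chain D x y) (h : m + c.deg = p)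
    (hf : interval.val f = 0) : Generated (X := (i, x)) (Y := (j, y)) (TwHom.mk (Pre.eps f c h)) := by
  have : f = (0 : k) • f := interval.ext (by rw [map_smul, hf, smul_zero])
  have h' := TwHom.sound (Rel.eps_smul (0 : k) f c h)
  rw [← this] at h'
  rw [h']
  have : TwHom.mk (Pre.smul (0 : k) (Pre.eps f c h)) = (0 : k) • TwHom.mk (Pre.eps f c h) := rfl
  rw [this, zero_smul]
  exact zero

lemma of_rel {X Y : (interval k n).Obj × D.Obj} {p : ℤ} {a b : Pre (interval k n) D X Y p}
    (h : Rel (interval k n) D a b) (hb : Generated (X := X) (Y := Y) (TwHom.mk b)) :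
    Generated (X := X) (Y := Y) (TwHom.mk a) := by
  have := TwHom.sound h
  exact Eq.mpr (congrArg _ this) hb

lemma mk_smul {X Y : (interval k n).Obj × D.Obj} {p : ℤ} (r : k) {a : Pre (interval k n) D X Y p}
    (ha : Generated (X := X) (Y := Y) (TwHom.mk a)) :
    Generated (X := X) (Y := Y) (TwHom.mk (Pre.smul r a)) := smul r ha

lemma mk_eps_smul {i j : (interval k n).Obj} {x y : D.Obj} {p : ℤ} (f e : (interval k n).Hom i j 0)
    (he : interval.val e = 1) (c : Chain D x y) (h : 0 + c.deg = p)
    (hg : Generated (X := (i, x)) (Y := (j, y)) (TwHom.mk (Pre.eps e c h))) :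
    Generated (X := (i, x)) (Y := (j, y)) (TwHom.mk (Pre.eps f c h)) := by
  rw [interval.eq_val_smul f e he]
  exact of_rel (Rel.eps_smul _ _ c h) (mk_smul _ hg)

lemma mk_eps_one (i : (interval k n).Obj) {x y : D.Obj} {p : ℤ} (c : Chain D x y)
    (h : 0 + c.deg = p) :
    Generated (X := (i, x)) (Y := (i, y)) (TwHom.mk (Pre.eps ((interval k n).one i) c h)) := by
  cases c with
  | nil =>
    have hp : p = 0 := by simp [← h, Chain.deg]
    subst hp
    exact of_rel (Rel.eps_one_nil _ _ h) (of_rel (Rel.right_one _ _ rfl).symm (right _ _))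
  | cons g c => exact of_rel (Rel.eps_one_cons _ _ _ h) zero

/-- Induction on the length of `i → j`: the last edge is split off, and the composition rule
expresses `ε` of the composite through `ε` of a shorter morphism and of an edge. Length `0` is the
case of an identity. -/
lemma mk_eps_add (d : ℕ) {i j : Fin (n + 1)} (hd : i.1 + d = j.1) {x y : D.Obj} {p : ℤ}
    (f : (interval k n).Hom i j 0) (c : Chain D x y) (h : 0 + c.deg = p) :
    Generated (X := (i, x)) (Y := (j, y)) (TwHom.mk (Pre.eps f c h)) := by
  induction d generalizing j x y p with
  | zero =>
    obtain rfl : i = j := Fin.ext (by omega)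
    exact mk_eps_smul f _ rfl c h (mk_eps_one _ _ _)
  | succ d ih =>
    have hi : i.1 + d < n + 1 := by omega
    have hl : (⟨i.1 + d, hi⟩ : Fin (n + 1)).1 + 1 = j.1 := by simp only; omega
    let e : (interval k n).Hom i (⟨i.1 + d, hi⟩ : Fin (n + 1)) 0 :=
      ⟨(1 : k), fun h' => absurd ⟨Fin.le_def.2 (by simp), rfl⟩ h'⟩
    refine mk_eps_smul f ((interval k n).comp (add_zero 0) e (interval.edge k hl))
      (mul_one (1 : k)) c h (of_rel (Rel.eps_comp e (interval.edge k hl) c (add_zero 0) h) ?_)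
    refine mk_sum _ _ fun S _ => ?_
    exact mk_smul _ (comp _ (f := TwHom.mk _) (g := TwHom.mk _)
      (ih (by simp) e S.left rfl) (eps hl S.right rfl))

lemma mk_eps {i j : (interval k n).Obj} {x y : D.Obj} {m p : ℤ} (f : (interval k n).Hom i j m)
    (c : Chain D x y) (h : m + c.deg = p) :
    Generated (X := (i, x)) (Y := (j, y)) (TwHom.mk (Pre.eps f c h)) := by
  by_cases hf : interval.ht i ≤ interval.ht j ∧ m = 0
  · obtain ⟨h1, rfl⟩ := hf
    exact mk_eps_add (interval.ht j - interval.ht i) (Nat.add_sub_cancel' h1) f c h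
  · exact mk_eps_of_val_eq_zero f c h (interval.val_eq_zero f hf)

/-- The Leibniz rule reduces to generators, and the Hochschild formula expresses the differential of
an `ε` without any differential of an `ε`. So no formal differentials are needed to generate. -/
lemma diff {X Y : (tw (interval k n) D).Obj} {p q : ℤ} (h : p + 1 = q)
    {f : (tw (interval k n) D).Hom X Y p} (hf : Generated f) :
    Generated ((tw (interval k n) D).d h f) := by
  induction hf generalizing q with
  | zero => rw [map_zero]; exact zero
  | add _ _ ih ih' => rw [map_add]; exact add (ih h) (ih' h)
  | smul r _ ih => rw [map_smul]; exact smul r (ih h)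
  | comp h' hf hg ih ih' =>
    rw [DGCat.d_comp _ h' h rfl rfl (by omega) (by omega)]
    exact add (comp _ (ih rfl) hg) (smul _ (comp _ hf (ih' rfl)))
  | right i g => rw [← DGFunctor.map_d]; exact right i _
  | eps he c hp =>
    refine of_rel (Rel.eps_diff (interval.edge k he) c hp h) ?_
    refine add (f := TwHom.mk _) (g := TwHom.mk _) (mk_eps _ _ _) (add (f := TwHom.mk _)
      (g := TwHom.mk _) ?_ (add (f := TwHom.mk _) (g := TwHom.mk _) ?_ ?_))
    · exact mk_sum _ _ fun t _ => smul _ (f := TwHom.mk _) (mk_eps _ _ _)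
    · exact mk_sum _ _ fun S _ => smul _ (f := TwHom.mk _)
        (comp _ (f := TwHom.mk _) (g := TwHom.mk _) (mk_tau _ _ _) (mk_eps _ _ _))
    · exact mk_sum _ _ fun S _ => smul _ (f := TwHom.mk _)
        (comp _ (f := TwHom.mk _) (g := TwHom.mk _) (mk_eps _ _ _) (mk_tau _ _ _))

lemma all {X Y : (tw (interval k n) D).Obj} {p : ℤ} :
    ∀ f : (tw (interval k n) D).Hom X Y p, Generated f := by
  refine TwHom.ind fun a => ?_
  induction a with
  | zero => exact zero
  | add a b ha hb => exact add (f := TwHom.mk a) (g := TwHom.mk b) ha hb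
  | smul r a ha => exact smul r (f := TwHom.mk a) ha
  | diff h a ha => exact diff h (f := TwHom.mk a) ha
  | one X => rw [← TwHom.sound (Rel.right_one X.1 X.2 rfl)]; exact right _ _
  | comp h a b ha hb => exact comp h (f := TwHom.mk a) (g := TwHom.mk b) ha hb
  | right x h g => exact mk_right _ _ _
  | eps f c h => exact mk_eps _ _ _

end Generated

end TwoOperad

namespace TwoOperad
variable {k : Type u} [Field k]

/-! ## Normal forms -/

lemma isDegenerate_iff {w : List Letter} : ¬ IsDegenerate w ↔ w.IsChain (· ≠ ·) := by
  constructor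
  · intro h
    induction w with
    | nil => exact List.isChain_nil
    | cons a w ih =>
      have ih' := ih fun h' => h (h'.append_left [a])
      cases w with
      | nil => exact List.isChain_singleton _
      | cons b w =>
        refine List.isChain_cons_cons.2 ⟨?_, ih'⟩
        rintro rfl
        exact h ⟨[], w, a, rfl⟩
  · rintro h ⟨u, v, a, rfl⟩
    have := (List.isChain_append.1 h).2.1
    exact (List.isChain_cons_cons.1 this).1 rfl

namespace Chain

variable {D : DGCat k}

lemma IsSum.deg_eq {y w : D.Obj} {c c₁ c₂ : Chain D y w} (h : IsSum c c₁ c₂) :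
    c.deg = c₁.deg ∧ c.deg = c₂.deg := by
  induction h with
  | head => exact ⟨rfl, rfl⟩
  | tail _ _ ih => simp only [deg]; omega

lemma IsSmul.deg_eq {r : k} {y w : D.Obj} {c c₁ : Chain D y w} (h : IsSmul r c c₁) :
    c.deg = c₁.deg := by
  induction h with
  | head => rfl
  | tail _ _ ih => simp only [deg]; omega

end Chain

/-- A graded category with objects `{0, …, n} × Ob D`, together with a functor from `D` for each
`i ∈ {0, …, n}`, and with morphisms indexed by the chains in `D` for each edge of `{0, …, n}`, that
are multilinear and normalised. -/
structure Brace (n : ℕ) (D : DGCat k) where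
  Hom : Fin (n + 1) × D.Obj → Fin (n + 1) × D.Obj → ℤ → Type u
  [acg : ∀ X Y p, AddCommGroup (Hom X Y p)]
  [mod : ∀ X Y p, Module k (Hom X Y p)]
  comp : ∀ {X Y Z : Fin (n + 1) × D.Obj} {m n p : ℤ}, m + n = p →
    (Hom X Y m →ₗ[k] Hom Y Z n →ₗ[k] Hom X Z p)
  assoc : ∀ {X Y Z W : Fin (n + 1) × D.Obj} {a b c ab bc abc : ℤ} (h₁ : a + b = ab)
    (h₂ : ab + c = abc) (h₃ : b + c = bc) (h₄ : a + bc = abc) (f : Hom X Y a) (g : Hom Y Z b)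
    (e : Hom Z W c), comp h₂ (comp h₁ f g) e = comp h₄ f (comp h₃ g e)
  right : ∀ (i : Fin (n + 1)) {x y : D.Obj} {m : ℤ}, D.Hom x y m →ₗ[k] Hom (i, x) (i, y) m
  right_comp : ∀ (i : Fin (n + 1)) {x y z : D.Obj} {a b ab : ℤ} (h : a + b = ab)
    (f : D.Hom x y a) (g : D.Hom y z b),
    right i (D.comp h f g) = comp h (right i f) (right i g)
  one_comp : ∀ (i : Fin (n + 1)) {x : D.Obj} {Y : Fin (n + 1) × D.Obj} {m : ℤ} (h : 0 + m = m)
    (f : Hom (i, x) Y m), comp h (right i (D.one x)) f = f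
  comp_one : ∀ (i : Fin (n + 1)) {x : D.Obj} {Y : Fin (n + 1) × D.Obj} {m : ℤ} (h : m + 0 = m)
    (f : Hom Y (i, x) m), comp h f (right i (D.one x)) = f
  eps : ∀ {i j : Fin (n + 1)} (_ : i.1 + 1 = j.1) {x y : D.Obj} (c : Chain D x y) {p : ℤ}
    (_ : c.deg = p), Hom (i, x) (j, y) p
  eps_add : ∀ {i j : Fin (n + 1)} (h : i.1 + 1 = j.1) {x y : D.Obj} {c c₁ c₂ : Chain D x y}
    (_ : Chain.IsSum c c₁ c₂) {p : ℤ} (hp : c.deg = p) (h₁ : c₁.deg = p) (h₂ : c₂.deg = p),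
    eps h c hp = eps h c₁ h₁ + eps h c₂ h₂
  eps_smul : ∀ {i j : Fin (n + 1)} (h : i.1 + 1 = j.1) {x y : D.Obj} {r : k} {c c₁ : Chain D x y}
    (_ : Chain.IsSmul r c c₁) {p : ℤ} (hp : c.deg = p) (h₁ : c₁.deg = p),
    eps h c hp = r • eps h c₁ h₁
  eps_one : ∀ {i j : Fin (n + 1)} (h : i.1 + 1 = j.1) {x y : D.Obj} {c : Chain D x y}
    (_ : Chain.HasOne c) {p : ℤ} (hp : c.deg = p), eps h c hp = 0

attribute [instance] Brace.acg Brace.mod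

/-- A basis of the morphisms of `D` that is represented, up to signs, by words. -/
structure WordBasis {D : DGCat k} (R : Rep D) where
  rel : ∀ x : D.Obj, List Letter → (Σ (y : D.Obj) (m : ℤ), D.Hom x y m) → Prop
  unique : ∀ {x w s s'}, rel x w s → rel x w s' → s = s'
  one : ∀ x, rel x [] ⟨x, 0, D.one x⟩
  span : ∀ x y m, Submodule.span k {g : D.Hom x y m | ∃ w, rel x w ⟨y, m, g⟩} = ⊤
  map : ∀ {x y : D.Obj} {m : ℤ} {g : D.Hom x y m} {w : List Letter}, rel x w ⟨y, m, g⟩ →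
    R.map g = sgn k m • bw k w
  nondeg : ∀ {x w s}, rel x w s → ¬ IsDegenerate w

lemma sgn_smul_bw_ne_zero {m : ℤ} {w : List Letter} (hw : ¬ IsDegenerate w) :
    sgn k m • bw k w ≠ 0 := by
  intro h
  have := congrArg (coefW w hw) h
  rw [map_smul, coefW_bw, if_pos rfl, map_zero, smul_eq_mul, mul_one] at this
  rcases sgn_eq_or (k := k) m with h | h <;> simp [h] at this

/-- A combination of elements that are indexed by words vanishes if it is mapped to zero in the
algebra of words. -/
lemma eq_zero_of_words {V : Type*} [AddCommGroup V] [Module k V] {rel : List Letter → V → Prop}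
    (unique : ∀ {w s s'}, rel w s → rel w s' → s = s') (F : V →ₗ[k] WAlg k) (m : ℤ)
    (map : ∀ {w s}, rel w s → F s = sgn k m • bw k w)
    (nondeg : ∀ {w s}, rel w s → ¬ IsDegenerate w) {s : V}
    (hs : s ∈ Submodule.span k {s | ∃ w, rel w s}) (h : F s = 0) : s = 0 := by
  classical
  -- The spanning set is indexed by the words that occur; uniqueness makes the choice of the element
  -- harmless. The index is then separated by the coefficient functionals.
  have : {s | ∃ w, rel w s} = Set.range fun w : {w // ∃ s, rel w s} => w.2.choose := by
    ext s
    constructor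
    · rintro ⟨w, hw⟩
      exact ⟨⟨w, s, hw⟩, unique (Exists.choose_spec (⟨s, hw⟩ : ∃ s, rel w s)) hw⟩
    · rintro ⟨w, rfl⟩
      exact ⟨w.1, w.2.choose_spec⟩
  rw [this, Finsupp.mem_span_range_iff_exists_finsupp] at hs
  obtain ⟨c, rfl⟩ := hs
  suffices c = 0 by simp [this]
  ext w
  have hw := nondeg w.2.choose_spec
  have h' := congrArg (coefW w.1 hw) h
  rw [Finsupp.sum, map_sum, map_sum, map_zero, Finset.sum_eq_single w] at h'
  · rw [map_smul, map w.2.choose_spec, map_smul, map_smul, coefW_bw, if_pos rfl] at h'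
    rcases sgn_eq_or (k := k) m with e | e <;> simpa [e] using h'
  · intro v _ hv
    rw [map_smul, map v.2.choose_spec, map_smul, map_smul, coefW_bw, if_neg]
    · simp
    · exact fun e => hv (Subtype.ext e)
  · intro hw
    simp [Finsupp.notMem_support_iff.1 hw]

namespace WordBasis

variable {D : DGCat k} {R : Rep D}

/-- The image `± w` is nonzero and lies in the homogeneous part attached to the source, the target
and the degree, so the word itself has the right letters and dimension. -/
lemma typed {B : WordBasis R} {x y : D.Obj} {m : ℤ} {g : D.Hom x y m} {w : List Letter} (h : B.rel x w ⟨y, m, g⟩) :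
    R.co x ≤ R.co y ∧ w ∈ wordsOf (btw (R.co x) (R.co y)) m := by
  have hg := mem_HT.1 (R.mem g)
  rw [B.map h] at hg
  rcases hg with hg | hg
  · exact absurd hg (sgn_smul_bw_ne_zero (k := k) (B.nondeg h))
  · refine ⟨hg.1, HW.mem_wordsOf (k := k) (B.nondeg h) ?_⟩
    have := Submodule.smul_mem _ (sgn k m) hg.2
    rwa [smul_smul, sgn_mul_self, one_smul] at this

lemma col_lt {B : WordBasis R} {x : D.Obj} {w : List Letter} {s : Σ (y : D.Obj) (m : ℤ), D.Hom x y m}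
    (h : B.rel x w s) {a : Letter} (ha : a ∈ w) : a.1 < R.len := by
  obtain ⟨y, m, g⟩ := s
  have := ((typed h).2.1 a).1 ha
  by_contra hn
  have h2 : a.2 < R.co y a.1 := this.2
  rw [R.co_eq _ _ (not_lt.1 hn)] at h2
  omega

/-- Basis elements go, up to sign, to nondegenerate words, a word determines the element, and
nondegenerate words are independent in `WAlg`. -/
lemma map_injective (B : WordBasis R) {x y : D.Obj} {m : ℤ} :
    Function.Injective (R.map : D.Hom x y m → WAlg k) := by
  rw [injective_iff_map_eq_zero]
  intro g hg
  refine eq_zero_of_words (rel := fun w g => B.rel x w ⟨y, m, g⟩) (fun {w s s'} h h' => ?_) R.map m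
    B.map B.nondeg (by rw [B.span]; trivial) hg
  simpa using B.unique h h'

/-- The words `X₁ l X₂ l … X_r l` of the chains of basis elements different from the identities. -/
inductive ChainWord (B : WordBasis R) (l : Letter) :
    ∀ x : D.Obj, List Letter → (Σ y : D.Obj, Chain D x y) → Prop
  | nil (x : D.Obj) : ChainWord B l x [] ⟨x, .nil x⟩
  | cons {x y z : D.Obj} {m : ℤ} {g : D.Hom x y m} {c : Chain D y z} {u v : List Letter} :
      B.rel x u ⟨y, m, g⟩ → u ≠ [] → ChainWord B l y v ⟨z, c⟩ →
      ChainWord B l x (u ++ l :: v) ⟨z, .cons g c⟩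

/-- The words of the normal forms in a brace structure. -/
inductive NormalWord (B : WordBasis R) {n : ℕ} (A : Brace n D) :
    ∀ X : Fin (n + 1) × D.Obj, List Letter →
      (Σ (Y : Fin (n + 1) × D.Obj) (p : ℤ), A.Hom X Y p) → Prop
  | base (i : Fin (n + 1)) {x y : D.Obj} {m : ℤ} {g : D.Hom x y m} {u : List Letter} :
      B.rel x u ⟨y, m, g⟩ → NormalWord B A (i, x) u ⟨(i, y), m, A.right i g⟩
  | step {i j : Fin (n + 1)} (h : i.1 + 1 = j.1) {x y z : D.Obj} {Y : Fin (n + 1) × D.Obj}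
      {m p : ℤ} {g : D.Hom x y m} {c : Chain D y z} {f : A.Hom (j, z) Y p} {u v w : List Letter} :
      B.rel x u ⟨y, m, g⟩ → ChainWord B (R.len, i.1) y v ⟨z, c⟩ → NormalWord B A (j, z) w ⟨Y, p, f⟩ →
      NormalWord B A (i, x) (u ++ (R.len, i.1) :: (v ++ w))
        ⟨Y, m + (c.deg + p), A.comp rfl (A.right i g) (A.comp rfl (A.eps h c rfl) f)⟩

section

variable {B : WordBasis R} {n : ℕ} {A : Brace n D}

lemma append_cons_inj {P : Letter → Prop} {u u' t t' : List Letter} {l l' : Letter}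
    (hu : ∀ a ∈ u, P a) (hu' : ∀ a ∈ u', P a) (hl : ¬ P l) (hl' : ¬ P l')
    (h : u ++ l :: t = u' ++ l' :: t') : u = u' ∧ l = l' ∧ t = t' := by
  induction u generalizing u' with
  | nil =>
    cases u' with
    | nil => simpa using h
    | cons a u' =>
      simp only [List.nil_append, List.cons_append, List.cons.injEq] at h
      exact absurd (h.1 ▸ hu' a (by simp)) hl
  | cons a u ih =>
    cases u' with
    | nil =>
      simp only [List.nil_append, List.cons_append, List.cons.injEq] at h
      exact absurd (h.1 ▸ hu a (by simp)) hl'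
    | cons b u' =>
      simp only [List.cons_append, List.cons.injEq] at h
      obtain ⟨h1, h2, h3⟩ := ih (fun a ha => hu a (List.mem_cons_of_mem _ ha))
        (fun a ha => hu' a (List.mem_cons_of_mem _ ha)) h.2
      exact ⟨by rw [h.1, h1], h2, h3⟩

/-- Parsing is forced: the letter `λ_i` closes every block, does not occur inside a block, whose
letters lie in earlier columns, and does not occur in the remainder. So the remainder starts after
its last occurrence. -/
lemma ChainWord.unique {i : ℕ} {x : D.Obj} {v v' w w' : List Letter} {s s' : Σ y, Chain D x y}
    (h : ChainWord B (R.len, i) x v s) (h' : ChainWord B (R.len, i) x v' s')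
    (hw : (R.len, i) ∉ w) (hw' : (R.len, i) ∉ w') (e : v ++ w = v' ++ w') :
    v = v' ∧ s = s' ∧ w = w' := by
  induction h generalizing v' with
  | nil x =>
    cases h' with
    | nil => exact ⟨rfl, rfl, by simpa using e⟩
    | cons h1 h2 h3 => rw [List.nil_append] at e; exact absurd (by simp [e]) hw
  | cons h1 h2 h3 ih =>
    cases h' with
    | nil => rw [List.nil_append] at e; exact absurd (by simp [← e]) hw'
    | cons h1' h2' h3' =>
      simp only [List.append_assoc, List.cons_append] at e
      obtain ⟨rfl, -, e⟩ := append_cons_inj (P := fun a => a.1 < R.len)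
        (fun a => col_lt h1) (fun a => col_lt h1') (by simp) (by simp) e
      have hs := B.unique h1 h1'
      simp only [Sigma.mk.injEq] at hs
      obtain ⟨rfl, hs⟩ := hs
      simp only [heq_eq_eq, Sigma.mk.injEq] at hs
      obtain ⟨rfl, hs⟩ := hs
      obtain rfl := eq_of_heq hs
      obtain ⟨rfl, hs, rfl⟩ := ih h3' e
      simp only [Sigma.mk.injEq] at hs
      obtain ⟨rfl, hs⟩ := hs
      obtain rfl := eq_of_heq hs
      exact ⟨rfl, rfl, rfl⟩

lemma ChainWord.letters {i : ℕ} {x : D.Obj} {v : List Letter} {s : Σ y, Chain D x y}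
    (h : ChainWord B (R.len, i) x v s) : ∀ a ∈ v, a.1 < R.len ∨ a = (R.len, i) := by
  induction h with
  | nil => simp
  | cons h1 _ _ ih =>
    intro a ha
    simp only [List.mem_append, List.mem_cons] at ha
    rcases ha with ha | ha | ha
    · exact Or.inl (col_lt h1 ha)
    · exact Or.inr ha
    · exact ih a ha

/-- Heights in the last column only increase along a normal form. In particular `λ_i` does not
reappear after the fragment of `ε(f_i; c)`. -/
lemma NormalWord.letters {X : Fin (n + 1) × D.Obj} {w : List Letter}
    {s : Σ Y p, A.Hom X Y p} (h : NormalWord B A X w s) :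
    ∀ a ∈ w, a.1 < R.len ∨ a.1 = R.len ∧ X.1.1 ≤ a.2 := by
  induction h with
  | base i h => exact fun a ha => Or.inl (col_lt h ha)
  | step h h1 h2 h3 ih =>
    intro a ha
    simp only [List.mem_append, List.mem_cons] at ha
    rcases ha with ha | rfl | ha | ha
    · exact Or.inl (col_lt h1 ha)
    · exact Or.inr ⟨rfl, le_rfl⟩
    · rcases h2.letters a ha with h | rfl
      · exact Or.inl h
      · exact Or.inr ⟨rfl, le_rfl⟩
    · rcases ih a ha with h | h
      · exact Or.inl h
      · refine Or.inr ⟨h.1, ?_⟩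
        simp only at h ⊢
        omega

/-- The first letter of the last column marks the end of the initial factor `id ⊗ g`, its last
occurrence marks the end of the brace, and induction applies to the rest. A word without letters of
the last column comes from `id ⊗ g` alone. -/
lemma NormalWord.unique {X : Fin (n + 1) × D.Obj} {w : List Letter}
    {s s' : Σ Y p, A.Hom X Y p} (h : NormalWord B A X w s) (h' : NormalWord B A X w s') :
    s = s' := by
  suffices H : ∀ w', NormalWord B A X w' s' → w = w' → s = s' from H w h' rfl
  clear h'
  induction h with
  | base i h1 =>
    intro w' h' e
    cases h' with
    | base _ h1' =>
      subst e
      have hs := B.unique h1 h1'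
      simp only [Sigma.mk.injEq] at hs
      obtain ⟨rfl, hs⟩ := hs
      simp only [heq_eq_eq, Sigma.mk.injEq] at hs
      obtain ⟨rfl, hs⟩ := hs
      obtain rfl := eq_of_heq hs
      rfl
    | step h h1' h2' h3' =>
      have := col_lt h1 (a := (R.len, i.1)) (by simp [e])
      exact absurd this (lt_irrefl _)
  | @step i j hij x y z Y m p g c f u v w h1 h2 h3 ih =>
    intro w' h' e
    cases h' with
    | base _ h1' =>
      have := col_lt h1' (a := (R.len, i.1)) (by simp [← e])
      exact absurd this (lt_irrefl _)
    | @step _ j' hij' _ _ _ _ _ _ _ _ _ _ _ _ h1' h2' h3' =>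
      obtain rfl : j = j' := Fin.ext (hij.symm.trans hij')
      obtain ⟨rfl, -, e⟩ := append_cons_inj (P := fun a => a.1 < R.len)
        (fun a => col_lt h1) (fun a => col_lt h1') (by simp) (by simp) e
      have hs := B.unique h1 h1'
      simp only [Sigma.mk.injEq] at hs
      obtain ⟨rfl, hs⟩ := hs
      simp only [heq_eq_eq, Sigma.mk.injEq] at hs
      obtain ⟨rfl, hs⟩ := hs
      obtain rfl := eq_of_heq hs
      have hn : ∀ {z : D.Obj} {w : List Letter} {s : Σ Y p, A.Hom (j, z) Y p},
          NormalWord B A (j, z) w s → (R.len, i.1) ∉ w := by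
        intro z w s h hm
        have := h.letters _ hm
        simp only at this
        omega
      obtain ⟨rfl, hs, rfl⟩ := h2.unique h2' (hn h3) (hn h3') e
      simp only [Sigma.mk.injEq] at hs
      obtain ⟨rfl, hs⟩ := hs
      obtain rfl := eq_of_heq hs
      have hs := ih _ h3' rfl
      simp only [Sigma.mk.injEq] at hs
      obtain ⟨rfl, hs⟩ := hs
      simp only [heq_eq_eq, Sigma.mk.injEq] at hs
      obtain ⟨rfl, hs⟩ := hs
      obtain rfl := eq_of_heq hs
      rfl

lemma isChain_append_cons {u t : List Letter} {l : Letter} (hu : u.IsChain (· ≠ ·))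
    (hl : ∀ a ∈ u, a ≠ l) (ht : (l :: t).IsChain (· ≠ ·)) : (u ++ l :: t).IsChain (· ≠ ·) := by
  refine hu.append ht fun x hx y hy => ?_
  obtain rfl : l = y := by simpa using hy
  exact hl x (List.mem_of_mem_getLast? hx)

/-- Here it matters that the blocks are nonempty: an empty block, the word of an identity, would
produce two adjacent copies of `λ_i`. -/
lemma ChainWord.isChain {i : ℕ} {x : D.Obj} {v w : List Letter} {s : Σ y, Chain D x y}
    (h : ChainWord B (R.len, i) x v s) (hw : ((R.len, i) :: w).IsChain (· ≠ ·)) :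
    ((R.len, i) :: (v ++ w)).IsChain (· ≠ ·) := by
  induction h with
  | nil => exact hw
  | @cons _ _ _ _ _ _ u v h1 h2 h3 ih =>
    have hl : ∀ a ∈ u, a ≠ (R.len, i) := by
      rintro a ha rfl
      exact absurd (col_lt h1 ha) (lt_irrefl _)
    rw [List.append_assoc, List.cons_append]
    refine List.isChain_cons.2 ⟨fun y hy e => ?_, isChain_append_cons
      (isDegenerate_iff.1 (B.nondeg h1)) hl ih⟩
    cases u with
    | nil => exact h2 rfl
    | cons a u =>
      obtain rfl : a = y := by simpa using hy
      exact hl a (by simp) e.symm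

lemma NormalWord.isChain {X : Fin (n + 1) × D.Obj} {w : List Letter}
    {s : Σ Y p, A.Hom X Y p} (h : NormalWord B A X w s) : w.IsChain (· ≠ ·) := by
  induction h with
  | base i h => exact isDegenerate_iff.1 (B.nondeg h)
  | @step i j hij x y z Y m p g c f u v w h1 h2 h3 ih =>
    refine isChain_append_cons (isDegenerate_iff.1 (B.nondeg h1)) ?_ (h2.isChain ?_)
    · rintro a ha rfl
      exact absurd (col_lt h1 ha) (lt_irrefl _)
    · refine List.isChain_cons.2 ⟨fun y hy e => ?_, ih⟩
      have := h3.letters y (List.mem_of_mem_head? hy)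
      rw [← e] at this
      simp only at this
      omega

/-- A submodule that contains the values of a multilinear map at the chains of basis elements
contains all its values. -/
lemma chain_mem (B : WordBasis R) (l : Letter) {V : Type*} [AddCommGroup V] [Module k V]
    {w : D.Obj} (N : Submodule k V) : ∀ {y : D.Obj} (φ : Chain D y w → V)
    (_ : ∀ c c₁ c₂, Chain.IsSum c c₁ c₂ → φ c = φ c₁ + φ c₂)
    (_ : ∀ (r : k) c c₁, Chain.IsSmul r c c₁ → φ c = r • φ c₁)
    (_ : ∀ c, Chain.HasOne c → φ c = 0)
    (_ : ∀ c v, ChainWord B l y v ⟨w, c⟩ → φ c ∈ N) (c : Chain D y w), φ c ∈ N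
  | _, φ, _, _, _, hN, .nil _ => hN _ _ (ChainWord.nil _)
  | y, φ, hs, hm, ho, hN, .cons (z := z) (m := m) g c => by
    have hg : g ∈ Submodule.span k {g : D.Hom y z m | ∃ w, B.rel y w ⟨z, m, g⟩} := by
      rw [B.span]; trivial
    induction hg using Submodule.span_induction with
    | mem g hg =>
      obtain ⟨u, hu⟩ := hg
      -- A basis element with the empty word is an identity, for which the value vanishes by
      -- normalisation. So only nonempty blocks remain.
      by_cases h : u = []
      · subst h
        have := B.unique hu (B.one y)
        simp only [Sigma.mk.injEq] at this
        obtain ⟨rfl, this⟩ := this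
        simp only [heq_eq_eq, Sigma.mk.injEq] at this
        obtain ⟨rfl, this⟩ := this
        obtain rfl := eq_of_heq this
        rw [ho _ (Chain.HasOne.head c)]
        exact N.zero_mem
      · exact chain_mem B l N (fun c => φ (.cons g c)) (fun c c₁ c₂ h => hs _ _ _ (h.tail g))
          (fun r c c₁ h => hm r _ _ (h.tail g)) (fun c h => ho _ (h.tail g))
          (fun c v hv => hN _ _ (ChainWord.cons hu h hv)) c
    | zero =>
      have := hm 0 _ _ (Chain.IsSmul.head (r := (0 : k)) (0 : D.Hom y z m) c)
      rw [smul_zero, zero_smul] at this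
      rw [this]
      exact N.zero_mem
    | add g g' _ _ h h' => rw [hs _ _ _ (Chain.IsSum.head g g' c)]; exact N.add_mem h h'
    | smul r g _ h => rw [hm r _ _ (Chain.IsSmul.head g c)]; exact N.smul_mem r h

variable (B A)

/-- The span of the normal forms. -/
def normal (X Y : Fin (n + 1) × D.Obj) (p : ℤ) : Submodule k (A.Hom X Y p) :=
  Submodule.span k {f | ∃ w, NormalWord B A X w ⟨Y, p, f⟩}

variable {B A}

lemma right_mem_normal (i : Fin (n + 1)) {x y : D.Obj} {m : ℤ} (g : D.Hom x y m) :
    A.right i g ∈ normal B A (i, x) (i, y) m := by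
  have hg : g ∈ Submodule.span k {g : D.Hom x y m | ∃ w, B.rel x w ⟨y, m, g⟩} := by
    rw [B.span]; trivial
  induction hg using Submodule.span_induction with
  | mem g hg => obtain ⟨u, hu⟩ := hg; exact Submodule.subset_span ⟨u, NormalWord.base i hu⟩
  | zero => rw [map_zero]; exact Submodule.zero_mem _
  | add g g' _ _ h h' => rw [map_add]; exact Submodule.add_mem _ h h'
  | smul r g _ h => rw [map_smul]; exact Submodule.smul_mem _ r h

/-- Frees the degrees from the particular expressions that the constructor `step` produces. -/
lemma NormalWord.step' {i j : Fin (n + 1)} (h : i.1 + 1 = j.1) {x y z : D.Obj}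
    {Y : Fin (n + 1) × D.Obj} {m p q r s : ℤ} {g : D.Hom x y m} {c : Chain D y z}
    {f : A.Hom (j, z) Y p} {u v w : List Letter} (h1 : B.rel x u ⟨y, m, g⟩)
    (h2 : ChainWord B (R.len, i.1) y v ⟨z, c⟩) (h3 : NormalWord B A (j, z) w ⟨Y, p, f⟩)
    (hq : c.deg = q) (hr : q + p = r) (hs : m + r = s) :
    NormalWord B A (i, x) (u ++ (R.len, i.1) :: (v ++ w))
      ⟨Y, s, A.comp hs (A.right i g) (A.comp hr (A.eps h c hq) f)⟩ := by
  subst hq hr hs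
  exact NormalWord.step h h1 h2 h3

/-- To show that composition with a fixed morphism maps normal forms to normal forms, it is enough to
consider the words. -/
lemma comp_mem_normal_of {X Y Z : Fin (n + 1) × D.Obj} {m q p : ℤ} (h : m + q = p)
    {f : A.Hom X Y m}
    (hf : ∀ w (f' : A.Hom Y Z q), NormalWord B A Y w ⟨Z, q, f'⟩ → A.comp h f f' ∈ normal B A X Z p)
    {f' : A.Hom Y Z q} (hf' : f' ∈ normal B A Y Z q) : A.comp h f f' ∈ normal B A X Z p := by
  induction hf' using Submodule.span_induction with
  | mem f' h => obtain ⟨w, hw⟩ := h; exact hf w f' hw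
  | zero => rw [map_zero]; exact Submodule.zero_mem _
  | add g g' _ _ h h' => rw [map_add]; exact Submodule.add_mem _ h h'
  | smul r g _ h => rw [map_smul]; exact Submodule.smul_mem _ r h

/-- The new factor is merged with the initial factor `id ⊗ g'` of the normal form, and the product
is expanded again in the basis of `D`. -/
lemma comp_right_mem_normal {i : Fin (n + 1)} {x y : D.Obj} {Z : Fin (n + 1) × D.Obj} {m q p : ℤ}
    (h : m + q = p) (g : D.Hom x y m) {f : A.Hom (i, y) Z q} (hf : f ∈ normal B A (i, y) Z q) :
    A.comp h (A.right i g) f ∈ normal B A (i, x) Z p := by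
  refine comp_mem_normal_of h (fun w f' hw => ?_) hf
  subst h
  cases hw with
  | base _ h1 => rw [← A.right_comp]; exact right_mem_normal i _
  | @step _ j hij _ y' z _ m' p' g' c f' u v w h1 h2 h3 =>
    rw [← A.assoc (ab := m + m') rfl (by omega) rfl rfl, ← A.right_comp]
    -- The product of two basis elements is in general not a basis element; it is replaced by an
    -- arbitrary morphism so that its expansion in the basis can be used.
    generalize hg : D.comp rfl g g' = e
    clear hg
    have he : e ∈ Submodule.span k {g : D.Hom x y' (m + m') | ∃ w, B.rel x w ⟨y', m + m', g⟩} := by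
      rw [B.span]; trivial
    induction he using Submodule.span_induction with
    | mem e he =>
      obtain ⟨u, hu⟩ := he
      exact Submodule.subset_span ⟨_, NormalWord.step' hij hu h2 h3 _ _ _⟩
    | zero => simp
    | add e e' _ _ h h' => simpa using Submodule.add_mem _ h h'
    | smul r e _ h => simpa using Submodule.smul_mem _ r h

/-- By multilinearity and normalisation the chain may be assumed to consist of basis elements other
than identities. The composite is then a normal form whose initial factor is an identity. -/
lemma comp_eps_mem_normal {i j : Fin (n + 1)} (hij : i.1 + 1 = j.1) {x y : D.Obj}
    {Z : Fin (n + 1) × D.Obj} {m q p : ℤ} (h : m + q = p) (c : Chain D x y) (hc : c.deg = m)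
    {f : A.Hom (j, y) Z q} (hf : f ∈ normal B A (j, y) Z q) :
    A.comp h (A.eps hij c hc) f ∈ normal B A (i, x) Z p := by
  classical
  refine comp_mem_normal_of h (fun w f' hw => ?_) hf
  have := chain_mem B (R.len, i.1) (normal B A (i, x) Z p)
    -- `chain_mem` ranges over chains of all degrees, so the map is extended by `0` to the chains of
    -- the wrong degree; sums and multiples preserve the degree.
    (fun c : Chain D x y => if hc : c.deg = m then A.comp h (A.eps hij c hc) f' else 0)
    (fun c c₁ c₂ hs => ?_) (fun r c c₁ hs => ?_) (fun c hs => ?_) (fun c v hv => ?_) c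
  · simpa [hc] using this
  · have h1 := hs.deg_eq
    by_cases hc : c.deg = m
    · simp only [hc, ← h1.1, ← h1.2, dif_pos]
      rw [A.eps_add hij hs hc (h1.1 ▸ hc) (h1.2 ▸ hc), map_add, LinearMap.add_apply]
    · simp [hc, ← h1.1, ← h1.2]
  · have h1 := hs.deg_eq
    by_cases hc : c.deg = m
    · simp only [hc, ← h1, dif_pos]
      rw [A.eps_smul hij hs hc (h1 ▸ hc), map_smul, LinearMap.smul_apply]
    · simp [hc, ← h1]
  · by_cases hc : c.deg = m
    · simp only [hc, dif_pos]
      rw [A.eps_one hij hs hc, map_zero, LinearMap.zero_apply]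
    · simp [hc]
  · by_cases hc : c.deg = m
    · simp only [hc, dif_pos]
      -- The empty first block is the word of the identity, which `A.one_comp` then removes from the
      -- composite.
      refine Submodule.subset_span ⟨[] ++ (R.len, i.1) :: (v ++ w), ?_⟩
      have := NormalWord.step' hij (B.one x) hv hw hc h (zero_add p)
      rwa [A.one_comp] at this
    · simp [hc]

/-- The left factor is peeled off from its right end: by associativity its elementary factors are
composed, one after the other, with the normal form on the right. Together with the generators this
shows that normal forms span. -/
lemma comp_mem_normal {X Y Z : Fin (n + 1) × D.Obj} {m q p : ℤ} (h : m + q = p)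
    {f : A.Hom X Y m} (hf : f ∈ normal B A X Y m) {f' : A.Hom Y Z q}
    (hf' : f' ∈ normal B A Y Z q) : A.comp h f f' ∈ normal B A X Z p := by
  induction hf using Submodule.span_induction with
  | mem f hf =>
    obtain ⟨w, hw⟩ := hf
    suffices H : ∀ {X : Fin (n + 1) × D.Obj} {w : List Letter} {s : Σ Y p, A.Hom X Y p},
        NormalWord B A X w s → ∀ {p q : ℤ} (h : s.2.1 + q = p) (f' : A.Hom s.1 Z q),
        f' ∈ normal B A s.1 Z q → A.comp h s.2.2 f' ∈ normal B A X Z p from H hw h f' hf'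
    intro X w s hw
    induction hw with
    | base i h1 => exact fun h f' hf' => comp_right_mem_normal h _ hf'
    | @step i j hij x y z Y m p g c f u v w h1 h2 h3 ih =>
      intro p q h f' hf'
      simp only at h hf' ⊢
      rw [A.assoc (bc := _) rfl h rfl (by omega)]
      refine comp_right_mem_normal _ _ ?_
      rw [A.assoc (bc := _) rfl rfl rfl (by omega)]
      exact comp_eps_mem_normal hij _ _ _ (ih rfl _ hf')
  | zero => rw [map_zero]; exact Submodule.zero_mem _
  | add g g' _ _ h h' => rw [map_add]; exact Submodule.add_mem _ h h'
  | smul r g _ h => rw [map_smul]; exact Submodule.smul_mem _ r h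

lemma eps_mem_normal {i j : Fin (n + 1)} (hij : i.1 + 1 = j.1) {x y : D.Obj}
    {p : ℤ} (c : Chain D x y) (hc : c.deg = p) :
    A.eps hij c hc ∈ normal B A (i, x) (j, y) p := by
  have := comp_eps_mem_normal (B := B) hij (add_zero p) c hc
    (right_mem_normal (A := A) j (D.one y))
  rwa [A.comp_one] at this

end

end WordBasis

/-- The twisted tensor product as a brace structure. -/
noncomputable def Brace.tw (n : ℕ) (D : DGCat k) : Brace n D where
  Hom := (TwoOperad.tw (interval k n) D).Hom
  acg := (TwoOperad.tw (interval k n) D).acg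
  mod := (TwoOperad.tw (interval k n) D).mod
  comp := (TwoOperad.tw (interval k n) D).comp
  assoc := (TwoOperad.tw (interval k n) D).assoc
  right i := (tw.right (C := interval k n) i).map
  right_comp i := (tw.right (C := interval k n) i).map_comp
  one_comp i {x Y m} h f := by
    have := (tw.right (C := interval k n) (D := D) i).map_one x
    exact Eq.trans (congrArg (fun e => (TwoOperad.tw (interval k n) D).comp h e f) this)
      ((TwoOperad.tw (interval k n) D).one_comp h f)
  comp_one i {x Y m} h f := by
    have := (tw.right (C := interval k n) (D := D) i).map_one x
    exact Eq.trans (congrArg (fun e => (TwoOperad.tw (interval k n) D).comp h f e) this)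
      ((TwoOperad.tw (interval k n) D).comp_one h f)
  eps h _ _ c p hp := tw.eps (interval.edge k h) c ((zero_add _).trans hp)
  eps_add h _ _ _ _ _ hc _ _ _ _ := TwHom.sound (Rel.eps_chain_add _ hc _ _ _)
  eps_smul h _ _ _ _ _ hc _ _ _ := TwHom.sound (Rel.eps_chain_smul _ hc _ _)
  eps_one h _ _ _ hc _ _ := TwHom.sound (Rel.eps_chain_one _ hc _)

/-- The product of two brace structures. -/
def Brace.prod {n : ℕ} {D : DGCat k} (A A' : Brace n D) : Brace n D where
  Hom X Y p := A.Hom X Y p × A'.Hom X Y p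
  comp h := LinearMap.mk₂ k (fun f g => (A.comp h f.1 g.1, A'.comp h f.2 g.2))
    (by intros; ext <;> simp) (by intros; ext <;> simp)
    (by intros; ext <;> simp) (by intros; ext <;> simp)
  assoc h₁ h₂ h₃ h₄ f g e :=
    Prod.ext (A.assoc h₁ h₂ h₃ h₄ f.1 g.1 e.1) (A'.assoc h₁ h₂ h₃ h₄ f.2 g.2 e.2)
  right i := (A.right i).prod (A'.right i)
  right_comp i _ _ _ _ _ _ h f g := Prod.ext (A.right_comp i h f g) (A'.right_comp i h f g)
  one_comp i _ _ _ h f := Prod.ext (A.one_comp i h f.1) (A'.one_comp i h f.2)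
  comp_one i _ _ _ h f := Prod.ext (A.comp_one i h f.1) (A'.comp_one i h f.2)
  eps h _ _ c p hp := (A.eps h c hp, A'.eps h c hp)
  eps_add h _ _ _ _ _ hc _ hp h₁ h₂ := Prod.ext (A.eps_add h hc hp h₁ h₂) (A'.eps_add h hc hp h₁ h₂)
  eps_smul h _ _ _ _ _ hc _ hp h₁ := Prod.ext (A.eps_smul h hc hp h₁) (A'.eps_smul h hc hp h₁)
  eps_one h _ _ _ hc _ hp := Prod.ext (A.eps_one h hc hp) (A'.eps_one h hc hp)

end TwoOperad

namespace TwoOperad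
variable {k : Type u} [Field k]

/-! ## The basis of a twisted tensor product -/

namespace WordBasis

variable {D : DGCat k} {R : Rep D} {B : WordBasis R} {n : ℕ} {A : Brace n D}

/-- Into a single letter there is just one way to insert a chain, and it produces `l X₁ l X₂ l … X_r
l`. The minus sign of each insertion combines with the sign of the entry to the sign of its degree
in the bar construction. -/
lemma ChainWord.map {l : Letter} {x : D.Obj} {v : List Letter} {s : Σ y, Chain D x y}
    (h : ChainWord B l x v s) : insW (R.seq s.2) [l] = sgn k s.2.deg • bw k (l :: v) := by
  induction h with
  | nil x => simp [insW_nil, Chain.deg, sgn_zero]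
  | @cons x y z m g c u v h1 h2 h3 ih =>
    simp only at ih ⊢
    rw [Rep.seq_cons, Rep.insW_nodup _ _ (List.nodup_singleton l), insW_cons_nil, ih, B.map h1,
      bw_cons l (u ++ l :: v), bw_append]
    simp only [Chain.deg, mul_smul_comm, smul_mul_assoc, mul_zero, add_zero, smul_smul, ← neg_smul]
    rw [← sgn_add, neg_sgn]
    congr 1
    refine sgn_congr ?_
    push_cast
    grind

/-- Stated for any brace structure with a map to `WAlg` having the right values on generators,
because it is used both for the twisted tensor product and for its product with another structure.
-/
lemma NormalWord.map (W : ∀ {X Y : Fin (n + 1) × D.Obj} {p : ℤ}, A.Hom X Y p →ₗ[k] WAlg k)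
    (comp : ∀ {X Y Z : Fin (n + 1) × D.Obj} {p q r : ℤ} (h : p + q = r) (f : A.Hom X Y p)
      (g : A.Hom Y Z q), W (A.comp h f g) = W f * W g)
    (right : ∀ (i : Fin (n + 1)) {x y : D.Obj} {m : ℤ} (g : D.Hom x y m),
      W (A.right i g) = R.map g)
    (eps : ∀ {i j : Fin (n + 1)} (h : i.1 + 1 = j.1) {x y : D.Obj} (c : Chain D x y) {p : ℤ}
      (hp : c.deg = p), W (A.eps h c hp) = insW (R.seq c) [(R.len, i.1)])
    {X : Fin (n + 1) × D.Obj} {w : List Letter} {s : Σ Y p, A.Hom X Y p}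
    (h : NormalWord B A X w s) : W s.2.2 = sgn k s.2.1 • bw k w := by
  induction h with
  | base i h => rw [right]; exact B.map h
  | step h h1 h2 h3 ih =>
    simp only at ih ⊢
    rw [comp, comp, right, eps, ih, B.map h1, h2.map, bw_append, ← List.cons_append, bw_append]
    simp only [mul_smul_comm, smul_mul_assoc, smul_smul, sgn_add]
    congr 1
    ring

lemma _root_.TwoOperad.Brace.tw_ind
    {P : ∀ {X Y : Fin (n + 1) × D.Obj} {p : ℤ}, (Brace.tw n D).Hom X Y p → Prop}
    (zero : ∀ X Y p, P (0 : (Brace.tw n D).Hom X Y p))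
    (add : ∀ {X Y p} {f g : (Brace.tw n D).Hom X Y p}, P f → P g → P (f + g))
    (smul : ∀ (r : k) {X Y p} {f : (Brace.tw n D).Hom X Y p}, P f → P (r • f))
    (comp : ∀ {X Y Z p q s} (h : p + q = s) {f : (Brace.tw n D).Hom X Y p}
      {g : (Brace.tw n D).Hom Y Z q}, P f → P g → P ((Brace.tw n D).comp h f g))
    (right : ∀ (i : Fin (n + 1)) {x y : D.Obj} {p : ℤ} (g : D.Hom x y p),
      P ((Brace.tw n D).right i g))
    (eps : ∀ {i j : Fin (n + 1)} (h : i.1 + 1 = j.1) {x y : D.Obj} {p : ℤ} (c : Chain D x y)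
      (hp : c.deg = p), P ((Brace.tw n D).eps h c hp))
    {X Y : Fin (n + 1) × D.Obj} {p : ℤ} (f : (Brace.tw n D).Hom X Y p) : P f := by
  have H : ∀ {X Y : (TwoOperad.tw (interval k n) D).Obj} {p : ℤ}
      {f : (TwoOperad.tw (interval k n) D).Hom X Y p}, Generated f →
      @P (X : Fin (n + 1) × D.Obj) (Y : Fin (n + 1) × D.Obj) p f := by
    intro X Y p f hf
    induction hf with
    | zero => exact zero _ _ _
    | add _ _ h h' => exact add h h'
    | smul r _ h => exact smul r h
    | comp h _ _ hf hg => exact comp h hf hg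
    | right i g => exact right i g
    | eps h c hp => exact eps h c ((zero_add _).symm.trans hp)
  exact H (Generated.all f)

/-- The span of the normal forms contains the generators and is closed under composition. -/
lemma normal_eq_top (X Y : Fin (n + 1) × D.Obj) (p : ℤ) : normal B (Brace.tw n D) X Y p = ⊤ := by
  rw [eq_top_iff]
  exact fun f _ => Brace.tw_ind (P := fun {X Y p} f => f ∈ normal B (Brace.tw n D) X Y p)
    (fun _ _ _ => Submodule.zero_mem _) (fun h h' => Submodule.add_mem _ h h') (fun r _ _ _ _ h => Submodule.smul_mem _ r h)
    (fun h _ _ hf hg => comp_mem_normal h hf hg) right_mem_normal eps_mem_normal f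

lemma ivWord_edge (c : ℕ) {i j : Fin (n + 1)} (h : i.1 + 1 = j.1) :
    ivWord c i.1 j.1 = [(c, i.1)] := by rw [← h, ivWord_succ]

variable (R n) in
/-- The map to the algebra of words. -/
noncomputable def twMap {X Y : Fin (n + 1) × D.Obj} {p : ℤ} :
    (Brace.tw n D).Hom X Y p →ₗ[k] WAlg k := (R.tensor n).map

lemma twMap_comp {X Y Z : Fin (n + 1) × D.Obj} {p q r : ℤ} (h : p + q = r)
    (f : (Brace.tw n D).Hom X Y p) (g : (Brace.tw n D).Hom Y Z q) :
    twMap R n ((Brace.tw n D).comp h f g) = twMap R n f * twMap R n g :=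
  (R.tensor n).map_comp h f g

lemma twMap_right (i : Fin (n + 1)) {x y : D.Obj} {m : ℤ} (g : D.Hom x y m) :
    twMap R n ((Brace.tw n D).right i g) = R.map g := rfl

lemma twMap_eps {i j : Fin (n + 1)} (h : i.1 + 1 = j.1) {x y : D.Obj} (c : Chain D x y) {p : ℤ}
    (hp : c.deg = p) :
    twMap R n ((Brace.tw n D).eps h c hp) = insW (R.seq c) [(R.len, i.1)] :=
  (congrArg (fun w => (1 : k) • insW (R.seq c) w) (ivWord_edge R.len h)).trans (one_smul k _)

variable (B n) in
/-- The basis of normal forms of the twisted tensor product. -/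
def tensor : WordBasis (R.tensor n) where
  rel X w s := NormalWord B (Brace.tw n D) X w s
  unique h h' := NormalWord.unique h h'
  one X := by
    have := NormalWord.base (A := Brace.tw n D) X.1 (B.one X.2)
    have h := (tw.right (C := interval k n) (D := D) X.1).map_one X.2
    exact Eq.mp (congrArg (fun f => NormalWord B (Brace.tw n D) X [] ⟨X, 0, f⟩) h) this
  span X Y p := normal_eq_top X Y p
  map h := NormalWord.map (twMap R n) twMap_comp twMap_right twMap_eps h
  nondeg h := isDegenerate_iff.2 (NormalWord.isChain h)

/-- Brace structures receive a functor from the twisted tensor product. -/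
theorem exists_hom (B : WordBasis R) (A : Brace n D) :
    ∃ F : ∀ (X Y : Fin (n + 1) × D.Obj) (p : ℤ), (Brace.tw n D).Hom X Y p →ₗ[k] A.Hom X Y p,
      (∀ {X Y Z : Fin (n + 1) × D.Obj} {p q r : ℤ} (h : p + q = r)
        (f : (Brace.tw n D).Hom X Y p) (g : (Brace.tw n D).Hom Y Z q),
        F _ _ _ ((Brace.tw n D).comp h f g) = A.comp h (F _ _ _ f) (F _ _ _ g)) ∧
      (∀ (i : Fin (n + 1)) {x y : D.Obj} {m : ℤ} (g : D.Hom x y m),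
        F _ _ _ ((Brace.tw n D).right i g) = A.right i g) ∧
      (∀ {i j : Fin (n + 1)} (h : i.1 + 1 = j.1) {x y : D.Obj} (c : Chain D x y) {p : ℤ}
        (hp : c.deg = p), F _ _ _ ((Brace.tw n D).eps h c hp) = A.eps h c hp) := by
  -- The functor is constructed as a graph: the span of the normal forms in the product. It is
  -- closed under all operations and projects onto the twisted tensor product. No relation has to be
  -- lifted by hand.
  let P := (Brace.tw n D).prod A
  let S : ∀ X Y p, Submodule k ((Brace.tw n D).Hom X Y p × A.Hom X Y p) := normal B P
  have total : ∀ {X Y : Fin (n + 1) × D.Obj} {p : ℤ} (f : (Brace.tw n D).Hom X Y p),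
      ∃ a : A.Hom X Y p, (f, a) ∈ S X Y p :=
    Brace.tw_ind (P := fun {X Y p} f => ∃ a : A.Hom X Y p, (f, a) ∈ S X Y p)
      (fun _ _ _ => ⟨0, Submodule.zero_mem _⟩)
      (fun ⟨_, h⟩ ⟨_, h'⟩ => ⟨_, Submodule.add_mem _ h h'⟩)
      (fun r _ _ _ _ ⟨_, h⟩ => ⟨_, Submodule.smul_mem _ r h⟩)
      (fun h _ _ ⟨_, hf⟩ ⟨_, hg⟩ => ⟨_, comp_mem_normal (A := P) h hf hg⟩)
      (fun i _ _ _ g => ⟨_, right_mem_normal (A := P) i g⟩)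
      (fun h _ _ _ c hp => ⟨_, eps_mem_normal (A := P) h c hp⟩)
  -- The graph is single valued: a combination of normal forms of the product with vanishing first
  -- component is zero, because the words of the first components already separate the normal forms.
  have unique : ∀ {X Y : Fin (n + 1) × D.Obj} {p : ℤ} {f : (Brace.tw n D).Hom X Y p}
      {a a' : A.Hom X Y p}, (f, a) ∈ S X Y p → (f, a') ∈ S X Y p → a = a' := by
    intro X Y p f a a' h h'
    have h0 := Submodule.sub_mem _ h h'
    have := eq_zero_of_words
      (rel := fun w (s : (Brace.tw n D).Hom X Y p × A.Hom X Y p) => NormalWord B P X w ⟨Y, p, s⟩)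
      (fun {w s s'} h h' => by
        have := NormalWord.unique h h'
        exact eq_of_heq (Sigma.mk.inj (eq_of_heq (Sigma.mk.inj this).2)).2)
      (twMap R n ∘ₗ LinearMap.fst k _ _) p
      (fun h => NormalWord.map (A := P) (fun {X Y p} => twMap R n ∘ₗ
          LinearMap.fst k ((Brace.tw n D).Hom X Y p) (A.Hom X Y p))
        (fun h f g => twMap_comp h f.1 g.1) twMap_right twMap_eps h)
      (fun h => isDegenerate_iff.2 (NormalWord.isChain h)) h0 (by simp)
    exact sub_eq_zero.1 (congrArg Prod.snd this)
  choose F hF using @total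
  refine ⟨fun X Y p => { toFun := F, map_add' := ?_, map_smul' := ?_ }, ?_, ?_, ?_⟩
  · exact fun f g => unique (hF _) (Submodule.add_mem _ (hF f) (hF g))
  · exact fun r f => unique (hF _) (Submodule.smul_mem _ r (hF f))
  · exact fun h f g => unique (hF _) (comp_mem_normal (A := P) h (hF f) (hF g))
  · exact fun i x y m g => unique (hF _) (right_mem_normal (A := P) i g)
  · exact fun h x y c p hp => unique (hF _) (eps_mem_normal (A := P) h c hp)

end WordBasis

/-- The basis of the unit category. -/
def WordBasis.unit : WordBasis (Rep.unit (k := k)) where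
  rel x w s := w = [] ∧ s = ⟨x, 0, (interval k 0).one x⟩
  unique h h' := h.2.trans h'.2.symm
  one x := ⟨rfl, rfl⟩
  span x y m := by
    rw [eq_top_iff]
    intro f _
    obtain rfl : x = y := Subsingleton.elim (α := Fin 1) x y
    by_cases h : m = 0
    · subst h
      rw [interval.eq_val_smul f ((interval k 0).one x) rfl]
      exact Submodule.smul_mem _ _ (Submodule.subset_span ⟨[], rfl, rfl⟩)
    · have : f = 0 := interval.ext (interval.val_eq_zero f fun h' => h h'.2)
      rw [this]
      exact Submodule.zero_mem _
  map {x y m g w} h := by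
    obtain ⟨rfl, h⟩ := h
    simp only [Sigma.mk.injEq] at h
    obtain ⟨rfl, h⟩ := h
    simp only [heq_eq_eq, Sigma.mk.injEq] at h
    obtain ⟨rfl, h⟩ := h
    obtain rfl := eq_of_heq h
    rw [Rep.map_one, sgn_zero, one_smul, bw_nil]
  nondeg h := by
    rw [h.1]
    exact isDegenerate_iff.2 List.isChain_nil

/-- The basis of `T k L`. -/
noncomputable def basisT (k : Type u) [Field k] : ∀ L : List ℕ, WordBasis (repT k L)
  | [] => WordBasis.unit
  | n :: L => (basisT k L).tensor n

/-- From here on, identities between morphisms of `T k L` are verified for their images in `WAlg`.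
-/
lemma repT_map_injective {L : List ℕ} {x y : (T k L).Obj} {m : ℤ} :
    Function.Injective ((repT k L).map : (T k L).Hom x y m → WAlg k) :=
  (basisT k L).map_injective

end TwoOperad

namespace TwoOperad
variable {k : Type u} [Field k]

/-! ## Configurations and normal forms -/

/-- The conditions on the words of configurations, in terms of subwords. -/
def IsSeq (w : List Letter) : Prop :=
  (∀ a b : Letter, a.1 < b.1 → ¬ [a, b, a].Sublist w) ∧
  ∀ a b : Letter, a.1 = b.1 → a.2 < b.2 → ¬ [b, a].Sublist w

lemma sublist_filter_iff {α : Type*} {p : α → Bool} {l w : List α} (h : ∀ a ∈ l, p a) :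
    l.Sublist (w.filter p) ↔ l.Sublist w := by
  constructor
  · exact fun h' => h'.trans List.filter_sublist
  · intro h'
    have := h'.filter p
    rwa [List.filter_eq_self.2 h] at this

/-- In a word in two letters, avoiding the subword `b a` means that every `a` precedes every `b`. -/
lemma not_sublist_pair_iff {a b : Letter} (hab : a ≠ b) {r : List Letter}
    (hr : ∀ x ∈ r, x = a ∨ x = b) : ¬ [b, a].Sublist r ↔
      r = List.replicate (r.count a) a ++ List.replicate (r.count b) b := by
  constructor
  · intro h
    induction r with
    | nil => simp
    | cons x r ih =>
      have ih := ih (fun y hy => hr y (List.mem_cons_of_mem _ hy))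
        fun h' => h (h'.trans (List.sublist_cons_self _ _))
      rcases hr x (by simp) with rfl | rfl
      · rw [List.count_cons_self, List.count_cons_of_ne hab, List.replicate_succ, List.cons_append,
          ← ih]
      · have h0 : a ∉ r := fun h' => h (List.cons_sublist_cons.2 (List.singleton_sublist.2 h'))
        rw [List.count_eq_zero.2 h0] at ih
        rw [List.count_cons_self, List.count_cons_of_ne hab.symm, List.count_eq_zero.2 h0,
          List.replicate_succ, List.replicate_zero, List.nil_append]
        simpa using ih
  · intro h h'
    rw [h] at h'
    obtain ⟨l₁, l₂, e, h1, h2⟩ := List.sublist_append_iff.1 h'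
    cases l₁ with
    | nil =>
      rw [List.nil_append] at e
      have := List.eq_of_mem_replicate (h2.subset (e ▸ (by simp : a ∈ [b, a])))
      exact hab this
    | cons x l₁ =>
      simp only [List.cons_append, List.cons.injEq] at e
      exact hab (List.eq_of_mem_replicate (h1.subset (by simp [← e.1] : b ∈ _))).symm

/-- Avoiding `a b a` means that the occurrences of `a` form one block. The three shapes are: the
block in front, at the end, or strictly between two groups of `b`. -/
lemma not_sublist_triple_iff {a b : Letter} (hab : a ≠ b) {r : List Letter}
    (hr : ∀ x ∈ r, x = a ∨ x = b) (ha : a ∈ r) : ¬ [a, b, a].Sublist r ↔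
      (r = List.replicate (r.count a) a ++ List.replicate (r.count b) b ∨
      r = List.replicate (r.count b) b ++ List.replicate (r.count a) a ∨
      ∃ s, s + 1 < r.count b ∧ r = List.replicate (s + 1) b ++
        List.replicate (r.count a) a ++ List.replicate (r.count b - (s + 1)) b) := by
  constructor
  · intro h
    induction r with
    | nil => simp at ha
    | cons x r ih =>
      rcases hr x (by simp) with rfl | rfl
      · left
        have := (not_sublist_pair_iff hab (fun y hy => hr y (List.mem_cons_of_mem _ hy))).1
          fun h' => h (List.cons_sublist_cons.2 h')
        rw [List.count_cons_self, List.count_cons_of_ne hab, List.replicate_succ, List.cons_append,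
          ← this]
      · have ha' : a ∈ r := by simpa [hab] using ha
        have ih := ih (fun y hy => hr y (List.mem_cons_of_mem _ hy)) ha'
          fun h' => h (h'.trans (List.sublist_cons_self _ _))
        rw [List.count_cons_self, List.count_cons_of_ne hab.symm]
        rcases ih with ih | ih | ⟨s, hs, ih⟩
        · by_cases hb : r.count x = 0
          · rw [hb] at ih ⊢
            right; left
            simpa using ih
          · right; right
            exact ⟨0, by omega, by simpa using ih⟩
        · right; left
          rw [List.replicate_succ, List.cons_append, ← ih]
        · right; right
          refine ⟨s + 1, by omega, ?_⟩
          rw [List.replicate_succ, List.cons_append, List.cons_append, Nat.add_sub_add_right, ← ih]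
  · intro h h'
    have hba : ∀ {l : List Letter} {p q : ℕ}, l.Sublist (List.replicate p a ++ List.replicate q b) →
        ¬ [b, a].Sublist l := by
      intro l p q hl hl'
      refine (not_sublist_pair_iff (r := List.replicate p a ++ List.replicate q b) hab ?_).2 ?_
        (hl'.trans hl)
      · intro x hx
        simp only [List.mem_append, List.mem_replicate] at hx
        tauto
      · simp [List.count_replicate, hab, hab.symm]
    rcases h with h | h | ⟨s, -, h⟩
    · rw [h] at h'
      exact hba h' (by simp)
    · rw [h] at h'
      have : [a, b].Sublist [a, b, a] := by simp
      refine (not_sublist_pair_iff (r := List.replicate (r.count b) b ++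
        List.replicate (r.count a) a) hab.symm ?_).2 ?_ (this.trans h')
      · intro x hx
        simp only [List.mem_append, List.mem_replicate] at hx
        tauto
      · simp [List.count_replicate, hab, hab.symm]
    · rw [h, List.append_assoc] at h'
      obtain ⟨l₁, l₂, e, h1, h2⟩ := List.sublist_append_iff.1 h'
      cases l₁ with
      | nil =>
        rw [List.nil_append] at e
        exact hba (e ▸ h2) (by simp)
      | cons x l₁ =>
        simp only [List.cons_append, List.cons.injEq] at e
        exact hab (List.eq_of_mem_replicate (h1.subset (by simp [← e.1] : a ∈ _)))

/-- Each condition on a pair of balls forbids one subword: `b a` for `a` below `b` in one column,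
and `a b a` for `a` in a column to the left of that of `b`. In this form the conditions pass to
subwords and are easy to test on concatenations. -/
lemma isConfig_iff {L : List ℕ} {w : List Letter} :
    IsConfig L w ↔ (∀ a, a ∈ w ↔ a ∈ balls L) ∧ IsSeq w := by
  unfold IsConfig
  refine and_congr_right fun hw => ?_
  have hr : ∀ a b, ∀ x ∈ restrict w a b, x = a ∨ x = b := by
    intro a b x hx
    simpa using (List.mem_filter.1 hx).2
  have hca : ∀ a b, (restrict w a b).count a = w.count a := fun a b =>
    List.count_filter (by simp)
  have hcb : ∀ a b, (restrict w a b).count b = w.count b := fun a b =>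
    List.count_filter (by simp)
  have h3 : ∀ a b, [a, b, a].Sublist (restrict w a b) ↔ [a, b, a].Sublist w := fun a b =>
    sublist_filter_iff (by simp)
  have h2 : ∀ a b, [b, a].Sublist (restrict w a b) ↔ [b, a].Sublist w := fun a b =>
    sublist_filter_iff (by simp)
  have key2 : ∀ a b : Letter, a ≠ b → (¬ [b, a].Sublist w ↔ restrict w a b =
      List.replicate (w.count a) a ++ List.replicate (w.count b) b) := by
    intro a b hab
    rw [← h2, not_sublist_pair_iff hab (hr a b), hca, hcb]
  have key3 : ∀ a b : Letter, a ≠ b → a ∈ w → (¬ [a, b, a].Sublist w ↔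
      (restrict w a b = List.replicate (w.count a) a ++ List.replicate (w.count b) b ∨
      restrict w a b = List.replicate (w.count b) b ++ List.replicate (w.count a) a ∨
      ∃ r, r + 1 < w.count b ∧ restrict w a b = List.replicate (r + 1) b ++
        List.replicate (w.count a) a ++ List.replicate (w.count b - (r + 1)) b)) := by
    intro a b hab ha
    rw [← h3, not_sublist_triple_iff hab (hr a b) (List.mem_filter.2 ⟨ha, by simp⟩), hca, hcb]
  constructor
  · rintro ⟨h1, h2⟩
    refine ⟨fun a b hab h => ?_, fun a b hab hab' h => ?_⟩
    · have ha : a ∈ w := h.subset (by simp)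
      have hb : b ∈ w := h.subset (by simp)
      exact (key3 a b (by rintro rfl; omega) ha).2 (h2 a ((hw a).1 ha) b ((hw b).1 hb) hab) h
    · have ha : a ∈ w := h.subset (by simp)
      have hb : b ∈ w := h.subset (by simp)
      exact (key2 a b (by rintro rfl; omega)).2 (h1 a ((hw a).1 ha) b ((hw b).1 hb) hab hab') h
  · rintro ⟨h1, h2⟩
    refine ⟨fun a ha b hb hab hab' => ?_, fun a ha b hb hab => ?_⟩
    · exact (key2 a b (by rintro rfl; omega)).1 (h2 a b hab hab')
    · exact (key3 a b (by rintro rfl; omega) ((hw a).2 ha)).1 (h1 a b hab)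

lemma IsSeq.sublist {w w' : List Letter} (h : IsSeq w) (h' : w'.Sublist w) : IsSeq w' :=
  ⟨fun a b hab hs => h.1 a b hab (hs.trans h'), fun a b hab hab' hs => h.2 a b hab hab' (hs.trans h')⟩

/-- A forbidden `a b a` cannot straddle the junction because the letters are disjoint, and a
forbidden `b a` cannot because heights in a column do not decrease across it. -/
lemma IsSeq.append {u v : List Letter} (hu : IsSeq u) (hv : IsSeq v) (hd : ∀ a ∈ u, a ∉ v)
    (ho : ∀ a ∈ u, ∀ b ∈ v, a.1 = b.1 → a.2 ≤ b.2) : IsSeq (u ++ v) := by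
  refine ⟨fun a b hab hs => ?_, fun a b hab hab' hs => ?_⟩
  · obtain ⟨l₁, l₂, e, h1, h2⟩ := List.sublist_append_iff.1 hs
    match l₁, e with
    | [], e => exact hv.1 a b hab (e ▸ h2)
    | [_], e =>
      simp only [List.cons_append, List.nil_append, List.cons.injEq] at e
      obtain ⟨rfl, rfl⟩ := e
      exact hd a (h1.subset (by simp)) (h2.subset (by simp))
    | [_, _], e =>
      simp only [List.cons_append, List.nil_append, List.cons.injEq] at e
      obtain ⟨rfl, rfl, rfl⟩ := e
      exact hd a (h1.subset (by simp)) (h2.subset (by simp))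
    | _ :: _ :: _ :: l, e =>
      simp only [List.cons_append, List.cons.injEq] at e
      obtain ⟨rfl, rfl, rfl, e⟩ := e
      obtain ⟨rfl, rfl⟩ : l = [] ∧ l₂ = [] := by simpa using e.symm
      exact hu.1 _ _ hab h1
  · obtain ⟨l₁, l₂, e, h1, h2⟩ := List.sublist_append_iff.1 hs
    match l₁, e with
    | [], e => exact hv.2 a b hab hab' (e ▸ h2)
    | [_], e =>
      simp only [List.cons_append, List.nil_append, List.cons.injEq] at e
      obtain ⟨rfl, rfl⟩ := e
      have := ho b (h1.subset (by simp)) a (h2.subset (by simp)) hab.symm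
      omega
    | _ :: _ :: l, e =>
      simp only [List.cons_append, List.cons.injEq] at e
      obtain ⟨rfl, rfl, e⟩ := e
      obtain ⟨rfl, rfl⟩ : l = [] ∧ l₂ = [] := by simpa using e.symm
      exact hu.2 _ _ hab hab' h1

lemma IsSeq.nil : IsSeq [] := by
  constructor <;> intros <;> simp

lemma IsSeq.cons {l : Letter} {t : List Letter} (ht : IsSeq t) (h1 : ∀ a ∈ t, a.1 ≤ l.1)
    (h2 : ∀ a ∈ t, a.1 = l.1 → l.2 ≤ a.2) : IsSeq (l :: t) := by
  refine ⟨fun a b hab hs => ?_, fun a b hab hab' hs => ?_⟩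
  · rcases List.sublist_cons_iff.1 hs with hs | ⟨r, e, hs⟩
    · exact ht.1 a b hab hs
    · simp only [List.cons.injEq] at e
      obtain ⟨rfl, rfl⟩ := e
      have := h1 b (hs.subset (by simp))
      omega
  · rcases List.sublist_cons_iff.1 hs with hs | ⟨r, e, hs⟩
    · exact ht.2 a b hab hab' hs
    · simp only [List.cons.injEq] at e
      obtain ⟨rfl, rfl⟩ := e
      have := h2 a (hs.subset (by simp)) hab
      omega

end TwoOperad

-- The words of normal forms are the nondegenerate configurations

namespace TwoOperad
variable {k : Type u} [Field k]

namespace WordBasis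

variable {D : DGCat k} {R : Rep D} {B : WordBasis R} {n : ℕ}

/-- The words of the basis satisfy the conditions on configurations. -/
def Sound (B : WordBasis R) : Prop := ∀ {x w s}, B.rel x w s → IsSeq w

/-- All the words that satisfy the conditions on configurations belong to the basis. -/
def Full (B : WordBasis R) : Prop := ∀ (x y : D.Obj) (w : List Letter), R.co x ≤ R.co y →
  (∀ a, a ∈ w ↔ a ∈ btw (R.co x) (R.co y)) → IsSeq w → w.IsChain (· ≠ ·) →
  ∃ m g, B.rel x w ⟨y, m, g⟩

lemma ChainWord.typed {i : ℕ} {x : D.Obj} {v : List Letter} {s : Σ y, Chain D x y}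
    (h : ChainWord B (R.len, i) x v s) : R.co x ≤ R.co s.1 ∧
      ∀ a ∈ v, a ∈ btw (R.co x) (R.co s.1) ∨ a = (R.len, i) := by
  induction h with
  | nil x => exact ⟨le_rfl, by simp⟩
  | cons h1 h2 h3 ih =>
    have h1 := WordBasis.typed h1
    refine ⟨h1.1.trans ih.1, fun a ha => ?_⟩
    rw [← btw_union h1.1 ih.1]
    simp only [List.mem_append, List.mem_cons] at ha
    rcases ha with ha | ha | ha
    · exact Or.inl (Or.inl ((h1.2.1 a).1 ha))
    · exact Or.inr ha
    · rcases ih.2 a ha with h | h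
      · exact Or.inl (Or.inr h)
      · exact Or.inr h

/-- Successive entries of the chain occupy disjoint ranges with increasing heights in each column,
and `λ_i` lies in a later column, so its repetitions enclosing other letters are allowed. -/
lemma ChainWord.isSeq (hB : B.Sound) {i : ℕ} {x : D.Obj} {v : List Letter} {s : Σ y, Chain D x y}
    (h : ChainWord B (R.len, i) x v s) : IsSeq ((R.len, i) :: v) := by
  induction h with
  | nil x => exact IsSeq.nil.cons (by simp) (by simp)
  | @cons x y z m g c u v h1 h2 h3 ih =>
    have t1 := (WordBasis.typed h1).2
    have t3 := h3.typed.2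
    have l1 := fun a => col_lt (a := a) h1
    have l3 := h3.letters
    refine (hB h1).append ih ?_ ?_ |>.cons ?_ ?_
    · intro a ha ha'
      rcases List.mem_cons.1 ha' with rfl | ha'
      · exact absurd (l1 _ ha) (lt_irrefl _)
      · rcases t3 a ha' with h | rfl
        · exact Set.disjoint_left.1 (btw_disjoint _ _ _) ((t1.1 a).1 ha) h
        · exact absurd (l1 _ ha) (lt_irrefl _)
    · intro a ha b hb hab
      have hla := l1 a ha
      rcases List.mem_cons.1 hb with rfl | hb
      · exact absurd hla (by simp [hab])
      · rcases t3 b hb with h | rfl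
        · have := ((t1.1 a).1 ha).2
          have := h.1
          rw [hab] at *
          omega
        · exact absurd hla (by simp [hab])
    · intro a ha
      simp only [List.mem_append, List.mem_cons] at ha
      rcases ha with ha | rfl | ha
      · exact (l1 a ha).le
      · exact le_rfl
      · rcases l3 a ha with h | rfl
        · exact h.le
        · exact le_rfl
    · intro a ha e
      simp only at e ⊢
      simp only [List.mem_append, List.mem_cons] at ha
      rcases ha with ha | rfl | ha
      · exact absurd (l1 a ha) (by omega)
      · exact le_rfl
      · rcases l3 a ha with h | rfl
        · exact absurd h (by omega)
        · exact le_rfl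

lemma NormalWord.typed_low {X : Fin (n + 1) × D.Obj} {w : List Letter}
    {s : Σ Y p, (Brace.tw n D).Hom X Y p} (h : NormalWord B (Brace.tw n D) X w s) {a : Letter}
    (ha : a ∈ w) : R.coTw n X.1 X.2 a.1 ≤ a.2 := by
  obtain ⟨Y, p, f⟩ := s
  exact (((WordBasis.typed (B := B.tensor n) h).2.1 a).1 ha).1

/-- The three pieces of a normal form have disjoint letters, and in every column they appear in the
order of heights, since the objects between them increase. -/
lemma sound_tensor (hB : B.Sound) : (B.tensor n).Sound := by
  suffices H : ∀ {X : Fin (n + 1) × D.Obj} {w : List Letter} {s : Σ Y p, (Brace.tw n D).Hom X Y p},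
      NormalWord B (Brace.tw n D) X w s → IsSeq w by
    intro X w s h
    exact H h
  intro X w s h
  induction h with
  | base i h => exact hB h
  | @step i j hij x y z Y m p g c f u v w h1 h2 h3 ih =>
    have t1 := (WordBasis.typed h1).2
    have t2 := h2.typed
    have l1 := fun a => col_lt (a := a) h1
    have l2 := h2.letters
    have l3 := h3.letters
    have hy : ∀ a ∈ w, a.1 < R.len → R.co z a.1 ≤ a.2 := by
      intro a ha hl
      have := h3.typed_low ha
      rwa [show R.coTw n j z a.1 = R.co z a.1 from if_neg hl.ne] at this
    rw [← List.cons_append]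
    refine (hB h1).append ((h2.isSeq hB).append ih ?_ ?_) ?_ ?_
    · intro a ha ha'
      have q3 := l3 a ha'
      rcases List.mem_cons.1 ha with rfl | ha
      · simp only at q3; omega
      · rcases l2 a ha with q2 | rfl
        · rcases t2.2 a ha with h | rfl
          · have := h.2
            have := hy a ha' q2
            simp only at *
            omega
          · exact lt_irrefl _ q2
        · simp only at q3; omega
    · intro a ha b hb hab
      have q3 := l3 b hb
      have hl : ∀ {b : Letter}, (b.1 < R.len ∨ b.1 = R.len ∧ j.1 ≤ b.2) → R.len = b.1 → i.1 ≤ b.2 := by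
        intro b h h'; omega
      rcases List.mem_cons.1 ha with rfl | ha
      · exact hl q3 hab
      · rcases t2.2 a ha with h | rfl
        · rcases l2 a ha with q2 | rfl
          · have := h.2
            have := hy b hb (hab ▸ q2)
            rw [hab] at *
            simp only at *
            omega
          · exact hl q3 hab
        · exact hl q3 hab
    · intro a ha ha'
      have q1 := l1 a ha
      have r1 := ((t1.1 a).1 ha).2
      rcases List.mem_append.1 ha' with ha' | ha'
      · rcases List.mem_cons.1 ha' with rfl | ha'
        · exact lt_irrefl _ q1
        · rcases t2.2 a ha' with h | rfl
          · have := h.1; omega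
          · exact lt_irrefl _ q1
      · have := hy a ha' q1
        have : R.co y a.1 ≤ R.co z a.1 := t2.1 _
        omega
    · intro a ha b hb hab
      have q1 := l1 a ha
      have r1 := ((t1.1 a).1 ha).2
      rw [hab] at q1 r1
      rcases List.mem_append.1 hb with hb | hb
      · rcases List.mem_cons.1 hb with rfl | hb
        · exact absurd q1 (lt_irrefl _)
        · rcases t2.2 b hb with h | rfl
          · have := h.1; omega
          · exact absurd q1 (lt_irrefl _)
      · have := hy b hb q1
        have : R.co y b.1 ≤ R.co z b.1 := t2.1 _
        omega

/-- Any position below the one of an object belongs to an object. -/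
def _root_.TwoOperad.Rep.Surj (R : Rep D) : Prop :=
  ∀ (y : D.Obj) (mid : ℕ → ℕ), mid ≤ R.co y → ∃ z, R.co z = mid

/-- A word that is cut into words with disjoint letters is cut at an object. -/
lemma exists_cut (hR : R.Surj) {i j : Fin (n + 1)} {x y : D.Obj} {p q : List Letter}
    (hle : R.co x ≤ R.co y) (hw : ∀ a, a ∈ p ++ q ↔ a ∈ btw (R.coTw n i x) (R.coTw n j y))
    (hs : IsSeq (p ++ q)) (hd : ∀ a ∈ p, a ∉ q) (hp : ∀ a ∈ p, a.1 < R.len) :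
    ∃ z, R.co x ≤ R.co z ∧ R.co z ≤ R.co y ∧ (∀ a, a ∈ p ↔ a ∈ btw (R.co x) (R.co z)) ∧
      ∀ a, a ∈ q ↔ a ∈ btw (R.coTw n i z) (R.coTw n j y) := by
  classical
  have hco : ∀ (i : Fin (n + 1)) (x : D.Obj) {c : ℕ}, c < R.len → R.coTw n i x c = R.co x c :=
    fun i x c hc => if_neg hc.ne
  have hpb : ∀ a ∈ p, R.co x a.1 ≤ a.2 ∧ a.2 < R.co y a.1 := by
    intro a ha
    have := (hw a).1 (List.mem_append_left _ ha)
    rwa [btw, Set.mem_ofPred_eq, hco _ _ (hp a ha), hco _ _ (hp a ha)] at this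
  have hex : ∀ c, ∃ t, R.co x c ≤ t ∧ (c, t) ∉ p := fun c =>
    ⟨R.co y c, hle c, fun h => lt_irrefl _ (hpb _ h).2⟩
  -- The height of the cut in a column is the first one whose letter is missing from `p`.
  let mid : ℕ → ℕ := fun c => Nat.find (hex c)
  have m1 : ∀ c, R.co x c ≤ mid c := fun c => (Nat.find_spec (hex c)).1
  have m2 : ∀ c, (c, mid c) ∉ p := fun c => (Nat.find_spec (hex c)).2
  have m3 : ∀ c t, R.co x c ≤ t → t < mid c → (c, t) ∈ p := by
    intro c t h h'
    by_contra hn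
    exact Nat.find_min (hex c) h' ⟨h, hn⟩
  have m4 : mid ≤ R.co y := fun c => Nat.find_min' (hex c) ⟨hle c, fun h => lt_irrefl _ (hpb _ h).2⟩
  have hpm : ∀ a, a ∈ p ↔ a ∈ btw (R.co x) mid := by
    intro a
    refine ⟨fun ha => ⟨(hpb a ha).1, ?_⟩, fun ha => m3 a.1 a.2 ha.1 ha.2⟩
    by_contra hn
    have hl := hp a ha
    have hm : (a.1, mid a.1) ∈ q := by
      have := (hw (a.1, mid a.1)).2 ⟨by simpa [hco i x hl] using m1 a.1, by
        have := (hpb a ha).2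
        simp only [hco j y hl]
        omega⟩
      rcases List.mem_append.1 this with h | h
      · exact absurd h (m2 _)
      · exact h
    have hne : mid a.1 ≠ a.2 := by
      intro e
      exact m2 a.1 (by rw [e]; exact ha)
    -- If `p` contained a letter above this height, the missing letter, which then lies in `q`,
    -- would come after a higher letter of its own column.
    refine hs.2 (a.1, mid a.1) a rfl (by simp only; omega) ?_
    exact (List.singleton_sublist.2 ha).append (List.singleton_sublist.2 hm)
  obtain ⟨z, hz⟩ := hR y mid m4
  refine ⟨z, hz ▸ m1, hz ▸ m4, hz ▸ hpm, fun a => ?_⟩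
  have hwa := hw a
  rw [List.mem_append] at hwa
  have hpa := hpm a
  rw [← hz] at hpa
  have hda := hd a
  have h1 : R.co x a.1 ≤ R.co z a.1 := hz ▸ m1 a.1
  have h2 : R.co z a.1 ≤ R.co y a.1 := hz ▸ m4 a.1
  have hpl := hp a
  simp only [btw, Set.mem_ofPred_eq, Rep.coTw] at hwa hpa ⊢
  by_cases hl : a.1 = R.len
  · simp only [hl, if_true] at hwa ⊢
    have : a ∉ p := fun h => absurd (hpl h) (by omega)
    tauto
  · simp only [hl, if_false] at hwa ⊢
    constructor
    · intro hq
      have := hwa.1 (Or.inr hq)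
      have : a ∉ p := fun h => hda h hq
      rw [hpa] at this
      omega
    · intro h
      rcases hwa.2 ⟨by omega, h.2⟩ with h' | h'
      · have := hpa.1 h'
        omega
      · exact h'

/-- Before the first `λ_i` no letter of the last column can occur, since it would be higher than
`λ_i`. A letter on both sides of `λ_i` would give a forbidden `a λ_i a`. So the word is cut at an
object, and the first part is a basis word because the basis of the other columns is full. -/
lemma exists_cut_at (hR : R.Surj) (hB : B.Full) {i j : Fin (n + 1)} {x y : D.Obj}
    {u t : List Letter} (hu : (R.len, i.1) ∉ u) (hle : R.co x ≤ R.co y)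
    (hw : ∀ a, a ∈ u ++ (R.len, i.1) :: t ↔ a ∈ btw (R.coTw n i x) (R.coTw n j y))
    (hs : IsSeq (u ++ (R.len, i.1) :: t)) (hc : (u ++ (R.len, i.1) :: t).IsChain (· ≠ ·)) :
    ∃ z m g, B.rel x u ⟨z, m, g⟩ ∧ R.co z ≤ R.co y ∧
      ∀ a, a ∈ (R.len, i.1) :: t ↔ a ∈ btw (R.coTw n i z) (R.coTw n j y) := by
  have hp : ∀ a ∈ u, a.1 < R.len := by
    intro a ha
    have hb := (hw a).1 (List.mem_append_left _ ha)
    rcases lt_trichotomy a.1 R.len with h | h | h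
    · exact h
    · have h1 : i.1 ≤ a.2 := by
        have := hb.1
        rwa [show R.coTw n i x a.1 = i.1 from if_pos h] at this
      have hne : a.2 ≠ i.1 := fun e => hu (by rw [← h, ← e]; exact ha)
      refine absurd ?_ (hs.2 (R.len, i.1) a h.symm (by simp only; omega))
      exact (List.singleton_sublist.2 ha).append (List.singleton_sublist.2 (by simp))
    · have := hb.2
      rw [show R.coTw n j y a.1 = R.co y a.1 from if_neg h.ne', R.co_eq _ _ h.le] at this
      omega
  obtain ⟨z, h1, h2, h3, h4⟩ := exists_cut hR hle hw hs (fun a ha ha' => by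
    rcases List.mem_cons.1 ha' with rfl | ha'
    · exact hu ha
    · refine hs.1 a (R.len, i.1) (hp a ha) ?_
      exact (List.singleton_sublist.2 ha).append
        (List.cons_sublist_cons.2 (List.singleton_sublist.2 ha'))) hp
  obtain ⟨m, g, h⟩ := hB x z u h1 h3 (hs.sublist (List.sublist_append_left _ _))
    (List.isChain_append.1 hc).1
  exact ⟨z, m, g, h, h2, h4⟩

/-- The word is cut in front of each further occurrence of `λ_i`; nondegeneracy makes the blocks
nonempty. The bound `N` on the length drives the recursion. -/
lemma exists_chainWord (hR : R.Surj) (hB : B.Full) {i i' j : Fin (n + 1)} (hi : i.1 + 1 = i'.1)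
    {y : D.Obj} (N : ℕ) {x : D.Obj} {t : List Letter} (ht : t.length < N) (hle : R.co x ≤ R.co y)
    (hw : ∀ a, a ∈ (R.len, i.1) :: t ↔ a ∈ btw (R.coTw n i x) (R.coTw n j y))
    (hs : IsSeq ((R.len, i.1) :: t)) (hc : ((R.len, i.1) :: t).IsChain (· ≠ ·)) :
    ∃ z c v w, t = v ++ w ∧ ChainWord B (R.len, i.1) x v ⟨z, c⟩ ∧ R.co z ≤ R.co y ∧
      ∀ a, a ∈ w ↔ a ∈ btw (R.coTw n i' z) (R.coTw n j y) := by
  induction N generalizing x t with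
  | zero => exact absurd ht (Nat.not_lt_zero _)
  | succ N ih =>
    by_cases hl : (R.len, i.1) ∈ t
    · obtain ⟨u, t', rfl, hu⟩ := List.eq_append_cons_of_mem hl
      have hc' := (List.isChain_cons.1 hc).2
      obtain ⟨z, m, g, h1, h2, h3⟩ := exists_cut_at hR hB hu hle (fun a => by
        rw [← hw a, List.mem_cons]
        exact ⟨Or.inr, fun h => h.elim (fun h => h ▸ hl) id⟩)
        (hs.sublist (List.sublist_cons_self _ _)) hc'
      obtain ⟨z', c, v, w, rfl, h4, h5, h6⟩ := ih (t := t') (by simp at ht; omega) h2 h3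
        (hs.sublist ((List.sublist_append_right _ _).trans (List.sublist_cons_self _ _)))
        (List.isChain_append.1 hc').2.1
      refine ⟨z', _, u ++ (R.len, i.1) :: v, w, by simp, ChainWord.cons h1 ?_ h4, h5, h6⟩
      rintro rfl
      exact (List.isChain_cons_cons.1 hc).1 rfl
    -- If `λ_i` does not occur again, the remaining letters of the last column have height at least
    -- `i + 1`, so the lower end moves from `i` to `i'`.
    · refine ⟨x, .nil x, [], t, rfl, ChainWord.nil x, hle, fun a => ?_⟩
      have h1 := hw a
      simp only [List.mem_cons, btw, Set.mem_ofPred_eq] at h1 ⊢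
      by_cases ha : a.1 = R.len
      · have e1 : R.coTw n i x a.1 = i.1 := if_pos ha
        have e2 : R.coTw n i' x a.1 = i'.1 := if_pos ha
        rw [e1] at h1
        rw [e2]
        have h2 : a = (R.len, i.1) ↔ a.2 = i.1 := by simp [Prod.ext_iff, ha]
        have h3 : a ∈ t → a.2 ≠ i.1 := fun h e => hl (h2.2 e ▸ h)
        constructor
        · intro h
          have := h1.1 (Or.inr h)
          have := h3 h
          omega
        · intro h
          rcases h1.2 ⟨by omega, h.2⟩ with h' | h'
          · have := h2.1 h'; omega
          · exact h'
      · have e1 : R.coTw n i x a.1 = R.co x a.1 := if_neg ha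
        have e2 : R.coTw n i' x a.1 = R.co x a.1 := if_neg ha
        rw [e1] at h1
        rw [e2, ← h1]
        refine ⟨Or.inr, fun h => h.resolve_left ?_⟩
        rintro rfl
        exact ha rfl

/-- Induction on the number of balls of the last column between source and target. The lowest of
them determines the initial factor and the first brace, and the rest starts one level higher. -/
lemma full_tensor (hR : R.Surj) (hB : B.Full) : (B.tensor n).Full := by
  suffices H : ∀ (N : ℕ) {i j : Fin (n + 1)} {x y : D.Obj} {w : List Letter} (_ : j.1 - i.1 = N)
      (_ : i.1 ≤ j.1) (_ : R.co x ≤ R.co y)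
      (_ : ∀ a, a ∈ w ↔ a ∈ btw (R.coTw n i x) (R.coTw n j y)) (_ : IsSeq w)
      (_ : w.IsChain (· ≠ ·)), ∃ m f, NormalWord B (Brace.tw n D) (i, x) w ⟨(j, y), m, f⟩ by
    intro X Y w hle hw hs hc
    have := (R.coTw_le n (i := X.1) (j := Y.1) (x := X.2) (y := Y.2)).1 hle
    exact H _ rfl this.1 this.2 hw hs hc
  intro N
  induction N with
  | zero =>
    intro i j x y w hN hij hle hw hs hc
    obtain rfl : i = j := Fin.ext (by omega)
    obtain ⟨m, g, h⟩ := hB x y w hle (fun a => (hw a).trans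
      ((Set.ext_iff.1 (R.btw_coTw n (i := i) (j := i) (x := x) (y := y)) a).trans (by
        rw [ivWord_self]; simp))) hs hc
    exact ⟨m, _, NormalWord.base i h⟩
  | succ N ih =>
    intro i j x y w hN hij hle hw hs hc
    -- Since `i < j`, the ball of height `i` lies between source and target and must occur.
    have hl : (R.len, i.1) ∈ w := by
      refine (hw _).2 ((Set.ext_iff.1 (R.btw_coTw n (i := i) (j := j) (x := x) (y := y)) _).2
        (Or.inl (mem_ivWord.2 ⟨rfl, le_rfl, ?_⟩)))
      change i.1 < j.1
      omega
    obtain ⟨u, t, rfl, hu⟩ := List.eq_append_cons_of_mem hl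
    obtain ⟨z, m, g, h1, h2, h3⟩ := exists_cut_at hR hB hu hle hw hs hc
    have hs' := hs.sublist (List.sublist_append_right _ _)
    have hc' := (List.isChain_append.1 hc).2.1
    have hi' : i.1 + 1 < n + 1 := by omega
    obtain ⟨z', c, v, w, rfl, h4, h5, h6⟩ := exists_chainWord hR hB (i' := ⟨i.1 + 1, hi'⟩) rfl
      (t.length + 1) (Nat.lt_succ_self _) h2 h3 hs' hc'
    obtain ⟨m', f, h7⟩ := ih (i := ⟨i.1 + 1, hi'⟩) (by simp only; omega) (by simp only; omega) h5 h6
      (hs'.sublist ((List.sublist_append_right v _).trans (List.sublist_cons_self _ _)))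
      (List.isChain_append.1 (List.isChain_cons.1 hc').2).2.1
    exact ⟨_, _, NormalWord.step rfl h1 h4 h7⟩

lemma surj_tensor (hR : R.Surj) : (R.tensor n).Surj := by
  intro Y mid h
  obtain ⟨z, hz⟩ := hR Y.2 (fun c => if c = R.len then 0 else mid c) fun c => by
    have := h c
    change mid c ≤ R.coTw n Y.1 Y.2 c at this
    dsimp only
    unfold Rep.coTw at this
    split_ifs with hc
    · exact Nat.zero_le _
    · rwa [if_neg hc] at this
  have hm : mid R.len < n + 1 := by
    have := h R.len
    change mid R.len ≤ R.coTw n Y.1 Y.2 R.len at this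
    rw [show R.coTw n Y.1 Y.2 R.len = (show Fin (n + 1) from Y.1).1 from if_pos rfl] at this
    exact lt_of_le_of_lt this (show Fin (n + 1) from Y.1).2
  refine ⟨((⟨mid R.len, hm⟩ : Fin (n + 1)), z), funext fun c => ?_⟩
  change R.coTw n _ z c = mid c
  unfold Rep.coTw
  split_ifs with hc
  · subst hc; rfl
  · rw [hz]; exact if_neg hc

end WordBasis

lemma repT_surj : ∀ L : List ℕ, (repT k L).Surj
  | [] => fun _ _ h => ⟨(0 : Fin 1), funext fun c => (Nat.le_zero.1 (h c)).symm⟩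
  | _ :: L => WordBasis.surj_tensor (repT_surj L)

lemma basisT_full : ∀ L : List ℕ, (basisT k L).Full
  | [] => fun x y w _ hw _ _ => by
    obtain rfl : x = y := Subsingleton.elim (α := Fin 1) x y
    have : w = [] := List.eq_nil_iff_forall_not_mem.2 fun a ha => by
      have := (hw a).1 ha
      rw [btw_self] at this
      exact this
    exact ⟨0, _, this, rfl⟩
  | _ :: L => WordBasis.full_tensor (repT_surj L) (basisT_full L)

lemma basisT_sound : ∀ L : List ℕ, (basisT k L).Sound
  | [] => fun h => by rw [h.1]; exact IsSeq.nil
  | _ :: L => WordBasis.sound_tensor (basisT_sound L)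

lemma repT_co_bot : ∀ (L : List ℕ) (c : ℕ), (repT k L).co (T.bot L) c = 0
  | [], _ => rfl
  | _ :: L, c => by
    change (repT k L).coTw _ _ _ c = 0
    unfold Rep.coTw
    split_ifs
    · rfl
    · exact repT_co_bot L c

lemma mem_balls : ∀ (L : List ℕ) (a : Letter), a ∈ balls L ↔ a.2 < (repT k L).co (T.top L) a.1
  | [], a => by simp [balls]; exact Nat.zero_le _
  | n :: L, a => by
    change _ ↔ a.2 < (repT k L).coTw n (Fin.last n) (T.top L) a.1
    rw [balls, Finset.mem_union, mem_balls L a]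
    by_cases h : a.1 = (repT k L).len
    · rw [show (repT k L).coTw n (Fin.last n) (T.top L) a.1 = n from if_pos h,
        (repT k L).co_eq _ _ h.ge]
      rw [repT_len] at h
      obtain ⟨a, b⟩ := a
      simp only at h
      simp [h]
    · rw [show (repT k L).coTw n (Fin.last n) (T.top L) a.1 = (repT k L).co (T.top L) a.1
        from if_neg h]
      rw [repT_len] at h
      obtain ⟨a, b⟩ := a
      simp only [Finset.mem_image, Finset.mem_range, Prod.mk.injEq, or_iff_left_iff_imp]
      rintro ⟨i, -, rfl, -⟩
      exact absurd rfl h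

/-- The nondegenerate configurations are the words of the basis. -/
lemma isConfig_iff_rel {L : List ℕ} {w : List Letter} {n : ℤ} :
    (IsConfig L w ∧ -(dim w : ℤ) = n) ∧ ¬ IsDegenerate w ↔
      ∃ f : O k L n, (basisT k L).rel (T.bot L) w ⟨T.top L, n, f⟩ := by
  have hb : ∀ a, a ∈ balls L ↔ a ∈ btw ((repT k L).co (T.bot L)) ((repT k L).co (T.top L)) := by
    intro a
    rw [mem_balls (k := k), btw, Set.mem_ofPred_eq, repT_co_bot]
    simp
  constructor
  · rintro ⟨⟨h1, h2⟩, h3⟩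
    rw [isConfig_iff] at h1
    obtain ⟨m, f, h⟩ := basisT_full L (T.bot L) (T.top L) w
      (fun c => by rw [repT_co_bot]; exact Nat.zero_le _)
      (fun a => (h1.1 a).trans (hb a)) h1.2 (isDegenerate_iff.1 h3)
    obtain rfl : m = n := (WordBasis.typed h).2.2.symm.trans h2
    exact ⟨f, h⟩
  · rintro ⟨f, h⟩
    have ht := (WordBasis.typed h).2
    exact ⟨⟨isConfig_iff.2 ⟨fun a => (ht.1 a).trans (hb a).symm, basisT_sound L h⟩, ht.2⟩,
      (basisT k L).nondeg h⟩

/-- A normal form is by construction a composition of factors `id ⊗ g` and `ε(f_i; c)` with basis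
elements as entries, and the same holds inside by induction on the columns. -/
lemma isMonomial_of_rel : ∀ (L : List ℕ) {x y : (T k L).Obj} {n : ℤ} {f : (T k L).Hom x y n}
    {w : List Letter}, (basisT k L).rel x w ⟨y, n, f⟩ → IsMonomial L f w
  | [], x, y, n, f, w, h => by
    obtain ⟨rfl, h⟩ := h
    obtain ⟨rfl, h⟩ := Sigma.mk.inj h
    obtain ⟨rfl, h⟩ := Sigma.mk.inj (eq_of_heq h)
    obtain rfl := eq_of_heq h
    exact IsMonomial.one [] y
  | n :: L, _, _, _, _, _, h => by
    have ih := @isMonomial_of_rel L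
    have hc : ∀ {l : Letter} {x : (T k L).Obj} {v : List Letter} {s : Σ y, Chain (T k L) x y},
        WordBasis.ChainWord (basisT k L) l x v s → IsChainMonomial L l s.2 v := by
      intro l x v s h
      induction h with
      | nil x => exact IsChainMonomial.nil _ _ _
      | cons h1 _ _ ih' => exact IsChainMonomial.cons _ _ (ih h1) ih'
    suffices H : ∀ {X : Fin (n + 1) × (T k L).Obj} {w : List Letter}
        {s : Σ Y p, (Brace.tw n (T k L)).Hom X Y p},
        WordBasis.NormalWord (basisT k L) (Brace.tw n (T k L)) X w s →
        IsMonomial (n :: L) (x := X) (y := s.1) s.2.2 w from H h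
    intro X w s h
    induction h with
    | base i h => exact IsMonomial.right n L i (ih h)
    | @step i j hij x y z Y m p g c f u v w h1 h2 h3 ih' =>
      refine IsMonomial.comp (n :: L) rfl (IsMonomial.right n L i (ih h1)) ?_
      rw [← List.cons_append]
      refine IsMonomial.comp (n :: L) rfl ?_ ih'
      obtain ⟨i, rfl⟩ : ∃ i' : Fin n, i'.castSucc = i := ⟨⟨i.1, by omega⟩, rfl⟩
      obtain rfl : i.succ = j := Fin.ext hij
      rw [repT_len] at h2 ⊢
      exact IsMonomial.brace n L i (zero_add _) (hc h2)

end TwoOperad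

namespace TwoOperad
variable {k : Type u} [Field k]

/-! ## Inversions -/

/-- The number of the elementary intervals of the letters below `c`. -/
def below (w : List Letter) (c : Letter) : ℕ := ∑ a ∈ w.toFinset with Letter.lt a c, ell w a

lemma ell_of_not_mem {w : List Letter} {a : Letter} (h : a ∉ w) : ell w a = 0 := by
  rw [ell, List.count_eq_zero.2 h]

lemma below_eq_sum {w : List Letter} {S : Finset Letter} (h : ∀ a ∈ w, a ∈ S) (c : Letter) :
    below w c = ∑ a ∈ S with Letter.lt a c, ell w a := by
  refine Finset.sum_subset (fun a ha => ?_) fun a ha ha' => ell_of_not_mem fun h => ha' ?_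
  · simp only [Finset.mem_filter, List.mem_toFinset] at ha ⊢
    exact ⟨h a ha.1, ha.2⟩
  · simp only [Finset.mem_filter, List.mem_toFinset] at ha ⊢
    exact ⟨h, ha.2⟩

lemma ell_cons (a : Letter) (w : List Letter) (b : Letter) :
    ell (a :: w) b = ell w b + if b = a then (if a ∈ w then 1 else 0) else 0 := by
  unfold ell
  by_cases h : b = a
  · subst h
    rw [List.count_cons_self, if_pos rfl]
    split_ifs with h
    · have := List.count_pos_iff.2 h; omega
    · rw [List.count_eq_zero.2 h]
  · rw [List.count_cons_of_ne (Ne.symm h), if_neg h, add_zero]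

lemma below_cons (a : Letter) (w : List Letter) (c : Letter) :
    below (a :: w) c = below w c + if a ∈ w ∧ Letter.lt a c then 1 else 0 := by
  rw [below, below_eq_sum (S := (a :: w).toFinset) (fun b hb => by simp [hb])]
  simp only [ell_cons]
  rw [Finset.sum_add_distrib, Finset.sum_ite_eq']
  congr 1
  simp only [Finset.mem_filter, List.mem_toFinset, List.mem_cons, true_or, true_and]
  by_cases h1 : a ∈ w <;> by_cases h2 : Letter.lt a c <;> simp [h1, h2]

lemma below_congr {w w' : List Letter} (h : ∀ a, ell w a = ell w' a) (c : Letter) :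
    below w c = below w' c := by
  rw [below_eq_sum (S := w.toFinset ∪ w'.toFinset) (fun b hb => by simp [hb]),
    below_eq_sum (w := w') (S := w.toFinset ∪ w'.toFinset) (fun b hb => by simp [hb])]
  exact Finset.sum_congr rfl fun a _ => h a

lemma below_perm {w w' : List Letter} (h : w.Perm w') (c : Letter) : below w c = below w' c :=
  below_congr (fun a => by rw [ell, ell, h.count_eq]) c

/-- The number of the inversions of the elementary intervals of a word with respect to the
lexicographic order. -/
def inv : List Letter → ℕ
  | [] => 0
  -- The interval that starts at the leading `a` is first in the order of the word and has to pass
  -- the intervals of all smaller letters.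
  | a :: w => inv w + if a ∈ w then below w a else 0

lemma ell_erase {w : List Letter} {a : Letter} (h : w.count a = 1) (b : Letter) :
    ell (w.erase a) b = ell w b := by
  unfold ell
  by_cases hb : b = a
  · subst hb; rw [List.count_erase_self]; omega
  · rw [List.count_erase_of_ne hb]

/-- A letter that occurs once has no elementary interval, so its removal changes no inversion. -/
lemma inv_erase {w : List Letter} {a : Letter} (h : w.count a = 1) : inv (w.erase a) = inv w := by
  induction w with
  | nil => simp at h
  | cons b w ih =>
    by_cases hb : b = a
    · subst hb
      have : b ∉ w := by
        rw [List.count_cons_self] at h; exact List.count_eq_zero.1 (by omega)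
      rw [List.erase_cons_head, inv, if_neg this, add_zero]
    · rw [List.count_cons_of_ne hb] at h
      rw [List.erase_cons_tail (by simpa using hb), inv, inv, ih h, below_congr (ell_erase h)]
      simp only [List.mem_erase_of_ne hb]

lemma get_inj_of_count_eq_one {w : List Letter} {a : Letter} (h : w.count a = 1) {s t : Fin w.length}
    (hs : a = w.get s) (ht : a = w.get t) : s = t := by
  induction w with
  | nil => exact s.elim0
  | cons b w ih =>
    have key : ∀ t : Fin w.length, a = w.get t → b ≠ a := by
      rintro t ht rfl
      rw [List.count_cons_self] at h
      have := List.count_pos_iff.2 (ht ▸ List.get_mem w t : b ∈ w)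
      omega
    induction s using Fin.cases with
    | zero =>
      induction t using Fin.cases with
      | zero => rfl
      | succ t => exact absurd hs.symm (key t ht)
    | succ s =>
      induction t using Fin.cases with
      | zero => exact absurd ht.symm (key s hs)
      | succ t =>
        rw [List.count_cons_of_ne (key s hs)] at h
        exact congrArg Fin.succ (ih h hs ht)

lemma before_eq (w : List Letter) (t : Fin w.length) :
    before w t = below w (w.get t) + (w.take t).count (w.get t) := rfl

lemma Letter.lt_irrefl (a : Letter) : ¬ Letter.lt a a := by
  unfold Letter.lt; omega

lemma Letter.lt_trichotomy {a b : Letter} (h : a ≠ b) :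
    (Letter.lt a b ∧ ¬ Letter.lt b a) ∨ (¬ Letter.lt a b ∧ Letter.lt b a) := by
  have : ¬ (a.1 = b.1 ∧ a.2 = b.2) := fun h' => h (Prod.ext h'.1 h'.2)
  unfold Letter.lt
  omega

/-- The signed sum of the deletions of the letters of a word is the differential, up to the signs
of the inversions. -/
lemma sum_delete (w : List Letter) :
    (∑ t : Fin w.length, if 2 ≤ w.count (w.get t) then
      sgn k (before w t + inv (w.eraseIdx t) : ℕ) • bw k (w.eraseIdx t) else 0) =
      sgn k (inv w) • dWord k w := by
  induction w with
  | nil => simp [dWord]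
  | cons a w ih =>
    have e : ∑ t : Fin (a :: w).length, (if 2 ≤ (a :: w).count ((a :: w).get t) then
        sgn k (before (a :: w) t + inv ((a :: w).eraseIdx t) : ℕ) • bw k ((a :: w).eraseIdx t)
        else 0) = (if 2 ≤ (a :: w).count a then
          sgn k (before (a :: w) ⟨0, by simp⟩ + inv w : ℕ) • bw k w else 0) +
        ∑ t : Fin w.length, (if 2 ≤ (a :: w).count (w.get t) then
          sgn k (before (a :: w) t.succ + inv (a :: w.eraseIdx t) : ℕ) •
            bw k (a :: w.eraseIdx t) else 0) := Fin.sum_univ_succ _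
    rw [e]
    have hb : ∀ t : Fin w.length, before (a :: w) t.succ = before w t +
        (if a ∈ w ∧ Letter.lt a (w.get t) then 1 else 0) + if a = w.get t then 1 else 0 := by
      intro t
      rw [before_eq, before_eq]
      have h1 : (a :: w).get t.succ = w.get t := rfl
      have h2 : (a :: w).take t.succ.1 = a :: w.take t.1 := rfl
      rw [h1, h2, below_cons, List.count_cons]
      simp only [beq_iff_eq]
      omega
    have h0 : before (a :: w) ⟨0, by simp⟩ = below w a := by
      rw [before_eq]
      change below (a :: w) a + 0 = _
      rw [below_cons, if_neg fun h => Letter.lt_irrefl _ h.2, add_zero, add_zero]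
    by_cases ha : a ∈ w
    · have hc : 1 ≤ w.count a := List.count_pos_iff.2 ha
      rw [if_pos (by rw [List.count_cons_self]; omega), h0, inv, if_pos ha,
        dWord_cons_of_mem ha]
      -- A deletion in `w` passes the interval of the leading `a`, which gives the first term. The
      -- second term is the exceptional deletion of the only other copy of `a`, as in the recursion
      -- of `dWord`.
      have key : ∀ t : Fin w.length, (if 2 ≤ (a :: w).count (w.get t) then
          sgn k (before (a :: w) t.succ + inv (a :: w.eraseIdx t) : ℕ) •
            bw k (a :: w.eraseIdx t) else 0) =
          -(sgn k (below w a : ℕ) • (bw k [a] * if 2 ≤ w.count (w.get t) then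
            sgn k (before w t + inv (w.eraseIdx t) : ℕ) • bw k (w.eraseIdx t) else 0)) -
          (if a = w.get t ∧ w.count a = 1 then
            sgn k (inv w + below w a : ℕ) • bw k (a :: w.erase a) else 0) := by
        intro t
        have hp : w.Perm (w.get t :: w.eraseIdx t) := (List.getElem_cons_eraseIdx_perm t.2).symm
        by_cases h2 : 2 ≤ w.count (w.get t)
        · have hne : ¬ (a = w.get t ∧ w.count a = 1) := by
            rintro ⟨h, h'⟩; rw [← h] at h2; omega
          rw [if_pos (le_trans h2 List.count_le_count_cons), if_pos h2, if_neg hne, sub_zero,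
            mul_smul_comm, ← bw_cons, sgn_smul_smul, ← neg_smul, neg_sgn, hb, inv]
          congr 1
          refine sgn_congr ?_
          have hct : w.get t ∈ w.eraseIdx t := by
            rw [hp.count_eq, List.count_cons_self] at h2
            exact List.count_pos_iff.1 (by omega)
          have ha' : a ∈ w.eraseIdx t := by
            rcases List.mem_cons.1 (hp.mem_iff.1 ha) with h | h
            · rwa [h]
            · exact h
          rw [if_pos ha', below_perm hp a, below_cons]
          simp only [ha, hct, true_and]
          -- Comparison with the deleted letter `c`: for `c = a` the face index grows by one; for `a
          -- < c` the interval of `a` precedes those of `c` lexicographically and adds one to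
          -- `before`; for `c < a` the deletion removes one inversion with the interval of `a`. The
          -- sign changes exactly once in each case.
          by_cases hac : a = w.get t
          · have := Letter.lt_irrefl a
            rw [← hac]
            simp only [this, if_false, if_true]
            push_cast
            ring
          · rcases Letter.lt_trichotomy hac with ⟨h3, h4⟩ | ⟨h3, h4⟩
            · simp only [h3, h4, hac, if_false, if_true]
              push_cast
              ring
            · simp only [h3, h4, hac, if_false, if_true]
              push_cast
              grind
        · rw [if_neg h2, mul_zero, smul_zero, neg_zero, zero_sub]
          by_cases hac : a = w.get t
          · rw [← hac] at h2
            have h1 : w.count a = 1 := by omega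
            have hea : w.eraseIdx t = w.erase a := by
              rw [List.erase_eq_eraseIdx_of_idxOf (i := t.1)]
              have hi : w.idxOf a < w.length := List.idxOf_lt_length_iff.2 ha
              exact congrArg Fin.val (get_inj_of_count_eq_one h1 (s := ⟨_, hi⟩) (by simp) hac)
            have hae : a ∉ w.erase a := by
              rw [← List.count_pos_iff, List.count_erase_self]; omega
            rw [if_pos (by rw [← hac, List.count_cons_self]; omega), if_pos ⟨hac, h1⟩, hb, hea, inv,
              inv_erase h1, ← neg_smul, neg_sgn, before_eq, ← hac, if_neg hae]
            simp only [Letter.lt_irrefl, and_false, if_false, if_true]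
            have h3 : (w.take t.1).count a = 0 := by
              have h4 : w = w.take t.1 ++ w.get t :: w.drop (t.1 + 1) := by simp
              rw [h4, List.count_append, ← hac, List.count_cons_self] at h1
              omega
            rw [h3]
            congr 1
            refine sgn_congr ?_
            push_cast
            ring
          · rw [if_neg (by rw [List.count_cons_of_ne hac]; exact h2), if_neg fun h => hac h.1,
              neg_zero]
      rw [Finset.sum_congr rfl fun t _ => key t, Finset.sum_sub_distrib, Finset.sum_neg_distrib,
        ← Finset.smul_sum, ← Finset.mul_sum, ih]
      -- The exceptional term is contributed by exactly one position, if there is one.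
      have hs : (∑ t : Fin w.length, if a = w.get t ∧ w.count a = 1 then
          sgn k (inv w + below w a : ℕ) • bw k (a :: w.erase a) else 0) =
          if w.count a = 1 then sgn k (inv w + below w a : ℕ) • bw k (a :: w.erase a) else 0 := by
        split_ifs with h1
        · simp only [h1, and_true]
          have : ∃! t : Fin w.length, a = w.get t := by
            obtain ⟨t, ht⟩ := List.mem_iff_get.1 ha
            exact ⟨t, ht.symm, fun t' ht' => get_inj_of_count_eq_one h1 ht' ht.symm⟩
          obtain ⟨t, ht, ht'⟩ := this
          rw [Finset.sum_eq_single t (fun b _ hb => if_neg fun h => hb (ht' b h)) (by simp),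
            if_pos ht]
        · simp [h1]
      rw [hs, smul_sub, smul_sub, mul_smul_comm, smul_smul, ← sgn_add]
      have h5 : (sgn k (below w a + inv w : ℕ)) = sgn k (inv w + below w a : ℕ) := by
        rw [add_comm]
      rw [h5]
      have h6 : sgn k ((below w a : ℕ) + (inv w : ℕ) : ℤ) = sgn k (inv w + below w a : ℕ) := by
        rw [← h5]; push_cast; rfl
      rw [h6]
      split_ifs <;> simp <;> abel
    · rw [if_neg (by rw [List.count_cons_self, List.count_eq_zero.2 ha]; omega), zero_add, inv,
        if_neg ha, add_zero, dWord_cons_of_not_mem ha, ← mul_smul_comm, ← ih, Finset.mul_sum]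
      refine Finset.sum_congr rfl fun t _ => ?_
      have hne : a ≠ w.get t := by
        rintro h; exact ha (h ▸ List.get_mem w t)
      have ha' : a ∉ w.eraseIdx t := fun h => ha (List.eraseIdx_subset h)
      rw [List.count_cons_of_ne hne, hb, inv, if_neg ha']
      simp only [ha, hne, false_and, if_false, add_zero]
      split_ifs
      · rw [mul_smul_comm, ← bw_cons]
      · rw [mul_zero]

end TwoOperad

namespace TwoOperad
variable {k : Type u} [Field k]

/-! ## The isomorphism of complexes -/

/-- The map from `Breq` to the algebra of words that reorders the elementary intervals. -/
noncomputable def breqMap (k : Type u) [Field k] (L : List ℕ) (n : ℤ) : Breq k L n →ₗ[k] WAlg k :=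
  Finsupp.linearCombination k fun w => sgn k (inv w.1 : ℕ) • bw k w.1

lemma breqMap_single (L : List ℕ) (n : ℤ) (w : Config L n) :
    breqMap k L n (Finsupp.single w 1) = sgn k (inv w.1 : ℕ) • bw k w.1 := by
  simp [breqMap]

lemma degenerate_le_ker (L : List ℕ) (n : ℤ) :
    degenerate k L n ≤ LinearMap.ker (breqMap k L n) := by
  refine Submodule.span_le.2 ?_
  rintro _ ⟨w, hw, rfl⟩
  change breqMap k L n _ = 0
  rw [breqMap_single, bw_deg hw, smul_zero]

/-- The embedding of `Nor(Breq)` into the algebra of words. -/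
noncomputable def norMap (k : Type u) [Field k] (L : List ℕ) (n : ℤ) : Nor k L n →ₗ[k] WAlg k :=
  (degenerate k L n).liftQ (breqMap k L n) (degenerate_le_ker L n)

lemma norMap_toNor {L : List ℕ} {n : ℤ} (x : Breq k L n) :
    norMap k L n (toNor x) = breqMap k L n x := Submodule.liftQ_apply _ _ _

lemma norMap_injective (L : List ℕ) (n : ℤ) : Function.Injective (norMap k L n) := by
  rw [← LinearMap.ker_eq_bot]
  refine Submodule.ker_liftQ_eq_bot _ _ _ fun x hx => ?_
  have h0 : ∀ w : Config L n, ¬ IsDegenerate w.1 → x w = 0 := by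
    intro w hw
    have := congrArg (coefW w.1 hw) (LinearMap.mem_ker.1 hx)
    rw [breqMap, Finsupp.linearCombination_apply, Finsupp.sum, map_sum, map_zero,
      Finset.sum_eq_single w] at this
    · rw [map_smul, map_smul, coefW_bw, if_pos rfl] at this
      rcases sgn_eq_or (k := k) (inv w.1 : ℕ) with e | e <;> simpa [e] using this
    · intro v _ hv
      rw [map_smul, map_smul, coefW_bw, if_neg fun e => hv (Subtype.ext e)]
      simp
    · intro hw
      simp [Finsupp.notMem_support_iff.1 hw]
  rw [← Finsupp.sum_single x]
  refine Submodule.sum_mem _ fun w hw => ?_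
  rw [← mul_one (x w), ← smul_eq_mul, ← Finsupp.smul_single]
  refine Submodule.smul_mem _ _ (Submodule.subset_span ⟨w, ?_, rfl⟩)
  by_contra hn
  exact Finsupp.mem_support_iff.1 hw (h0 w hn)

/-- The span of the nondegenerate configurations. -/
noncomputable def configSpan (k : Type u) [Field k] (L : List ℕ) (n : ℤ) : Submodule k (WAlg k) :=
  Submodule.span k (bw k '' {w | (IsConfig L w ∧ -(dim w : ℤ) = n) ∧ ¬ IsDegenerate w})

lemma sgn_smul_mem {S : Submodule k (WAlg k)} {n : ℤ} {v : WAlg k} :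
    sgn k n • v ∈ S ↔ v ∈ S := by
  refine ⟨fun h => ?_, S.smul_mem _⟩
  have := S.smul_mem (sgn k n) h
  rwa [smul_smul, sgn_mul_self, one_smul] at this

lemma range_norMap (L : List ℕ) (n : ℤ) : LinearMap.range (norMap k L n) = configSpan k L n := by
  apply le_antisymm
  · rintro _ ⟨x, rfl⟩
    obtain ⟨x, rfl⟩ := Submodule.mkQ_surjective _ x
    change norMap k L n (toNor x) ∈ _
    rw [norMap_toNor]
    induction x using Finsupp.induction_linear with
    | zero => rw [map_zero]; exact Submodule.zero_mem _
    | add x y hx hy => rw [map_add]; exact Submodule.add_mem _ hx hy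
    | single w r =>
      rw [← mul_one r, ← smul_eq_mul, ← Finsupp.smul_single, map_smul, breqMap_single]
      refine Submodule.smul_mem _ _ (Submodule.smul_mem _ _ ?_)
      by_cases hw : IsDegenerate w.1
      · rw [bw_deg hw]; exact Submodule.zero_mem _
      · exact Submodule.subset_span ⟨w.1, ⟨w.2, hw⟩, rfl⟩
  · refine Submodule.span_le.2 ?_
    rintro _ ⟨w, ⟨hw, -⟩, rfl⟩
    change bw k w ∈ LinearMap.range (norMap k L n)
    rw [← sgn_smul_mem (n := (inv w : ℕ))]
    exact ⟨toNor (Finsupp.single (⟨w, hw⟩ : Config L n) 1),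
      (norMap_toNor _).trans (breqMap_single L n ⟨w, hw⟩)⟩

/-- Morphisms from `min` to `max` are spanned by basis elements, which go to plus or minus their
words, and these words are the nondegenerate configurations. So the image is that of `Nor(Breq)`. -/
lemma range_repT (L : List ℕ) (n : ℤ) :
    LinearMap.range ((repT k L).map : O k L n →ₗ[k] WAlg k) = configSpan k L n := by
  apply le_antisymm
  · rintro _ ⟨f, rfl⟩
    have hf : f ∈ Submodule.span k
        {g : O k L n | ∃ w, (basisT k L).rel (T.bot L) w ⟨T.top L, n, g⟩} := by
      rw [(basisT k L).span]; trivial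
    induction hf using Submodule.span_induction with
    | mem f hf =>
      obtain ⟨w, hw⟩ := hf
      rw [(basisT k L).map hw, sgn_smul_mem]
      exact Submodule.subset_span ⟨w, (isConfig_iff_rel (k := k)).2 ⟨f, hw⟩, rfl⟩
    | zero => rw [map_zero]; exact Submodule.zero_mem _
    | add x y _ _ hx hy => rw [map_add]; exact Submodule.add_mem _ hx hy
    | smul r x _ hx => rw [map_smul]; exact Submodule.smul_mem _ r hx
  · refine Submodule.span_le.2 ?_
    rintro _ ⟨w, hw, rfl⟩
    change bw k w ∈ LinearMap.range _
    obtain ⟨f, hf⟩ := (isConfig_iff_rel (k := k)).1 hw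
    rw [← sgn_smul_mem (n := n)]
    exact ⟨f, (basisT k L).map hf⟩

/-- The isomorphism from `Nor(Breq)` to the twisted tensor product 2-operad. -/
noncomputable def phi (k : Type u) [Field k] (L : List ℕ) (n : ℤ) : Nor k L n ≃ₗ[k] O k L n :=
  LinearEquiv.ofInjective (norMap k L n) (norMap_injective L n) ≪≫ₗ
    LinearEquiv.ofEq _ _ ((range_norMap L n).trans (range_repT L n).symm) ≪≫ₗ
    (LinearEquiv.ofInjective ((repT k L).map : O k L n →ₗ[k] WAlg k) repT_map_injective).symm

lemma map_phi {L : List ℕ} {n : ℤ} (x : Nor k L n) :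
    (repT k L).map (phi k L n x) = norMap k L n x := by
  have := LinearEquiv.apply_symm_apply
    (LinearEquiv.ofInjective ((repT k L).map : O k L n →ₗ[k] WAlg k) repT_map_injective)
    (LinearEquiv.ofEq _ _ ((range_norMap L n).trans (range_repT L n).symm)
      (LinearEquiv.ofInjective (norMap k L n) (norMap_injective L n) x))
  exact congrArg Subtype.val this

open Classical in
/-- The projection to the span of the configurations. -/
noncomputable def projW (k : Type u) [Field k] (L : List ℕ) (n : ℤ) : WAlg k →ₗ[k] WAlg k :=
  WAlg.lift (fun w => if IsConfig L w ∧ -(dim w : ℤ) = n then bw k w else 0)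
    fun w h => by rw [bw_deg h, ite_self]

lemma projW_of_mem {L : List ℕ} {n : ℤ} {v : WAlg k} (h : v ∈ configSpan k L n) :
    projW k L n v = v := by
  induction h using Submodule.span_induction with
  | mem x hx =>
    obtain ⟨w, hw, rfl⟩ := hx
    rw [projW, WAlg.lift_bw, if_pos hw.1]
  | zero => exact map_zero _
  | add x y _ _ hx hy => rw [map_add, hx, hy]
  | smul r x _ hx => rw [map_smul, hx]

/-- Makes it unnecessary to show that deletions and compositions of configurations are
configurations again: `ofWord` discards other words, which amounts to applying `projW`, and on the
image of `O` this projection is the identity. -/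
lemma projW_map {L : List ℕ} {n : ℤ} (f : O k L n) :
    projW k L n ((repT k L).map f) = (repT k L).map f :=
  projW_of_mem ((range_repT (k := k) L n).le ⟨f, rfl⟩)

lemma breqMap_ofWord (L : List ℕ) (n : ℤ) (w : List Letter) :
    breqMap k L n (ofWord k L n w) = projW k L n (sgn k (inv w : ℕ) • bw k w) := by
  rw [map_smul, projW, WAlg.lift_bw, ofWord]
  split_ifs with h
  · exact breqMap_single L n ⟨w, h⟩
  · simp

lemma breqMap_breqD (L : List ℕ) (n : ℤ) (x : Breq k L n) :
    breqMap k L (n + 1) (breqD k L n x) = projW k L (n + 1) (dW (breqMap k L n x)) := by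
  suffices H : breqMap k L (n + 1) ∘ₗ breqD k L n =
      projW k L (n + 1) ∘ₗ dW ∘ₗ breqMap k L n from LinearMap.congr_fun H x
  refine Finsupp.lhom_ext' fun w => LinearMap.ext_ring ?_
  simp only [LinearMap.comp_apply, Finsupp.lsingle_apply, breqMap_single, map_smul, dW_bw]
  rw [← map_smul, ← sum_delete, breqD, Finsupp.linearCombination_single, one_smul, map_sum, map_sum]
  refine Finset.sum_congr rfl fun t _ => ?_
  split_ifs
  · rw [map_smul, breqMap_ofWord, ← map_smul, sgn_smul_smul]
    push_cast
    rfl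
  · simp

lemma phi_d {L : List ℕ} {n : ℤ} (x : Breq k L n) :
    phi k L (n + 1) (toNor (breqD k L n x)) = (T k L).d rfl (phi k L n (toNor x)) := by
  apply repT_map_injective
  rw [map_phi, norMap_toNor, breqMap_breqD, ← norMap_toNor, ← map_phi, ← (repT k L).map_d rfl,
    projW_map]

lemma phi_monomial {L : List ℕ} {n : ℤ} (w : Config L n) (h : ¬ IsDegenerate w.1) :
    ∃ f : O k L n, IsMonomial L f w.1 ∧ (phi k L n (toNor (Finsupp.single w 1)) = f ∨
      phi k L n (toNor (Finsupp.single w 1)) = -f) := by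
  obtain ⟨f, hf⟩ := (isConfig_iff_rel (k := k)).1 ⟨w.2, h⟩
  refine ⟨f, isMonomial_of_rel L hf, ?_⟩
  -- The sign combines that of the inversions, from the embedding of `Nor(Breq)`, with the sign of
  -- the degree, which relates a basis element to its word.
  have : (repT k L).map (phi k L n (toNor (Finsupp.single w 1))) =
      sgn k ((inv w.1 : ℕ) + n) • (repT k L).map f := by
    rw [map_phi, norMap_toNor, breqMap_single, (basisT k L).map hf, sgn_smul_smul, add_assoc,
      sgn_add _ (n + n), sgn_add n n, sgn_mul_self, mul_one]
  rcases sgn_eq_or (k := k) ((inv w.1 : ℕ) + n) with e | e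
  · left
    apply repT_map_injective
    rw [this, e, one_smul]
  · right
    apply repT_map_injective
    rw [this, e, map_neg, neg_smul, one_smul]

lemma phi_unit : phi k Disk.unit.heights 0 (toNor (Finsupp.single unitWord 1)) = unitO k := by
  apply repT_map_injective
  rw [map_phi, norMap_toNor]
  refine (breqMap_single _ _ unitWord).trans ?_
  have h1 : sgn k (inv unitWord.1 : ℕ) = 1 := sgn_zero (k := k)
  rw [h1]
  exact congrArg (fun w => (1 : k) • insW (k := k) [] w) (WordBasis.ivWord_edge 0 (n := 1) (i := 0) (j := 1)
    rfl).symm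

end TwoOperad

namespace TwoOperad
variable {k : Type u} [Field k]

/-! ## The associativity constraints in the algebra of words -/

/-- The shift of the columns of the letters. -/
def shiftL (s : ℕ) (a : Letter) : Letter := (s + a.1, a.2)

lemma shiftL_injective (s : ℕ) : Function.Injective (shiftL s) := by
  rintro ⟨a, b⟩ ⟨c, d⟩ h
  simp only [shiftL, Prod.mk.injEq] at h ⊢
  omega

lemma HT_relabel {ρ : Letter → Letter} (hρ : Function.Injective ρ) {lo hi lo' hi' : ℕ → ℕ}
    (h : lo ≤ hi → lo' ≤ hi') (h' : lo ≤ hi → ρ '' btw lo hi = btw lo' hi') {n : ℤ} {v : WAlg k}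
    (hv : v ∈ HT k lo hi n) : relabel ρ v ∈ HT k lo' hi' n := by
  rw [mem_HT] at hv ⊢
  rcases hv with rfl | hv
  · left; simp
  · right
    refine ⟨h hv.1, ?_⟩
    rw [← h' hv.1]
    exact relabel_mem_HW hρ.injOn hv.2

namespace Rep

/-- The shift of the columns of a representation. -/
noncomputable def shift {D : DGCat k} (R : Rep D) (s : ℕ) : Rep D where
  len := s + R.len
  co x c := if c < s then 0 else R.co x (c - s)
  co_eq x c h := by
    rw [if_neg (by omega)]
    exact R.co_eq x _ (by omega)
  map := (relabel (shiftL s) : WAlg k →ₗ[k] WAlg k) ∘ₗ R.map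
  map_one x := by simp [R.map_one, relabel_one]
  map_comp h f g := by simp [R.map_comp, relabel_mul]
  map_d h f := by
    rw [LinearMap.comp_apply, LinearMap.comp_apply, R.map_d,
      dW_relabel (shiftL_injective s).injOn (HT.mem_HW (R.mem f))]
  mem {x y n} f := by
    refine HT_relabel (shiftL_injective s) ?_ ?_ (R.mem f)
    · intro h c
      by_cases hc : c < s
      · simp [hc]
      · simpa [hc] using h _
    · intro h
      ext ⟨a, b⟩
      simp only [btw, shiftL, Set.mem_image, Prod.exists, Set.mem_ofPred_eq, Prod.mk.injEq]
      constructor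
      · rintro ⟨c, d, h1, rfl, rfl⟩
        rw [if_neg (by omega), if_neg (by omega), Nat.add_sub_cancel_left]
        exact h1
      · rintro h1
        have : ¬ a < s := fun h2 => by rw [if_pos h2, if_pos h2] at h1; omega
        rw [if_neg this, if_neg this] at h1
        exact ⟨a - s, b, h1, by omega, rfl⟩

lemma not_mem_btw {D : DGCat k} (R : Rep D) {w : List Letter} (hw : ∀ a ∈ w, R.len ≤ a.1) (x y : D.Obj) :
    ∀ a ∈ w, a ∉ btw (R.co x) (R.co y) := fun a ha hb => by
  have h1 := R.co_eq y a.1 (hw a ha)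
  have h2 : a.2 < R.co y a.1 := hb.2
  omega

lemma insW_seq_mem {D : DGCat k} (R : Rep D) {x y : D.Obj} (c : Chain D x y) {w : List Letter}
    (hw : ∀ a ∈ w, R.len ≤ a.1) (hn : w.Nodup) :
    insW (R.seq c) w ∈ HW k ({a | a ∈ w} ∪ btw (R.co x) (R.co y)) c.deg := by
  rcases R.good_seq c with h | h
  · have := insW_mem h.2 (R.not_mem_btw hw x y)
    rwa [dim_nodup hn, Nat.cast_zero, neg_zero, zero_add, bdeg_seq] at this
  · rw [h]; exact Submodule.zero_mem _

lemma insN_map_mul_insW {D : DGCat k} (R : Rep D) (c : List (ℤ × WAlg k)) {x y z : D.Obj} {m : ℤ}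
    (g : D.Hom x y m) (gs : Chain D y z) {w : List Letter} (hw : ∀ a ∈ w, R.len ≤ a.1)
    (hn : w.Nodup) :
    insN c (R.map g * insW (R.seq gs) w) = ((lsplits c).map fun s =>
      sgn k (gs.deg * bdeg s.1) • (insN s.1 (R.map g) * insN s.2 (insW (R.seq gs) w))).sum := by
  refine insN_mul c ?_ (HT.mem_HW (R.mem g)) (R.insW_seq_mem gs hw hn)
  rw [Set.disjoint_union_right]
  exact ⟨Set.disjoint_left.2 fun a ha hb => R.not_mem_btw hw x y a hb ha, btw_disjoint _ _ _⟩

/-- There are three possibilities at the leading letter `l`: first `h` is inserted there, first `g`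
is, or neither. They are the three summands. -/
lemma insN_cons_insW {D : DGCat k} (R : Rep D) (h : ℤ × WAlg k) (c : List (ℤ × WAlg k))
    {x y z : D.Obj} {m : ℤ}
    (g : D.Hom x y m) (gs : Chain D y z) {l : Letter} {w : List Letter}
    (hw : ∀ a ∈ l :: w, R.len ≤ a.1) (hn : (l :: w).Nodup) :
    insN (h :: c) (insW (R.seq (Chain.cons g gs)) (l :: w)) =
      -(sgn k ((m - 1 + gs.deg) * (h.1 - 1)) • (bw k [l] * (h.2 *
        insN c (insW (R.seq (Chain.cons g gs)) (l :: w))))) -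
      bw k [l] * insN (h :: c) (R.map g * insW (R.seq gs) (l :: w)) +
      bw k [l] * insN (h :: c) (insW (R.seq (Chain.cons g gs)) w) := by
  have hw' : ∀ a ∈ w, R.len ≤ a.1 := fun a ha => hw a (List.mem_cons_of_mem _ ha)
  have h1 : R.map g * insW (R.seq gs) (l :: w) ∈ HW k _ (m + gs.deg) :=
    mul_mem_HW (B := {a | a ∈ l :: w} ∪ btw (R.co y) (R.co z)) (by
      rw [Set.disjoint_union_right]
      exact ⟨Set.disjoint_left.2 fun a ha hb => R.not_mem_btw hw x y a hb ha, btw_disjoint _ _ _⟩)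
      (HT.mem_HW (R.mem g)) (R.insW_seq_mem gs hw hn)
  have h2 := R.insW_seq_mem (Chain.cons g gs) hw' (List.nodup_cons.1 hn).2
  have e1 := insN_cons_mul h c l (e := m - 1 + gs.deg) (fun _ => by omega)
    (fun h3 => absurd (Or.inr (Or.inl (List.mem_cons_self ..))) h3) h1
  have e2 := insN_cons_mul h c l (e := m - 1 + gs.deg)
    (fun h3 => (h3.elim (fun h4 => (List.nodup_cons.1 hn).1 h4)
      (R.not_mem_btw hw x z l (List.mem_cons_self ..))).elim) (fun _ => rfl) h2
  rw [R.seq_cons] at e2 ⊢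
  rw [insW_nodup _ _ hn, map_add, map_neg, e1, e2, map_add, map_neg]
  simp only [mul_add, mul_neg, smul_add, smul_neg]
  abel

end Rep

namespace Chain

variable {A D E : DGCat k} (RA : Rep A) (RD : Rep D) (RE : Rep E) (po : D.Obj → E.Obj → A.Obj)
  (emb : ∀ (x : D.Obj) {y y' : E.Obj} {n : ℤ}, E.Hom y y' n → A.Hom (po x y) (po x y') n)
  (φ : ∀ {x x' : D.Obj} {y y' : E.Obj} {n : ℤ}, D.Hom x x' n → ∀ c : Chain E y y',
    A.Hom (po x y) (po x' y') (n + c.deg))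

/-- The image in the algebra of words of a signed sum of chains. -/
noncomputable def termSum {X Y : A.Obj} {s : ℤ} (l : List (Term A X Y s)) (w : List Letter) :
    WAlg k :=
  (l.map fun t => sgn k t.sign • insW (RA.seq t.chain) w).sum

lemma seq_mapTerm {po : E.Obj → A.Obj}
    {emb : ∀ {y y' : E.Obj} {n : ℤ}, E.Hom y y' n → A.Hom (po y) (po y') n}
    (hemb : ∀ {y y' : E.Obj} {n : ℤ} (h : E.Hom y y' n), RA.map (emb h) = RE.map h) :
    ∀ {y y' : E.Obj} (c : Chain E y y'), RA.seq (mapTerm (po := po) emb c).chain = RE.seq c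
  | _, _, nil y => rfl
  | _, _, cons g c => by
    simp only [mapTerm, Rep.seq_cons, hemb, seq_mapTerm hemb c]

variable {po emb φ RA RD RE}

/-- The terms of `insertCons` in which the first entry comes from the first chain. -/
noncomputable def headSum (RA : Rep A) (φ : ∀ {x x' : D.Obj} {y y' : E.Obj} {n : ℤ}, D.Hom x x' n → ∀ c : Chain E y y',
    A.Hom (po x y) (po x' y') (n + c.deg)) {x x₁ x' : D.Obj} {m : ℤ} (g : D.Hom x x₁ m) (s : ℤ)
    (rec : ∀ {y y' : E.Obj} (c : Chain E y y'), List (Term A (po x₁ y) (po x' y') (s + c.deg)))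
    {y y' : E.Obj} (c : Chain E y y') (w : List Letter) : WAlg k :=
  (c.splits.map fun S => sgn k (s * S.left.deg) • ((rec S.right).map fun t =>
    sgn k t.sign • insW ((m + S.left.deg, RA.map (φ g S.left)) :: RA.seq t.chain) w).sum).sum

lemma sum_flatMap {ι V : Type*} [AddCommMonoid V] (l : List ι) (f : ι → List V) :
    (l.flatMap f).sum = (l.map fun i => (f i).sum).sum := by
  induction l with
  | nil => rfl
  | cons a l ih => simp [ih]

lemma termSum_insertCons_nil {x x₁ x' : D.Obj} {m : ℤ} (g : D.Hom x x₁ m) (s : ℤ)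
    (rec : ∀ {y y' : E.Obj} (c : Chain E y y'), List (Term A (po x₁ y) (po x' y') (s + c.deg)))
    (y : E.Obj) (w : List Letter) :
    termSum RA (insertCons po emb φ g s rec (nil y)) w = headSum RA φ g s rec (nil y) w := by
  simp only [termSum, insertCons, headSum, List.map_append, List.sum_append, List.map_flatMap,
    sum_flatMap, List.map_map, Function.comp_def, Rep.seq_cons, sgn_add, List.map_nil, List.sum_nil,
    add_zero, mul_smul, ← smul_list_sum]

lemma termSum_insertCons_cons (hemb : ∀ x {y y' : E.Obj} {n : ℤ} (h : E.Hom y y' n),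
      RA.map (emb x h) = RE.map h)
    {x x₁ x' : D.Obj} {m : ℤ} (g : D.Hom x x₁ m) (s : ℤ)
    (rec : ∀ {y y' : E.Obj} (c : Chain E y y'), List (Term A (po x₁ y) (po x' y') (s + c.deg)))
    {y z y' : E.Obj} {n : ℤ} (h : E.Hom y z n) (c : Chain E z y') (w : List Letter) :
    termSum RA (insertCons po emb φ g s rec (cons h c)) w = headSum RA φ g s rec (cons h c) w +
      sgn k ((m - 1 + s) * (n - 1)) • ((insertCons po emb φ g s rec c).map fun t =>
        sgn k t.sign • insW ((n, RE.map h) :: RA.seq t.chain) w).sum := by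
  rw [termSum, insertCons]
  simp only [headSum, List.map_append, List.sum_append, List.map_flatMap,
    sum_flatMap, List.map_map, Function.comp_def, Rep.seq_cons, sgn_add, hemb, mul_smul,
    ← smul_list_sum]

lemma sum_insW_nodup {ι : Type*} (L : List ι) (r : ι → k) (g : ℤ × WAlg k)
    (q : ι → List (ℤ × WAlg k)) {l : Letter} {w : List Letter} (hn : (l :: w).Nodup) :
    (L.map fun t => r t • insW (g :: q t) (l :: w)).sum =
      -(bw k [l] * (g.2 * (L.map fun t => r t • insW (q t) (l :: w)).sum)) +
      bw k [l] * (L.map fun t => r t • insW (g :: q t) w).sum := by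
  simp only [Rep.insW_nodup _ _ hn, smul_add, smul_neg, sum_map_add, mul_list_sum, mul_smul_comm,
    sum_map_neg_smul]

/-- The first entry of the inserted chain is `g` with a subchain inserted in it, and it is either
placed at `l` or later. In the former case the sum over the splittings is the product rule for
insertion into `g` times the rest. -/
lemma headSum_cons (hφ : ∀ {x x' : D.Obj} {y y' : E.Obj} {n : ℤ} (g : D.Hom x x' n)
      (c : Chain E y y'), RA.map (φ g c) = insN (RE.seq c) (RD.map g))
    {x x₁ x' : D.Obj} {m : ℤ} (g : D.Hom x x₁ m) (gs : Chain D x₁ x')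
    (rec : ∀ {y y' : E.Obj} (c : Chain E y y'),
      List (Term A (po x₁ y) (po x' y') (gs.deg + c.deg)))
    (hrec : ∀ {y y' : E.Obj} (c : Chain E y y') {w : List Letter}, (∀ a ∈ w, RD.len ≤ a.1) →
      w.Nodup → insN (RE.seq c) (insW (RD.seq gs) w) = termSum RA (rec c) w)
    {y y' : E.Obj} (c : Chain E y y') {l : Letter} {w : List Letter}
    (hw : ∀ a ∈ l :: w, RD.len ≤ a.1) (hn : (l :: w).Nodup) :
    headSum RA φ g gs.deg rec c (l :: w) =
      -(bw k [l] * insN (RE.seq c) (RD.map g * insW (RD.seq gs) (l :: w))) +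
      bw k [l] * headSum RA φ g gs.deg rec c w := by
  rw [RD.insN_map_mul_insW _ _ _ hw hn, Rep.seq_splits, headSum, headSum]
  simp only [sum_insW_nodup _ _ _ _ hn, smul_add, smul_neg, sum_map_add, mul_list_sum,
    mul_smul_comm, sum_map_neg_smul, List.map_map, Function.comp_def, Rep.bdeg_seq, hrec _ hw hn,
    hφ, termSum]

/-- Both sides satisfy the same recursion, on the word and then on the chain `c`: at the leading
letter either the first entry of `c` or the first entry of `g :: gs` is inserted, or the letter is
passed. -/
lemma insN_insertCons (hemb : ∀ x {y y' : E.Obj} {n : ℤ} (h : E.Hom y y' n),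
      RA.map (emb x h) = RE.map h)
    (hφ : ∀ {x x' : D.Obj} {y y' : E.Obj} {n : ℤ} (g : D.Hom x x' n)
      (c : Chain E y y'), RA.map (φ g c) = insN (RE.seq c) (RD.map g))
    {x x₁ x' : D.Obj} {m : ℤ} (g : D.Hom x x₁ m) (gs : Chain D x₁ x')
    (rec : ∀ {y y' : E.Obj} (c : Chain E y y'),
      List (Term A (po x₁ y) (po x' y') (gs.deg + c.deg)))
    (hrec : ∀ {y y' : E.Obj} (c : Chain E y y') {w : List Letter}, (∀ a ∈ w, RD.len ≤ a.1) →
      w.Nodup → insN (RE.seq c) (insW (RD.seq gs) w) = termSum RA (rec c) w)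
    {y y' : E.Obj} (c : Chain E y y') {w : List Letter} (hw : ∀ a ∈ w, RD.len ≤ a.1)
    (hn : w.Nodup) : insN (RE.seq c) (insW (RD.seq (cons g gs)) w) =
      termSum RA (insertCons po emb φ g gs.deg rec c) w := by
  induction w generalizing y y' with
  | nil =>
    rw [RD.seq_cons, insW_cons_nil, map_zero]
    cases c with
    | nil => rw [termSum_insertCons_nil]; simp [headSum, insW_cons_nil]
    | cons h c => rw [termSum_insertCons_cons hemb]; simp [headSum, insW_cons_nil]
  | cons l w ih =>
    have ih' := fun {y y'} (c : Chain E y y') =>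
      ih c (fun a ha => hw a (List.mem_cons_of_mem _ ha)) (List.nodup_cons.1 hn).2
    induction c with
    | nil y =>
      have := ih' (nil y)
      rw [termSum_insertCons_nil, RE.seq_nil, insN_nil_apply] at this
      rw [termSum_insertCons_nil, headSum_cons hφ _ _ _ hrec _ hw hn, ← this, RE.seq_nil,
        insN_nil_apply, insN_nil_apply, RD.seq_cons, Rep.insW_nodup _ _ hn]
    | @cons y z y' n h c ihc =>
      have := ih' (cons h c)
      rw [termSum_insertCons_cons hemb] at this
      rw [termSum_insertCons_cons hemb, headSum_cons hφ _ _ _ hrec _ hw hn,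
        sum_insW_nodup _ _ _ _ hn, RE.seq_cons, RD.insN_cons_insW _ _ _ _ hw hn, ← RE.seq_cons,
        this, ihc, termSum]
      simp only [mul_add, smul_add, smul_neg, mul_smul_comm]
      abel

/-- When `c` is inserted into a word that results from the insertion of `gs`, the entries of `c`
placed inside the image of `g_i` form a consecutive subchain `c_i`, and those placed at letters of
the original word become separate entries in between. This is the rule for the associativity
constraint on an `ε` of an `ε`. -/
lemma insN_insert (hemb : ∀ x {y y' : E.Obj} {n : ℤ} (h : E.Hom y y' n),
      RA.map (emb x h) = RE.map h)
    (hφ : ∀ {x x' : D.Obj} {y y' : E.Obj} {n : ℤ} (g : D.Hom x x' n)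
      (c : Chain E y y'), RA.map (φ g c) = insN (RE.seq c) (RD.map g))
    {x x' : D.Obj} (gs : Chain D x x') {y y' : E.Obj} (c : Chain E y y') {w : List Letter}
    (hw : ∀ a ∈ w, RD.len ≤ a.1) (hn : w.Nodup) :
    insN (RE.seq c) (insW (RD.seq gs) w) = termSum RA (insert po emb φ gs c) w := by
  induction gs generalizing y y' w with
  | nil x =>
    rw [RD.seq_nil, insW_nil, insN_bw, insert, termSum]
    simp [sgn_zero, seq_mapTerm RA RE (emb := emb x) (hemb x)]
  | cons g gs ih => exact insN_insertCons hemb hφ g gs _ (fun c w hw hn => ih c hw hn) c hw hn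

end Chain

end TwoOperad

-- Existence and uniqueness of the associativity constraints

namespace TwoOperad
variable {k : Type u} [Field k]

lemma T.hom_ind {n : ℕ} {L : List ℕ}
    {P : ∀ {X Y : (T k (n :: L)).Obj} {p : ℤ}, (T k (n :: L)).Hom X Y p → Prop}
    (zero : ∀ (X Y : (T k (n :: L)).Obj) p, P (0 : (T k (n :: L)).Hom X Y p))
    (add : ∀ {X Y p} {f g : (T k (n :: L)).Hom X Y p}, P f → P g → P (f + g))
    (smul : ∀ (r : k) {X Y p} {f : (T k (n :: L)).Hom X Y p}, P f → P (r • f))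
    (comp : ∀ {X Y Z p q s} (h : p + q = s) {f : (T k (n :: L)).Hom X Y p}
      {g : (T k (n :: L)).Hom Y Z q}, P f → P g → P ((T k (n :: L)).comp h f g))
    (right : ∀ (i : Fin (n + 1)) {x y : (T k L).Obj} {p : ℤ} (g : (T k L).Hom x y p),
      P ((T.right i).map g))
    (eps : ∀ (i : Fin n) {x y : (T k L).Obj} {p : ℤ} (c : Chain (T k L) x y)
      (hp : 0 + c.deg = p), P (T.eps (interval.gen k i) c hp))
    {X Y : (T k (n :: L)).Obj} {p : ℤ} (f : (T k (n :: L)).Hom X Y p) : P f := by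
  have H : ∀ {X Y : (tw (interval k n) (T k L)).Obj} {p : ℤ}
      {f : (tw (interval k n) (T k L)).Hom X Y p}, Generated f → P f := by
    intro X Y p f hf
    induction hf with
    | zero => exact zero _ _ _
    | add _ _ h h' => exact add h h'
    | smul r _ h => exact smul r h
    | comp h _ _ hf hg => exact comp h hf hg
    | right i g => exact right i g
    | @eps i j h x y p c hp =>
      obtain ⟨i, hi⟩ := i
      obtain ⟨j, hj⟩ := j
      simp only at h
      subst h
      exact eps ⟨i, Nat.lt_of_succ_lt_succ hj⟩ c hp
  exact H (Generated.all f)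

/-- Morphisms of `T k L` can be defined by their words: a linear map to `WAlg` with values in the
image of a faithful representation lifts. -/
lemma exists_lift {V W : Type u} [AddCommGroup V] [Module k V] [AddCommGroup W] [Module k W]
    {G : W →ₗ[k] WAlg k} (hG : Function.Injective G) (F : V →ₗ[k] WAlg k)
    (h : ∀ v, F v ∈ LinearMap.range G) : ∃ E : V →ₗ[k] W, ∀ v, G (E v) = F v :=
  ⟨(LinearEquiv.ofInjective G hG).symm.toLinearMap ∘ₗ F.codRestrict _ h, fun v =>
    congrArg Subtype.val ((LinearEquiv.ofInjective G hG).apply_symm_apply ⟨F v, h v⟩)⟩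

section ext

variable (cs L : List ℕ)

/-- The representation of the left columns of `cs ++ L`. -/
noncomputable def repS (k : Type u) [Field k] (cs L : List ℕ) : Rep (T k cs) :=
  (repT k cs).shift L.length

variable {cs L}

lemma repS_len : (repS k cs L).len = (cs ++ L).length := by
  simp only [repS, Rep.shift, repT_len, List.length_append, Nat.add_comm]

lemma repS_seq : ∀ {x x' : (T k cs).Obj} (gs : Chain (T k cs) x x'),
    (repS k cs L).seq gs = relabelSeq (shiftL L.length) ((repT k cs).seq gs)
  | _, _, .nil _ => rfl
  | _, _, .cons _ gs => congrArg (_ :: ·) (repS_seq gs)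

lemma map_shiftL_ivWord (s c i j : ℕ) : (ivWord c i j).map (shiftL s) = ivWord (s + c) i j := by
  simp only [ivWord, List.map_map]
  rfl

lemma repT_eps {n : ℕ} {i j : Fin (n + 1)} {y w : (T k L).Obj} {m p : ℤ}
    (f : (interval k n).Hom i j m) (c : Chain (T k L) y w) (h : m + c.deg = p) :
    (repT k (n :: L)).map (T.eps f c h) =
      interval.val f • insW ((repT k L).seq c) (ivWord L.length i.1 j.1) := by
  rw [← repT_len (k := k)]
  rfl

lemma repS_eps {n : ℕ} {i j : Fin (n + 1)} {x x' : (T k cs).Obj} {m p : ℤ}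
    (f : (interval k n).Hom i j m) (gs : Chain (T k cs) x x') (h : m + gs.deg = p) :
    (repS k (n :: cs) L).map (T.eps f gs h) =
      interval.val f • insW ((repS k cs L).seq gs) (ivWord (cs ++ L).length i.1 j.1) := by
  change relabel (shiftL L.length) ((repT k (n :: cs)).map (T.eps f gs h)) = _
  rw [repT_eps, map_smul, relabel_insW (shiftL_injective _).injOn, map_shiftL_ivWord, repS_seq,
    List.length_append, Nat.add_comm]

/-- The associativity constraint applied to `ε(f; c)`, in the algebra of words. -/
noncomputable def extW (cs L : List ℕ) {y y' : (T k L).Obj} (c : Chain (T k L) y y')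
    {x x' : (T k cs).Obj} {n : ℤ} : (T k cs).Hom x x' n →ₗ[k] WAlg k :=
  insN ((repT k L).seq c) ∘ₗ (repS k cs L).map

lemma extW_comp {x x' x'' : (T k cs).Obj} {y w : (T k L).Obj} {m n q : ℤ}
    (f : (T k cs).Hom x x' m) (f' : (T k cs).Hom x' x'' n) (c : Chain (T k L) y w)
    (hq : m + n = q) : extW cs L c ((T k cs).comp hq f f') =
      (c.splits.map fun S => sgn k (n * S.left.deg) •
        (extW cs L S.left f * extW cs L S.right f')).sum := by
  simp only [extW, LinearMap.comp_apply, Rep.map_comp]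
  rw [insN_mul _ (btw_disjoint _ _ _) (HT.mem_HW (Rep.mem _ f)) (HT.mem_HW (Rep.mem _ f')),
    Rep.seq_splits, List.map_map]
  simp only [Function.comp_def, Rep.bdeg_seq]

/-- The maps `φ` and `emb` are left arbitrary, with prescribed images in `WAlg`, so that the lemma
serves both the constraint constructed here and the one of any given `Plugging`. -/
lemma extW_eps (φ : ∀ {x x' : (T k cs).Obj} {y y' : (T k L).Obj} {n : ℤ}, (T k cs).Hom x x' n →
      ∀ c : Chain (T k L) y y', (T k (cs ++ L)).Hom (T.pair x y) (T.pair x' y') (n + c.deg))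
    (emb : ∀ (x : (T k cs).Obj) {y y' : (T k L).Obj} {n : ℤ}, (T k L).Hom y y' n →
      (T k (cs ++ L)).Hom (T.pair x y) (T.pair x y') n)
    (hemb : ∀ x {y y' : (T k L).Obj} {n : ℤ} (h : (T k L).Hom y y' n),
      (repT k (cs ++ L)).map (emb x h) = (repT k L).map h)
    (hφ : ∀ {x x' : (T k cs).Obj} {y y' : (T k L).Obj} {n : ℤ} (g : (T k cs).Hom x x' n)
      (c : Chain (T k L) y y'), (repT k (cs ++ L)).map (φ g c) = extW cs L c g)
    {n : ℕ} {i j : Fin (n + 1)} {x x' : (T k cs).Obj} {y w : (T k L).Obj} {m q p : ℤ}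
    (f : (interval k n).Hom i j m) (gs : Chain (T k cs) x x') (c : Chain (T k L) y w)
    (hq : m + gs.deg = q) (hp : q + c.deg = p) :
    extW (n :: cs) L c (T.eps f gs hq) =
      (repT k (n :: (cs ++ L))).map ((Chain.insert T.pair emb φ gs c).map
        fun t => sgn k t.sign • T.eps (L := cs ++ L) f t.chain
          (show m + t.chain.deg = p by have := t.deg_eq; omega)).sum := by
  rw [map_list_sum (repT k (n :: (cs ++ L))).map]
  simp only [map_smul]
  rw [extW, LinearMap.comp_apply, repS_eps, map_smul,
    Chain.insN_insert (RA := repT k (cs ++ L)) (po := T.pair) (emb := emb) (φ := φ) hemb hφ gs c _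
    (ivWord_nodup _ _ _)]
  · rw [Chain.termSum, smul_list_sum]
    refine congrArg List.sum (List.map_congr_left fun t _ => ?_)
    rw [smul_comm]
    exact congrArg _ (repT_eps _ _ _).symm
  · intro a ha
    rw [repS_len]
    exact (mem_ivWord.1 ha).1.ge

/-- Tensoring with identities adds no letters, and the columns of `L`, which are counted from the
left, keep their numbers. -/
lemma repT_embed : ∀ (cs L : List ℕ) (x : (T k cs).Obj) {y y' : (T k L).Obj} {n : ℤ}
    (h : (T k L).Hom y y' n),
    (repT k (cs ++ L)).map ((T.embed cs L x).map h) = (repT k L).map h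
  | [], _, _, _, _, _, _ => rfl
  | _ :: cs, L, x, _, _, _, h => repT_embed cs L (T.snd x) h

lemma exists_ext_of_mem {cs L : List ℕ}
    (H : ∀ {x x' : (T k cs).Obj} {n : ℤ} (f : (T k cs).Hom x x' n) {y y' : (T k L).Obj} {p : ℤ}
      (c : Chain (T k L) y y') (_ : n + c.deg = p),
      extW cs L c f ∈ LinearMap.range ((repT k (cs ++ L)).map :
        (T k (cs ++ L)).Hom (T.pair x y) (T.pair x' y') p →ₗ[k] WAlg k)) :
    ∃ E : ∀ {x x' : (T k cs).Obj} {y y' : (T k L).Obj} {n p : ℤ}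
    (c : Chain (T k L) y y'), n + c.deg = p →
    ((T k cs).Hom x x' n →ₗ[k] (T k (cs ++ L)).Hom (T.pair x y) (T.pair x' y') p),
    ∀ {x x' : (T k cs).Obj} {y y' : (T k L).Obj} {n p : ℤ}
    (c : Chain (T k L) y y') (h : n + c.deg = p) (f : (T k cs).Hom x x' n),
    (repT k (cs ++ L)).map (E c h f) = extW cs L c f := by
  have := fun {x x' : (T k cs).Obj} {y y' : (T k L).Obj} {n p : ℤ} (c : Chain (T k L) y y')
    (h : n + c.deg = p) => exists_lift (repT_map_injective (x := T.pair x y) (y := T.pair x' y')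
      (m := p)) (extW cs L c : (T k cs).Hom x x' n →ₗ[k] WAlg k) fun f => H f c h
  exact ⟨fun c h => (this c h).choose, fun c h => (this c h).choose_spec⟩

/-- Checked on generators by induction on the columns. For composites the image is a sum of
composites, for `id ⊗ g` it comes from one column less, and for `ε` it is a sum of elements `ε` by
`extW_eps`. Over the unit category, insertion of a nonempty chain into a scalar multiple of the
empty word vanishes. -/
lemma extW_mem_range (cs L : List ℕ) {x x' : (T k cs).Obj} {n : ℤ} (f : (T k cs).Hom x x' n)
    {y y' : (T k L).Obj} {p : ℤ} (c : Chain (T k L) y y') (h : n + c.deg = p) :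
    extW cs L c f ∈ LinearMap.range ((repT k (cs ++ L)).map :
      (T k (cs ++ L)).Hom (T.pair x y) (T.pair x' y') p →ₗ[k] WAlg k) := by
  induction cs generalizing n y y' p with
  | nil =>
    have e : extW [] L c f = interval.val f • insN ((repT k L).seq c) 1 := by
      change insN _ (relabel _ (interval.val f • (1 : WAlg k))) = _
      rw [map_smul, map_smul, relabel_one]
    rw [e]
    cases c with
    | cons g c => rw [Rep.seq_cons, insN_one_cons, smul_zero]; exact Submodule.zero_mem _
    | nil =>
      by_cases hn : n = 0
      · subst hn
        obtain rfl : 0 = p := h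
        exact Submodule.smul_mem _ _ ⟨(T k L).one _, ((repT k L).map_one _).trans
          (insN_nil_apply 1).symm⟩
      · rw [interval.val_eq_zero f fun h' => hn h'.2, zero_smul]
        exact Submodule.zero_mem _
  | cons m cs ih =>
    -- The constraint for the shorter list is needed as an operation on morphisms: its values are
    -- entries of the chains in the rule for `ε`.
    obtain ⟨E, hE⟩ := exists_ext_of_mem (cs := cs) (L := L) fun f => ih f
    induction f using T.hom_ind generalizing y y' p with
    | zero => rw [map_zero]; exact Submodule.zero_mem _
    | add hf hg => rw [map_add]; exact Submodule.add_mem _ (hf _ h) (hg _ h)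
    | smul r hf => rw [map_smul]; exact Submodule.smul_mem _ _ (hf _ h)
    | comp h hf hg =>
      rw [extW_comp]
      refine list_sum_mem fun z hz => ?_
      obtain ⟨S, -, rfl⟩ := List.mem_map.1 hz
      refine Submodule.smul_mem _ _ ?_
      obtain ⟨u, hu⟩ := hf S.left rfl
      obtain ⟨v, hv⟩ := hg S.right rfl
      rw [← hu, ← hv]
      exact ⟨DGCat.comp _ (by have := S.deg_eq; omega) u v, Rep.map_comp _ _ _ _⟩
    | right i g =>
      obtain ⟨u, hu⟩ := ih g c h
      exact ⟨(T.right (L := cs ++ L) i).map u, hu⟩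
    | eps i gs hq =>
      rw [extW_eps (fun g c => E c rfl g) (fun x => (T.embed cs L x).map) (repT_embed cs L)
        (fun g c => hE c rfl g) _ gs c hq h]
      exact ⟨_, rfl⟩

/-- The associativity constraint applied to `ε(f; c)`. -/
noncomputable def extT (cs L : List ℕ) {x x' : (T k cs).Obj} {y y' : (T k L).Obj} {n p : ℤ}
    (c : Chain (T k L) y y') (h : n + c.deg = p) :
    (T k cs).Hom x x' n →ₗ[k] (T k (cs ++ L)).Hom (T.pair x y) (T.pair x' y') p :=
  (exists_ext_of_mem fun f => extW_mem_range cs L f).choose c h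

lemma repT_extT (cs L : List ℕ) {x x' : (T k cs).Obj} {y y' : (T k L).Obj} {n p : ℤ}
    (c : Chain (T k L) y y') (h : n + c.deg = p) (f : (T k cs).Hom x x' n) :
    (repT k (cs ++ L)).map (extT cs L c h f) = extW cs L c f :=
  (exists_ext_of_mem fun f => extW_mem_range cs L f).choose_spec c h f

lemma extT_one_nil (cs L : List ℕ) (x : (T k cs).Obj) (y : (T k L).Obj)
    (h : 0 + (Chain.nil y).deg = 0) :
    extT cs L (Chain.nil y) h ((T k cs).one x) = (T k (cs ++ L)).one (T.pair x y) := by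
  apply repT_map_injective
  rw [repT_extT, Rep.map_one, extW, LinearMap.comp_apply, Rep.map_one]
  exact insN_nil_apply 1

lemma extT_one_cons (cs L : List ℕ) (x : (T k cs).Obj) {y z w : (T k L).Obj} {m p : ℤ}
    (g : (T k L).Hom y z m) (c : Chain (T k L) z w) (h : 0 + (Chain.cons g c).deg = p) :
    extT cs L (Chain.cons g c) h ((T k cs).one x) = 0 := by
  apply repT_map_injective
  rw [repT_extT, map_zero, extW, LinearMap.comp_apply, Rep.map_one]
  exact insN_one_cons _ _

lemma extT_comp (cs L : List ℕ) {x x' x'' : (T k cs).Obj} {y w : (T k L).Obj} {m n q p : ℤ}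
    (f : (T k cs).Hom x x' m) (f' : (T k cs).Hom x' x'' n) (c : Chain (T k L) y w)
    (hq : m + n = q) (hp : q + c.deg = p) :
    extT cs L c hp ((T k cs).comp hq f f') =
      (c.splits.map fun S => sgn k (n * S.left.deg) • (T k (cs ++ L)).comp
        (show (m + S.left.deg) + (n + S.right.deg) = p by have := S.deg_eq; omega)
        (extT cs L S.left rfl f) (extT cs L S.right rfl f')).sum := by
  apply repT_map_injective
  rw [repT_extT, map_list_sum (repT k (cs ++ L)).map, extW_comp]
  simp only [map_smul, Rep.map_comp, repT_extT]

lemma extT_right (n : ℕ) (cs L : List ℕ) (i : Fin (n + 1)) {x x' : (T k cs).Obj}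
    {y w : (T k L).Obj} {m p : ℤ} (g : (T k cs).Hom x x' m) (c : Chain (T k L) y w)
    (h : m + c.deg = p) :
    extT (n :: cs) L c h ((T.right i).map g) =
      (T.right (L := cs ++ L) i).map (extT cs L c h g) := by
  apply repT_map_injective
  exact (repT_extT _ _ _ _ _).trans (repT_extT cs L c h g).symm

lemma extT_eps (n : ℕ) (cs L : List ℕ) {i j : Fin (n + 1)} {x x' : (T k cs).Obj}
    {y w : (T k L).Obj} {m q p : ℤ} (f : (interval k n).Hom i j m) (gs : Chain (T k cs) x x')
    (c : Chain (T k L) y w) (hq : m + gs.deg = q) (hp : q + c.deg = p) :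
    extT (n :: cs) L c hp (T.eps f gs hq) =
      ((Chain.insert T.pair (fun x => (T.embed cs L x).map) (fun g c => extT cs L c rfl g)
        gs c).map fun t => sgn k t.sign • T.eps (L := cs ++ L) f t.chain
          (show m + t.chain.deg = p by have := t.deg_eq; omega)).sum := by
  apply repT_map_injective
  exact (repT_extT _ _ _ _ _).trans (extW_eps _ _ (repT_embed cs L)
    (fun g c => repT_extT cs L c rfl g) f gs c hq hp)

/-- The prescribed values on generators determine the constraint, and insertion into words satisfies
the same rules. So every `Plugging` has this constraint. -/
lemma Plugging.repT_ext (S : Plugging k) (cs L : List ℕ) {x x' : (T k cs).Obj}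
    {y y' : (T k L).Obj} {n p : ℤ} (c : Chain (T k L) y y') (h : n + c.deg = p)
    (f : (T k cs).Hom x x' n) :
    (repT k (cs ++ L)).map (S.ext cs L c h f) = extW cs L c f := by
  induction cs generalizing n y y' p with
  | nil =>
    by_cases hn : n = 0
    · subst hn
      obtain rfl : x = x' := Subsingleton.elim (α := Fin 1) x x'
      have e : f = interval.val f • (T k []).one x := interval.ext (mul_one (interval.val f)).symm
      rw [e, map_smul, map_smul, map_smul]
      refine congrArg _ ?_
      rw [extW, LinearMap.comp_apply, Rep.map_one]
      cases c with
      | nil =>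
        have hp : p = 0 := h.symm
        subst hp
        rw [S.ext_one_nil]
        exact ((repT k L).map_one _).trans (insN_nil_apply 1).symm
      | cons g c => rw [S.ext_one_cons, map_zero]; exact (insN_one_cons _ _).symm
    · have e : f = 0 := interval.ext (interval.val_eq_zero f fun h' => hn h'.2)
      rw [e, map_zero, map_zero, map_zero]
  | cons m cs ih =>
    induction f using T.hom_ind generalizing y y' p with
    | zero => rw [map_zero, map_zero, map_zero]
    | add hf hg => rw [map_add, map_add, map_add, hf _ h, hg _ h]
    | smul r hf => rw [map_smul, map_smul, map_smul, hf _ h]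
    | comp h hf hg =>
      rw [S.ext_comp, extW_comp, map_list_sum (repT k (m :: cs ++ L)).map]
      refine congrArg List.sum (List.map_congr_left fun t _ => ?_)
      rw [map_smul, Rep.map_comp, hf _ rfl, hg _ rfl]
    | right i g =>
      rw [S.ext_right]
      exact ih c h g
    | eps i gs hq =>
      rw [S.ext_eps, extW_eps (fun g c => S.ext cs L c rfl g) (fun x => (T.embed cs L x).map)
        (repT_embed cs L) (fun g c => ih c rfl g) _ gs c hq h]
      rfl

end ext

end TwoOperad

namespace TwoOperad
variable {k : Type u} [Field k]

/-! ## The existence of the plugging operation -/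

namespace Inputs

lemma deg_self {bs : List Block} (a : Inputs k bs) (x : (T k (trg bs)).Obj) : a.deg x x = 0 :=
  sub_self _

lemma deg_add {bs : List Block} (a : Inputs k bs) (x y z : (T k (trg bs)).Obj) :
    a.deg x y + a.deg y z = a.deg x z := by
  simp only [deg]; ring

lemma deg_cons {b : Block} {bs : List Block} (a : Inputs k (b :: bs))
    (x y : (T k (trg (b :: bs))).Obj) :
    a.deg x y = a.colDeg (T.fst y) - a.colDeg (T.fst x) + a.tail.deg (T.snd x) (T.snd y) := by
  simp only [deg, degBelow]; ring

lemma colDeg_succ {b : Block} {bs : List Block} (a : Inputs k (b :: bs)) (i : Fin b.ht) :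
    a.colDeg i.succ = a.colDeg i.castSucc + (a.head i).1 := by
  unfold colDeg
  have : (Finset.univ.filter fun t : Fin b.ht => t.castSucc < i.succ) =
      insert i (Finset.univ.filter fun t : Fin b.ht => t.castSucc < i.castSucc) := by
    ext t
    simp only [Finset.mem_filter, Finset.mem_univ, true_and, Finset.mem_insert, Fin.lt_def,
      Fin.ext_iff, Fin.val_castSucc, Fin.val_succ]
    omega
  rw [this, Finset.sum_insert (by simp), add_comm]

/-- Both sides count the transpositions that sort the inputs into three consecutive groups. This
cocycle identity makes the composition twisted by the sign associative. -/
lemma shuffle_cocycle : ∀ {bs : List Block} (a : Inputs k bs) (x y z w : (T k (trg bs)).Obj),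
    a.shuffle x y z + a.shuffle x z w = a.shuffle y z w + a.shuffle x y w
  | [], _, _, _, _, _ => rfl
  | _ :: _, a, x, y, z, w => by
    have := shuffle_cocycle a.tail (T.snd x) (T.snd y) (T.snd z) (T.snd w)
    simp only [shuffle, ← deg_add a.tail (T.snd y) (T.snd z) (T.snd w)]
    linear_combination this

lemma shuffle_self_left : ∀ {bs : List Block} (a : Inputs k bs) (x y : (T k (trg bs)).Obj),
    a.shuffle x x y = 0
  | [], _, _, _ => rfl
  | _ :: _, a, x, y => by
    rw [shuffle, shuffle_self_left a.tail, sub_self, zero_mul, zero_add]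

lemma shuffle_self_right : ∀ {bs : List Block} (a : Inputs k bs) (x y : (T k (trg bs)).Obj),
    a.shuffle x y y = 0
  | [], _, _, _ => rfl
  | _ :: _, a, x, y => by
    rw [shuffle, shuffle_self_right a.tail, deg_self, mul_zero, zero_add]

lemma shuffle_add_deg_left {bs : List Block} (a : Inputs k bs) (x y : (T k (trg bs)).Obj) (m : ℤ) :
    a.shuffle x x y + a.deg x x * m = 0 := by
  rw [shuffle_self_left, deg_self, zero_mul, add_zero]

lemma shuffle_add_deg_right {bs : List Block} (a : Inputs k bs) (x y : (T k (trg bs)).Obj) :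
    a.shuffle x y y + a.deg x y * 0 = 0 := by
  rw [shuffle_self_right, mul_zero, add_zero]

end Inputs

/-- The type of the operations of plugging along the maps with the blocks `bs`. -/
abbrev PlugMap (k : Type u) [Field k] (bs : List Block) : Type u :=
  ∀ (a : Inputs k bs) (x y : (T k (trg bs)).Obj) (n p : ℤ), n + a.deg x y = p →
    ((T k (trg bs)).Hom x y n →ₗ[k] (T k (src bs)).Hom (obMap bs x) (obMap bs y) p)

/-- The laws that do not involve the generators. -/
structure PlugMap.IsFunctor {bs : List Block} (F : PlugMap k bs) : Prop where
  one : ∀ (a : Inputs k bs) (x : (T k (trg bs)).Obj) (p : ℤ) (h : 0 + a.deg x x = p),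
    (repT k (src bs)).map (F a x x 0 p h ((T k (trg bs)).one x)) = 1
  comp : ∀ (a : Inputs k bs) {x y z : (T k (trg bs)).Obj}
    {m n q p m' n' : ℤ} (f : (T k (trg bs)).Hom x y m) (g : (T k (trg bs)).Hom y z n)
    (hq : m + n = q) (hp : q + a.deg x z = p) (hm : m + a.deg x y = m')
    (hn : n + a.deg y z = n') (h : m' + n' = p),
    F a _ _ _ _ hp ((T k (trg bs)).comp hq f g) =
      sgn k (a.shuffle x y z + a.deg x y * n) •
        (T k (src bs)).comp h (F a _ _ _ _ hm f) (F a _ _ _ _ hn g)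

section plugChain

variable {bs : List Block} {F : PlugMap k bs} (a : Inputs k bs)

/-- The chain of `plugChain`. -/
abbrev plugCh (F : PlugMap k bs) {x y : (T k (trg bs)).Obj} (c : Chain (T k (trg bs)) x y) :
    SignedChain (T k (src bs)) (obMap bs x) (obMap bs y) :=
  plugChain a (fun {_ _ _} g => F a _ _ _ _ rfl g) c

lemma deg_plugCh {x y : (T k (trg bs)).Obj} (c : Chain (T k (trg bs)) x y) :
    (plugCh a F c).chain.deg = c.deg + a.deg x y := by
  induction c with
  | nil x => exact (a.deg_self x).symm.trans (zero_add _).symm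
  | @cons x y z m g c ih =>
    have := a.deg_add x y z
    simp only [plugCh, plugChain, Chain.deg] at ih ⊢
    omega

lemma plugCh_isSum {x y : (T k (trg bs)).Obj} {c c₁ c₂ : Chain (T k (trg bs)) x y}
    (h : Chain.IsSum c c₁ c₂) :
    Chain.IsSum (plugCh a F c).chain (plugCh a F c₁).chain (plugCh a F c₂).chain ∧
      (plugCh a F c₁).sign = (plugCh a F c).sign ∧ (plugCh a F c₂).sign = (plugCh a F c).sign := by
  induction h with
  | head g g' c =>
    simp only [plugCh, plugChain, map_add]
    exact ⟨Chain.IsSum.head _ _ _, trivial, trivial⟩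
  | tail g hc ih =>
    have h1 := hc.deg_eq
    simp only [plugCh, plugChain] at ih ⊢
    exact ⟨Chain.IsSum.tail _ ih.1, by rw [ih.2.1, h1.1], by rw [ih.2.2, h1.2]⟩

lemma plugCh_isSmul {r : k} {x y : (T k (trg bs)).Obj} {c c₁ : Chain (T k (trg bs)) x y}
    (h : Chain.IsSmul r c c₁) :
    Chain.IsSmul r (plugCh a F c).chain (plugCh a F c₁).chain ∧
      (plugCh a F c₁).sign = (plugCh a F c).sign := by
  induction h with
  | head g c =>
    simp only [plugCh, plugChain, map_smul]
    exact ⟨Chain.IsSmul.head _ _, trivial⟩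
  | tail g hc ih =>
    simp only [plugCh, plugChain, hc.deg_eq] at ih ⊢
    exact ⟨Chain.IsSmul.tail _ ih.1, by rw [ih.2]⟩

/-- The image of an identity has degree `0 + a.deg x x`, which equals `0` only propositionally, so
the plugged chain need not satisfy `HasOne` syntactically. The vanishing is therefore stated for
insertions in `WAlg`, where the image is `1`. -/
lemma plugCh_hasOne (hF : F.IsFunctor) {x y : (T k (trg bs)).Obj} {c : Chain (T k (trg bs)) x y}
    (h : Chain.HasOne c) : insW ((repT k (src bs)).seq (plugCh a F c).chain) = 0 := by
  induction h with
  | head c =>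
    funext w
    simp only [plugCh, plugChain, Rep.seq_cons, hF.one]
    exact insW_one_cons _ _ _
  | tail g hc ih =>
    funext w
    simp only [plugCh, plugChain, Rep.seq_cons] at ih ⊢
    change insStep _ (insW _) w = 0
    rw [ih, ← zero_smul k (0 : List Letter → WAlg k), insStep_smul, zero_smul]

end plugChain

section step

variable {b : Block} {bs : List Block} (F : PlugMap k bs) (hF : F.IsFunctor)
  (a : Inputs k (b :: bs))

/-- The value of the plugging operation at `ε(f_i; c)`. -/
noncomputable def plugEps (i : Fin b.ht) {x y : (T k (trg bs)).Obj} (c : Chain (T k (trg bs)) x y)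
    {p : ℤ} (h : (a.head i).1 + (plugCh a.tail F c).chain.deg = p) :
    (T k (src (b :: bs))).Hom (obMap (b :: bs) (T.pt i.castSucc x))
      (obMap (b :: bs) (T.pt i.succ y)) p :=
  sgn k ((a.head i).1 * (c.deg + a.tail.deg x y) + (plugCh a.tail F c).sign) •
    extT b.heights (src bs) (plugCh a.tail F c).chain h (place b i (a.head i).2)

lemma repT_plugEps (i : Fin b.ht) {x y : (T k (trg bs)).Obj} (c : Chain (T k (trg bs)) x y)
    {p : ℤ} (h : (a.head i).1 + (plugCh a.tail F c).chain.deg = p) :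
    (repT k (src (b :: bs))).map (plugEps F a i c h) =
      sgn k ((a.head i).1 * (c.deg + a.tail.deg x y) + (plugCh a.tail F c).sign) •
        insN ((repT k (src bs)).seq (plugCh a.tail F c).chain)
          ((repS k b.heights (src bs)).map (place b i (a.head i).2)) :=
  (map_smul _ _ _).trans (congrArg _ (repT_extT b.heights (src bs) _ h _))

lemma deg_pt_succ (i : Fin b.ht) {x y : (T k (trg bs)).Obj} :
    a.deg (bs := b :: bs) (T.pt i.castSucc x) (T.pt i.succ y) =
      (a.head i).1 + a.tail.deg x y := by
  refine (Inputs.deg_cons a _ _).trans ?_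
  have := a.colDeg_succ i
  change a.colDeg i.succ - a.colDeg i.castSucc + a.tail.deg x y = _
  omega

lemma deg_pt_self (i : Fin (b.ht + 1)) (x y : (T k (trg bs)).Obj) :
    a.deg (bs := b :: bs) (T.pt i x) (T.pt i y) = a.tail.deg x y := by
  refine (Inputs.deg_cons a _ _).trans ?_
  change a.colDeg i - a.colDeg i + a.tail.deg x y = _
  omega

lemma shuffle_pt_self (i : Fin (b.ht + 1)) (x y z : (T k (trg bs)).Obj) :
    a.shuffle (bs := b :: bs) (T.pt i x) (T.pt i y) (T.pt i z) = a.tail.shuffle x y z := by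
  change (a.colDeg i - a.colDeg i) * _ + a.tail.shuffle x y z = _
  rw [sub_self, zero_mul, zero_add]

/-- The value of the plugging operation at `id ⊗ g`. -/
noncomputable def plugRight (i : Fin (b.ht + 1)) (x y : (T k (trg bs)).Obj) (n p : ℤ)
    (h : n + a.deg (bs := b :: bs) (T.pt i x) (T.pt i y) = p) :
    (T k (trg bs)).Hom x y n →ₗ[k] (T k (src (b :: bs))).Hom (obMap (b :: bs) (T.pt i x))
      (obMap (b :: bs) (T.pt i y)) p :=
  (T.embed b.heights (src bs) (cut b.cols i)).map ∘ₗ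
    F a.tail x y n p ((congrArg (n + ·) (deg_pt_self a i x y)).symm.trans h)

lemma repT_plugRight (i : Fin (b.ht + 1)) (x y : (T k (trg bs)).Obj) (n p : ℤ)
    (h : n + a.deg (bs := b :: bs) (T.pt i x) (T.pt i y) = p) (g : (T k (trg bs)).Hom x y n) :
    (repT k (src (b :: bs))).map (plugRight F a i x y n p h g) =
      (repT k (src bs)).map (F a.tail x y n p
        ((congrArg (n + ·) (deg_pt_self a i x y)).symm.trans h) g) := repT_embed _ _ _ _

/-- The value at `ε(e; c)`, where `e` is an edge of the interval. -/
noncomputable def plugEdge : ∀ {i j : Fin (b.ht + 1)} (_ : i.1 + 1 = j.1)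
    {x y : (T k (trg bs)).Obj} (c : Chain (T k (trg bs)) x y) {p : ℤ} (_ : c.deg = p),
    (T k (src (b :: bs))).Hom (obMap (b :: bs) (T.pt i x)) (obMap (b :: bs) (T.pt j y))
      (p + a.deg (bs := b :: bs) (T.pt i x) (T.pt j y))
  | ⟨i, hi⟩, ⟨_, hj⟩, rfl, x, y, c, p, hp =>
      plugEps F a ⟨i, Nat.lt_of_succ_lt_succ hj⟩ c (by
        rw [deg_plugCh, hp]
        refine .trans ?_ (congrArg (p + ·)
          (deg_pt_succ a ⟨i, Nat.lt_of_succ_lt_succ hj⟩ (x := x) (y := y))).symm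
        omega)

/-- The brace structure given by the target of the plugging operation. -/
noncomputable def plugBrace : Brace b.ht (T k (trg bs)) where
  Hom X Y n := (T k (src (b :: bs))).Hom (obMap (b :: bs) X) (obMap (b :: bs) Y)
    (n + a.deg (bs := b :: bs) X Y)
  -- The twist by the sign of `plug_comp`, which sorts the inputs and moves those between `X` and
  -- `Y` past the second factor, turns plugging into an honest functor.
  comp {X Y Z m n p} h := sgn k (a.shuffle (bs := b :: bs) X Y Z + a.deg (bs := b :: bs) X Y * n) •
    (T k (src (b :: bs))).comp (by have := a.deg_add X Y Z; omega)
  assoc {X Y Z W p q r pq pqr qr} h₁ h₂ h₃ h₄ f g e := by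
    apply repT_map_injective
    simp only [LinearMap.smul_apply, map_smul, Rep.map_comp, smul_smul, mul_assoc, ← sgn_add]
    congr 2
    -- The exponents on the two sides of associativity agree by the cocycle identity and the
    -- additivity of the degrees.
    have h1 := a.shuffle_cocycle X Y Z W
    have h2 := a.deg_add X Y Z
    subst h₁ h₃
    rw [← h2]
    linear_combination h1
  right i {x y m} := plugRight F a i x y m _ rfl
  right_comp i {x y z p q r} h f g := by
    apply repT_map_injective
    have e := congrArg (repT k (src bs)).map (hF.comp a.tail f g h rfl rfl rfl
      (by have := a.tail.deg_add x y z; omega))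
    rw [map_smul, Rep.map_comp] at e
    have hT : ∀ {x y : (T k (trg bs)).Obj} {m p : ℤ} (h : m + a.tail.deg x y = p) (g),
        (repT k (src bs)).map (F a.tail x y m p h g) =
          (repT k (src bs)).map (F a.tail x y m _ rfl g) := by
      rintro x y m _ rfl g; rfl
    refine (repT_plugRight F a i x z r _ rfl _).trans ((hT _ _).trans (e.trans ?_))
    refine Eq.symm ((map_smul _ _ _).trans (congrArg₂ (· • ·) (congrArg (sgn k) ?_)
      ((Rep.map_comp _ _ _ _).trans (congrArg₂ (· * ·)
        ((repT_plugRight F a i x y p _ rfl _).trans (hT _ _))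
        ((repT_plugRight F a i y z q _ rfl _).trans (hT _ _))))))
    exact congrArg₂ (· + ·) (shuffle_pt_self a i x y z) (congrArg (· * q) (deg_pt_self a i x y))
  one_comp i {x Y m} h f := by
    apply repT_map_injective
    refine (map_smul _ _ _).trans ?_
    have e : a.shuffle (bs := b :: bs) (T.pt i x) (T.pt i x) Y +
        a.deg (bs := b :: bs) (T.pt i x) (T.pt i x) * m = 0 := by
      exact a.shuffle_add_deg_left (bs := b :: bs) _ _ m
    refine (congrArg (sgn k · • _) e).trans ?_
    rw [sgn_zero, one_smul]
    refine (Rep.map_comp _ _ _ _).trans ?_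
    refine (congrArg (· * _) ((repT_plugRight F a i x x 0 _ rfl _).trans (hF.one _ _ _ _))).trans ?_
    exact one_mul _
  comp_one i {x Y m} h f := by
    apply repT_map_injective
    refine (map_smul _ _ _).trans ?_
    have e : a.shuffle (bs := b :: bs) Y (T.pt i x) (T.pt i x) +
        a.deg (bs := b :: bs) Y (T.pt i x) * 0 = 0 := by
      exact a.shuffle_add_deg_right (bs := b :: bs) _ _
    refine (congrArg (sgn k · • _) e).trans ?_
    rw [sgn_zero, one_smul]
    refine (Rep.map_comp _ _ _ _).trans ?_
    refine (congrArg (_ * ·) ((repT_plugRight F a i x x 0 _ rfl _).trans (hF.one _ _ _ _))).trans ?_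
    exact mul_one _
  eps {_ _} h {_ _} c {_} hp := plugEdge F a h c hp
  eps_add := by
    rintro ⟨i, hi⟩ ⟨j, hj⟩ h x y c c₁ c₂ hc p hp h₁ h₂
    obtain rfl : i + 1 = j := h
    apply repT_map_injective
    obtain ⟨e1, e2, e3⟩ := plugCh_isSum (F := F) a.tail hc
    refine (repT_plugEps F a (⟨i, Nat.lt_of_succ_lt_succ hj⟩ : Fin b.ht) c _).trans (Eq.symm ((map_add _ _ _).trans
      ((congrArg₂ (· + ·) (repT_plugEps F a (⟨i, Nat.lt_of_succ_lt_succ hj⟩ : Fin b.ht) c₁ _) (repT_plugEps F a (⟨i, Nat.lt_of_succ_lt_succ hj⟩ : Fin b.ht) c₂ _)).trans ?_)))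
    rw [e2, e3, h₁, h₂, hp, ← smul_add, ← LinearMap.add_apply]
    congr 2
    refine WAlg.hom_ext fun w => ?_
    rw [LinearMap.add_apply, insN_bw, insN_bw, insN_bw, Rep.insW_seq_isSum _ e1]
    rfl
  eps_smul := by
    rintro ⟨i, hi⟩ ⟨j, hj⟩ h x y r c c₁ hc p hp h₁
    obtain rfl : i + 1 = j := h
    apply repT_map_injective
    obtain ⟨e1, e2⟩ := plugCh_isSmul (F := F) a.tail hc
    refine (repT_plugEps F a (⟨i, Nat.lt_of_succ_lt_succ hj⟩ : Fin b.ht) c _).trans (Eq.symm ((map_smul _ _ _).trans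
      ((congrArg (r • ·) (repT_plugEps F a (⟨i, Nat.lt_of_succ_lt_succ hj⟩ : Fin b.ht) c₁ _)).trans ?_)))
    rw [e2, h₁, hp, smul_comm, ← LinearMap.smul_apply]
    congr 2
    refine WAlg.hom_ext fun w => ?_
    rw [LinearMap.smul_apply, insN_bw, insN_bw, Rep.insW_seq_isSmul _ e1]
    rfl
  eps_one := by
    rintro ⟨i, hi⟩ ⟨j, hj⟩ h x y c hc p hp
    obtain rfl : i + 1 = j := h
    apply repT_map_injective
    refine (repT_plugEps F a (⟨i, Nat.lt_of_succ_lt_succ hj⟩ : Fin b.ht) c _).trans (Eq.symm ((map_zero _).trans ?_))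
    have : insN ((repT k (src bs)).seq (plugCh a.tail F c).chain) = 0 :=
      WAlg.hom_ext fun w => by rw [insN_bw, plugCh_hasOne _ hF hc]; rfl
    rw [this, LinearMap.zero_apply, smul_zero]

/-- With one more column, plugging is the functor from the twisted tensor product to `plugBrace`
whose existence follows from the independence of normal forms. Its values on `id ⊗ g` and on `ε(f_i;
c)` are the prescribed ones. -/
lemma exists_plug_step (hF : F.IsFunctor) : ∃ G : PlugMap k (b :: bs), G.IsFunctor ∧
    (∀ (a : Inputs k (b :: bs)) (i : Fin (b.ht + 1)) {x y : (T k (trg bs)).Obj} {n p : ℤ}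
      (g : (T k (trg bs)).Hom x y n)
      (h : n + a.deg (bs := b :: bs) (T.pt i x) (T.pt i y) = p),
      G a _ _ _ _ h ((T.right i).map g) = plugRight F a i x y n p h g) ∧
    ∀ (a : Inputs k (b :: bs)) (i : Fin b.ht) {x y : (T k (trg bs)).Obj} {m p : ℤ}
      (c : Chain (T k (trg bs)) x y) (hm : 0 + c.deg = m)
      (hp : m + a.deg (bs := b :: bs) (T.pt i.castSucc x) (T.pt i.succ y) = p)
      (h : (a.head i).1 + (plugCh a.tail F c).chain.deg = p),
      G a _ _ _ _ hp (T.eps (interval.gen k i) c hm) = plugEps F a i c h := by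
  choose H h1 h2 h3 using fun a => WordBasis.exists_hom (basisT k (trg bs)) (plugBrace F hF a)
  -- The functor lands in the degree `n + a.deg x y`; the transport along `h` allows any degree
  -- equal to it.
  let G : PlugMap k (b :: bs) := fun a x y n p h => h ▸ H a x y n
  refine ⟨G, ⟨?_, ?_⟩, ?_, ?_⟩
  · rintro a x _ rfl
    have e : (T k (trg (b :: bs))).one x = (T.right (T.fst x)).map ((T k (trg bs)).one (T.snd x)) :=
      ((T.right (T.fst x)).map_one (T.snd x)).symm
    refine (congrArg (fun g => (repT k (src (b :: bs))).map (H a x x 0 g)) e).trans ?_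
    refine (congrArg (repT k (src (b :: bs))).map (h2 a (T.fst x) _)).trans ?_
    exact (repT_plugRight F a (T.fst x) _ _ 0 _ rfl _).trans (hF.one _ _ _ _)
  · rintro a x y z m n _ _ _ _ f g rfl rfl rfl rfl h
    exact h1 a rfl f g
  · rintro a i x y n _ g rfl
    exact h2 a i g
  · rintro a ⟨i, hi⟩ x y m _ c hm rfl h
    exact h3 a (i := (⟨i, hi⟩ : Fin b.ht).castSucc) (j := (⟨i, hi⟩ : Fin b.ht).succ) rfl c
      ((zero_add _).symm.trans hm)

end step

/-- The plugging operation. -/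
noncomputable def plugT (k : Type u) [Field k] : ∀ bs : List Block, {F : PlugMap k bs // F.IsFunctor}
  | [] => ⟨fun a x y n p h =>
      { toFun := fun f => ⟨interval.val f, fun h' => interval.val_eq_zero f fun h'' => h' ⟨h''.1, by
          rw [← h, h''.2]; exact a.deg_self x⟩⟩
        map_add' := fun _ _ => rfl
        map_smul' := fun _ _ => rfl },
      fun _ _ _ _ => one_smul k (1 : WAlg k), fun a x y z m n q p m' n' f g hq hp hm hn h => by
        have e : a.shuffle x y z + a.deg x y * n = 0 := by
          have e1 : a.shuffle x y z = 0 := rfl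
          have e2 : a.deg x y = 0 := a.deg_self x
          rw [e1, e2, zero_mul, add_zero]
        refine Eq.trans ?_ (congrArg (fun t => sgn k t • (T k (src [])).comp h _ _) e).symm
        rw [sgn_zero, one_smul]
        rfl⟩
  | _ :: bs => ⟨(exists_plug_step (plugT k bs).1 (plugT k bs).2).choose,
      (exists_plug_step (plugT k bs).1 (plugT k bs).2).choose_spec.1⟩

theorem nonempty_plugging : Nonempty (Plugging k) := ⟨{
  ext := extT
  ext_one_nil := extT_one_nil
  ext_one_cons := extT_one_cons
  ext_comp := extT_comp
  ext_right := extT_right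
  ext_eps := extT_eps
  plug := fun bs a {_ _ _ _} h => (plugT k bs).1 a _ _ _ _ h
  plug_one := fun bs a x h => repT_map_injective
    (((plugT k bs).2.one a x 0 h).trans ((repT k _).map_one _).symm)
  plug_comp := fun bs a {_ _ _ _ _ _ _ _ _} f g => (plugT k bs).2.comp a f g
  plug_right := fun _ bs a i {_ _ _ _} g h _ =>
    (exists_plug_step (plugT k bs).1 (plugT k bs).2).choose_spec.2.1 a i g h
  plug_eps := fun _ bs a i {_ _ _ _} c hm hp h =>
    (exists_plug_step (plugT k bs).1 (plugT k bs).2).choose_spec.2.2 a i c hm hp h }⟩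

end TwoOperad

namespace TwoOperad
variable {k : Type u} [Field k]

/-! ## Plugging words into a word -/

/-- The sum of the dimensions of the words plugged into the letters of `β`. -/
def totDim (σ : Letter → List Letter) (β : List Letter) : ℤ := ∑ a ∈ β.toFinset, (dim (σ a) : ℤ)

/-- The sum of the dimensions of the words plugged into the letters of `β` smaller than `μ`. -/
def lowDim (σ : Letter → List Letter) (μ : Letter) (β : List Letter) : ℤ :=
  ∑ a ∈ β.toFinset with Letter.lt a μ, (dim (σ a) : ℤ)

/-- The exponent of the sign that results from the exchange of the words plugged into `β` and the
ones plugged into `β'`. -/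
def crossDim (σ : Letter → List Letter) (β β' : List Letter) : ℤ :=
  ∑ a ∈ β.toFinset, dim (σ a) * lowDim σ a β'

lemma totDim_congr {σ τ : Letter → List Letter} {β : List Letter} (h : ∀ a ∈ β, σ a = τ a) :
    totDim σ β = totDim τ β :=
  Finset.sum_congr rfl fun a ha => by rw [h a (List.mem_toFinset.1 ha)]

lemma lowDim_congr {σ τ : Letter → List Letter} {β : List Letter} (μ : Letter)
    (h : ∀ a ∈ β, a ≠ μ → σ a = τ a) : lowDim σ μ β = lowDim τ μ β :=
  Finset.sum_congr rfl fun a ha => by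
    rw [Finset.mem_filter] at ha
    rw [h a (List.mem_toFinset.1 ha.1) fun e => Letter.lt_irrefl μ (e ▸ ha.2)]

lemma toFinset_append_disjoint {β β' : List Letter} (h : ∀ a ∈ β, a ∉ β') :
    (β ++ β').toFinset = β.toFinset ∪ β'.toFinset ∧ Disjoint β.toFinset β'.toFinset :=
  ⟨List.toFinset_append, Finset.disjoint_left.2 fun a ha hb =>
    h a (List.mem_toFinset.1 ha) (List.mem_toFinset.1 hb)⟩

lemma lowDim_append (σ : Letter → List Letter) (μ : Letter) {β β' : List Letter}
    (h : ∀ a ∈ β, a ∉ β') : lowDim σ μ (β ++ β') = lowDim σ μ β + lowDim σ μ β' := by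
  obtain ⟨h1, h2⟩ := toFinset_append_disjoint h
  rw [lowDim, h1, Finset.filter_union, Finset.sum_union (Finset.disjoint_filter_filter h2)]; rfl

lemma totDim_cons_of_mem (σ : Letter → List Letter) {μ : Letter} {β : List Letter} (h : μ ∈ β) :
    totDim σ (μ :: β) = totDim σ β := by
  rw [totDim, List.toFinset_cons, Finset.insert_eq_of_mem (List.mem_toFinset.2 h)]; rfl

lemma crossDim_cons_of_mem (σ : Letter → List Letter) {μ : Letter} {β : List Letter} (h : μ ∈ β)
    (β' : List Letter) : crossDim σ (μ :: β) β' = crossDim σ β β' := by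
  rw [crossDim, List.toFinset_cons, Finset.insert_eq_of_mem (List.mem_toFinset.2 h)]; rfl

lemma insert_erase_self_eq (S : Finset Letter) (μ : Letter) : insert μ (S.erase μ) = insert μ S := by
  ext a
  by_cases h : a = μ <;> simp [h]

lemma totDim_cons_update (σ : Letter → List Letter) (μ : Letter) (β α : List Letter) :
    totDim (Function.update σ μ α) (μ :: β) = dim α + ∑ a ∈ β.toFinset.erase μ, (dim (σ a) : ℤ) := by
  rw [totDim, List.toFinset_cons, ← insert_erase_self_eq,
    Finset.sum_insert (Finset.notMem_erase _ _), Function.update_self]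
  refine congrArg _ (Finset.sum_congr rfl fun a ha => ?_)
  rw [Function.update_of_ne (Finset.ne_of_mem_erase ha)]

lemma crossDim_cons_update (σ : Letter → List Letter) {μ : Letter} (β α : List Letter)
    {β' : List Letter} (h : μ ∉ β') :
    crossDim (Function.update σ μ α) (μ :: β) β' =
      dim α * lowDim σ μ β' + ∑ a ∈ β.toFinset.erase μ, dim (σ a) * lowDim σ a β' := by
  have hl : ∀ a, lowDim (Function.update σ μ α) a β' = lowDim σ a β' := fun a =>
    lowDim_congr a fun b hb _ => Function.update_of_ne (fun e => h (by rwa [← e])) _ _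
  rw [crossDim, List.toFinset_cons, ← insert_erase_self_eq,
    Finset.sum_insert (Finset.notMem_erase _ _), Function.update_self, hl]
  refine congrArg _ (Finset.sum_congr rfl fun a ha => ?_)
  rw [Function.update_of_ne (Finset.ne_of_mem_erase ha), hl]

/-- One step of `plugW`, in which the word plugged into the first letter is used up to a cut. -/
noncomputable def plugStep (s : k) (m : Prop) [Decidable m] (δ : ℤ) (G : List Letter → WAlg k) :
    List Letter → WAlg k
  -- The condition `m` says that `μ` occurs again in the rest of `β`. The plugged word may be used
  -- up only at the last occurrence of `μ`, and then the coefficient enters. Otherwise its first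
  -- letter `x` is written, and either there is a cut, after which `x` is still available, or `x` is
  -- consumed; if `x` recurs, its elementary interval then contributes the sign with exponent `δ`.
  | [] => if m then 0 else s • G []
  | x :: α => bw k [x] * ((if m then G (x :: α) else 0) +
      sgn k (if x ∈ α then δ else 0) • plugStep s m δ G α)

/-- The signed sum over all the ways to plug the words `σ a` into the letters `a` of a word, with
coefficients `s a`. -/
noncomputable def plugW (s : Letter → k) : List Letter → (Letter → List Letter) → WAlg k
  | [], _ => 1
  | μ :: β, σ => plugStep (s μ) (μ ∈ β) (dim (μ :: β) + lowDim σ μ β)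
      (fun α => plugW s β (Function.update σ μ α)) (σ μ)

variable (s : Letter → k)

lemma plugW_congr {s t : Letter → k} {σ τ : Letter → List Letter} {β : List Letter}
    (h : ∀ a ∈ β, σ a = τ a) (h' : ∀ a ∈ β, s a = t a) : plugW s β σ = plugW t β τ := by
  induction β generalizing σ τ with
  | nil => rfl
  | cons μ β ih =>
    have e : (fun α => plugW s β (Function.update σ μ α)) =
        fun α => plugW t β (Function.update τ μ α) := by
      funext α
      refine ih (fun a ha => ?_) fun a ha => h' a (List.mem_cons_of_mem _ ha)
      simp only [Function.update_apply, h a (List.mem_cons_of_mem _ ha)]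
    rw [plugW, plugW, e, h μ (List.mem_cons_self ..), h' μ (List.mem_cons_self ..),
      lowDim_congr (σ := σ) (τ := τ) μ fun a ha _ => h a (List.mem_cons_of_mem _ ha)]

lemma plugW_cons_update (μ : Letter) (β : List Letter) (σ : Letter → List Letter)
    (α : List Letter) : plugW s (μ :: β) (Function.update σ μ α) =
      plugStep (s μ) (μ ∈ β) (dim (μ :: β) + lowDim σ μ β)
        (fun α => plugW s β (Function.update σ μ α)) α := by
  rw [plugW, Function.update_self, lowDim_congr (σ := Function.update σ μ α) (τ := σ) μ
    fun a _ ha => Function.update_of_ne ha _ _]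
  simp only [Function.update_idem]

lemma plugW_update_nil_of_mem {μ : Letter} {β : List Letter} (h : μ ∈ β)
    (σ : Letter → List Letter) : plugW s (μ :: β) (Function.update σ μ []) = 0 := by
  rw [plugW_cons_update, plugStep, if_pos h]

lemma plugW_update_nil_of_not_mem {μ : Letter} {β : List Letter} (h : μ ∉ β)
    (σ : Letter → List Letter) :
    plugW s (μ :: β) (Function.update σ μ []) = s μ • plugW s β σ := by
  rw [plugW_cons_update, plugStep, if_neg h]
  exact congrArg _ (plugW_congr (fun a ha => Function.update_of_ne (fun e => h (by rwa [← e])) _ _)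
    fun _ _ => rfl)

lemma plugW_update_cons (μ : Letter) (β : List Letter) (σ : Letter → List Letter) (x : Letter)
    (α : List Letter) : plugW s (μ :: β) (Function.update σ μ (x :: α)) =
      bw k [x] * ((if μ ∈ β then plugW s β (Function.update σ μ (x :: α)) else 0) +
        sgn k (if x ∈ α then dim (μ :: β) + lowDim σ μ β else 0) •
          plugW s (μ :: β) (Function.update σ μ α)) := by
  rw [plugW_cons_update, plugW_cons_update, plugStep]

lemma dim_cons_append {μ : Letter} {β β' : List Letter} (h : ∀ a ∈ μ :: β, a ∉ β') :
    (dim (μ :: (β ++ β')) : ℤ) = dim (μ :: β) + dim β' := by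
  rw [← List.cons_append, dim_append h]; push_cast; rfl

/-- Plugging words into a product. -/
lemma plugW_append {β β' : List Letter} (h : ∀ a ∈ β, a ∉ β') (σ : Letter → List Letter) :
    plugW s (β ++ β') σ = sgn k (dim β' * totDim σ β + crossDim σ β β') •
      (plugW s β σ * plugW s β' σ) := by
  induction β generalizing σ with
  | nil => simp [totDim, crossDim, plugW, sgn_zero]
  | cons μ β ih =>
    have hμ : μ ∉ β' := h μ (List.mem_cons_self ..)
    have h' : ∀ a ∈ β, a ∉ β' := fun a ha => h a (List.mem_cons_of_mem _ ha)
    have hm : μ ∈ β ++ β' ↔ μ ∈ β := by simp [hμ]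
    have hc : ∀ α, plugW s β' (Function.update σ μ α) = plugW s β' σ := fun α =>
      plugW_congr (fun a ha => Function.update_of_ne (fun e => hμ (by rwa [← e])) _ _) fun _ _ => rfl
    -- The word plugged into `μ` is made a variable, since the recursion shortens it before it
    -- passes on in `β`.
    suffices H : ∀ α, plugW s (μ :: (β ++ β')) (Function.update σ μ α) =
        sgn k (dim β' * totDim (Function.update σ μ α) (μ :: β) +
          crossDim (Function.update σ μ α) (μ :: β) β') •
          (plugW s (μ :: β) (Function.update σ μ α) * plugW s β' σ) by
      have := H (σ μ)
      rwa [Function.update_eq_self] at this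
    intro α
    induction α with
    | nil =>
      by_cases hb : μ ∈ β
      · rw [plugW_update_nil_of_mem s (hm.2 hb), plugW_update_nil_of_mem s hb, zero_mul, smul_zero]
      · rw [plugW_update_nil_of_not_mem s (mt hm.1 hb), plugW_update_nil_of_not_mem s hb, ih h',
          totDim_cons_update, crossDim_cons_update _ _ _ hμ,
          Finset.erase_eq_of_notMem (mt List.mem_toFinset.1 hb), dim_nil, smul_comm,
          smul_mul_assoc]
        simp only [Nat.cast_zero, zero_mul, zero_add]
        rfl
    | cons x α ihα =>
      rw [plugW_update_cons, plugW_update_cons, ihα, totDim_cons_update, totDim_cons_update,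
        crossDim_cons_update _ _ _ hμ, crossDim_cons_update _ _ _ hμ, dim_cons_append h,
        lowDim_append _ _ h', mul_assoc]
      refine .trans (congrArg (bw k [x] * ·) ?_) (mul_smul_comm _ _ _)
      rw [add_mul, smul_add]
      congr 1
      · by_cases hb : μ ∈ β
        · rw [if_pos hb, if_pos (hm.2 hb), ih h', hc, ← totDim_cons_of_mem _ hb,
            ← crossDim_cons_of_mem _ hb, totDim_cons_update, crossDim_cons_update _ _ _ hμ]
        · rw [if_neg hb, if_neg (mt hm.1 hb), zero_mul, smul_zero]
      · rw [smul_mul_assoc, smul_smul, smul_smul, ← sgn_add, ← sgn_add]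
        congr 1
        refine sgn_congr ?_
        rw [dim_cons x α]
        split_ifs <;> push_cast <;> grind

end TwoOperad

namespace TwoOperad
variable {k : Type u} [Field k]

/-! ## The plugging operation in the algebra of words -/

/-- The words `σ` represent the inputs `a`, up to the coefficients `s`. -/
def Inputs.Represents (s : Letter → k) (σ : Letter → List Letter) :
    ∀ {bs : List Block} (_ : Inputs k bs), Prop
  | [], _ => True
  | b :: bs, a => (∀ i : Fin b.ht,
      (a.head i).1 = -(dim (σ ((repT k (trg bs)).len, i.1)) : ℤ) ∧
      (repS k b.heights (src bs)).map (place b i (a.head i).2) =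
        s ((repT k (trg bs)).len, i.1) • bw k (σ ((repT k (trg bs)).len, i.1))) ∧
      Represents s σ a.tail

section sums

variable {b : Block} {bs : List Block} {X Y : (T k (trg (b :: bs))).Obj} {A : Finset Letter}

lemma filter_ne_mem (h : ∀ a, a ∈ A ↔ a ∈ btw ((repT k (trg (b :: bs))).co X)
      ((repT k (trg (b :: bs))).co Y)) (a : Letter) :
    a ∈ A.filter (fun a => ¬ a.1 = (repT k (trg bs)).len) ↔
      a ∈ btw ((repT k (trg bs)).co (T.snd X)) ((repT k (trg bs)).co (T.snd Y)) := by
  rw [Finset.mem_filter, h]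
  by_cases ha : a.1 = (repT k (trg bs)).len
  · have h1 := (repT k (trg bs)).co_eq (T.snd Y) a.1 ha.ge
    simp only [ha, not_true, and_false, false_iff]
    rintro ⟨-, h2⟩
    omega
  · simp only [ha, not_false_eq_true, and_true]
    change _ ≤ _ ∧ _ < _ ↔ _ ≤ _ ∧ _ < _
    rw [show (repT k (trg (b :: bs))).co X a.1 = (repT k (trg bs)).co (T.snd X) a.1 from if_neg ha,
      show (repT k (trg (b :: bs))).co Y a.1 = (repT k (trg bs)).co (T.snd Y) a.1 from if_neg ha]

lemma filter_eq_mem (h : ∀ a, a ∈ A ↔ a ∈ btw ((repT k (trg (b :: bs))).co X)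
      ((repT k (trg (b :: bs))).co Y)) (a : Letter) :
    a ∈ A.filter (fun a => a.1 = (repT k (trg bs)).len) ↔
      a.1 = (repT k (trg bs)).len ∧ (T.fst X).1 ≤ a.2 ∧ a.2 < (T.fst Y).1 := by
  rw [Finset.mem_filter, h, and_comm]
  refine and_congr_right fun ha => ?_
  change _ ≤ _ ∧ _ < _ ↔ _
  rw [show (repT k (trg (b :: bs))).co X a.1 = (T.fst X).1 from if_pos ha,
    show (repT k (trg (b :: bs))).co Y a.1 = (T.fst Y).1 from if_pos ha]

variable {s : Letter → k} {σ : Letter → List Letter}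

lemma Inputs.Represents.colDeg_sub {a : Inputs k (b :: bs)} (ha : a.Represents s σ)
    (hXY : T.fst X ≤ T.fst Y)
    (h : ∀ a, a ∈ A ↔ a ∈ btw ((repT k (trg (b :: bs))).co X) ((repT k (trg (b :: bs))).co Y)) :
    a.colDeg (T.fst Y) - a.colDeg (T.fst X) =
      -∑ ν ∈ A with ν.1 = (repT k (trg bs)).len, (dim (σ ν) : ℤ) := by
  unfold colDeg
  have h1 : (Finset.univ.filter fun t : Fin b.ht => t.castSucc < T.fst X) ⊆
      Finset.univ.filter fun t : Fin b.ht => t.castSucc < T.fst Y :=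
    fun t ht => by
      simp only [Finset.mem_filter, Finset.mem_univ, true_and] at ht ⊢
      exact ht.trans_le hXY
  rw [← Finset.sum_sdiff h1, add_sub_cancel_right, ← Finset.sum_neg_distrib]
  refine Finset.sum_bij (fun t _ => ((repT k (trg bs)).len, t.1)) ?_ ?_ ?_ ?_
  · intro t ht
    rw [filter_eq_mem h]
    simp only [Finset.mem_sdiff, Finset.mem_filter, Finset.mem_univ, true_and, not_lt,
      Fin.lt_def, Fin.val_castSucc] at ht
    exact ⟨rfl, ht.2, ht.1⟩
  · intro t _ t' _ e
    exact Fin.ext (congrArg Prod.snd e)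
  · rintro ⟨c, t⟩ ht
    obtain ⟨rfl, h2, h3⟩ := (filter_eq_mem h _).1 ht
    simp only at h2 h3
    refine ⟨⟨t, by have := (T.fst Y).2; omega⟩, ?_, rfl⟩
    simp only [Finset.mem_sdiff, Finset.mem_filter, Finset.mem_univ, true_and, not_lt,
      Fin.lt_def, Fin.val_castSucc]
    exact ⟨h3, h2⟩
  · intro t _
    exact (ha.1 t).1

end sums

lemma fst_le_snd_le {b : Block} {bs : List Block} {X Y : (T k (trg (b :: bs))).Obj}
    (h : (repT k (trg (b :: bs))).co X ≤ (repT k (trg (b :: bs))).co Y) :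
    T.fst X ≤ T.fst Y ∧ (repT k (trg bs)).co (T.snd X) ≤ (repT k (trg bs)).co (T.snd Y) :=
  ((repT k (trg bs)).coTw_le (n := b.ht)).1 h

variable {s : Letter → k} {σ : Letter → List Letter}

lemma Inputs.Represents.deg_eq : ∀ {bs : List Block} {a : Inputs k bs} (_ : a.Represents s σ)
    {x y : (T k (trg bs)).Obj} (_ : (repT k (trg bs)).co x ≤ (repT k (trg bs)).co y)
    {A : Finset Letter}
    (_ : ∀ a, a ∈ A ↔ a ∈ btw ((repT k (trg bs)).co x) ((repT k (trg bs)).co y)),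
    a.deg x y = -∑ ν ∈ A, (dim (σ ν) : ℤ)
  | [], a, _, x, y, _, A, hA => by
    have : A = ∅ := Finset.eq_empty_of_forall_notMem fun a ha => by
      have := ((hA a).1 ha).2
      exact absurd this (Nat.not_lt_zero _)
    rw [this, Finset.sum_empty, neg_zero]
    exact a.deg_self x
  | b :: bs, a, ha, x, y, hxy, A, hA => by
    obtain ⟨h1, h2⟩ := fst_le_snd_le hxy
    rw [Inputs.deg_cons, ha.colDeg_sub h1 hA, deg_eq ha.2 h2 (filter_ne_mem hA),
      ← Finset.sum_filter_add_sum_filter_not A (fun ν => ν.1 = (repT k (trg bs)).len)]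
    ring

/-- The last column consists of the lexicographically largest letters, so each of its inputs between
`x` and `y` is inverted with all inputs of earlier columns between `y` and `z`. Within that column
there are no inversions because the first group lies lower. The earlier columns are handled by
induction. -/
lemma Inputs.Represents.shuffle_eq : ∀ {bs : List Block} {a : Inputs k bs} (_ : a.Represents s σ)
    {x y z : (T k (trg bs)).Obj} (_ : (repT k (trg bs)).co x ≤ (repT k (trg bs)).co y)
    (_ : (repT k (trg bs)).co y ≤ (repT k (trg bs)).co z) {A B : Finset Letter}
    (_ : ∀ a, a ∈ A ↔ a ∈ btw ((repT k (trg bs)).co x) ((repT k (trg bs)).co y))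
    (_ : ∀ a, a ∈ B ↔ a ∈ btw ((repT k (trg bs)).co y) ((repT k (trg bs)).co z)),
    a.shuffle x y z = ∑ ν ∈ A, dim (σ ν) * ∑ μ ∈ B with Letter.lt μ ν, (dim (σ μ) : ℤ)
  | [], a, _, x, y, _, _, _, A, _, hA, _ => by
    have : A = ∅ := Finset.eq_empty_of_forall_notMem fun a ha => by
      have := ((hA a).1 ha).2
      exact absurd this (Nat.not_lt_zero _)
    rw [this, Finset.sum_empty]
    rfl
  | b :: bs, a, ha, x, y, z, hxy, hyz, A, B, hA, hB => by
    obtain ⟨h1, h2⟩ := fst_le_snd_le hxy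
    obtain ⟨h3, h4⟩ := fst_le_snd_le hyz
    have lt_len : ∀ {u v : (T k (trg bs)).Obj} {a : Letter},
        a ∈ btw ((repT k (trg bs)).co u) ((repT k (trg bs)).co v) →
        a.1 < (repT k (trg bs)).len := by
      intro u v a h
      by_contra hn
      have := h.2
      rw [(repT k (trg bs)).co_eq _ _ (not_lt.1 hn)] at this
      exact absurd this (Nat.not_lt_zero _)
    rw [← Finset.sum_filter_add_sum_filter_not A (fun ν => ν.1 = (repT k (trg bs)).len)]
    refine (congrArg₂ (· + ·) (congrArg₂ (· * ·) (ha.colDeg_sub h1 hA)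
      (ha.2.deg_eq h4 (filter_ne_mem hB))) (ha.2.shuffle_eq h2 h4 (filter_ne_mem hA)
        (filter_ne_mem hB))).trans ?_
    rw [neg_mul_neg, Finset.sum_mul]
    refine congrArg₂ (· + ·) (Finset.sum_congr rfl fun ν hν => congrArg _ (Finset.sum_congr ?_
      fun _ _ => rfl)) (Finset.sum_congr rfl fun ν hν => congrArg _ (Finset.sum_congr ?_
      fun _ _ => rfl))
    · ext μ
      have hν := (filter_eq_mem hA ν).1 hν
      simp only [Finset.mem_filter]
      refine and_congr_right fun hμ => ⟨fun h => ?_, fun h h' => ?_⟩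
      · have := lt_len ((filter_ne_mem hB μ).1 (Finset.mem_filter.2 ⟨hμ, h⟩))
        exact Or.inl (by omega)
      · have := (filter_eq_mem hB μ).1 (Finset.mem_filter.2 ⟨hμ, h'⟩)
        unfold Letter.lt at h
        omega
    · ext μ
      have hν := lt_len ((filter_ne_mem hA ν).1 hν)
      simp only [Finset.mem_filter]
      refine ⟨fun h => ⟨h.1.1, h.2⟩, fun h => ⟨⟨h.1, fun h' => ?_⟩, h.2⟩⟩
      have := h.2
      unfold Letter.lt at this
      omega

end TwoOperad

-- Evaluation of plugging on the basis of normal forms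

namespace TwoOperad
variable {k : Type u} [Field k]

section plug

variable (S : Plugging k) {s : Letter → k} {σ : Letter → List Letter} {bs : List Block}

lemma Inputs.Represents.deg_word {a : Inputs k bs} (ha : a.Represents s σ)
    {x y : (T k (trg bs)).Obj} (h : (repT k (trg bs)).co x ≤ (repT k (trg bs)).co y)
    {w : List Letter} {n : ℤ}
    (hw : w ∈ wordsOf (btw ((repT k (trg bs)).co x) ((repT k (trg bs)).co y)) n) :
    a.deg x y = -totDim σ w :=
  ha.deg_eq h fun a => (List.mem_toFinset).trans (hw.1 a)

lemma Inputs.Represents.shuffle_word {a : Inputs k bs} (ha : a.Represents s σ)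
    {x y z : (T k (trg bs)).Obj} (h : (repT k (trg bs)).co x ≤ (repT k (trg bs)).co y)
    (h' : (repT k (trg bs)).co y ≤ (repT k (trg bs)).co z) {u w : List Letter} {m n : ℤ}
    (hu : u ∈ wordsOf (btw ((repT k (trg bs)).co x) ((repT k (trg bs)).co y)) m)
    (hw : w ∈ wordsOf (btw ((repT k (trg bs)).co y) ((repT k (trg bs)).co z)) n) :
    a.shuffle x y z = crossDim σ u w :=
  ha.shuffle_eq h h' (fun a => (List.mem_toFinset).trans (hu.1 a))
    fun a => (List.mem_toFinset).trans (hw.1 a)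

lemma not_mem_of_wordsOf {D : DGCat k} {R : Rep D} {x y z : D.Obj} {u w : List Letter} {m n : ℤ}
    (hu : u ∈ wordsOf (btw (R.co x) (R.co y)) m) (hw : w ∈ wordsOf (btw (R.co y) (R.co z)) n) :
    ∀ a ∈ u, a ∉ w := fun a ha ha' =>
  Set.disjoint_left.1 (btw_disjoint _ _ _) ((hu.1 a).1 ha) ((hw.1 a).1 ha')

/-- The result of plugging the inputs `a` into `f` is the result of plugging the words `σ` into the
word `w`. -/
def PlugsTo (s : Letter → k) (σ : Letter → List Letter) (a : Inputs k bs)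
    {x y : (T k (trg bs)).Obj} {n : ℤ} (f : (T k (trg bs)).Hom x y n) (w : List Letter) : Prop :=
  ∀ (p : ℤ) (h : n + a.deg x y = p),
    (repT k (src bs)).map (S.plug bs a h f) = sgn k n • plugW s w σ

variable {S}

/-- The sign in `plug_comp` and the sign in `plugW_append` count the same exchanges, once the
degrees of inputs are expressed through the dimensions of their words. -/
lemma PlugsTo.comp {a : Inputs k bs} (ha : a.Represents s σ) {x y z : (T k (trg bs)).Obj}
    (hxy : (repT k (trg bs)).co x ≤ (repT k (trg bs)).co y)
    (hyz : (repT k (trg bs)).co y ≤ (repT k (trg bs)).co z) {u w : List Letter} {m n q : ℤ}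
    (hu : u ∈ wordsOf (btw ((repT k (trg bs)).co x) ((repT k (trg bs)).co y)) m)
    (hw : w ∈ wordsOf (btw ((repT k (trg bs)).co y) ((repT k (trg bs)).co z)) n)
    {f : (T k (trg bs)).Hom x y m} {g : (T k (trg bs)).Hom y z n}
    (hf : PlugsTo S s σ a f u) (hg : PlugsTo S s σ a g w) (hq : m + n = q) :
    PlugsTo S s σ a ((T k (trg bs)).comp hq f g) (u ++ w) := by
  subst hq
  intro p hp
  have hd := a.deg_add x y z
  rw [S.plug_comp bs a f g rfl hp rfl rfl (by omega), map_smul, Rep.map_comp, hf _ rfl, hg _ rfl,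
    plugW_append s (not_mem_of_wordsOf hu hw), ha.shuffle_word hxy hyz hu hw,
    ha.deg_word hxy hu, ← hw.2]
  simp only [smul_mul_assoc, mul_smul_comm, smul_smul, ← sgn_add]
  congr 1
  refine sgn_congr ?_
  push_cast
  grind

/-- Each entry contributes the elementary intervals of its own word and one interval of `λ_i`, which
is its degree in the bar construction up to sign. -/
lemma dim_chainWord {D : DGCat k} {R : Rep D} {B : WordBasis R} {i : ℕ} {x : D.Obj}
    {v : List Letter} {t : Σ y, Chain D x y} (h : WordBasis.ChainWord B (R.len, i) x v t) :
    (dim ((R.len, i) :: v) : ℤ) = -t.2.deg := by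
  induction h with
  | nil x => simp [dim_cons, dim_nil, Chain.deg]
  | @cons x y z m g c u v h1 h2 h3 ih =>
    have h4 := (WordBasis.typed h1).2
    have h5 : ∀ a ∈ u, a ∉ (R.len, i) :: v := by
      intro a ha ha'
      have h6 := WordBasis.col_lt h1 ha
      rcases List.mem_cons.1 ha' with rfl | ha'
      · exact lt_irrefl _ h6
      · rcases h3.typed.2 a ha' with h | rfl
        · exact Set.disjoint_left.1 (btw_disjoint _ _ _) ((h4.1 a).1 ha) h
        · exact lt_irrefl _ h6
    rw [dim_cons, if_pos (by simp), dim_append h5]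
    push_cast
    have h6 := h4.2
    simp only [Chain.deg] at ih ⊢
    omega

/-- The plugging operation along the maps with the blocks `bs`. -/
abbrev Plugging.plugMap (S : Plugging k) (bs : List Block) : PlugMap k bs :=
  fun a _ _ _ _ h => S.plug bs a h

lemma ChainWord.filter_mem {D : DGCat k} {R : Rep D} {B : WordBasis R} {i : ℕ} {x : D.Obj}
    {v : List Letter} {t : Σ y, Chain D x y} (h : WordBasis.ChainWord B (R.len, i) x v t)
    (a : Letter) : a ∈ v.toFinset.erase (R.len, i) ↔ a ∈ btw (R.co x) (R.co t.1) := by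
  rw [Finset.mem_erase, List.mem_toFinset]
  have hlt : ∀ {x y : D.Obj} {a : Letter}, a ∈ btw (R.co x) (R.co y) → a ≠ (R.len, i) := by
    rintro x y a h rfl
    have := h.2
    rw [R.co_eq _ _ le_rfl] at this
    exact absurd this (Nat.not_lt_zero _)
  refine ⟨fun h' => (h.typed.2 a h'.2).resolve_right h'.1, fun h' => ⟨hlt h', ?_⟩⟩
  induction h with
  | nil x => rw [btw_self] at h'; exact absurd h' (Set.notMem_empty _)
  | cons h1 h2 h3 ih =>
    have h4 := WordBasis.typed h1
    rw [← btw_union h4.1 h3.typed.1] at h'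
    rcases h' with h' | h'
    · exact List.mem_append_left _ ((h4.2.1 a).2 h')
    · exact List.mem_append_right _ (List.mem_cons_of_mem _ (ih h'))

lemma lt_of_mem_btw {D : DGCat k} {R : Rep D} {x y : D.Obj} {a : Letter}
    (h : a ∈ btw (R.co x) (R.co y)) (i : ℕ) : Letter.lt a (R.len, i) := by
  by_contra hn
  have := h.2
  rw [R.co_eq _ _ (by by_contra h'; exact hn (Or.inl (not_le.1 h')))] at this
  exact absurd this (Nat.not_lt_zero _)

/-- Plugging `α` into the letter `λ` of `λ X₁ λ … X_l λ` means cutting `α` at `l` letters and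
filling in the plugged words `X_j`. This is the insertion of the plugged chain into `α`: a cut
corresponds to an insertion at the current letter, and consuming that letter corresponds to passing
on. The induction on the chain uses the hypothesis `IH` for its entries, and the inner one is on
`α`. -/
lemma plugW_chainWord {a : Inputs k bs} (ha : a.Represents s σ)
    (IH : ∀ {x y : (T k (trg bs)).Obj} {n : ℤ} {f : (T k (trg bs)).Hom x y n} {w : List Letter},
      (basisT k (trg bs)).rel x w ⟨y, n, f⟩ → PlugsTo S s σ a f w)
    {i : ℕ} {y : (T k (trg bs)).Obj} {v : List Letter} {t : Σ z, Chain (T k (trg bs)) y z}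
    (h : WordBasis.ChainWord (basisT k (trg bs)) ((repT k (trg bs)).len, i) y v t)
    (α : List Letter) :
    plugW s (((repT k (trg bs)).len, i) :: v)
        (Function.update σ ((repT k (trg bs)).len, i) α) =
      sgn k (dim α * (t.2.deg + a.deg y t.1) + (plugCh a (S.plugMap bs) t.2).sign + t.2.deg) •
        s ((repT k (trg bs)).len, i) •
          insW ((repT k (src bs)).seq (plugCh a (S.plugMap bs) t.2).chain) α := by
  induction h generalizing α with
  | nil x =>
    have e : plugCh a (S.plugMap bs) (Chain.nil x) = ⟨0, .nil _⟩ := rfl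
    simp only [e, Rep.seq_nil, insW_nil, Chain.deg, a.deg_self, add_zero, mul_zero, sgn_zero,
      one_smul]
    induction α with
    | nil => rw [plugW_update_nil_of_not_mem s List.not_mem_nil, bw_nil]; rfl
    | cons x α ih =>
      rw [plugW_update_cons, ih, if_neg List.not_mem_nil, zero_add, bw_cons x α, dim_cons,
        if_neg List.not_mem_nil, dim_nil]
      have : lowDim σ ((repT k (trg bs)).len, i) [] = 0 := rfl
      simp [this, sgn_zero]
  | @cons x y z m g c u v h1 h2 h3 ih =>
    obtain ⟨hxy, hu⟩ := WordBasis.typed h1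
    obtain ⟨hyz, -⟩ := h3.typed
    simp only at ih hyz
    set l : Letter := ((repT k (trg bs)).len, i)
    have hlu : l ∉ u := fun h => lt_irrefl _ (WordBasis.col_lt h1 h)
    have hd : ∀ a ∈ u, a ∉ l :: v := by
      intro a ha' hb
      rcases List.mem_cons.1 hb with rfl | hb
      · exact hlu ha'
      · rcases h3.typed.2 a hb with h | rfl
        · exact Set.disjoint_left.1 (btw_disjoint _ _ _) ((hu.1 a).1 ha') h
        · exact hlu ha'
    have e : plugCh a (S.plugMap bs) (Chain.cons g c) =
      ⟨a.shuffle x y z + a.deg x y * c.deg + (plugCh a (S.plugMap bs) c).sign,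
        .cons (S.plug bs a rfl g) (plugCh a (S.plugMap bs) c).chain⟩ := rfl
    -- The letter `l` lies in the last column, so all other letters of the chain word are smaller.
    have hlow : lowDim σ l (u ++ l :: v) = -a.deg x z := by
      rw [ha.deg_eq (hxy.trans hyz) (ChainWord.filter_mem (WordBasis.ChainWord.cons h1 h2 h3) ·), neg_neg]
      refine Finset.sum_congr ?_ fun _ _ => rfl
      ext b
      simp only [Finset.mem_filter, Finset.mem_erase]
      refine ⟨fun hb => ⟨fun e => Letter.lt_irrefl b (e ▸ hb.2), hb.1⟩, fun hb => ⟨hb.2, ?_⟩⟩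
      exact lt_of_mem_btw ((ChainWord.filter_mem (WordBasis.ChainWord.cons h1 h2 h3) b).1 (Finset.mem_erase.2 hb)) i
    have hcross : ∀ α, crossDim (Function.update σ l α) u (l :: v) = a.shuffle x y z := by
      intro α
      rw [ha.shuffle_eq hxy hyz (fun a => (List.mem_toFinset).trans (hu.1 a))
        (ChainWord.filter_mem h3 ·)]
      refine Finset.sum_congr rfl fun b hb => ?_
      have hb := List.mem_toFinset.1 hb
      have hbl : b ≠ l := fun e => hlu (e ▸ hb)
      rw [Function.update_of_ne hbl]
      refine congrArg _ (Finset.sum_congr ?_ fun c hc => ?_)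
      · ext c
        simp only [Finset.mem_filter, Finset.mem_erase, List.mem_toFinset, List.mem_cons]
        have := Letter.lt_irrefl l
        have h7 : Letter.lt b l := lt_of_mem_btw ((hu.1 b).1 hb) i
        have h8 : ¬ Letter.lt l b := by
          unfold Letter.lt at h7 ⊢; omega
        by_cases hcl : c = l
        · simp [hcl, h8]
        · simp only [hcl, false_or]
          exact ⟨fun h => ⟨⟨hcl, h.1⟩, h.2⟩, fun h => ⟨h.1.2, h.2⟩⟩
      · rw [Function.update_of_ne (Finset.ne_of_mem_erase (Finset.mem_filter.1 hc).1)]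
    have htot : ∀ α, totDim (Function.update σ l α) u = -a.deg x y := by
      intro α
      rw [ha.deg_word hxy hu, neg_neg]
      exact totDim_congr fun b hb => Function.update_of_ne (fun e => hlu (by rwa [← e])) _ _
    have hdim := dim_chainWord h3
    have hdim' := dim_chainWord (WordBasis.ChainWord.cons h1 h2 h3)
    simp only [Chain.deg] at hdim hdim'
    have hdeg := a.deg_add x y z
    have hpu : ∀ α, plugW s u (Function.update σ l α) = plugW s u σ := fun α =>
      plugW_congr (fun b hb => Function.update_of_ne (fun e => hlu (by rwa [← e])) _ _) fun _ _ => rfl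
    simp only [e, Rep.seq_cons, Chain.deg]
    induction α with
    | nil => rw [plugW_update_nil_of_mem s (by simp), insW_cons_nil, smul_zero, smul_zero]
    | cons b α ihα =>
      -- The two summands of the recursion match: a cut after `b` with the first summand of `insW`,
      -- in which the plugged `g` is inserted at `b`; consumption of `b` with the second.
      rw [plugW_update_cons, if_pos (by simp), ihα, plugW_append s hd, hcross, htot, hpu, ih,
        insW_cons_cons, IH h1 _ rfl, hlow, hdim, hdim', mul_add, smul_add, smul_add]
      simp only [mul_smul_comm, smul_mul_assoc, smul_smul, ← neg_smul]
      congr 1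
      · congr 1
        rw [← mul_assoc, ← sgn_add, mul_left_comm _ (s l), ← sgn_add, neg_sgn, ← sgn_add,
          mul_comm _ (s l)]
        congr 1
        refine sgn_congr ?_
        rw [← hdeg]
        push_cast
        grind
      · congr 1
        rw [← mul_assoc, ← sgn_add]
        congr 1
        refine sgn_congr ?_
        rw [dim_cons b α]
        split_ifs <;> push_cast <;> grind

/-- The plugging operation is given by plugging the words of the inputs into the words of the basis
elements. -/
theorem plugsTo_of_rel : ∀ {bs : List Block} {a : Inputs k bs} (_ : a.Represents s σ)
    {x y : (T k (trg bs)).Obj} {n : ℤ} {f : (T k (trg bs)).Hom x y n} {w : List Letter}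
    (_ : (basisT k (trg bs)).rel x w ⟨y, n, f⟩), PlugsTo S s σ a f w
  | [], a, _, x, y, n, f, w, h => by
    obtain ⟨rfl, h⟩ := h
    obtain ⟨rfl, h⟩ := Sigma.mk.inj h
    obtain ⟨rfl, h⟩ := Sigma.mk.inj (eq_of_heq h)
    obtain rfl := eq_of_heq h
    intro p hp
    obtain rfl : 0 = p := by rw [← hp]; exact (a.deg_self y).symm
    rw [sgn_zero, one_smul]
    exact (congrArg _ (S.plug_one [] a y hp)).trans (Rep.map_one _ _)
  | b :: bs, a, ha, _, _, _, _, _, h => by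
    have IH := fun {x y : (T k (trg bs)).Obj} {n : ℤ} {f : (T k (trg bs)).Hom x y n}
      {w : List Letter} => @plugsTo_of_rel bs a.tail ha.2 x y n f w
    have hright : ∀ (i : Fin (b.ht + 1)) {x y : (T k (trg bs)).Obj} {n : ℤ}
        {f : (T k (trg bs)).Hom x y n} {w : List Letter},
        (basisT k (trg bs)).rel x w ⟨y, n, f⟩ →
          PlugsTo S s σ (bs := b :: bs) a ((T.right i).map f) w := by
      intro i x y n f w h p hp
      have e := deg_pt_self a i x y
      refine (congrArg _ (S.plug_right b bs a i f hp
        ((congrArg (n + ·) e).symm.trans hp))).trans ?_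
      exact (repT_embed _ _ _ _).trans (IH h _ _)
    have heps : ∀ (i : Fin b.ht) {x : (T k (trg bs)).Obj} {v : List Letter}
        {t : Σ z, Chain (T k (trg bs)) x z},
        WordBasis.ChainWord (basisT k (trg bs)) ((repT k (trg bs)).len, i.1) x v t →
        PlugsTo S s σ (bs := b :: bs) a
          (T.eps (interval.gen k i) t.2 (zero_add t.2.deg)) (((repT k (trg bs)).len, i.1) :: v) := by
      intro i x v t h p hp
      have e := deg_pt_succ a i (x := x) (y := t.1)
      have hd := deg_plugCh a.tail (F := S.plugMap bs) t.2
      have h1 : (a.head i).1 + (plugCh a.tail (S.plugMap bs) t.2).chain.deg = p := by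
        rw [hd]
        refine .trans ?_ hp
        refine .trans ?_ (congrArg (t.2.deg + ·) e).symm
        ring
      refine (congrArg _ (S.plug_eps b bs a i t.2 _ hp h1)).trans ((map_smul _ _ _).trans ?_)
      refine (congrArg (_ • ·) ((S.repT_ext b.heights (src bs) _ h1 _).trans
        (congrArg (insN _) (ha.1 i).2))).trans ?_
      have h2 := plugW_chainWord (S := S) ha.2 IH h (σ ((repT k (trg bs)).len, i.1))
      rw [Function.update_eq_self] at h2
      rw [map_smul, insN_bw, h2, smul_smul (sgn k t.2.deg),
        ← sgn_add, (ha.1 i).1]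
      congr 1
      refine sgn_congr ?_
      push_cast
      grind
    suffices H : ∀ {X : Fin (b.ht + 1) × (T k (trg bs)).Obj} {w : List Letter}
        {t : Σ Y p, (Brace.tw b.ht (T k (trg bs))).Hom X Y p},
        WordBasis.NormalWord (basisT k (trg bs)) (Brace.tw b.ht (T k (trg bs))) X w t →
        PlugsTo S s σ (bs := b :: bs) (x := X) (y := t.1) a t.2.2 w from H h
    intro X w t h
    induction h with
    | base i h => exact hright i h
    | @step i j hij x y z Y m p g c f u v w h1 h2 h3 ih' =>
      obtain ⟨i, rfl⟩ : ∃ i' : Fin b.ht, i'.castSucc = i := ⟨⟨i.1, by omega⟩, rfl⟩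
      obtain rfl : i.succ = j := Fin.ext hij
      -- The factors of the normal form, regarded as normal forms themselves, provide the letters
      -- and degrees needed to compare the signs of the two compositions.
      have t1 := WordBasis.typed (B := basisT k (trg (b :: bs)))
        (WordBasis.NormalWord.base i.castSucc h1)
      have t2 := WordBasis.typed (B := basisT k (trg (b :: bs)))
        (WordBasis.NormalWord.step hij ((basisT k (trg bs)).one y) h2
          (WordBasis.NormalWord.base i.succ ((basisT k (trg bs)).one z)))
      have t3 := WordBasis.typed (B := basisT k (trg (b :: bs))) h3
      have t4 := WordBasis.typed (B := basisT k (trg (b :: bs)))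
        (WordBasis.NormalWord.step hij ((basisT k (trg bs)).one y) h2 h3)
      simp only [List.nil_append, List.append_nil, zero_add, add_zero] at t2 t4
      refine PlugsTo.comp (bs := b :: bs) ha t1.1 t4.1 t1.2 t4.2 (hright _ h1) ?_ rfl
      rw [← List.cons_append]
      exact PlugsTo.comp (bs := b :: bs) ha t2.1 t3.1 t2.2 t3.2 (heps i h2) ih' rfl

end plug

end TwoOperad

namespace TwoOperad
variable {k : Type u} [Field k]

/-! ## The words of the inputs -/

lemma Rep.map_cast {D : DGCat k} (R : Rep D) {x x' y y' : D.Obj} {n : ℤ} (hx : x = x')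
    (hy : y = y') (f : D.Hom x y n) : R.map (D.cast hx hy f) = R.map f := by
  subst hx hy
  rfl

lemma Rep.relabel_congr {D : DGCat k} (R : Rep D) {ρ ρ' : Letter → Letter}
    (h : ∀ a : Letter, a.1 < R.len → ρ a = ρ' a) {x y : D.Obj} {n : ℤ} (f : D.Hom x y n) :
    relabel ρ (R.map f) = relabel ρ' (R.map f) := by
  refine HW.eq_of (fun w hw => ?_) (HT.mem_HW (R.mem f))
  rw [relabel_bw, relabel_bw]
  refine congrArg _ (List.map_congr_left fun a ha => h a ?_)
  by_contra hn
  have := ((hw.1 a).1 ha).2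
  rw [R.co_eq _ _ (not_lt.1 hn)] at this
  exact absurd this (Nat.not_lt_zero _)

lemma relabel_id (x : WAlg k) : relabel id x = x := by
  have : relabel (k := k) id = LinearMap.id := WAlg.hom_ext fun w => by simp
  rw [this]; rfl

-- Inclusions of fibres in terms of letters

section incl

variable {L L' : List ℕ} (F : DGFunctor (T k L) (T k L')) (ρ : Letter → Letter)

/-- The map of letters that extends `ρ` by the inclusion of a column. -/
def inclLetter (L L' : List ℕ) (ρ : Letter → Letter) (o : ℕ) (x : Letter) : Letter :=
  if x.1 < L.length then ρ x else (L'.length, o + x.2)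

variable {F ρ} (hF : ∀ {x y : (T k L).Obj} {n : ℤ} (f : (T k L).Hom x y n),
  (repT k L').map (F.map f) = relabel ρ ((repT k L).map f))

include hF in
lemma seq_map {x y : (T k L).Obj} (c : Chain (T k L) x y) :
    (repT k L').seq (c.map F) = relabelSeq ρ ((repT k L).seq c) := by
  induction c with
  | nil => rfl
  | cons g c ih => simp only [Chain.map, Rep.seq_cons, ih, hF, relabelSeq, List.map_cons]

include hF in
lemma relabel_inclLetter (o : ℕ) {x y : (T k L).Obj} {n : ℤ} (f : (T k L).Hom x y n) :
    (repT k L').map (F.map f) = relabel (inclLetter L L' ρ o) ((repT k L).map f) := by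
  rw [hF]
  refine (repT k L).relabel_congr (fun a ha => ?_) f
  rw [repT_len] at ha
  exact (if_pos ha).symm

/-- The inclusion of a column, tensored with a dg functor. -/
def shiftIncl (F : DGFunctor (T k L) (T k L')) {h n : ℕ} (o : ℕ) (ho : o + h ≤ n) :
    DGFunctor (T k (h :: L)) (T k (n :: L')) := tw.map (interval.shift k o ho) F

-- Checked on generators. A generator `f_i` goes to `f_{o+i}`, so the letter of height `i` in the
-- new column is raised by `o`, while the entries of the chain are relabelled by `ρ`.
include hF in
lemma repT_shiftIncl {h n : ℕ} (o : ℕ) (ho : o + h ≤ n) {X Y : (T k (h :: L)).Obj} {p : ℤ}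
    (f : (T k (h :: L)).Hom X Y p) : (repT k (n :: L')).map ((shiftIncl F o ho).map f) =
      relabel (inclLetter L L' ρ o) ((repT k (h :: L)).map f) := by
  induction f using T.hom_ind with
  | zero X Y p => simp only [map_zero]
  | add hf hg => rw [map_add, map_add, map_add, map_add, hf, hg]
  | smul r hf => rw [map_smul, map_smul, map_smul, map_smul, hf]
  | comp e hf hg => rw [DGFunctor.map_comp, Rep.map_comp, Rep.map_comp, relabel_mul, hf, hg]
  | right i g => exact relabel_inclLetter hF o g
  | @eps i x y p c hp =>
    have hp' : 0 + (c.map F).deg = p := by rw [Chain.deg_map]; exact hp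
    refine Eq.trans (repT_eps (n := n) ((interval.shift k o ho).map (interval.gen k i))
      (c.map F) hp') ?_
    rw [repT_eps]
    have e1 : interval.val ((interval.shift k o ho).map (interval.gen k i)) = 1 := rfl
    have e2 : interval.val (interval.gen k i) = 1 := rfl
    rw [e1, e2, one_smul, one_smul]
    change insW _ (ivWord L'.length (o + i.1) (o + (i.1 + 1))) =
      relabel _ (insW _ (ivWord L.length i.1 (i.1 + 1)))
    rw [← add_assoc, ivWord_succ, ivWord_succ, relabel_insW (by simp),
      seq_map (relabel_inclLetter hF o)]
    have e3 : inclLetter L L' ρ o (L.length, i.1) = (L'.length, o + i.1) :=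
      if_neg (lt_irrefl _)
    rw [List.map_singleton, e3]

include hF in
lemma repT_inclNZ : ∀ (h n o : ℕ) (ho : o + h ≤ n) {X Y : (T k (consNZ h L)).Obj} {p : ℤ}
    (f : (T k (consNZ h L)).Hom X Y p), (repT k (n :: L')).map ((inclNZ F h n o ho).map f) =
      relabel (inclLetter L L' ρ o) ((repT k (consNZ h L)).map f)
  | 0, _, o, _, _, _, _, f => relabel_inclLetter hF o f
  | _ + 1, _, o, ho, _, _, _, f => repT_shiftIncl hF o ho f

end incl

/-- The words of the images of the fibres. -/
lemma repT_fibreIncl {m : ℕ} : ∀ (cs : List (Col m)) (i : Fin m)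
    {x y : (T k (fibreList cs i)).Obj} {n : ℤ} (f : (T k (fibreList cs i)).Hom x y n),
    (repT k (cs.map Col.ht)).map ((fibreIncl cs i).map f) =
      relabel (fibreLetter cs i 0) ((repT k (fibreList cs i)).map f)
  | [], _, _, _, _, f => (relabel_id _).symm
  | c :: cs, i, _, _, _, f => by
    refine (repT_inclNZ (fun f => repT_fibreIncl cs i f) _ _ _ (c.below_add_fibre_le i) f).trans ?_
    refine congrArg (fun ρ => relabel ρ ((repT k (fibreList (c :: cs) i)).map f)) (funext fun a => ?_)
    simp only [inclLetter, fibreLetter, List.length_map, zero_add]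

lemma length_consNZ (h : ℕ) (L : List ℕ) :
    (consNZ h L).length = L.length ∨ (consNZ h L).length = L.length + 1 := by
  cases h with
  | zero => exact Or.inl rfl
  | succ h => exact Or.inr rfl

lemma fibreLetter_col_lt {m : ℕ} (i : Fin m) (o : ℕ) : ∀ (cs : List (Col m)) (x : Letter),
    x.1 < (fibreList cs i).length → (fibreLetter cs i o x).1 < o + cs.length
  | [], _, h => absurd h (Nat.not_lt_zero _)
  | c :: cs, x, h => by
    rw [fibreLetter, List.length_cons]
    split_ifs with h'
    · have := fibreLetter_col_lt i o cs x h'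
      omega
    · simp only; omega

/-- Pruning empty columns and shifting heights keep the order of the balls. Hence relabelling the
words of a fibre changes neither the dimensions nor the numbers of inversions. -/
lemma fibreLetter_mono {m : ℕ} (i : Fin m) (o : ℕ) : ∀ (cs : List (Col m)) {x y : Letter},
    x.1 < (fibreList cs i).length → y.1 < (fibreList cs i).length → Letter.lt x y →
      Letter.lt (fibreLetter cs i o x) (fibreLetter cs i o y)
  | [], _, _, h, _, _ => absurd h (Nat.not_lt_zero _)
  | c :: cs, x, y, hx, hy, h => by
    have hl := length_consNZ (c.fibre i) (fibreList cs i)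
    rw [fibreList] at hx hy
    rw [fibreLetter, fibreLetter]
    split_ifs with h1 h2 h2
    · exact fibreLetter_mono i o cs h1 h2 h
    · have := fibreLetter_col_lt i o cs x h1
      exact Or.inl this
    · unfold Letter.lt at h; omega
    · unfold Letter.lt at h ⊢
      simp only
      refine Or.inr ⟨trivial, ?_⟩
      omega

lemma fibreLetter_shift {m : ℕ} (i : Fin m) (o : ℕ) : ∀ (cs : List (Col m)) {x : Letter},
    x.1 < (fibreList cs i).length → shiftL o (fibreLetter cs i 0 x) = fibreLetter cs i o x
  | [], _, h => absurd h (Nat.not_lt_zero _)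
  | c :: cs, x, h => by
    rw [fibreLetter, fibreLetter]
    split_ifs with h'
    · exact fibreLetter_shift i o cs h'
    · simp [shiftL]

-- Order-preserving maps of letters

section mono

variable {ρ : Letter → Letter} {P : Letter → Prop}
  (hρ : ∀ {x y}, P x → P y → Letter.lt x y → Letter.lt (ρ x) (ρ y))

include hρ in
lemma lt_iff_of_mono {x y : Letter} (hx : P x) (hy : P y) :
    Letter.lt (ρ x) (ρ y) ↔ Letter.lt x y := by
  refine ⟨fun h => ?_, hρ hx hy⟩
  by_cases e : x = y
  · subst e; exact absurd h (Letter.lt_irrefl _)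
  · rcases Letter.lt_trichotomy e with h' | h'
    · exact h'.1
    · have := hρ hy hx h'.2
      unfold Letter.lt at h this
      omega

include hρ in
lemma injOn_of_mono : Set.InjOn ρ {x | P x} := by
  intro x hx y hy e
  by_contra h
  rcases Letter.lt_trichotomy h with h | h
  · exact Letter.lt_irrefl _ (e ▸ hρ hx hy h.1)
  · exact Letter.lt_irrefl _ (e ▸ hρ hy hx h.2)

include hρ in
lemma mem_map_of_mono {a : Letter} {w : List Letter} (ha : P a) (hw : ∀ b ∈ w, P b) :
    ρ a ∈ w.map ρ ↔ a ∈ w := by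
  refine ⟨fun h => ?_, List.mem_map_of_mem⟩
  obtain ⟨b, hb, e⟩ := List.mem_map.1 h
  rwa [← injOn_of_mono hρ (hw b hb) ha e]

include hρ in
lemma inv_map_of_mono {w : List Letter} (hw : ∀ a ∈ w, P a) : inv (w.map ρ) = inv w := by
  have hb : ∀ {v : List Letter} {c : Letter}, P c → (∀ a ∈ v, P a) →
      below (v.map ρ) (ρ c) = below v c := by
    intro v c hc hv
    induction v with
    | nil => rfl
    | cons b v ih =>
      have hv' := fun a ha => hv a (List.mem_cons_of_mem _ ha)
      have hb := hv b (List.mem_cons_self ..)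
      rw [List.map_cons, below_cons, below_cons, ih hv']
      simp only [mem_map_of_mono hρ hb hv', lt_iff_of_mono hρ hb hc]
  induction w with
  | nil => rfl
  | cons b w ih =>
    have hv' := fun a ha => hw a (List.mem_cons_of_mem _ ha)
    have hb' := hw b (List.mem_cons_self ..)
    rw [List.map_cons, inv, inv, ih hv', hb hb' hv']
    simp only [mem_map_of_mono hρ hb' hv']

end mono

lemma col_lt_of_mem_balls : ∀ {L : List ℕ} {a : Letter}, a ∈ balls L → a.1 < L.length
  | [], _, h => absurd h (Finset.notMem_empty _)
  | _ :: L, a, h => by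
    rcases Finset.mem_union.1 h with h | h
    · exact (col_lt_of_mem_balls h).trans (Nat.lt_succ_self _)
    · obtain ⟨i, -, rfl⟩ := Finset.mem_image.1 h
      exact Nat.lt_succ_self _

lemma length_trg : ∀ bs : List Block, (trg bs).length = bs.length
  | [] => rfl
  | _ :: bs => congrArg (· + 1) (length_trg bs)

/-- The words of the inputs represent the inputs. -/
theorem represents_toInputs : ∀ {bs : List Block} (α : WordInputs bs) {σ : Letter → List Letter}
    (_ : ∀ a : Letter, a.1 < bs.length → σ a = α.word a),
    (α.toInputs fun (U : Disk) (n : ℤ) => phi k U.heights n).Represents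
      (fun a => sgn k (inv (σ a) : ℕ)) σ
  | [], _, _, _ => trivial
  | b :: bs, α, σ, h => by
    refine ⟨fun i => ?_, represents_toInputs α.2 fun a ha => ?_⟩
    · have e : σ ((repT k (trg bs)).len, i.1) =
          (α.1 i).1.map (fibreLetter b.cols i (src bs).length) := by
        rw [repT_len, length_trg, h _ (Nat.lt_succ_self _), WordInputs.word, if_pos rfl,
          dif_pos i.2]
      have hP : ∀ a ∈ (α.1 i).1, a.1 < (fibreList b.cols i).length := fun a ha =>
        col_lt_of_mem_balls (((α.1 i).2.1 a).1 ha)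
      have hm := @fibreLetter_mono b.ht i (src bs).length b.cols
      refine ⟨?_, ?_⟩
      · rw [e, dim_map ((injOn_of_mono (P := fun a => a.1 < (fibreList b.cols i).length) hm).mono hP)]
        rfl
      · simp only [e, inv_map_of_mono (P := fun a => a.1 < (fibreList b.cols i).length) hm hP]
        change relabel (shiftL (src bs).length) ((repT k b.heights).map (DGCat.cast _ _ _
          ((fibreIncl b.cols i).map (phi k (b.fibre i).heights _ _)))) = _
        refine (congrArg _ (Rep.map_cast (repT k b.heights) _ _ _)).trans ?_
        refine (congrArg _ (repT_fibreIncl b.cols i _)).trans ?_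
        refine (congrArg (fun v => relabel _ (relabel _ v)) ((map_phi _).trans
          ((norMap_toNor _).trans (breqMap_single _ _ _)))).trans ?_
        rw [map_smul, map_smul, relabel_bw, relabel_bw, List.map_map]
        refine congrArg (_ • bw k ·) (List.map_congr_left fun a ha => ?_)
        exact fibreLetter_shift i _ b.cols (hP a ha)
    · rw [h a (ha.trans (Nat.lt_succ_self _)), WordInputs.word, if_neg ha.ne]

end TwoOperad

namespace TwoOperad
variable {k : Type u} [Field k]

/-! ## Signs modulo 2 -/

/-- The sign of an element of `ℤ/2`. -/
def sgnZ (k : Type u) [Field k] (e : ZMod 2) : k := sgn k (e.val : ℤ)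

lemma sgn_eq_sgnZ (n : ℤ) : sgn k n = sgnZ k (n : ZMod 2) :=
  sgn_congr (by rw [Int.cast_natCast, ZMod.natCast_val, ZMod.cast_id])

lemma sgnZ_add (a b : ZMod 2) : sgnZ k (a + b) = sgnZ k a * sgnZ k b := by
  rw [sgnZ, sgnZ, sgnZ, ← sgn_add]
  refine sgn_congr ?_
  push_cast
  simp

/-- The indicator of a proposition, modulo 2. -/
def chi (p : Prop) [Decidable p] : ZMod 2 := if p then 1 else 0

lemma chi_true {p : Prop} [Decidable p] (h : p) : chi p = 1 := if_pos h

lemma chi_false {p : Prop} [Decidable p] (h : ¬ p) : chi p = 0 := if_neg h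

lemma chi_congr {p q : Prop} [Decidable p] [Decidable q] (h : p ↔ q) : chi p = chi q := by
  simp only [chi, h]

/-- The sum of `h` over the elementary intervals of a word. -/
def sumE (h : Letter → ZMod 2) : List Letter → ZMod 2
  | [] => 0
  | x :: w => sumE h w + chi (x ∈ w) * h x

lemma sumE_eq_sum (h : Letter → ZMod 2) {w : List Letter} {A : Finset Letter}
    (hA : ∀ a ∈ w, a ∈ A) : sumE h w = ∑ a ∈ A, ell w a * h a := by
  induction w with
  | nil => simp [sumE, ell]
  | cons x w ih =>
    rw [sumE, ih fun a ha => hA a (List.mem_cons_of_mem _ ha)]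
    simp only [ell_cons, Nat.cast_add, add_mul, Finset.sum_add_distrib]
    congr 1
    rw [Finset.sum_eq_single_of_mem x (hA x (List.mem_cons_self ..))]
    · rw [if_pos rfl, chi]; push_cast; rfl
    · intro b _ hb
      rw [if_neg hb, Nat.cast_zero, zero_mul]

lemma sumE_congr {h h' : Letter → ZMod 2} {w : List Letter} (e : ∀ a ∈ w, h a = h' a) :
    sumE h w = sumE h' w := by
  induction w with
  | nil => rfl
  | cons x w ih =>
    rw [sumE, sumE, ih fun a ha => e a (List.mem_cons_of_mem _ ha), e x (List.mem_cons_self ..)]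

lemma sumE_add (h h' : Letter → ZMod 2) (w : List Letter) :
    sumE (fun a => h a + h' a) w = sumE h w + sumE h' w := by
  induction w with
  | nil => rfl
  | cons x w ih => rw [sumE, sumE, sumE, ih]; ring

lemma sumE_zero (w : List Letter) : sumE (fun _ => 0) w = 0 := by
  induction w with
  | nil => rfl
  | cons x w ih => rw [sumE, ih, mul_zero, add_zero]

lemma sumE_one (w : List Letter) : sumE (fun _ => 1) w = dim w := by
  induction w with
  | nil => rfl
  | cons x w ih => rw [sumE, ih, dim_cons, chi]; push_cast; rw [mul_one]

lemma sumE_lt (w : List Letter) (c : Letter) : sumE (fun a => chi (Letter.lt a c)) w = below w c := by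
  induction w with
  | nil => rfl
  | cons x w ih =>
    rw [sumE, ih, below_cons, chi, chi]
    by_cases h1 : x ∈ w <;> by_cases h2 : Letter.lt x c <;> simp [h1, h2]

lemma inv_cons (x : Letter) (w : List Letter) : (inv (x :: w) : ZMod 2) =
    inv w + chi (x ∈ w) * sumE (fun a => chi (Letter.lt a x)) w := by
  rw [inv, sumE_lt, chi]
  split_ifs <;> simp

/-- The sum of `h` over the letters of a word, with multiplicities. -/
def sumM (h : Letter → ZMod 2) : List Letter → List ℕ → ZMod 2
  | x :: α, n :: r => n * h x + sumM h α r
  | _, _ => 0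

lemma sumM_congr {h h' : Letter → ZMod 2} : ∀ {α : List Letter} (_ : ∀ a ∈ α, h a = h' a)
    (r : List ℕ), sumM h α r = sumM h' α r
  | [], _, _ => rfl
  | _ :: _, _, [] => rfl
  | x :: α, e, n :: r => by
    rw [sumM, sumM, e x (List.mem_cons_self ..),
      sumM_congr (fun a ha => e a (List.mem_cons_of_mem _ ha)) r]

lemma sumM_zero : ∀ (α : List Letter) (r : List ℕ), sumM (fun _ => 0) α r = 0
  | [], _ => rfl
  | _ :: _, [] => rfl
  | x :: α, n :: r => by rw [sumM, sumM_zero α r, mul_zero, add_zero]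

lemma sumM_one : ∀ (α : List Letter) (r : List ℕ), r.length = α.length →
    sumM (fun _ => 1) α r = (r.sum : ℕ)
  | [], [], _ => rfl
  | x :: α, n :: r, h => by
    rw [sumM, sumM_one α r (by simpa using h), List.sum_cons]; push_cast; ring

/-- The exponent of the sign of the whiskering map. -/
def whiskE : List Letter → List ℕ → ZMod 2
  -- The `n` new intervals at `x` pass the old intervals of smaller letters and the later new
  -- intervals in smaller letters. The last summand counts the old interval that starts at `x`, if
  -- `x` recurs, against the later new intervals in letters that are not smaller: modulo 2, `1 + chi
  -- (a < x)` is the indicator of the complement.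
  | x :: α, n :: r => n * (sumE (fun a => chi (Letter.lt a x)) α +
      sumM (fun a => chi (Letter.lt a x)) α r) + whiskE α r +
      chi (x ∈ α) * sumM (fun a => 1 + chi (Letter.lt a x)) α r
  | _, _ => 0

/-- The pairs of letters that are exchanged in the composition, for a letter `x`. -/
def crossE (own : Letter → Letter) (x y : Letter) : ZMod 2 :=
  chi (Letter.lt y x ∧ Letter.lt (own x) (own y)) + chi (Letter.lt x y ∧ Letter.lt (own y) (own x))

/-- The exponent of the sign that puts the elementary intervals of a word in lexicographic order,
`own a` being the letter that has been replaced by `a`. -/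
def shufE (own : Letter → Letter) : List Letter → ZMod 2
  | [] => 0
  | x :: w => shufE own w + chi (x ∈ w) * sumE (crossE own x) w

/-! ## The runs of the plugging operation -/

/-- `Run σ β r w`: the word `w` results if the words `σ` are plugged into `β`, with the
multiplicities `r` of the cuts. -/
inductive Run : (Letter → List Letter) → List Letter → (Letter → List ℕ) → List Letter → Prop
  | nil {σ : Letter → List Letter} {r : Letter → List ℕ} (hσ : ∀ a, σ a = []) (hr : ∀ a, r a = []) :
      Run σ [] r []
  | finish {σ : Letter → List Letter} {r : Letter → List ℕ} {μ : Letter} {β w : List Letter}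
      (hσ : σ μ = []) (hμ : μ ∉ β) (h : Run σ β r w) : Run σ (μ :: β) r w
  | cut {σ : Letter → List Letter} {r : Letter → List ℕ} {μ x : Letter} {α β w : List Letter}
      {n : ℕ} {ρ : List ℕ} (hσ : σ μ = x :: α) (hμ : μ ∈ β) (hr : r μ = (n + 1) :: ρ)
      (h : Run σ β (Function.update r μ (n :: ρ)) w) : Run σ (μ :: β) r (x :: w)
  | consume {σ : Letter → List Letter} {r : Letter → List ℕ} {μ x : Letter} {α β w : List Letter}
      {ρ : List ℕ} (hσ : σ μ = x :: α) (hr : r μ = 0 :: ρ)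
      (h : Run (Function.update σ μ α) (μ :: β) (Function.update r μ ρ) w) :
      Run σ (μ :: β) r (x :: w)

/-- The letters of `β` belong to `V`, only words for these letters remain, and these words have
different letters. -/
structure Pluggable (V : Finset Letter) (own : Letter → Letter) (σ : Letter → List Letter)
    (β : List Letter) : Prop where
  sub : ∀ a ∈ β, a ∈ V
  nil : ∀ a, a ∉ β → σ a = []
  own : ∀ a, ∀ y ∈ σ a, own y = a

section run

variable {V : Finset Letter} {own : Letter → Letter} {σ : Letter → List Letter}
  {β w : List Letter} {r : Letter → List ℕ} {μ x : Letter} {α : List Letter}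

lemma Pluggable.finish (h : Pluggable V own σ (μ :: β)) (hσ : σ μ = []) : Pluggable V own σ β where
  sub a ha := h.sub a (List.mem_cons_of_mem _ ha)
  nil a ha := by
    by_cases e : a = μ
    · rw [e, hσ]
    · exact h.nil a (by simp [e, ha])
  own := h.own

lemma Pluggable.cut (h : Pluggable V own σ (μ :: β)) (hμ : μ ∈ β) : Pluggable V own σ β where
  sub a ha := h.sub a (List.mem_cons_of_mem _ ha)
  nil a ha := h.nil a fun h' => by
    rcases List.mem_cons.1 h' with rfl | h'
    · exact ha hμ
    · exact ha h'
  own := h.own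

lemma Pluggable.consume (h : Pluggable V own σ (μ :: β)) (hσ : σ μ = x :: α) :
    Pluggable V own (Function.update σ μ α) (μ :: β) where
  sub := h.sub
  nil a ha := by
    rw [Function.update_of_ne (fun e => ha (by simp [e]))]
    exact h.nil a ha
  own a y hy := by
    by_cases e : a = μ
    · subst e
      rw [Function.update_self] at hy
      exact h.own a y (hσ ▸ List.mem_cons_of_mem _ hy)
    · rw [Function.update_of_ne e] at hy
      exact h.own a y hy

lemma Run.length_eq (h : Run σ β r w) (a : Letter) : (r a).length = (σ a).length := by
  induction h with
  | nil hσ hr => rw [hσ, hr]; rfl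
  | finish _ _ _ ih => exact ih
  | @cut σ r μ x α β w n ρ hσ hμ hr h ih =>
    by_cases e : a = μ
    · subst e
      rw [Function.update_self] at ih
      rw [hr, ← ih]; rfl
    · rwa [Function.update_of_ne e] at ih
  | @consume σ r μ x α β w ρ hσ hr h ih =>
    by_cases e : a = μ
    · subst e
      rw [Function.update_self, Function.update_self] at ih
      rw [hr, hσ, List.length_cons, List.length_cons, ih]
    · rwa [Function.update_of_ne e, Function.update_of_ne e] at ih

lemma Run.sum_eq (h : Run σ β r w) (a : Letter) : (r a).sum = ell β a := by
  induction h with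
  | nil hσ hr => rw [hr]; rfl
  | @finish σ r μ β w hσ hμ h ih => rw [ih, ell_cons, if_neg hμ, ite_self, add_zero]
  | @cut σ r μ x α β w n ρ hσ hμ hr h ih =>
    rw [ell_cons, if_pos hμ, ← ih]
    by_cases e : a = μ
    · subst e
      rw [Function.update_self, if_pos rfl, hr, List.sum_cons, List.sum_cons]
      omega
    · rw [Function.update_of_ne e, if_neg e, add_zero]
  | @consume σ r μ x α β w ρ hσ hr h ih =>
    rw [← ih]
    by_cases e : a = μ
    · subst e
      rw [Function.update_self, hr, List.sum_cons, zero_add]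
    · rw [Function.update_of_ne e]

lemma Run.mem_iff (h : Run σ β r w) (y : Letter) : y ∈ w ↔ ∃ a, y ∈ σ a := by
  induction h with
  | nil hσ hr => simp [hσ]
  | finish _ _ _ ih => exact ih
  | @cut σ r μ x α β w n ρ hσ hμ hr h ih =>
    rw [List.mem_cons, ih, or_iff_right_iff_imp]
    rintro rfl
    exact ⟨μ, by simp [hσ]⟩
  | @consume σ r μ x α β w ρ hσ hr h ih =>
    rw [List.mem_cons, ih]
    constructor
    · rintro (rfl | ⟨a, ha⟩)
      · exact ⟨μ, by simp [hσ]⟩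
      · by_cases e : a = μ
        · subst e
          rw [Function.update_self] at ha
          exact ⟨a, by simp [hσ, ha]⟩
        · rw [Function.update_of_ne e] at ha
          exact ⟨a, ha⟩
    · rintro ⟨a, ha⟩
      by_cases e : a = μ
      · subst e
        rw [hσ, List.mem_cons] at ha
        exact ha.imp_right fun ha => ⟨a, by rwa [Function.update_self]⟩
      · exact Or.inr ⟨a, by rwa [Function.update_of_ne e]⟩

lemma Run.consume_mem (hP : Pluggable V own σ (μ :: β)) (hσ : σ μ = x :: α)
    (h : Run (Function.update σ μ α) (μ :: β) r w) : x ∈ w ↔ x ∈ α := by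
  rw [h.mem_iff]
  have h1 := hP.own μ x (by simp [hσ])
  constructor
  · rintro ⟨a, ha⟩
    have h2 := (hP.consume hσ).own a x ha
    obtain rfl : a = μ := h2.symm.trans h1
    rwa [Function.update_self] at ha
  · exact fun ha => ⟨μ, by rwa [Function.update_self]⟩

/-- Two sums that differ at one place only are compared by adding the two values there, which is the
same as subtracting in characteristic 2. -/
lemma sum_update_mem {V : Finset Letter} {μ : Letter} (hμ : μ ∈ V) {f g : Letter → ZMod 2}
    (h : ∀ a, a ≠ μ → f a = g a) : ∑ a ∈ V, f a = ∑ a ∈ V, g a + (f μ + g μ) := by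
  rw [← Finset.add_sum_erase V f hμ, ← Finset.add_sum_erase V g hμ,
    Finset.sum_congr rfl fun a ha => h a (Finset.ne_of_mem_erase ha)]
  have := CharTwo.add_self_eq_zero (g μ)
  linear_combination -this

/-- The elementary intervals of the resulting word are those of the plugged words together with one
for each cut, in the letter at which the cut is made. -/
lemma Run.sumE_eq (h : Run σ β r w) (hP : Pluggable V own σ β) (f : Letter → ZMod 2) :
    sumE f w = ∑ b ∈ V, (sumE f (σ b) + sumM f (σ b) (r b)) := by
  induction h with
  | nil hσ hr =>
    refine (Finset.sum_eq_zero fun b _ => ?_).symm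
    rw [hσ]; rfl
  | finish hσ _ _ ih => exact ih (hP.finish hσ)
  | @cut σ r μ x α β w n ρ hσ hμ hr h ih =>
    rw [sumE, ih (hP.cut hμ), chi_true ((h.mem_iff x).2 ⟨μ, by simp [hσ]⟩), one_mul,
      sum_update_mem (hP.sub μ (List.mem_cons_self ..)) (f := fun b => sumE f (σ b) + sumM f (σ b) (r b))
        (g := fun b => sumE f (σ b) + sumM f (σ b) (Function.update r μ (n :: ρ) b))
        fun a ha => by simp only [Function.update_of_ne ha]]
    simp only [Function.update_self, hr, hσ, sumM]
    push_cast
    grind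
  | @consume σ r μ x α β w ρ hσ hr h ih =>
    rw [sumE, ih (hP.consume hσ), chi_congr (h.consume_mem hP hσ),
      sum_update_mem (hP.sub μ (List.mem_cons_self ..)) (f := fun b => sumE f (σ b) + sumM f (σ b) (r b))
        (g := fun b => sumE f (Function.update σ μ α b) + sumM f (Function.update σ μ α b)
          (Function.update r μ ρ b))
        fun a ha => by simp only [Function.update_of_ne ha]]
    simp only [Function.update_self, hr, hσ, sumM, sumE]
    push_cast
    grind

end run

end TwoOperad

-- The change of the sign exponent under one move of a run

namespace TwoOperad
variable {k : Type u} [Field k]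

lemma sumM_add (h h' : Letter → ZMod 2) : ∀ (α : List Letter) (r : List ℕ),
    sumM (fun a => h a + h' a) α r = sumM h α r + sumM h' α r
  | [], _ => rfl
  | _ :: _, [] => rfl
  | x :: α, n :: r => by rw [sumM, sumM, sumM, sumM_add h h' α r]; ring

section run

variable {V : Finset Letter} {own : Letter → Letter} {σ : Letter → List Letter}
  {β w : List Letter} {r : Letter → List ℕ} {μ x : Letter} {α : List Letter}

/-- For letters with different owners, `crossE` detects whether their order disagrees with that of
the owners. Adding the inversion of the letters therefore leaves the inversion of the owners. -/
lemma crossE_add_chi {x y : Letter} (h : own y ≠ own x) :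
    crossE own x y + chi (Letter.lt y x) = chi (Letter.lt (own y) (own x)) := by
  have hxy : x ≠ y := fun e => h (by rw [e])
  unfold crossE chi
  rcases Letter.lt_trichotomy h with ⟨h1, h2⟩ | ⟨h1, h2⟩ <;>
  rcases Letter.lt_trichotomy hxy with ⟨h3, h4⟩ | ⟨h3, h4⟩ <;>
  simp [h1, h2, h3, h4]
  rfl

lemma crossE_self {x y : Letter} (h : own y = own x) : crossE own x y = 0 := by
  have := Letter.lt_irrefl (own x)
  simp [crossE, chi, h, this]

/-- The sum over the elementary intervals of the words that remain to be plugged in. -/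
lemma Run.cross_eq (h : Run σ β r w) (hP : Pluggable V own σ β) (hμ : own x ∈ V) :
    sumE (crossE own x) w + sumE (fun a => chi (Letter.lt a x)) w =
      ∑ b ∈ V, chi (Letter.lt b (own x)) * dim (σ b) +
        sumE (fun b => chi (Letter.lt b (own x))) β +
        (sumE (fun a => chi (Letter.lt a x)) (σ (own x)) +
          sumM (fun a => chi (Letter.lt a x)) (σ (own x)) (r (own x))) := by
  rw [← sumE_add, h.sumE_eq hP, sumE_eq_sum _ hP.sub, ← Finset.sum_add_distrib,
    sum_update_mem hμ (g := fun b => chi (Letter.lt b (own x)) * dim (σ b) +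
      ell β b * chi (Letter.lt b (own x)))]
  · rw [chi_false (Letter.lt_irrefl (own x)), zero_mul, mul_zero, add_zero, add_zero]
    have e : ∀ a ∈ σ (own x), crossE own x a + chi (Letter.lt a x) = chi (Letter.lt a x) := by
      intro a ha
      rw [crossE_self (hP.own _ a ha), zero_add]
    rw [sumE_congr e, sumM_congr e]
  · intro b hb
    have e : ∀ a ∈ σ b, crossE own x a + chi (Letter.lt a x) = chi (Letter.lt b (own x)) := by
      intro a ha
      rw [crossE_add_chi (by rwa [hP.own _ a ha]), hP.own _ a ha]
    rw [sumE_congr e, sumM_congr e]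
    by_cases hlt : Letter.lt b (own x)
    · rw [chi_true hlt, sumE_one, sumM_one _ _ (h.length_eq b), h.sum_eq, one_mul, mul_one]
    · rw [chi_false hlt, sumE_zero, sumM_zero, zero_mul, mul_zero]

/-- Every elementary interval belongs to a letter below `μ`, above `μ` or equal to `μ`. -/
lemma dim_eq_sumE {β : List Letter} (μ : Letter) : (dim β : ZMod 2) =
    sumE (fun b => chi (Letter.lt b μ)) β + sumE (fun b => chi (Letter.lt μ b)) β + ell β μ := by
  have e : (ell β μ : ZMod 2) = sumE (fun b => chi (b = μ)) β := by
    rw [sumE_eq_sum (A := insert μ β.toFinset) _ fun a ha => by simp [ha],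
      Finset.sum_eq_single_of_mem μ (Finset.mem_insert_self _ _), chi_true rfl, mul_one]
    intro b _ hb
    rw [chi_false hb, mul_zero]
  rw [e, ← sumE_add, ← sumE_add, ← sumE_one]
  refine sumE_congr fun b _ => ?_
  by_cases hb : b = μ
  · have := Letter.lt_irrefl μ
    simp [chi, hb, this]
  · rcases Letter.lt_trichotomy hb with ⟨h3, h4⟩ | ⟨h3, h4⟩ <;> simp [chi, hb, h3, h4]

/-- The exponent of the sign of a word in the composition. -/
def expo (V : Finset Letter) (own : Letter → Letter) (σ : Letter → List Letter) (β : List Letter)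
    (r : Letter → List ℕ) (w : List Letter) : ZMod 2 :=
  ∑ a ∈ V, (whiskE (σ a) (r a) + dim (σ a) * sumE (fun b => chi (Letter.lt a b)) β + inv (σ a)) +
    shufE own w + inv w + inv β

lemma expo_finish (hμ : μ ∉ β) : expo V own σ (μ :: β) r w = expo V own σ β r w := by
  simp only [expo, sumE, inv_cons, chi_false hμ, zero_mul, add_zero]

/-- Writing `x` at a cut creates an interval of `x` in the result and uses up an interval of `μ` in
`β`. By the count of intervals below them in `Run.cross_eq`, the changes of all contributions
cancel, in accordance with the absence of a sign in `plugW`. -/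
lemma expo_cut {n : ℕ} {ρ : List ℕ} (hP : Pluggable V own σ (μ :: β)) (hσ : σ μ = x :: α)
    (hμ : μ ∈ β) (hr : r μ = (n + 1) :: ρ) (h : Run σ β (Function.update r μ (n :: ρ)) w) :
    expo V own σ (μ :: β) r (x :: w) = expo V own σ β (Function.update r μ (n :: ρ)) w := by
  have hx : own x = μ := hP.own μ x (by simp [hσ])
  have hV : μ ∈ V := hP.sub μ (List.mem_cons_self ..)
  have key := h.cross_eq (hP.cut hμ) (x := x) (by rwa [hx])
  rw [hx, Function.update_self, hσ] at key
  simp only [sumE, sumM, chi_false (Letter.lt_irrefl x), mul_zero, add_zero, zero_add] at key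
  have e : ∀ a, whiskE (σ a) (r a) + dim (σ a) * sumE (fun b => chi (Letter.lt a b)) (μ :: β) +
      inv (σ a) = (whiskE (σ a) (r a) + dim (σ a) * sumE (fun b => chi (Letter.lt a b)) β +
        inv (σ a)) + chi (Letter.lt a μ) * dim (σ a) := by
    intro a
    rw [sumE, chi_true hμ]
    ring
  unfold expo
  simp only [e]
  rw [Finset.sum_add_distrib, sum_update_mem hV
    (g := fun a => whiskE (σ a) (Function.update r μ (n :: ρ) a) +
      dim (σ a) * sumE (fun b => chi (Letter.lt a b)) β + inv (σ a))
    fun a ha => by simp only [Function.update_of_ne ha]]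
  rw [Function.update_self, hσ, hr, whiskE, whiskE, shufE, inv_cons x, inv_cons x, inv_cons μ, chi_true hμ,
    chi_true ((h.mem_iff x).2 ⟨μ, by simp [hσ]⟩)]
  push_cast
  grind

/-- Consuming `x` removes an old interval of `σ μ` if `x` recurs, and nothing otherwise. The change
of the exponent is the sign attached to this move in `plugStep`. -/
lemma expo_consume {ρ : List ℕ} (hP : Pluggable V own σ (μ :: β)) (hσ : σ μ = x :: α)
    (hr : r μ = 0 :: ρ)
    (h : Run (Function.update σ μ α) (μ :: β) (Function.update r μ ρ) w) :
    expo V own σ (μ :: β) r (x :: w) =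
      expo V own (Function.update σ μ α) (μ :: β) (Function.update r μ ρ) w +
        chi (x ∈ α) * ((dim (μ :: β) + lowDim σ μ β : ℤ) : ZMod 2) := by
  have hx : own x = μ := hP.own μ x (by simp [hσ])
  have hV : μ ∈ V := hP.sub μ (List.mem_cons_self ..)
  have key := h.cross_eq (hP.consume hσ) (x := x) (by rwa [hx])
  have hl := h.length_eq μ
  have hs := h.sum_eq μ
  rw [Function.update_self, Function.update_self] at hl
  rw [Function.update_self] at hs
  rw [hx, Function.update_self, Function.update_self] at key
  -- Letters of `V` outside `μ :: β` carry empty words of dimension `0`, and `μ` is not smaller than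
  -- itself, so the sum may be extended to `V`.
  have hlow : ((lowDim σ μ β : ℤ) : ZMod 2) = ∑ b ∈ V, chi (Letter.lt b μ) * dim (σ b) := by
    rw [lowDim]
    push_cast
    rw [Finset.sum_filter]
    refine Finset.sum_subset_zero_on_sdiff (fun a ha => hP.sub a (by simp_all)) ?_ ?_
    · intro a ha
      by_cases e : a = μ
      · rw [e, chi_false (Letter.lt_irrefl μ), zero_mul]
      · have : a ∉ μ :: β := by simp_all
        rw [hP.nil a this]
        simp [dim_nil]
    · intro a _
      rw [chi]
      split_ifs <;> simp
  have hlow' : ∑ b ∈ V, chi (Letter.lt b μ) * dim (Function.update σ μ α b) =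
      ∑ b ∈ V, chi (Letter.lt b μ) * (dim (σ b) : ZMod 2) := by
    refine Finset.sum_congr rfl fun b _ => ?_
    by_cases e : b = μ
    · rw [e, chi_false (Letter.lt_irrefl μ), zero_mul, zero_mul]
    · rw [Function.update_of_ne e]
  have hd := dim_eq_sumE (β := μ :: β) μ
  have h1 := sumM_one α ρ hl
  rw [hs] at h1
  rw [hlow'] at key
  unfold expo
  rw [sum_update_mem hV
    (g := fun a => whiskE (Function.update σ μ α a) (Function.update r μ ρ a) +
      dim (Function.update σ μ α a) * sumE (fun b => chi (Letter.lt a b)) (μ :: β) +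
        inv (Function.update σ μ α a))
    fun a ha => by simp only [Function.update_of_ne ha]]
  rw [Function.update_self, Function.update_self, hσ, hr, whiskE, shufE, inv_cons, inv_cons,
    chi_congr (h.consume_mem hP hσ), sumM_add, h1, dim_cons]
  push_cast
  rw [hlow, hd]
  have h2 : (((if x ∈ α then 1 else 0 : ℕ)) : ZMod 2) = chi (x ∈ α) := by
    rw [chi]; push_cast; rfl
  push_cast at h2
  rw [h2]
  generalize chi (x ∈ α) = c at *
  grind

end run

end TwoOperad

-- Plugging as a sum over runs

namespace TwoOperad
variable {k : Type u} [Field k]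

/-- Each coefficient enters exactly once, at the last occurrence of its letter. -/
lemma plugW_eq_smul (s : Letter → k) : ∀ (β : List Letter) (σ : Letter → List Letter),
    plugW s β σ = (∏ a ∈ β.toFinset, s a) • plugW (fun _ => 1) β σ
  | [], σ => by simp [plugW]
  | μ :: β, σ => by
    suffices H : ∀ α, plugW s (μ :: β) (Function.update σ μ α) =
        (∏ a ∈ (μ :: β).toFinset, s a) • plugW (fun _ => 1) (μ :: β) (Function.update σ μ α) by
      simpa using H (σ μ)
    intro α
    induction α with
    | nil =>
      by_cases h : μ ∈ β
      · rw [plugW_update_nil_of_mem s h, plugW_update_nil_of_mem _ h, smul_zero]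
      · rw [plugW_update_nil_of_not_mem s h, plugW_update_nil_of_not_mem _ h, plugW_eq_smul s β,
          List.toFinset_cons, Finset.prod_insert (by simpa using h), one_smul, mul_smul]
    | cons x α ih =>
      rw [plugW_update_cons, plugW_update_cons, ih, plugW_eq_smul s β]
      by_cases h : μ ∈ β
      · rw [if_pos h, if_pos h, List.toFinset_cons, Finset.insert_eq_of_mem (List.mem_toFinset.2 h), smul_comm,
          ← smul_add, mul_smul_comm]
      · rw [if_neg h, if_neg h, zero_add, zero_add, smul_comm, mul_smul_comm]

/-- For `μ μ` in `β`, a cut at the first `μ` leaves its letter `x` available, and the second `μ`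
writes `x` again, so `x x` results. -/
lemma plugW_eq_zero (s : Letter → k) {β : List Letter} (h : IsDegenerate β) :
    ∀ (σ : Letter → List Letter), plugW s β σ = 0 := by
  obtain ⟨u, v, μ, rfl⟩ := h
  induction u with
  | nil =>
    intro σ
    suffices H : ∀ α, plugW s (μ :: μ :: v) (Function.update σ μ α) = 0 by simpa using H (σ μ)
    intro α
    induction α with
    | nil => exact plugW_update_nil_of_mem s (List.mem_cons_self ..) σ
    | cons x α ih =>
      rw [plugW_update_cons, ih, smul_zero, add_zero, if_pos (List.mem_cons_self ..),
        plugW_update_cons, bw_sq_assoc]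
  | cons x u ih =>
    intro σ
    suffices H : ∀ α, plugW s (x :: (u ++ μ :: μ :: v)) (Function.update σ x α) = 0 by
      simpa using H (σ x)
    intro α
    induction α with
    | nil =>
      by_cases h : x ∈ u ++ μ :: μ :: v
      · exact plugW_update_nil_of_mem s h σ
      · rw [plugW_update_nil_of_not_mem s h, ih, smul_zero]
    | cons y α ih' => rw [plugW_update_cons, ih', ih, smul_zero, ite_self, add_zero, mul_zero]

section runs

variable {V : Finset Letter} {own : Letter → Letter}

/-- Increase the first multiplicity of the word for `μ`. -/
def runCut (μ x : Letter) (p : (Letter → List ℕ) × List Letter) :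
    (Letter → List ℕ) × List Letter :=
  (Function.update p.1 μ ((p.1 μ).modifyHead (· + 1)), x :: p.2)

/-- Add the multiplicity `0` to the word for `μ`. -/
def runConsume (μ x : Letter) (p : (Letter → List ℕ) × List Letter) :
    (Letter → List ℕ) × List Letter :=
  (Function.update p.1 μ (0 :: p.1 μ), x :: p.2)

lemma runCut_injective (μ x : Letter) : Function.Injective (runCut μ x) :=
  Function.LeftInverse.injective (g := fun p =>
    (Function.update p.1 μ ((p.1 μ).modifyHead (· - 1)), p.2.tail)) fun p => by
      have e : ∀ l : List ℕ, (l.modifyHead (· + 1)).modifyHead (· - 1) = l := by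
        rintro (_ | ⟨n, l⟩) <;> rfl
      simp only [runCut, Function.update_self, Function.update_idem, List.tail_cons, e,
        Function.update_eq_self]

lemma runConsume_injective (μ x : Letter) : Function.Injective (runConsume μ x) :=
  Function.LeftInverse.injective (g := fun p =>
    (Function.update p.1 μ (p.1 μ).tail, p.2.tail)) fun p => by simp [runConsume]

-- The terms of the recursion are collected: a run starts with a cut or with a consumption, and each
-- of these moves is an injective operation on the runs of the smaller problem. The signs follow
-- `expo_cut` and `expo_consume`.
open scoped Classical in
lemma exists_runs : ∀ (β : List Letter) (σ : Letter → List Letter), Pluggable V own σ β →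
    ∃ R : Finset ((Letter → List ℕ) × List Letter), (∀ p, p ∈ R ↔ Run σ β p.1 p.2) ∧
      plugW (fun _ => (1 : k)) β σ = ∑ p ∈ R, sgnZ k (expo V own σ β p.1 p.2) • bw k p.2
  | [], σ, hP => by
    have hσ := fun a => hP.nil a List.not_mem_nil
    refine ⟨{(fun _ => [], [])}, fun p => ?_, ?_⟩
    · rw [Finset.mem_singleton]
      constructor
      · rintro rfl
        exact .nil hσ fun _ => rfl
      · obtain ⟨r, w⟩ := p
        rintro (⟨-, hr⟩)
        exact Prod.ext (funext hr) rfl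
    · rw [Finset.sum_singleton, plugW, bw_nil]
      simp [expo, hσ, whiskE, dim_nil, inv, shufE, sgnZ, sgn_zero]
  | μ :: β, σ, hP => by
    obtain ⟨α, hα⟩ : ∃ α, σ μ = α := ⟨_, rfl⟩
    induction α generalizing σ with
    | nil =>
      have e : σ = Function.update σ μ [] := by rw [← hα, Function.update_eq_self]
      by_cases h : μ ∈ β
      -- The word for `μ` is used up although `μ` occurs again: there is no run, in agreement with
      -- the value `0`.
      · refine ⟨∅, fun p => ?_, ?_⟩
        · refine iff_of_false (Finset.notMem_empty _) ?_
          obtain ⟨r, w⟩ := p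
          rintro (_ | ⟨_, h', _⟩ | ⟨h', _⟩ | ⟨h', _⟩)
          · exact h' h
          all_goals simp [hα] at h'
        · rw [e, plugW_update_nil_of_mem _ h, Finset.sum_empty]
      · obtain ⟨R, h1, h2⟩ := exists_runs β σ (hP.finish hα)
        refine ⟨R, fun p => (h1 p).trans ⟨.finish hα h, ?_⟩, ?_⟩
        · obtain ⟨r, w⟩ := p
          rintro (_ | ⟨_, _, h'⟩ | ⟨h', _⟩ | ⟨h', _⟩)
          · exact h'
          all_goals simp [hα] at h'
        · conv_lhs => rw [e]
          rw [plugW_update_nil_of_not_mem _ h, h2, one_smul]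
          exact Finset.sum_congr rfl fun p _ => by rw [expo_finish h]
    | cons x α ih =>
      have e : σ = Function.update σ μ (x :: α) := by rw [← hα, Function.update_eq_self]
      obtain ⟨R₂, h1, h2⟩ := ih _ (hP.consume hα) (Function.update_self ..)
      -- The runs that start with a cut; there are none if `μ` does not occur again.
      have key : ∃ R₁ : Finset ((Letter → List ℕ) × List Letter),
          (∀ p, p ∈ R₁ ↔ μ ∈ β ∧ Run σ β p.1 p.2) ∧
          (if μ ∈ β then plugW (fun _ => (1 : k)) β σ else 0) =
            ∑ p ∈ R₁, sgnZ k (expo V own σ β p.1 p.2) • bw k p.2 := by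
        by_cases h : μ ∈ β
        · obtain ⟨R₁, h3, h4⟩ := exists_runs β σ (hP.cut h)
          exact ⟨R₁, by simpa [h] using h3, by rw [if_pos h, h4]⟩
        · exact ⟨∅, by simp [h], by simp [h]⟩
      obtain ⟨R₁, h3, h4⟩ := key
      have hR₁ : ∀ p ∈ R₁, μ ∈ β ∧ ∃ n ρ, p.1 μ = n :: ρ ∧ (runCut μ x p).1 μ = (n + 1) :: ρ ∧
          Run σ β (Function.update (runCut μ x p).1 μ (n :: ρ)) p.2 ∧
          Function.update (runCut μ x p).1 μ (n :: ρ) = p.1 := by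
        intro p hp
        obtain ⟨hμ, hr⟩ := (h3 p).1 hp
        have hl := hr.length_eq μ
        rw [hα] at hl
        obtain ⟨n, ρ, hn⟩ := List.exists_cons_of_length_eq_add_one hl
        have : Function.update (runCut μ x p).1 μ (n :: ρ) = p.1 := by
          rw [runCut, Function.update_idem, ← hn, Function.update_eq_self]
        exact ⟨hμ, n, ρ, hn, by simp [runCut, hn], by rwa [this], this⟩
      have hR₂ : ∀ p : (Letter → List ℕ) × List Letter,
          Function.update (runConsume μ x p).1 μ (p.1 μ) = p.1 := fun p => by
        rw [runConsume, Function.update_idem, Function.update_eq_self]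
      refine ⟨R₁.image (runCut μ x) ∪ R₂.image (runConsume μ x), fun p => ?_, ?_⟩
      · rw [Finset.mem_union, Finset.mem_image, Finset.mem_image]
        constructor
        · rintro (⟨q, hq, rfl⟩ | ⟨q, hq, rfl⟩)
          · obtain ⟨hμ, n, ρ, -, h5, h6, -⟩ := hR₁ q hq
            exact .cut hα hμ h5 h6
          · exact .consume (ρ := q.1 μ) hα (by simp [runConsume])
              (by rw [hR₂]; exact (h1 q).1 hq)
        · obtain ⟨r, w⟩ := p
          rintro (_ | ⟨h, _⟩ | @⟨_, _, _, _, α', _, w, n, ρ, hσ, hμ, hr, h⟩ |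
            @⟨_, _, _, _, α', _, w, ρ, hσ, hr, h⟩)
          · simp [hα] at h
          · obtain ⟨rfl, rfl⟩ : x = _ ∧ α = α' := by simpa [hα] using hσ
            refine Or.inl ⟨_, (h3 (Function.update r μ (n :: ρ), w)).2 ⟨hμ, h⟩, ?_⟩
            simp [runCut, ← hr]
          · obtain ⟨rfl, rfl⟩ : x = _ ∧ α = α' := by simpa [hα] using hσ
            refine Or.inr ⟨_, (h1 (Function.update r μ ρ, w)).2 h, ?_⟩
            simp [runConsume, ← hr]
      · rw [Finset.sum_union, Finset.sum_image (runCut_injective μ x).injOn,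
          Finset.sum_image (runConsume_injective μ x).injOn]
        · conv_lhs => rw [e, plugW_update_cons, ← e, h4, h2]
          rw [mul_add, Finset.mul_sum, Finset.smul_sum, Finset.mul_sum]
          refine congrArg₂ (· + ·) (Finset.sum_congr rfl fun p hp => ?_)
            (Finset.sum_congr rfl fun p hp => ?_)
          · obtain ⟨hμ, n, ρ, -, h5, h6, h7⟩ := hR₁ p hp
            have := expo_cut hP hα hμ h5 h6
            rw [h7] at this
            rw [mul_smul_comm, ← bw_cons, ← this]
            rfl
          · have := expo_consume hP hα (r := (runConsume μ x p).1) (ρ := p.1 μ) (w := p.2)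
              (by simp [runConsume]) (by rw [hR₂]; exact (h1 p).1 hp)
            rw [hR₂] at this
            rw [mul_smul_comm, mul_smul_comm, ← bw_cons, smul_smul, mul_comm, sgn_eq_sgnZ,
              ← sgnZ_add]
            refine congrArg₂ (fun a b => sgnZ k a • bw k b) (Eq.trans ?_ this.symm) rfl
            rw [chi]
            split_ifs <;> simp
        -- The first multiplicity for `μ` is positive after a cut and `0` after a consumption, so
        -- the two families are disjoint.
        · rw [Finset.disjoint_left]
          rintro _ hp hq
          obtain ⟨p, hp', rfl⟩ := Finset.mem_image.1 hp
          obtain ⟨q, -, hq⟩ := Finset.mem_image.1 hq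
          obtain ⟨-, n, ρ, -, h5, -⟩ := hR₁ p hp'
          rw [← hq] at h5
          simp [runConsume] at h5

end runs

end TwoOperad

namespace TwoOperad
variable {k : Type u} [Field k]

/-! ## The composition of the 2-operad in terms of runs -/

lemma substitute_congr : ∀ {β : List Letter} {σ τ : Letter → List (List Letter)}
    (_ : ∀ a ∈ β, σ a = τ a), substitute β σ = substitute β τ
  | [], _, _, _ => rfl
  | a :: β, σ, τ, h => by
    rw [substitute, substitute, h a (List.mem_cons_self ..)]
    refine congrArg _ (substitute_congr fun b hb => ?_)
    by_cases e : b = a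
    · rw [e, Function.update_self, Function.update_self]
    · rw [Function.update_of_ne e, Function.update_of_ne e, h b (List.mem_cons_of_mem _ hb)]

section run

variable {V : Finset Letter} {own : Letter → Letter} {σ : Letter → List Letter}
  {β w : List Letter} {r : Letter → List ℕ}

/-- A run produces the segments letter by letter instead of cutting all the words beforehand; its
word is determined by the multiplicities. -/
lemma Run.eq_substitute (h : Run σ β r w) :
    w = substitute β fun a => segmentsAux ((σ a).zip (r a)) := by
  induction h with
  | nil => rfl
  | finish hσ hμ h ih =>
    rw [substitute, hσ]
    refine ih.trans (substitute_congr fun a ha => ?_)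
    rw [Function.update_of_ne fun e => hμ (by rwa [← e])]
  | @cut σ r μ x α β w n ρ hσ hμ hr h ih =>
    rw [substitute, hσ, hr, List.zip_cons_cons, segmentsAux, List.replicate_succ]
    refine congrArg (x :: ·) (ih.trans (substitute_congr fun a _ => ?_))
    by_cases e : a = μ
    · subst e
      rw [Function.update_self, Function.update_self, hσ, List.zip_cons_cons, segmentsAux]
      rfl
    · rw [Function.update_of_ne e, Function.update_of_ne e]
  | @consume σ r μ x α β w ρ hσ hr h ih =>
    rw [substitute, hσ, hr, List.zip_cons_cons, segmentsAux]
    refine congrArg (x :: ·) (ih.trans ?_)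
    rw [substitute, Function.update_self, Function.update_self]
    refine congrArg _ (substitute_congr fun a _ => ?_)
    by_cases e : a = μ
    · subst e
      rw [Function.update_self, Function.update_self]
      rfl
    · simp only [Function.update_of_ne e]

/-- A positive first multiplicity forces a cut and the value `0` forces a consumption. The condition
on the sums guarantees that cuts are available exactly as long as the letter of `β` occurs again. -/
lemma exists_run : ∀ (β : List Letter) (σ : Letter → List Letter) (r : Letter → List ℕ),
    (∀ a, (r a).length = (σ a).length) → (∀ a, (r a).sum = ell β a) → (∀ a, a ∉ β → σ a = []) →
      ∃ w, Run σ β r w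
  | [], σ, r, hl, _, hn => by
    have hσ := fun a => hn a List.not_mem_nil
    exact ⟨[], .nil hσ fun a => List.eq_nil_of_length_eq_zero (by rw [hl, hσ]; rfl)⟩
  | μ :: β, σ, r, hl, hs, hn => by
    have hμ := hs μ
    rw [ell_cons, if_pos rfl] at hμ
    obtain ⟨α, hα⟩ : ∃ α, σ μ = α := ⟨_, rfl⟩
    induction α generalizing σ r with
    | nil =>
      have hr : r μ = [] := List.eq_nil_of_length_eq_zero (by rw [hl, hα]; rfl)
      have h : μ ∉ β := fun h => by simp [hr, h] at hμ
      obtain ⟨w, hw⟩ := exists_run β σ r hl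
        (fun a => by rw [hs, ell_cons, if_neg h, ite_self, add_zero]) fun a ha => by
          by_cases e : a = μ
          · rw [e, hα]
          · exact hn a (by simp [e, ha])
      exact ⟨w, .finish hα h hw⟩
    | cons x α ih =>
      obtain ⟨n, ρ, hn'⟩ := List.exists_cons_of_length_eq_add_one
        ((hl μ).trans (congrArg List.length hα))
      have hl' := hl μ
      rw [hn', hα] at hl'
      have hs' := hs μ
      rw [hn', List.sum_cons] at hs'
      cases n with
      | zero =>
        obtain ⟨w, hw⟩ := ih (Function.update σ μ α) (Function.update r μ ρ)
          (fun a => by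
            by_cases e : a = μ
            · subst e
              simpa using hl'
            · rw [Function.update_of_ne e, Function.update_of_ne e, hl])
          (fun a => by
            by_cases e : a = μ
            · subst e
              rw [Function.update_self, ← hs', zero_add]
            · rw [Function.update_of_ne e, hs])
          (fun a ha => by
            rw [Function.update_of_ne fun e => ha (by rw [e]; exact List.mem_cons_self ..), hn a ha])
          (by rw [Function.update_self, ← hμ, hn', List.sum_cons, zero_add])
          (Function.update_self ..)
        exact ⟨_, .consume hα hn' hw⟩
      | succ n =>
        have h : μ ∈ β := by
          by_contra h
          rw [ell_cons, if_pos rfl, if_neg h, ell_of_not_mem h] at hs'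
          omega
        obtain ⟨w, hw⟩ := exists_run β σ (Function.update r μ (n :: ρ))
          (fun a => by
            by_cases e : a = μ
            · subst e
              simpa [hα] using hl'
            · rw [Function.update_of_ne e, hl])
          (fun a => by
            have := hs a
            rw [ell_cons, if_pos h] at this
            by_cases e : a = μ
            · subst e
              rw [Function.update_self, List.sum_cons]
              rw [if_pos rfl, hn', List.sum_cons] at this
              omega
            · rw [Function.update_of_ne e, this, if_neg e, add_zero])
          (fun a ha => hn a fun h' => by
            rcases List.mem_cons.1 h' with rfl | h'
            · exact ha h
            · exact ha h')
        exact ⟨_, .cut hα h hn' hw⟩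

lemma sumM_ofFn (f : Letter → ZMod 2) : ∀ (α : List Letter) (r : Fin α.length → ℕ),
    sumM f α (List.ofFn r) = ∑ t, r t * f (α.get t)
  | [], _ => rfl
  | x :: α, r => by
    have e : List.ofFn r = r ⟨0, Nat.succ_pos _⟩ :: List.ofFn fun t : Fin α.length => r t.succ :=
      List.ofFn_succ
    have e' := Fin.sum_univ_succ (n := α.length) fun t => (r t : ZMod 2) * f ((x :: α).get t)
    rw [e, sumM, sumM_ofFn f α]
    exact e'.symm

lemma whiskerSign_eq : ∀ (α : List Letter) (r : Fin α.length → ℕ),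
    (whiskerSign α r : ZMod 2) = whiskE α (List.ofFn r)
  | [], _ => by simp [whiskerSign, whiskE]
  | x :: α, r => by
    have e : List.ofFn r = r ⟨0, Nat.succ_pos _⟩ :: List.ofFn fun t : Fin α.length => r t.succ :=
      List.ofFn_succ
    have ih := whiskerSign_eq α fun t => r t.succ
    -- Prefixing `x` adds one to `before` for every later letter that is not smaller than `x`,
    -- provided `x` recurs: a larger letter through the interval of `x`, and an equal one through
    -- the face index.
    have h1 : ∀ t : Fin α.length, (before (x :: α) t.succ : ZMod 2) = before α t +
        chi (x ∈ α) * (1 + chi (Letter.lt (α.get t) x)) := by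
      intro t
      rw [before_eq, before_eq]
      have h1 : (x :: α).get t.succ = α.get t := rfl
      have h2 : (x :: α).take t.succ.1 = x :: α.take t.1 := rfl
      rw [h1, h2, below_cons, List.count_cons]
      by_cases hx : x = α.get t
      · have : x ∈ α := hx ▸ List.get_mem α t
        rw [← hx, if_neg fun h => Letter.lt_irrefl x h.2, chi_true this,
          chi_false (Letter.lt_irrefl x)]
        simp
        ring
      · have hx' : ¬ (x == α.get t) = true := by simpa using hx
        rw [if_neg hx']
        rcases Letter.lt_trichotomy hx with ⟨h3, h4⟩ | ⟨h3, h4⟩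
        · rw [chi_false h4, chi]
          simp only [h3, and_true]
          split_ifs <;> push_cast <;> ring
        · rw [chi_true h4, if_neg fun h => h3 h.2, CharTwo.add_self_eq_zero]
          push_cast
          ring
    have h0 : before (x :: α) ⟨0, Nat.succ_pos _⟩ = below α x := by
      rw [before_eq]
      change below (x :: α) x + 0 = _
      rw [below_cons, if_neg fun h => Letter.lt_irrefl _ h.2, add_zero, add_zero]
    rw [e, whiskE, ← ih, sumM_ofFn, sumM_ofFn, sumE_lt, ← h0]
    have e1 := Fin.sum_univ_succ (n := α.length) fun t => r t * before (x :: α) t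
    have e2 := Fin.sum_univ_succ (n := α.length) fun t => ∑ t' : Fin (x :: α).length,
      if t < t' ∧ Letter.lt ((x :: α).get t') ((x :: α).get t) then r t * r t' else 0
    have e3 := fun t : Fin (x :: α).length => Fin.sum_univ_succ (n := α.length) fun t' =>
      if t < t' ∧ Letter.lt ((x :: α).get t') ((x :: α).get t) then r t * r t' else 0
    have e4 : whiskerSign (x :: α) r = r ⟨0, Nat.succ_pos _⟩ * before (x :: α) ⟨0, Nat.succ_pos _⟩ +
        (∑ t : Fin α.length, r t.succ * before (x :: α) t.succ) +
        ((∑ t' : Fin α.length, if Letter.lt (α.get t') x then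
          r ⟨0, Nat.succ_pos _⟩ * r t'.succ else 0) +
        ∑ t : Fin α.length, ∑ t' : Fin α.length,
          if t < t' ∧ Letter.lt (α.get t') (α.get t) then r t.succ * r t'.succ else 0) := by
      refine (congrArg₂ (· + ·) e1 (e2.trans (congrArg₂ (· + ·) ((e3 0).trans ?_)
        (Finset.sum_congr rfl fun t _ => (e3 t.succ).trans ?_))))
      · rw [if_neg (by simp), zero_add]
        refine Finset.sum_congr rfl fun t _ => ?_
        simp only [Fin.succ_pos, true_and]
        rfl
      · rw [if_neg (by simp), zero_add]
        refine Finset.sum_congr rfl fun t' _ => ?_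
        simp only [Fin.succ_lt_succ_iff]
        rfl
    rw [e4, whiskerSign]
    push_cast
    simp only [h1, mul_add, Finset.sum_add_distrib, Finset.mul_sum, chi]
    have e5 : ∀ t : Fin α.length, (if Letter.lt (α.get t) x then
        (r ⟨0, Nat.succ_pos _⟩ : ZMod 2) * r t.succ else 0) =
        r ⟨0, Nat.succ_pos _⟩ * (r t.succ * if Letter.lt (α.get t) x then 1 else 0) := by
      intro t
      split_ifs <;> simp
    have e6 : ∀ (c d e : ZMod 2), c * (d * e) = d * (c * e) := fun c d e => by ring
    simp only [e5, e6 (r (Fin.succ _) : ZMod 2)]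
    ring

lemma koszulSign_eq {V : Finset Letter} (hβ : ∀ a ∈ β, a ∈ V) : (koszulSign V β σ : ZMod 2) =
    ∑ a ∈ V, dim (σ a) * sumE (fun b => chi (Letter.lt a b)) β := by
  rw [koszulSign]
  push_cast
  refine Finset.sum_congr rfl fun a _ => ?_
  rw [sumE_eq_sum _ hβ, Finset.mul_sum, Finset.sum_filter]
  refine Finset.sum_congr rfl fun b _ => ?_
  rw [chi]
  split_ifs <;> ring

/-- The recursive exponent counts pairs of elementary intervals whose letters are ordered
differently from their owners. A new interval of `c` is paired with those already present, in either
position, which is why `crossE` is symmetric. -/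
lemma shufE_eq_sum (own : Letter → Letter) {A : Finset Letter} : ∀ (w : List Letter)
    (_ : ∀ a ∈ w, a ∈ A), shufE own w = ∑ x ∈ A, ∑ y ∈ A,
      chi (Letter.lt (own x) (own y) ∧ Letter.lt y x) * (ell w x * ell w y)
  | [], _ => by simp [shufE, ell]
  | c :: w, hA => by
    have hw := fun a ha => hA a (List.mem_cons_of_mem _ ha)
    have hc := hA c (List.mem_cons_self ..)
    rw [shufE, shufE_eq_sum own w hw, sumE_eq_sum _ hw]
    by_cases h : c ∈ w
    · have e : ∀ a, (ell (c :: w) a : ZMod 2) = ell w a + if a = c then 1 else 0 := by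
        intro a
        rw [ell_cons, if_pos h]
        push_cast
        rfl
      have hcc : chi (Letter.lt c c ∧ Letter.lt (own c) (own c)) = 0 :=
        chi_false fun h => Letter.lt_irrefl _ h.1
      simp only [e, crossE, add_mul, mul_add, Finset.sum_add_distrib, mul_ite, mul_one, mul_zero,
        ite_mul, one_mul, zero_mul, Finset.sum_ite_eq', hc, if_true, chi_true h, Finset.sum_ite_irrel,
        Finset.sum_const_zero, and_comm]
      have e' : ∀ x y : Letter, chi (Letter.lt y x ∧ Letter.lt (own x) (own y)) * (ell w x : ZMod 2) =
        ell w x * chi (Letter.lt y x ∧ Letter.lt (own x) (own y)) := fun x y => mul_comm _ _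
      have e'' : ∀ x y : Letter, chi (Letter.lt y x ∧ Letter.lt (own x) (own y)) * (ell w y : ZMod 2) =
        ell w y * chi (Letter.lt y x ∧ Letter.lt (own x) (own y)) := fun x y => mul_comm _ _
      simp only [e', e'', hcc]
      ring
    · have e : ∀ a, ell (c :: w) a = ell w a := fun a => by
        rw [ell_cons, if_neg h, ite_self, add_zero]
      simp only [e, chi_false h, zero_mul, add_zero]

/-- The letters of the word are partitioned by their owners, so the double sum over pairs of letters
breaks up according to pairs of balls of the target. -/
lemma shuffleSign_eq (hown : ∀ a, ∀ y ∈ σ a, own y = a)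
    (hw : ∀ y ∈ w, ∃ a ∈ V, y ∈ σ a) : (shuffleSign V σ w : ZMod 2) = shufE own w := by
  have hd : (V : Set Letter).PairwiseDisjoint fun a => (σ a).toFinset := by
    intro a _ b _ hab
    refine Finset.disjoint_left.2 fun y ha hb => hab ?_
    rw [← hown a y (List.mem_toFinset.1 ha), hown b y (List.mem_toFinset.1 hb)]
  rw [shufE_eq_sum own (A := V.biUnion fun a => (σ a).toFinset) w fun y hy => by
    obtain ⟨a, ha, hy⟩ := hw y hy
    exact Finset.mem_biUnion.2 ⟨a, ha, List.mem_toFinset.2 hy⟩, Finset.sum_biUnion hd, shuffleSign]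
  push_cast
  refine Finset.sum_congr rfl fun a _ => ?_
  simp only [Finset.sum_biUnion hd]
  rw [Finset.sum_comm]
  refine Finset.sum_congr rfl fun x hx => ?_
  rw [Finset.sum_filter]
  refine Finset.sum_congr rfl fun b _ => ?_
  have e : ∀ y ∈ (σ b).toFinset, chi (Letter.lt (own x) (own y) ∧ Letter.lt y x) =
      if Letter.lt a b then (if Letter.lt y x then 1 else 0) else 0 := by
    intro y hy
    rw [hown a x (List.mem_toFinset.1 hx), hown b y (List.mem_toFinset.1 hy), chi]
    simp only [ite_and]
  rw [Finset.sum_congr rfl fun y hy => congrArg (· * ((ell w x : ZMod 2) * ell w y)) (e y hy),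
    Finset.sum_filter]
  split_ifs
  · exact Finset.sum_congr rfl fun y _ => by split_ifs <;> simp
  · simp

end run

end TwoOperad

namespace TwoOperad
variable {k : Type u} [Field k]

/-! ## The letters of the inputs -/

lemma fibreLetter_col_le {m : ℕ} (i : Fin m) (o : ℕ) : ∀ (cs : List (Col m)) {x : Letter},
    x.1 < (fibreList cs i).length → o ≤ (fibreLetter cs i o x).1
  | [], _, h => absurd h (Nat.not_lt_zero _)
  | c :: cs, x, h => by
    rw [fibreLetter]
    split_ifs with h'
    · exact fibreLetter_col_le i o cs h'
    · exact Nat.le_add_right _ _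

lemma Col.below_mono {m : ℕ} (c : Col m) {i j : Fin (m + 1)} (h : i ≤ j) : c.below i ≤ c.below j :=
  Finset.card_le_card fun t ht => by
    rw [Finset.mem_filter] at ht ⊢
    exact ⟨ht.1, ht.2.trans_le h⟩

lemma mem_balls_consNZ {n : ℕ} {L : List ℕ} {x : Letter} (h : x ∈ balls (consNZ n L)) :
    x ∈ balls L ∨ x.1 = L.length ∧ x.2 < n := by
  cases n with
  | zero => exact Or.inl h
  | succ n =>
    rcases Finset.mem_union.1 h with h | h
    · exact Or.inl h
    · obtain ⟨i, hi, rfl⟩ := Finset.mem_image.1 h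
      exact Or.inr ⟨rfl, Finset.mem_range.1 hi⟩

/-- In each column the fibre over `i` ends where the balls over the next level begin, so fibres over
different balls of one column do not meet. -/
lemma fibreLetter_ne_of_lt {m : ℕ} {i j : Fin m} (hij : i < j) (o : ℕ) : ∀ (cs : List (Col m))
    {x y : Letter} (_ : x ∈ balls (fibreList cs i)) (_ : y ∈ balls (fibreList cs j)),
    fibreLetter cs i o x ≠ fibreLetter cs j o y
  | [], _, _, h, _ => absurd h (Finset.notMem_empty _)
  | c :: cs, x, y, hx, hy => by
    rw [fibreList] at hx hy
    rw [fibreLetter, fibreLetter]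
    rcases mem_balls_consNZ hx with hx | ⟨h1, h2⟩ <;> rcases mem_balls_consNZ hy with hy | ⟨h3, h4⟩
    · rw [if_pos (col_lt_of_mem_balls hx), if_pos (col_lt_of_mem_balls hy)]
      exact fibreLetter_ne_of_lt hij o cs hx hy
    · rw [if_pos (col_lt_of_mem_balls hx), if_neg h3.not_lt]
      exact fun e => (fibreLetter_col_lt i o cs x (col_lt_of_mem_balls hx)).ne (congrArg Prod.fst e)
    · rw [if_neg h1.not_lt, if_pos (col_lt_of_mem_balls hy)]
      exact fun e => (fibreLetter_col_lt j o cs y (col_lt_of_mem_balls hy)).ne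
        (congrArg Prod.fst e).symm
    · rw [if_neg h1.not_lt, if_neg h3.not_lt]
      intro e
      have e := congrArg Prod.snd e
      have h5 := c.below_succ i
      have h6 : c.below i.succ ≤ c.below j.castSucc := c.below_mono (Fin.succ_le_castSucc_iff.2 hij)
      simp only at e
      omega

namespace WordInputs

lemma word_eq_nil : ∀ {bs : List Block} (α : WordInputs bs) {a : Letter}
    (_ : a ∉ balls (trg bs)), α.word a = []
  | [], _, _, _ => rfl
  | b :: bs, α, a, h => by
    rw [word]
    split_ifs with h1 h2
    · refine absurd (Finset.mem_union_right _ (Finset.mem_image.2 ⟨a.2, Finset.mem_range.2 h2, ?_⟩)) h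
      exact Prod.ext ((length_trg bs).trans h1.symm) rfl
    · rfl
    · exact word_eq_nil α.2 fun h' => h (Finset.mem_union_left _ h')

lemma exists_of_mem_word {b : Block} {bs : List Block} (α : WordInputs (b :: bs)) {a y : Letter}
    (h : a.1 = bs.length) (hy : y ∈ α.word a) : ∃ (i : Fin b.ht) (x : Letter), a = (bs.length, i.1) ∧
      x ∈ balls (fibreList b.cols i) ∧ y = fibreLetter b.cols i (src bs).length x := by
  rw [word, if_pos h] at hy
  split_ifs at hy with h'
  · obtain ⟨x, hx, rfl⟩ := List.mem_map.1 hy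
    exact ⟨⟨a.2, h'⟩, x, Prod.ext h rfl, ((α.1 ⟨a.2, h'⟩).2.1 x).1 hx, rfl⟩
  · exact absurd hy List.not_mem_nil

lemma col_lt_of_mem_word : ∀ {bs : List Block} (α : WordInputs bs) {a y : Letter}
    (_ : y ∈ α.word a), y.1 < (src bs).length
  | [], _, _, _, h => absurd h List.not_mem_nil
  | b :: bs, α, a, y, h => by
    have e : (src (b :: bs)).length = (src bs).length + b.cols.length := by
      rw [src, List.length_append, Block.heights, List.length_map, add_comm]
    rw [e]
    by_cases h1 : a.1 = bs.length
    · obtain ⟨i, x, -, hx, rfl⟩ := exists_of_mem_word α h1 h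
      exact fibreLetter_col_lt i _ b.cols x (col_lt_of_mem_balls hx)
    · rw [word, if_neg h1] at h
      exact Nat.lt_add_right _ (col_lt_of_mem_word α.2 h)

/-- Fibres over different columns use different blocks of columns of the source, and fibres over one
column are separated by heights. So every letter has a unique owner. -/
lemma eq_of_mem_word : ∀ {bs : List Block} (α : WordInputs bs) {a a' y : Letter}
    (_ : y ∈ α.word a) (_ : y ∈ α.word a'), a = a'
  | [], _, _, _, _, h, _ => absurd h List.not_mem_nil
  | b :: bs, α, a, a', y, h, h' => by
    have key : ∀ {c : Letter}, c.1 = bs.length → y ∈ α.word c → (src bs).length ≤ y.1 := by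
      intro c hc hy
      obtain ⟨i, x, -, hx, rfl⟩ := exists_of_mem_word α hc hy
      exact fibreLetter_col_le i _ b.cols (col_lt_of_mem_balls hx)
    have key' : ∀ {c : Letter}, c.1 ≠ bs.length → y ∈ α.word c → y ∈ word α.2 c := by
      intro c hc hy
      rwa [word, if_neg hc] at hy
    by_cases h1 : a.1 = bs.length <;> by_cases h2 : a'.1 = bs.length
    · obtain ⟨i, x, rfl, hx, e⟩ := exists_of_mem_word α h1 h
      obtain ⟨j, x', rfl, hx', e'⟩ := exists_of_mem_word α h2 h'
      rcases lt_trichotomy i j with hij | rfl | hij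
      · exact absurd (e.symm.trans e') (fibreLetter_ne_of_lt hij _ b.cols hx hx')
      · rfl
      · exact absurd (e'.symm.trans e) (fibreLetter_ne_of_lt hij _ b.cols hx' hx)
    · exact absurd (key h1 h) (col_lt_of_mem_word α.2 (key' h2 h')).not_ge
    · exact absurd (key h2 h') (col_lt_of_mem_word α.2 (key' h1 h)).not_ge
    · exact eq_of_mem_word α.2 (key' h1 h) (key' h2 h')

open Classical in
lemma exists_pluggable {bs : List Block} (α : WordInputs bs) {β : List Letter}
    (hβ : ∀ a, a ∈ β ↔ a ∈ balls (trg bs)) :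
    ∃ own, Pluggable (balls (trg bs)) own α.word β := by
  refine ⟨fun y => if h : ∃ a, y ∈ α.word a then h.choose else y, fun a ha => (hβ a).1 ha,
    fun a ha => α.word_eq_nil (mt (hβ a).2 ha), fun a y hy => ?_⟩
  have h : ∃ a, y ∈ α.word a := ⟨a, hy⟩
  simp only [dif_pos h]
  exact α.eq_of_mem_word h.choose_spec hy

end WordInputs

/-! ## The sum of the composition -/

lemma prod_sgn (f : Letter → ℕ) (V : Finset Letter) :
    ∏ a ∈ V, sgn k (f a : ℕ) = sgnZ k (∑ a ∈ V, (f a : ZMod 2)) := by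
  classical
  induction V using Finset.induction_on with
  | empty => simp [sgnZ, sgn_zero]
  | insert a V ha ih =>
    rw [Finset.prod_insert ha, Finset.sum_insert ha, sgnZ_add, ih, sgn_eq_sgnZ, Int.cast_natCast]

lemma exists_ofFn {A : Type*} {n : ℕ} (l : List A) (h : l.length = n) :
    ∃ f : Fin n → A, List.ofFn f = l := by
  subst h
  exact ⟨l.get, List.ofFn_get l⟩

/-- The sum over the runs of the plugging operation is the sum in the composition of `Breq`. -/
theorem plugW_eq_sum {V : Finset Letter} {own : Letter → Letter} {σ : Letter → List Letter}
    {β : List Letter} (hP : Pluggable V own σ β) (hV : β.toFinset = V) :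
    sgn k (inv β : ℕ) • plugW (fun a => sgn k (inv (σ a) : ℕ)) β σ =
      ∑ r ∈ V.pi fun a => Finset.Nat.antidiagonalTuple (σ a).length (ell β a),
        let w := substitute β fun a => if h : a ∈ V then segments (σ a) (r a h) else []
        sgn k ((∑ a ∈ V.attach, whiskerSign (σ a) (r a a.2)) + koszulSign V β σ +
          shuffleSign V σ w : ℕ) • (sgn k (inv w : ℕ) • bw k w) := by
  classical
  obtain ⟨R, hR, e⟩ := exists_runs (k := k) β σ hP
  -- Multiplicities are extended by the empty list outside `V`, where the plugged words are empty
  -- too.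
  let ex (r : ∀ a ∈ V, Fin (σ a).length → ℕ) (a : Letter) : List ℕ :=
    if h : a ∈ V then List.ofFn (r a h) else []
  have hex : ∀ r a h, ex r a = List.ofFn (r a h) := fun r a h => dif_pos h
  have hσ : ∀ a, a ∉ V → σ a = [] := fun a ha => hP.nil a fun h => ha (hP.sub a h)
  have hsub : ∀ r, substitute β (fun a => if h : a ∈ V then segments (σ a) (r a h) else []) =
      substitute β fun a => segmentsAux ((σ a).zip (ex r a)) := fun r =>
    substitute_congr fun a ha => by
      rw [dif_pos (hP.sub a ha), hex r a (hP.sub a ha), segments]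
  -- The condition that the multiplicities for `a` have the sum `ell β a` is exactly what a run
  -- requires.
  have hrun : ∀ r ∈ V.pi fun a => Finset.Nat.antidiagonalTuple (σ a).length (ell β a),
      Run σ β (ex r) (substitute β fun a => segmentsAux ((σ a).zip (ex r a))) := by
    intro r hr
    obtain ⟨w, hw⟩ := exists_run β σ (ex r)
      (fun a => by
        by_cases h : a ∈ V
        · rw [hex r a h, List.length_ofFn]
        · rw [hσ a h]
          simp only [ex, dif_neg h]
          rfl)
      (fun a => by
        by_cases h : a ∈ V
        · rw [hex r a h, List.sum_ofFn]
          exact Finset.Nat.mem_antidiagonalTuple.1 (Finset.mem_pi.1 hr a h)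
        · simp only [ex, dif_neg h]
          rw [ell_of_not_mem fun h' => h (hP.sub a h')]
          rfl)
      hP.nil
    rwa [hw.eq_substitute] at hw
  rw [plugW_eq_smul, e, Finset.smul_sum, Finset.smul_sum, hV, prod_sgn]
  symm
  -- The choices of multiplicities in the composition correspond to the runs, since the word of a
  -- run is determined by its multiplicities.
  refine Finset.sum_bij (fun r _ => (ex r, substitute β fun a => segmentsAux ((σ a).zip (ex r a))))
    (fun r hr => (hR _).2 (hrun r hr)) (fun r _ r' _ h => ?_) (fun p hp => ?_) fun r hr => ?_
  · funext a ha
    have := congrFun (congrArg Prod.fst h) a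
    simp only [hex _ a ha] at this
    exact List.ofFn_injective this
  · obtain ⟨ρ, w⟩ := p
    have hw := (hR _).1 hp
    choose f hf using fun a => exists_ofFn (ρ a) (hw.length_eq a)
    have e' : ex (fun a _ => f a) = ρ := by
      funext a
      by_cases h : a ∈ V
      · exact (hex (fun a _ => f a) a h).trans (hf a)
      · have := hw.length_eq a
        rw [hσ a h] at this
        exact (dif_neg h).trans (List.eq_nil_of_length_eq_zero this).symm
    refine ⟨fun a _ => f a, Finset.mem_pi.2 fun a ha => Finset.Nat.mem_antidiagonalTuple.2 ?_, ?_⟩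
    · rw [← List.sum_ofFn, hf]
      exact hw.sum_eq a
    · rw [e']
      exact Prod.ext rfl hw.eq_substitute.symm
  · rw [smul_smul, smul_smul, smul_smul]
    simp only [hsub]
    refine congrArg (· • bw k _) ?_
    rw [sgn_eq_sgnZ, sgn_eq_sgnZ, sgn_eq_sgnZ, ← sgnZ_add, ← sgnZ_add, ← sgnZ_add]
    refine congrArg (sgnZ k) ?_
    push_cast
    rw [koszulSign_eq hP.sub, shuffleSign_eq (own := own) hP.own fun y hy => ?_]
    · have e1 : ∑ a ∈ V.attach, (whiskerSign (σ a) (r a a.2) : ZMod 2) =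
          ∑ a ∈ V, whiskE (σ a) (ex r a) := by
        rw [← Finset.sum_attach V fun a => whiskE (σ a) (ex r a)]
        exact Finset.sum_congr rfl fun a _ => by rw [whiskerSign_eq, hex r a a.2]
      rw [e1, expo, Finset.sum_add_distrib, Finset.sum_add_distrib]
      grind
    · obtain ⟨a, ha⟩ := ((hrun r hr).mem_iff y).1 hy
      refine ⟨a, ?_, ha⟩
      by_contra h
      rw [hσ a h] at ha
      exact List.not_mem_nil ha

end TwoOperad

-- Compatibility with the operadic compositions

namespace TwoOperad
variable {k : Type u} [Field k]

/-- The signs of the inversions of `β` and of the inputs, together with the sign of the composition,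
give the sign of the inversions of the result. The projection accounts for the words that `ofWord`
would discard. -/
lemma breqMap_breqComp {bs : List Block} (α : WordInputs bs) {β : List Letter}
    (hβ : IsConfig (trg bs) β) (p : ℤ) :
    breqMap k (src bs) p (breqComp k bs β α.word p) =
      projW k (src bs) p (sgn k (inv β : ℕ) •
        plugW (fun a => sgn k (inv (α.word a) : ℕ)) β α.word) := by
  obtain ⟨own, hP⟩ := α.exists_pluggable hβ.1
  rw [plugW_eq_sum hP (by ext a; rw [List.mem_toFinset, hβ.1 a]), breqComp, map_sum, map_sum]
  refine Finset.sum_congr rfl fun r _ => ?_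
  simp only [map_smul]
  rw [breqMap_ofWord, map_smul]

/-- The isomorphism is compatible with the compositions. -/
theorem phi_comp (S : Plugging k) (P : DiskMap) {n p : ℤ} (β : Config P.target.heights n)
    (α : WordInputs P.blocks)
    (h : n + (α.toInputs fun (U : Disk) (n : ℤ) => phi k U.heights n).deg (T.bot _) (T.top _) = p) :
    phi k P.source.heights p (toNor (breqComp k P.blocks β.1 α.word p)) =
      S.comp P (α.toInputs fun U n => phi k U.heights n) h
        (phi k P.target.heights n (toNor (Finsupp.single β 1))) := by
  apply repT_map_injective
  refine (map_phi _).trans ((norMap_toNor _).trans ?_)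
  refine (breqMap_breqComp α β.2.1 p).trans ?_
  by_cases hd : IsDegenerate β.1
  -- A degenerate `β` is zero in `Nor(Breq)`, and plugging into it gives only degenerate words, so
  -- both sides vanish.
  · have e : toNor (Finsupp.single β 1) = (0 : Nor k P.target.heights n) :=
      (Submodule.Quotient.mk_eq_zero _).2 (Submodule.subset_span ⟨β, hd, rfl⟩)
    rw [plugW_eq_zero _ hd, smul_zero, map_zero, e, map_zero]
    refine Eq.symm ((Rep.map_cast (repT k (src P.blocks)) _ _ _).trans ?_)
    exact (congrArg _ (LinearMap.map_zero _)).trans (LinearMap.map_zero _)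
  · obtain ⟨f, hf⟩ := (isConfig_iff_rel (k := k)).1 ⟨β.2, hd⟩
    -- The sign of the degree `n` that relates a basis element to its word appears here and again in
    -- the evaluation of plugging, and cancels.
    have e : phi k P.target.heights n (toNor (Finsupp.single β 1)) =
        sgn k ((inv β.1 : ℕ) + n) • f := by
      apply repT_map_injective
      rw [map_smul, map_phi, norMap_toNor, breqMap_single, (basisT k _).map hf, sgn_smul_smul,
        add_assoc, sgn_add _ (n + n), sgn_add n n, sgn_mul_self, mul_one]
    have key : (repT k P.source.heights).map (S.comp P
        (α.toInputs fun U n => phi k U.heights n) h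
        (phi k P.target.heights n (toNor (Finsupp.single β 1)))) = sgn k (inv β.1 : ℕ) •
          plugW (fun a => sgn k (inv (α.word a) : ℕ)) β.1 α.word := by
      refine (Rep.map_cast (repT k (src P.blocks)) _ _ _).trans ?_
      rw [e]
      refine ((congrArg _ (LinearMap.map_smul _ _ _)).trans (LinearMap.map_smul _ _ _)).trans ?_
      refine (congrArg _ (plugsTo_of_rel (S := S)
        (represents_toInputs (k := k) α (fun a _ => rfl)) hf p h)).trans ?_
      rw [sgn_smul_smul, add_assoc, sgn_add _ (n + n), sgn_add n n, sgn_mul_self, mul_one]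
    -- The sum of words is the image of an element of `O`, so the projection leaves it unchanged.
    exact (congrArg _ key.symm).trans ((projW_map _).trans rfl)

end TwoOperad

theorem mainTheorem3 (k : Type*) [Field k] [CharZero k] :
    Nonempty (Plugging k) ∧
    ∃ Φ : ∀ (U : Disk) (n : ℤ), Nor k U.heights n ≃ₗ[k] O k U.heights n,
      (∀ (U : Disk) (n : ℤ) (x : Breq k U.heights n),
        Φ U (n + 1) (toNor (breqD k U.heights n x)) =
          (T k U.heights).d rfl (Φ U n (toNor x))) ∧
      Φ Disk.unit 0 (toNor (Finsupp.single unitWord 1)) = unitO k ∧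
      (∀ (S : Plugging k) (P : DiskMap) (n p : ℤ) (β : Config P.target.heights n)
        (α : WordInputs P.blocks)
        (h : n + (α.toInputs Φ).deg (T.bot _) (T.top _) = p),
        Φ P.source p (toNor (breqComp k P.blocks β.1 α.word p)) =
          S.comp P (α.toInputs Φ) h (Φ P.target n (toNor (Finsupp.single β 1)))) ∧
      (∀ (U : Disk) (n : ℤ) (w : Config U.heights n), ¬ IsDegenerate w.1 →
        ∃ f : O k U.heights n, IsMonomial U.heights f w.1 ∧
          (Φ U n (toNor (Finsupp.single w 1)) = f ∨
            Φ U n (toNor (Finsupp.single w 1)) = -f)) := by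
  exact ⟨nonempty_plugging, fun U n => phi k U.heights n, fun U n x => phi_d x, phi_unit,
    fun S P n p β α h => phi_comp S P β α h, fun U n w hw => phi_monomial w hw⟩
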